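/- **Conventions.** Let $k$ be a field of characteristic zero. A *complete complex* is a cochain complex $V$ over $k$ with a decreasing $\mathbb Z$-indexed filtration by subcomplexes $F^pV$ that is exhaustive ($V=\bigcup_p F^pV$), complete and Hausdorff ($V\cong\lim_p V/F^pV$, in each degree); $\hat\otimes$ is the completed tensor product, and all signs follow the Koszul rule. *Graded mixed cdga.* $(B,\delta)$ consists of a complete filtered cdga $(B,d)$ whose filtration is split by a multiplicative weight grading preserved by $d$ (i.e. $B=\mathrm{Tot}(B_{\mathrm{gr}})$ for a weight-graded cdga $B_{\mathrm{gr}}$), and a derivation $\delta$ of $B$ of degree $1$ and filtration weight $1$ with $\delta^2+[d,\delta]=0$. A $B$-module is a complete dg-module over $(B,d)$. *Cooperads.* $\mathcal C$ is a complete (symmetric, non-counital) cooperad over $k$ (operations of arity $0$ and $1$ are allowed) with counital coaugmented version $\mathcal C_+=\mathcal C\oplus I$. It is assumed to be *complete conilpotent*: for every $c\in\mathcal C(n)$ and every $N$, all components of $c$, under iterated decomposition, on trees with sufficiently many vertices lie in filtration weight $\geq N$. We write $\Delta_{(1)}$ for the infinitesimal and $\Delta$ for the total cocomposition. *Algebras.*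 For a complete complex $A$, an $\Omega(\mathcal C)$-algebra structure on $A$ is a map of operads $\Omega(\mathcal C)\to\mathrm{End}_A$, equivalently a twisting morphism $\alpha\colon\mathcal C\to \mathrm{End}_A$: a filtered $\Sigma$-equivariant map of degree $1$ with $\partial\alpha+\alpha\star\alpha=0$, where $f\star g=\gamma_{(1)}\circ(f\otimes g)\circ\Delta_{(1)}$. Let $\lambda\colon\mathcal C(1)\to k$ be linear. A *$\mathsf P_B$-algebra* is a $B$-module $M$ with an $\Omega(\mathcal C)$-algebra structure $\alpha$ on the underlying complete complex such that for homogeneous $c\in\mathcal C(n)$, operating with degree $|c|+1$, $$\alpha_c(b_1m_1,\dots,b_nm_n)=\pm\, b_1\cdots b_n\,\alpha_c(m_1,\dots,m_n)\quad(n\neq1),\qquad \alpha_c(bm)=(-1)^{|b|(|c|+1)}\,b\,\alpha_c(m)+\lambda_c\,\delta(b)\,m\quad(n=1),$$ with $\pm$ the Koszul sign. (Whenever $c\circ(b_1,\dots,b_n)\mapsto\pm(b_1\cdots b_n)\circ c$ for $n\ne1$ and $c\circ b\mapsto\pm b\circ c+\lambda_c\delta(b)\circ1$ for $n=1$ define a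 distributive law $\Omega(\mathcal C)\circ B\to B\circ\Omega(\mathcal C)$, these are exactly the algebras over the resulting operad $\mathsf P_B=B\circ\Omega(\mathcal C)$.) *$\infty$-morphisms.* An $\infty$-morphism $f\colon V\rightsquigarrow W$ of $\mathsf P_B$-algebras is a map of dg $\mathcal C$-coalgebras $\mathcal C_+\circ V\to\mathcal C_+\circ W$ between the bar constructions all of whose components $f_c\colon V^{\otimes n}\to W$, $c\in\mathcal C_+(n)$, are $B$-multilinear. Equivalently, it is a filtered, $\Sigma$-equivariant, $B$-multilinear family $f_c$ of degree $|c|$ such that $f_{\mathrm{id}}$ is a chain map and $\partial f=f\star\alpha_V-\alpha_W\circledcirc f$ on $\mathcal C$, where $\alpha_W\circledcirc f=\gamma\circ(\alpha_W\circ f)\circ\Delta$. It *extends* $i\colon V\to W$ if $f_{\mathrm{id}}=i$. **Theorem (Homotopy Transfer Theorem over $B$).** Let $(B,\delta)$ be a graded mixed cdga, $\mathcal C$ a complete conilpotent non-counital cooperad over $k$ and $\lambda\colon \mathcal C(1)\to k$ linear. Let $W$ be a $\mathsf P_B$-algebra, $V$ a $B$-module, and consider a deformation retract of $B$-modules: filtration-preserving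 $B$-linear chain maps $i\colon V\to W$, $p\colon W\to V$ and a filtration-preserving (graded) $B$-linear map $h\colon W\to W$ of degree $-1$, with $$pi=\mathrm{id}_V,\qquad ip-\mathrm{id}_W=dh+hd,$$ and the side conditions $ph=0$, $hi=0$, $h^2=0$. Then the $B$-module structure on $V$ extends to a transferred $\mathsf P_B$-algebra structure $\alpha_V$, and $i$ extends to an $\infty$-morphism $i_\infty\colon V\rightsquigarrow W$ of $\mathsf P_B$-algebras (in particular all its components are $B$-multilinear). Here *transferred* means that $\alpha_V$ and $i_\infty$ are given by the usual sums over trees (leaves labelled $i$, vertices by operations of $W$, internal edges $h$, root $p$, resp. $h$), i.e. for all $c\in\mathcal C$ $$(\alpha_V)_c=p\circ(\alpha_W\circledcirc i_\infty)_c,\qquad (i_\infty)_c=h\circ(\alpha_W\circledcirc i_\infty)_c .$$ -/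

import Mathlib

open scoped TensorProduct

noncomputable section

namespace FilteredHTT

/-! ### Filtered modules, completion and completed tensor products -/

section Completion

variable {k : Type*} [Field k]
variable {X Y A D : Type*} [AddCommGroup X] [Module k X] [AddCommGroup Y] [Module k Y]
  [AddCommGroup A] [Module k A] [AddCommGroup D] [Module k D]

/-- The submodule `∑_{p+q=N} F^p ⊗ G^q` of `X ⊗ Y`. It is used for the tensor product filtration,
and, applied to homogeneous components, for the total degree of a tensor product. -/
def tensorSum (F : ℤ → Submodule k X) (G : ℤ → Submodule k Y) (N : ℤ) :
    Submodule k (X ⊗[k] Y) :=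
  ⨆ p : ℤ, Submodule.map₂ (TensorProduct.mk k X Y) (F p) (G (N - p))

/-- The completion `lim_N X / F^N X` of a filtered module: compatible families of classes. For a
decreasing filtration the compatibility below says that `X / F^N → X / F^M` sends `y_N` to `y_M`. -/
def Compl (F : ℤ → Submodule k X) : Submodule k (∀ N : ℤ, X ⧸ F N) where
  carrier := {y | ∀ M N, M ≤ N → ∃ t : X, (F N).mkQ t = y N ∧ (F M).mkQ t = y M}
  zero_mem' := fun M N _ => ⟨0, by simp, by simp⟩
  add_mem' := by
    intro y z hy hz M N h
    obtain ⟨s, hs, hs'⟩ := hy M N h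
    obtain ⟨t, ht, ht'⟩ := hz M N h
    exact ⟨s + t, by rw [map_add, hs, ht]; rfl, by rw [map_add, hs', ht']; rfl⟩
  smul_mem' := by
    intro a y hy M N h
    obtain ⟨s, hs, hs'⟩ := hy M N h
    exact ⟨a • s, by rw [map_smul, hs]; rfl, by rw [map_smul, hs']; rfl⟩

/-- The canonical map of a filtered module to its completion. -/
def Compl.of (F : ℤ → Submodule k X) : X →ₗ[k] Compl F where
  toFun x := ⟨fun N => (F N).mkQ x, fun _ _ _ => ⟨x, rfl, rfl⟩⟩
  map_add' _ _ := rfl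
  map_smul' _ _ := rfl

/-- A linear map into a completion preserves filtrations; recall that `y ∈ F^N` means that the
class of `y` modulo `F^N` vanishes. -/
def IsFiltered (F : ℤ → Submodule k X) (G : ℤ → Submodule k Y) (f : X →ₗ[k] Compl G) : Prop :=
  ∀ N, ∀ x ∈ F N, (f x).1 N = 0

theorem isFiltered_of (F : ℤ → Submodule k X) : IsFiltered F F (Compl.of F) :=
  fun N _ hx => (Submodule.Quotient.mk_eq_zero (F N)).2 hx

/-- The continuous extension of a filtered map `X → Ŷ` to `X̂ → Ŷ`. -/
def Compl.extend {F : ℤ → Submodule k X} {G : ℤ → Submodule k Y} (f : X →ₗ[k] Compl G)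
    (hf : IsFiltered F G f) : Compl F →ₗ[k] Compl G where
  toFun y := ⟨fun N => (F N).liftQ ((LinearMap.proj N).comp ((Compl G).subtype.comp f))
      (fun x hx => hf N x hx) (y.1 N), by
    intro M N h
    obtain ⟨t, ht, ht'⟩ := y.2 M N h
    obtain ⟨s, hs, hs'⟩ := (f t).2 M N h
    refine ⟨s, ?_, ?_⟩
    · change _ = (F N).liftQ _ _ (y.1 N)
      rw [hs, ← ht]; rfl
    · change _ = (F M).liftQ _ _ (y.1 M)
      rw [hs', ← ht']; rfl⟩
  map_add' y z := by ext N; simp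
  map_smul' a y := by ext N; simp

theorem Compl.rep_sub {F : ℤ → Submodule k X} (hF : Antitone F) (y : Compl F) {M N : ℤ}
    (h : M ≤ N) {s t : X} (hs : (F M).mkQ s = y.1 M) (ht : (F N).mkQ t = y.1 N) :
    s - t ∈ F M := by
  obtain ⟨r, hr, hr'⟩ := y.2 M N h
  have h1 : t - r ∈ F M := hF h ((Submodule.Quotient.eq (F N)).1 (ht.trans hr.symm))
  have h2 : s - r ∈ F M := (Submodule.Quotient.eq (F M)).1 (hs.trans hr'.symm)
  have := (F M).sub_mem h2 h1
  simpa using this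

theorem Compl.exists_weight {F : ℤ → Submodule k X} (hF : Antitone F) (hF' : ∀ x, ∃ p, x ∈ F p)
    (y : Compl F) : ∃ p, ∀ L, p ≤ L → ∀ s, (F L).mkQ s = y.1 L → s ∈ F p := by
  obtain ⟨t, ht⟩ := (F 0).mkQ_surjective (y.1 0)
  obtain ⟨p, hp⟩ := hF' t
  refine ⟨min p 0, fun L hL s hs => ?_⟩
  rcases le_total L 0 with h0 | h0
  · have h1 := Compl.rep_sub hF y h0 hs ht
    have h2 := (F (min p 0)).add_mem (hF hL h1) (hF (min_le_left p 0) hp)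
    simpa using h2
  · have h1 := Compl.rep_sub hF y h0 ht hs
    have h2 := (F (min p 0)).sub_mem (hF (min_le_left p 0) hp) (hF (min_le_right p 0) h1)
    simpa using h2

theorem tmul_mem_tensorSum {F : ℤ → Submodule k X} {G : ℤ → Submodule k Y} {p q N : ℤ}
    (h : p + q = N) {x : X} {y : Y} (hx : x ∈ F p) (hy : y ∈ G q) :
    x ⊗ₜ[k] y ∈ tensorSum F G N := by
  have hq : N - p = q := by omega
  refine Submodule.mem_iSup_of_mem p ?_
  rw [hq]
  exact Submodule.apply_mem_map₂ (TensorProduct.mk k X Y) hx hy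

theorem Compl.exists_tmul {F : ℤ → Submodule k X} {G : ℤ → Submodule k Y}
    (hF : Antitone F) (hF' : ∀ x, ∃ p, x ∈ F p) (hG : Antitone G) (hG' : ∀ x, ∃ p, x ∈ G p)
    (y : Compl F) (z : Compl G) (N : ℤ) :
    ∃ v : (X ⊗[k] Y) ⧸ tensorSum F G N, ∃ L₀ : ℤ, ∀ L, L₀ ≤ L → ∀ s t,
      (F L).mkQ s = y.1 L → (G L).mkQ t = z.1 L → (tensorSum F G N).mkQ (s ⊗ₜ[k] t) = v := by
  obtain ⟨p, hp⟩ := Compl.exists_weight hF hF' y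
  obtain ⟨q, hq⟩ := Compl.exists_weight hG hG' z
  set L₀ : ℤ := max (max p q) (max (N - p) (N - q)) with hL₀
  obtain ⟨s₀, hs₀⟩ := (F L₀).mkQ_surjective (y.1 L₀)
  obtain ⟨t₀, ht₀⟩ := (G L₀).mkQ_surjective (z.1 L₀)
  refine ⟨(tensorSum F G N).mkQ (s₀ ⊗ₜ[k] t₀), L₀, fun L hL s t hs ht => ?_⟩
  have hpL : p ≤ L₀ := by omega
  have hqL : q ≤ L₀ := by omega
  have e : s₀ ⊗ₜ[k] t₀ - s ⊗ₜ[k] t = (s₀ - s) ⊗ₜ[k] t₀ + s ⊗ₜ[k] (t₀ - t) := by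
    rw [TensorProduct.sub_tmul, TensorProduct.tmul_sub]; abel
  have h1 : (s₀ - s) ⊗ₜ[k] t₀ ∈ tensorSum F G N :=
    tmul_mem_tensorSum (p := N - q) (q := q) (by ring)
      (hF (by omega) (Compl.rep_sub hF y hL hs₀ hs)) (hq L₀ hqL t₀ ht₀)
  have h2 : s ⊗ₜ[k] (t₀ - t) ∈ tensorSum F G N :=
    tmul_mem_tensorSum (p := p) (q := N - p) (by ring)
      (hp L (hpL.trans hL) s hs) (hG (by omega) (Compl.rep_sub hG z hL ht₀ ht))
  refine ((Submodule.Quotient.eq (tensorSum F G N)).2 ?_).symm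
  rw [e]
  exact Submodule.add_mem _ h1 h2

/-- The completed exterior product `X̂ × Ŷ → (X ⊗ Y)^`, computed on representatives of high
precision. -/
def Compl.tmul {F : ℤ → Submodule k X} {G : ℤ → Submodule k Y}
    (hF : Antitone F) (hF' : ∀ x, ∃ p, x ∈ F p) (hG : Antitone G) (hG' : ∀ x, ∃ p, x ∈ G p) :
    Compl F →ₗ[k] Compl G →ₗ[k] Compl (tensorSum F G) :=
  LinearMap.mk₂ k (fun y z => ⟨fun N => (Compl.exists_tmul hF hF' hG hG' y z N).choose, by
      intro M N _
      obtain ⟨L, hL⟩ := (Compl.exists_tmul hF hF' hG hG' y z N).choose_spec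
      obtain ⟨L', hL'⟩ := (Compl.exists_tmul hF hF' hG hG' y z M).choose_spec
      obtain ⟨s, hs⟩ := (F (max L L')).mkQ_surjective (y.1 (max L L'))
      obtain ⟨t, ht⟩ := (G (max L L')).mkQ_surjective (z.1 (max L L'))
      exact ⟨s ⊗ₜ[k] t, hL _ (le_max_left _ _) s t hs ht, hL' _ (le_max_right _ _) s t hs ht⟩⟩)
    (by
      intro y y' z
      ext N
      obtain ⟨L₁, h₁⟩ := (Compl.exists_tmul hF hF' hG hG' (y + y') z N).choose_spec
      obtain ⟨L₂, h₂⟩ := (Compl.exists_tmul hF hF' hG hG' y z N).choose_spec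
      obtain ⟨L₃, h₃⟩ := (Compl.exists_tmul hF hF' hG hG' y' z N).choose_spec
      set L := max L₁ (max L₂ L₃) with hL
      obtain ⟨s, hs⟩ := (F L).mkQ_surjective (y.1 L)
      obtain ⟨s', hs'⟩ := (F L).mkQ_surjective (y'.1 L)
      obtain ⟨t, ht⟩ := (G L).mkQ_surjective (z.1 L)
      have e₁ := h₁ L (by omega) (s + s') t (by rw [map_add, hs, hs']; rfl) ht
      have e₂ := h₂ L (by omega) s t hs ht
      have e₃ := h₃ L (by omega) s' t hs' ht
      rw [TensorProduct.add_tmul, map_add, e₂, e₃] at e₁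
      exact e₁.symm)
    (by
      intro a y z
      ext N
      obtain ⟨L₁, h₁⟩ := (Compl.exists_tmul hF hF' hG hG' (a • y) z N).choose_spec
      obtain ⟨L₂, h₂⟩ := (Compl.exists_tmul hF hF' hG hG' y z N).choose_spec
      set L := max L₁ L₂ with hL
      obtain ⟨s, hs⟩ := (F L).mkQ_surjective (y.1 L)
      obtain ⟨t, ht⟩ := (G L).mkQ_surjective (z.1 L)
      have e₁ := h₁ L (by omega) (a • s) t (by rw [map_smul, hs]; rfl) ht
      have e₂ := h₂ L (by omega) s t hs ht
      rw [← TensorProduct.smul_tmul', map_smul, e₂] at e₁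
      exact e₁.symm)
    (by
      intro y z z'
      ext N
      obtain ⟨L₁, h₁⟩ := (Compl.exists_tmul hF hF' hG hG' y (z + z') N).choose_spec
      obtain ⟨L₂, h₂⟩ := (Compl.exists_tmul hF hF' hG hG' y z N).choose_spec
      obtain ⟨L₃, h₃⟩ := (Compl.exists_tmul hF hF' hG hG' y z' N).choose_spec
      set L := max L₁ (max L₂ L₃) with hL
      obtain ⟨s, hs⟩ := (F L).mkQ_surjective (y.1 L)
      obtain ⟨t, ht⟩ := (G L).mkQ_surjective (z.1 L)
      obtain ⟨t', ht'⟩ := (G L).mkQ_surjective (z'.1 L)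
      have e₁ := h₁ L (by omega) s (t + t') hs (by rw [map_add, ht, ht']; rfl)
      have e₂ := h₂ L (by omega) s t hs ht
      have e₃ := h₃ L (by omega) s t' hs ht'
      rw [TensorProduct.tmul_add, map_add, e₂, e₃] at e₁
      exact e₁.symm)
    (by
      intro a y z
      ext N
      obtain ⟨L₁, h₁⟩ := (Compl.exists_tmul hF hF' hG hG' y (a • z) N).choose_spec
      obtain ⟨L₂, h₂⟩ := (Compl.exists_tmul hF hF' hG hG' y z N).choose_spec
      set L := max L₁ L₂ with hL
      obtain ⟨s, hs⟩ := (F L).mkQ_surjective (y.1 L)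
      obtain ⟨t, ht⟩ := (G L).mkQ_surjective (z.1 L)
      have e₁ := h₁ L (by omega) s (a • t) hs (by rw [map_smul, ht]; rfl)
      have e₂ := h₂ L (by omega) s t hs ht
      rw [TensorProduct.tmul_smul, map_smul, e₂] at e₁
      exact e₁.symm)

theorem Compl.tmul_eq_zero {F : ℤ → Submodule k X} {G : ℤ → Submodule k Y}
    (hF : Antitone F) (hF' : ∀ x, ∃ p, x ∈ F p) (hG : Antitone G) (hG' : ∀ x, ∃ p, x ∈ G p)
    {p q N : ℤ} (h : p + q = N) (y : Compl F) (z : Compl G) (hy : y.1 p = 0) (hz : z.1 q = 0) :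
    (Compl.tmul hF hF' hG hG' y z).1 N = 0 := by
  obtain ⟨L₁, h₁⟩ := (Compl.exists_tmul hF hF' hG hG' y z N).choose_spec
  set L := max L₁ (max p q) with hL
  obtain ⟨s, hs⟩ := (F L).mkQ_surjective (y.1 L)
  obtain ⟨t, ht⟩ := (G L).mkQ_surjective (z.1 L)
  have e₁ := h₁ L (by omega) s t hs ht
  have hs' : s ∈ F p := by
    simpa using Compl.rep_sub hF y (show p ≤ L by omega) (s := 0) (by rw [hy, map_zero]) hs
  have ht' : t ∈ G q := by
    simpa using Compl.rep_sub hG z (show q ≤ L by omega) (s := 0) (by rw [hz, map_zero]) ht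
  refine e₁.symm.trans ((Submodule.Quotient.mk_eq_zero (tensorSum F G N)).2 ?_)
  exact tmul_mem_tensorSum h hs' ht'

/-- The completed tensor product `f ⊗̂ g : (A ⊗ D)^ → (X ⊗ Y)^` of two filtered maps
`f : A → X̂` and `g : D → Ŷ`. -/
def Compl.tmap {FA : ℤ → Submodule k A} {FD : ℤ → Submodule k D}
    {F : ℤ → Submodule k X} {G : ℤ → Submodule k Y}
    (hF : Antitone F) (hF' : ∀ x, ∃ p, x ∈ F p) (hG : Antitone G) (hG' : ∀ x, ∃ p, x ∈ G p)
    (f : A →ₗ[k] Compl F) (hf : IsFiltered FA F f) (g : D →ₗ[k] Compl G)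
    (hg : IsFiltered FD G g) : Compl (tensorSum FA FD) →ₗ[k] Compl (tensorSum F G) :=
  Compl.extend (TensorProduct.lift ((Compl.tmul hF hF' hG hG').compl₁₂ f g)) (by
    intro N
    let K : Submodule k (A ⊗[k] D) := LinearMap.ker ((LinearMap.proj N).comp
      ((Compl (tensorSum F G)).subtype.comp
        (TensorProduct.lift ((Compl.tmul hF hF' hG hG').compl₁₂ f g))))
    have : tensorSum FA FD N ≤ K := by
      refine iSup_le fun p => Submodule.map₂_le.2 fun a ha b hb => ?_
      exact Compl.tmul_eq_zero hF hF' hG hG' (by ring) _ _ (hf p a ha) (hg _ b hb)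
    exact fun x hx => this hx)

end Completion

/-! ### Complete complexes -/

/-- The structure of a complete filtered cochain complex on a `k`-module `V`, the direct sum of its
components `deg n`: a differential of degree `1` and a decreasing filtration by subcomplexes that is
exhaustive, and complete and Hausdorff in each degree. -/
structure CompleteComplex (k : Type*) (V : Type*) [Field k] [AddCommGroup V] [Module k V] where
  deg : ℤ → Submodule k V
  fil : ℤ → Submodule k V
  d : V →ₗ[k] V
  isInternal : DirectSum.IsInternal deg
  fil_antitone : Antitone fil
  fil_homog : ∀ p, fil p ≤ ⨆ n, fil p ⊓ deg n
  fil_exhaustive : ∀ x, ∃ p, x ∈ fil p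
  fil_separated : ∀ x, (∀ p, x ∈ fil p) → x = 0
  fil_complete : ∀ (n : ℤ) (x : ℕ → V), (∀ m : ℕ, x m ∈ deg n) →
    (∀ m : ℕ, x (m + 1) - x m ∈ fil m) → ∃ y ∈ deg n, ∀ m : ℕ, y - x m ∈ fil m
  d_deg : ∀ n, ∀ x ∈ deg n, d x ∈ deg (n + 1)
  d_fil : ∀ p, ∀ x ∈ fil p, d x ∈ fil p
  d_d : ∀ x, d (d x) = 0

namespace CompleteComplex

variable {k V : Type*} [Field k] [AddCommGroup V] [Module k V] (X : CompleteComplex k V)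

/-- The projection of `V` onto the part of odd degree. -/
def odd : V →ₗ[k] V :=
  (DirectSum.toModule k ℤ V fun n => if Odd n then (X.deg n).subtype else 0) ∘ₗ
    (LinearEquiv.ofBijective (DirectSum.coeLinearMap X.deg) X.isInternal).symm.toLinearMap

/-- The sign involution `x ↦ (-1)^{|x|} x`. -/
def sgn : V →ₗ[k] V := LinearMap.id - (2 : k) • X.odd

/-- The component of parity `e`. -/
def par (e : ZMod 2) (x : V) : V := if e = 1 then X.odd x else x - X.odd x

end CompleteComplex

/-- The differential `d ⊗ 1 + 1 ⊗ d` of a tensor product, where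
`(1 ⊗ d)(x ⊗ y) = (-1)^{|x|} x ⊗ d y`. -/
def tensorD {k V W : Type*} [Field k] [AddCommGroup V] [Module k V] [AddCommGroup W] [Module k W]
    (X : CompleteComplex k V) (Y : CompleteComplex k W) : V ⊗[k] W →ₗ[k] V ⊗[k] W :=
  TensorProduct.map X.d LinearMap.id + TensorProduct.map X.sgn Y.d

/-- The symmetry `x ⊗ y ↦ (-1)^{|x||y|} y ⊗ x`. -/
def tensorSwap {k V W : Type*} [Field k] [AddCommGroup V] [Module k V] [AddCommGroup W]
    [Module k W] (X : CompleteComplex k V) (Y : CompleteComplex k W) : V ⊗[k] W →ₗ[k] W ⊗[k] V :=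
  (TensorProduct.comm k V W).toLinearMap ∘ₗ
    (LinearMap.id - (2 : k) • TensorProduct.map X.odd Y.odd)

/-! ### Complete cooperads -/

/-- `v ∘ ρ` lists `v` with its first block of length `a` and its next block of length `b`
exchanged. -/
def IsBlockSwap (a b : ℕ) {n : ℕ} (ρ : Equiv.Perm (Fin n)) : Prop :=
  ∀ i : Fin n, (ρ i : ℕ) = if (i : ℕ) < b then a + i else if (i : ℕ) < a + b then i - b else i

/-- A complete symmetric sequence: complete complexes `C(n)` with a right action of the symmetric
group `Σ_n` by automorphisms of complete complexes. An element `c` of arity `n` is thought of as an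
operation, and `c · ρ` as the operation with `(c · ρ)(v ∘ ρ) = ± c(v)`. -/
structure CompleteSymmSeq (k : Type*) [Field k] where
  obj : ℕ → Type*
  [addCommGroup : ∀ n, AddCommGroup (obj n)]
  [module : ∀ n, Module k (obj n)]
  cx : ∀ n, CompleteComplex k (obj n)
  act : ∀ n, Equiv.Perm (Fin n) → obj n →ₗ[k] obj n
  act_one : ∀ n c, act n 1 c = c
  act_mul : ∀ n σ τ c, act n (σ * τ) c = act n τ (act n σ c)
  act_deg : ∀ n σ e, ∀ c ∈ (cx n).deg e, act n σ c ∈ (cx n).deg e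
  act_fil : ∀ n σ p, ∀ c ∈ (cx n).fil p, act n σ c ∈ (cx n).fil p
  act_d : ∀ n σ c, act n σ ((cx n).d c) = (cx n).d (act n σ c)

attribute [instance] CompleteSymmSeq.addCommGroup CompleteSymmSeq.module

namespace CompleteSymmSeq

variable {k : Type*} [Field k] (C : CompleteSymmSeq k)

/-- The filtration of `C(m) ⊗ C(q)`. -/
abbrev fil₂ (m q : ℕ) : ℤ → Submodule k (C.obj m ⊗[k] C.obj q) :=
  tensorSum (C.cx m).fil (C.cx q).fil

/-- The completed tensor product `C(m) ⊗̂ C(q)`. -/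
abbrev tensor₂ (m q : ℕ) := Compl (C.fil₂ m q)

theorem fil₂_antitone (m q : ℕ) : Antitone (C.fil₂ m q) := fun _ _ h =>
  iSup_mono fun _ => Submodule.map₂_le_map₂ le_rfl ((C.cx q).fil_antitone (by omega))

theorem fil₂_exhaustive (m q : ℕ) (x : C.obj m ⊗[k] C.obj q) : ∃ p, x ∈ C.fil₂ m q p := by
  induction x with
  | zero => exact ⟨0, Submodule.zero_mem _⟩
  | tmul a b =>
    obtain ⟨p, hp⟩ := (C.cx m).fil_exhaustive a
    obtain ⟨r, hr⟩ := (C.cx q).fil_exhaustive b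
    exact ⟨p + r, tmul_mem_tensorSum rfl hp hr⟩
  | add x y hx hy =>
    obtain ⟨p, hp⟩ := hx
    obtain ⟨r, hr⟩ := hy
    exact ⟨min p r, Submodule.add_mem _ (C.fil₂_antitone m q (min_le_left p r) hp)
      (C.fil₂_antitone m q (min_le_right p r) hr)⟩

/-- `f ⊗̂ id : C(a) ⊗̂ C(r) → (C(m) ⊗ C(q)) ⊗̂ C(r)` for a filtered map `f : C(a) → C(m) ⊗̂ C(q)`. -/
def mapLeft {a m q : ℕ} (r : ℕ) (f : C.obj a →ₗ[k] C.tensor₂ m q)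
    (hf : IsFiltered (C.cx a).fil (C.fil₂ m q) f) :
    C.tensor₂ a r →ₗ[k] Compl (tensorSum (C.fil₂ m q) (C.cx r).fil) :=
  Compl.tmap (C.fil₂_antitone m q) (C.fil₂_exhaustive m q) (C.cx r).fil_antitone
    (C.cx r).fil_exhaustive f hf (Compl.of (C.cx r).fil) (isFiltered_of _)

/-- `id ⊗̂ f : C(r) ⊗̂ C(a) → C(r) ⊗̂ (C(m) ⊗ C(q))` for a filtered map `f : C(a) → C(m) ⊗̂ C(q)`. -/
def mapRight {a m q : ℕ} (r : ℕ) (f : C.obj a →ₗ[k] C.tensor₂ m q)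
    (hf : IsFiltered (C.cx a).fil (C.fil₂ m q) f) :
    C.tensor₂ r a →ₗ[k] Compl (tensorSum (C.cx r).fil (C.fil₂ m q)) :=
  Compl.tmap (C.cx r).fil_antitone (C.cx r).fil_exhaustive (C.fil₂_antitone m q)
    (C.fil₂_exhaustive m q) (Compl.of (C.cx r).fil) (isFiltered_of _) f hf

end CompleteSymmSeq

/-- A complete (non-counital, symmetric) cooperad, presented by its infinitesimal cocomposition.
`dec p q n : C(n) → C(p + 1) ⊗̂ C(q)`, where `n = q + p`, is the component of the infinitesimal
cocomposition on the tree with two vertices whose upper vertex carries the first `q` leaves and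
sits on the first input of the lower vertex, which has the other `p` leaves as its remaining inputs;
the components on the other trees with two vertices are obtained by the symmetric group action.
An equation `(g ⊗̂ g')(y) = z` in a completion, with a linear map `g ⊗ g'` that preserves the
filtrations, is written out on representatives modulo each step of the filtration. -/
structure CompleteCooperad (k : Type*) [Field k] extends CompleteSymmSeq k where
  dec : ∀ p q n : ℕ, q + p = n → obj n →ₗ[k] toCompleteSymmSeq.tensor₂ (p + 1) q
  dec_fil : ∀ p q n h,
    IsFiltered (cx n).fil (toCompleteSymmSeq.fil₂ (p + 1) q) (dec p q n h)
  dec_deg : ∀ p q n h e, ∀ c ∈ (cx n).deg e, ∀ N, (dec p q n h c).1 N ∈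
    (tensorSum (cx (p + 1)).deg (cx q).deg e).map (toCompleteSymmSeq.fil₂ (p + 1) q N).mkQ
  /-- `dec` commutes with the differentials. -/
  dec_d : ∀ p q n h c N t,
    (toCompleteSymmSeq.fil₂ (p + 1) q N).mkQ t = (dec p q n h c).1 N →
    (toCompleteSymmSeq.fil₂ (p + 1) q N).mkQ (tensorD (cx (p + 1)) (cx q) t) =
      (dec p q n h ((cx n).d c)).1 N
  /-- `dec` is equivariant for permutations `ρ` that consist of a permutation `σ` of the first `q`
  leaves and a permutation of the other `p` leaves; `τ` is the latter, acting on the last `p` inputs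
  of the lower vertex. -/
  dec_act : ∀ p q n h c (ρ : Equiv.Perm (Fin n)) (σ : Equiv.Perm (Fin q))
    (τ : Equiv.Perm (Fin (p + 1))),
    (∀ j : Fin q, (ρ ⟨j, by omega⟩ : ℕ) = σ j) → τ 0 = 0 →
    (∀ j : Fin p, (ρ ⟨q + j, by omega⟩ : ℕ) + 1 = q + τ j.succ) →
    ∀ N t, (toCompleteSymmSeq.fil₂ (p + 1) q N).mkQ t = (dec p q n h c).1 N →
      (toCompleteSymmSeq.fil₂ (p + 1) q N).mkQ
        (TensorProduct.map (act (p + 1) τ) (act q σ) t) = (dec p q n h (act n ρ c)).1 N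
  /-- Sequential coassociativity: the two ways to arrive at the component on the tree with three
  vertices on top of each other agree. -/
  coassoc_seq : ∀ (p q r n : ℕ) (h : r + q + p = n) (c : obj n) (N : ℤ)
    (t : (obj (p + 1) ⊗[k] obj (q + 1)) ⊗[k] obj r),
    (tensorSum (toCompleteSymmSeq.fil₂ (p + 1) (q + 1)) (cx r).fil N).mkQ t =
      (toCompleteSymmSeq.mapLeft r (dec p (q + 1) (q + p + 1) (by omega)) (dec_fil _ _ _ _)
        (dec (q + p) r n (by omega) c)).1 N →
    (tensorSum (cx (p + 1)).fil (toCompleteSymmSeq.fil₂ (q + 1) r) N).mkQ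
        (TensorProduct.assoc k _ _ _ t) =
      (toCompleteSymmSeq.mapRight (p + 1) (dec q r (r + q) rfl) (dec_fil _ _ _ _)
        (dec p (r + q) n h c)).1 N
  /-- Parallel coassociativity: the two ways to arrive at the component on the tree with two
  vertices, with `q` and `r` leaves, on top of the first two inputs of the lower vertex agree. -/
  coassoc_par : ∀ (p q r n : ℕ) (h : r + q + p = n)
    (ρ₁ : Equiv.Perm (Fin (q + p + 1))) (ρ₂ : Equiv.Perm (Fin n))
    (ρ₃ : Equiv.Perm (Fin (r + p + 1))) (τ : Equiv.Perm (Fin (p + 1 + 1))),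
    IsBlockSwap 1 q ρ₁ → IsBlockSwap r q ρ₂ → IsBlockSwap 1 r ρ₃ → IsBlockSwap 1 1 τ →
    ∀ (c : obj n) (N : ℤ) (t : obj (p + 1 + 1) ⊗[k] (obj r ⊗[k] obj q)),
    (tensorSum (toCompleteSymmSeq.fil₂ (p + 1 + 1) r) (cx q).fil N).mkQ
        ((TensorProduct.assoc k _ _ _).symm t) =
      (toCompleteSymmSeq.mapLeft q
        (dec (p + 1) r (r + p + 1) (by omega) ∘ₗ act (r + p + 1) ρ₃)
        (fun N x hx => dec_fil _ _ _ _ N _ (act_fil _ _ _ _ hx))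
        (dec (r + p) q n (by omega) (act n ρ₂ c))).1 N →
    (tensorSum (toCompleteSymmSeq.fil₂ (p + 1 + 1) q) (cx r).fil N).mkQ
        ((TensorProduct.assoc k _ _ _).symm
          (TensorProduct.map (act (p + 1 + 1) τ) (tensorSwap (cx r) (cx q)) t)) =
      (toCompleteSymmSeq.mapLeft r
        (dec (p + 1) q (q + p + 1) (by omega) ∘ₗ act (q + p + 1) ρ₁)
        (fun N x hx => dec_fil _ _ _ _ N _ (act_fil _ _ _ _ hx))
        (dec (q + p) r n (by omega) c)).1 N

namespace CompleteCooperad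

variable {k : Type*} [Field k] (C : CompleteCooperad k)

/-- `C.iterFil m N n` consists of the elements of `C(n)` all of whose `m`-fold iterated
decompositions have filtration weight at least `N`. Here the lower factor is decomposed again and
again, after an arbitrary permutation of its inputs, so that every tree with `m + 1` vertices
occurs. For `m = 0` this is `F^N C(n)`; in the recursion, the preimage of
`F^N(X ⊗ C(q))` under `f ⊗ id : C(p + 1) ⊗ C(q) → X ⊗ C(q)` is `∑_r f⁻¹(F^r X) ⊗ F^{N-r} C(q)`. -/
def iterFil : ℕ → ℤ → ∀ n, Submodule k (C.obj n)
  | 0 => fun N n => (C.cx n).fil N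
  | m + 1 => fun N n =>
    ⨅ (p : ℕ) (q : ℕ) (h : q + p = n) (ρ : Equiv.Perm (Fin n)),
      ((tensorSum (fun r => iterFil m r (p + 1)) (C.cx q).fil N).map
        (C.fil₂ (p + 1) q N).mkQ).comap
          ((LinearMap.proj N ∘ₗ (C.tensor₂ (p + 1) q).subtype) ∘ₗ C.dec p q n h ∘ₗ C.act n ρ)

/-- Complete conilpotence: every operation may decompose into infinitely many trees, but their sum
converges, i.e. for every `N` all its components on trees with sufficiently many vertices have
filtration weight at least `N`. -/
def IsConilpotent : Prop :=
  ∀ (n : ℕ) (c : C.obj n) (N : ℤ), ∃ m₀ : ℕ, ∀ m, m₀ ≤ m → c ∈ C.iterFil m N n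

end CompleteCooperad

/-! ### The convolution product -/

section Star

variable {k : Type*} [Field k]

/-- `z` is the value at `y` of the continuous extension to the completed tensor product of a
bilinear map `β` (a finite sum of pure tensors is given by the list of its terms). -/
def IsEval {A D Z : Type*} [AddCommGroup A] [Module k A] [AddCommGroup D] [Module k D]
    [AddCommGroup Z] [Module k Z] {T : ℤ → Submodule k (A ⊗[k] D)} (F : ℤ → Submodule k Z)
    (β : A → D → Z) (y : Compl T) (z : Z) : Prop :=
  ∀ N : ℤ, ∃ M : ℤ, ∀ L : List (A × D),
    (T M).mkQ (L.map fun u => u.1 ⊗ₜ[k] u.2).sum = y.1 M →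
      z - (L.map fun u => β u.1 u.2).sum ∈ F N

open Classical in
/-- The value at `y` of the continuous extension of the bilinear map `β`. -/
def evalCompl {A D Z : Type*} [AddCommGroup A] [Module k A] [AddCommGroup D] [Module k D]
    [AddCommGroup Z] [Module k Z] {T : ℤ → Submodule k (A ⊗[k] D)} (F : ℤ → Submodule k Z)
    (β : A → D → Z) (y : Compl T) : Z :=
  if h : ∃ z, IsEval F β y z then h.choose else 0

/-- `ρ` is increasing on the first `q` entries and on the remaining ones: `v ∘ ρ` first lists `q` of
the entries of `v` and then the others, without changing the order among them. -/
def IsUnshuffle (q : ℕ) {n : ℕ} (ρ : Equiv.Perm (Fin n)) : Prop :=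
  ∀ i j : Fin n, i < j → ((j : ℕ) < q ∨ q ≤ (i : ℕ)) → ρ i < ρ j

/-- The Koszul sign of the rearrangement `v ↦ v ∘ ρ` of a family `v` of parities `e`. -/
def koszulSign {n : ℕ} (ρ : Equiv.Perm (Fin n)) (e : Fin n → ZMod 2) : ℤˣ :=
  ∏ i : Fin n, ∏ j : Fin n,
    if i < j ∧ ρ j < ρ i ∧ e (ρ i) = 1 ∧ e (ρ j) = 1 then -1 else 1

open Classical in
/-- The convolution (pre-Lie) product `f ⋆ g = γ_{(1)} ∘ (f ⊗ g) ∘ Δ_{(1)}` of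
`f : C(n) → Hom(X^{⊗n}, Z)` and `g : C(n) → Hom(X^{⊗n}, X)`, where `g` has degree `s`: for
`Δ_{(1)}(c) = ∑ (c' ∘_1 c'')^{ρ⁻¹}`, summed over the trees with two vertices, i.e. over unshuffles,
`(f ⋆ g)(c)(x) = ∑ ± (-1)^{s|c'|} f(c')(g(c'')(x_{ρ(1)}, …, x_{ρ(q)}), x_{ρ(q+1)}, …, x_{ρ(n)})`
with `±` the Koszul sign of `ρ` on `x`. Here `x` is split into its components of given parities
by `par`, and `F` is the filtration of `Z`. -/
def star (C : CompleteCooperad k) {X Z : Type*} [AddCommGroup Z] [Module k Z]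
    (par : ZMod 2 → X → X) (F : ℤ → Submodule k Z) (s : ℕ)
    (f : ∀ n, C.obj n → (Fin n → X) → Z) (g : ∀ n, C.obj n → (Fin n → X) → X) :
    ∀ n, C.obj n → (Fin n → X) → Z :=
  fun n c x =>
    ∑ q : Fin (n + 1), ∑ ρ : Equiv.Perm (Fin n) with IsUnshuffle q ρ, ∑ e : Fin n → ZMod 2,
      koszulSign ρ e • evalCompl F
        (fun a b => f (n - q + 1) (((C.cx (n - q + 1)).sgn ^ s) a)
          (Fin.cons
            (g q b fun j => par (e (ρ ⟨j, by omega⟩)) (x (ρ ⟨j, by omega⟩)))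
            (fun j : Fin (n - q) =>
              par (e (ρ ⟨q + j, by omega⟩)) (x (ρ ⟨q + j, by omega⟩)))))
        (C.dec (n - q) q n (by omega) (C.act n ρ c))

/-- The differential `∂f = d ∘ f - (-1)^{|f|} f ∘ d` of `f : C → Hom(V^{⊗n}, W)` of degree `s`, at
`c` of degree `e` and at `x` of degrees `t`. -/
def boundary (C : CompleteCooperad k) {V W : Type*} [AddCommGroup V] [Module k V]
    [AddCommGroup W] [Module k W] (𝕍 : CompleteComplex k V) (𝕎 : CompleteComplex k W) (s : ℤ)
    (f : ∀ n, C.obj n → (Fin n → V) → W) (n : ℕ) (e : ℤ) (c : C.obj n) (t : Fin n → ℤ)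
    (x : Fin n → V) : W :=
  𝕎.d (f n c x)
    - (s + e).negOnePow • ∑ j, (∑ i with i < j, t i).negOnePow •
        f n c (Function.update x j (𝕍.d (x j)))
    - s.negOnePow • f n ((C.cx n).d c) x

end Star

/-! ### Graded mixed cdgas and their modules -/

/-- A graded mixed cdga `(B, δ)`: a complete filtered commutative dg-algebra whose filtration is
split by a multiplicative weight grading `wt` (so that `B` is the totalization of the weight-graded
cdga formed by the `wt p`), with a derivation `δ` of degree `1` and filtration weight `1` such that
`δ² + [d, δ] = 0`. -/
structure GradedMixedCDGA (k B : Type*) [Field k] [Ring B] [Algebra k B] extends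
    CompleteComplex k B where
  one_deg : (1 : B) ∈ deg 0
  mul_deg : ∀ m n, ∀ a ∈ deg m, ∀ b ∈ deg n, a * b ∈ deg (m + n)
  mul_fil : ∀ p q, ∀ a ∈ fil p, ∀ b ∈ fil q, a * b ∈ fil (p + q)
  mul_comm : ∀ m n, ∀ a ∈ deg m, ∀ b ∈ deg n, a * b = (m * n).negOnePow • (b * a)
  d_mul : ∀ m, ∀ a ∈ deg m, ∀ b, d (a * b) = d a * b + m.negOnePow • (a * d b)
  wt : ℤ → Submodule k B
  wt_homog : ∀ p, wt p ≤ ⨆ n, wt p ⊓ deg n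
  one_wt : (1 : B) ∈ wt 0
  mul_wt : ∀ p q, ∀ a ∈ wt p, ∀ b ∈ wt q, a * b ∈ wt (p + q)
  d_wt : ∀ p, ∀ a ∈ wt p, d a ∈ wt p
  wt_sup : ∀ p, wt p ⊔ fil (p + 1) = fil p
  wt_inf : ∀ p, wt p ⊓ fil (p + 1) = ⊥
  δ : B →ₗ[k] B
  δ_deg : ∀ n, ∀ a ∈ deg n, δ a ∈ deg (n + 1)
  δ_fil : ∀ p, ∀ a ∈ fil p, δ a ∈ fil (p + 1)
  δ_mul : ∀ m, ∀ a ∈ deg m, ∀ b, δ (a * b) = δ a * b + m.negOnePow • (a * δ b)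
  δ_δ : ∀ a, δ (δ a) + (d (δ a) + δ (d a)) = 0

variable {k : Type*} [Field k] {B : Type*} [Ring B] [Algebra k B]

/-- The structure of a complete dg-module over the complete cdga `(B, d)`. -/
structure CompleteDGModule (𝔹 : GradedMixedCDGA k B) (V : Type*) [AddCommGroup V] [Module k V]
    [Module B V] [IsScalarTower k B V] extends CompleteComplex k V where
  smul_deg : ∀ m n, ∀ b ∈ 𝔹.deg m, ∀ x ∈ deg n, b • x ∈ deg (m + n)
  smul_fil : ∀ p q, ∀ b ∈ 𝔹.fil p, ∀ x ∈ fil q, b • x ∈ fil (p + q)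
  d_smul : ∀ m, ∀ b ∈ 𝔹.deg m, ∀ x, d (b • x) = 𝔹.d b • x + m.negOnePow • b • d x

/-! ### Algebras, infinity-morphisms and deformation retracts -/

section Algebras

variable (C : CompleteCooperad k) {𝔹 : GradedMixedCDGA k B}
  {V : Type*} [AddCommGroup V] [Module k V] [Module B V] [IsScalarTower k B V]
  {W : Type*} [AddCommGroup W] [Module k W] [Module B W] [IsScalarTower k B W]

/-- The structure of a `P_B`-algebra, for `P_B = B ∘ Ω(C)`, on a complete `B`-module `V`: an algebra
over the cobar construction `Ω(C)`, i.e. a twisting morphism `C → End_V` (a filtered equivariant map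
of degree `1` which satisfies the Maurer-Cartan equation `∂α + α ⋆ α = 0`), such that the generating
operations `c ∈ C[-1]` interact with the `B`-module structure as prescribed by
`c ∘ (b_1, …, b_n) = ± (b_1 ⋯ b_n) ∘ c` in arity `n ≠ 1` and
`c ∘ b = ± b ∘ c + λ_c δ(b) ∘ 1` in arity `1`. Operations attached to `c` of degree `e` in `C` have
degree `e + 1`. -/
structure PBAlgebra (lam : C.obj 1 →ₗ[k] k) (𝕍 : CompleteDGModule 𝔹 V) where
  op : ∀ n, C.obj n →ₗ[k] MultilinearMap k (fun _ : Fin n => V) V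
  op_deg : ∀ n e, ∀ c ∈ (C.cx n).deg e, ∀ (t : Fin n → ℤ) (x : Fin n → V),
    (∀ j, x j ∈ 𝕍.deg (t j)) → op n c x ∈ 𝕍.deg (e + 1 + ∑ j, t j)
  op_fil : ∀ n p, ∀ c ∈ (C.cx n).fil p, ∀ (w : Fin n → ℤ) (x : Fin n → V),
    (∀ j, x j ∈ 𝕍.fil (w j)) → op n c x ∈ 𝕍.fil (p + ∑ j, w j)
  op_act : ∀ n c (ρ : Equiv.Perm (Fin n)) (t : Fin n → ℤ) (x : Fin n → V),
    (∀ j, x j ∈ 𝕍.deg (t j)) →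
      op n (C.act n ρ c) (x ∘ ρ) = koszulSign ρ (fun j => (t j : ZMod 2)) • op n c x
  maurerCartan : ∀ n e, ∀ c ∈ (C.cx n).deg e, ∀ (t : Fin n → ℤ) (x : Fin n → V),
    (∀ j, x j ∈ 𝕍.deg (t j)) →
      boundary C 𝕍.toCompleteComplex 𝕍.toCompleteComplex 1 (fun n c x => op n c x) n e c t x
        + star C 𝕍.par 𝕍.fil 1 (fun n c x => op n c x) (fun n c x => op n c x) n c x = 0
  op_smul : ∀ n, n ≠ 1 → ∀ e, ∀ c ∈ (C.cx n).deg e, ∀ (t : Fin n → ℤ) (x : Fin n → V),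
    (∀ j, x j ∈ 𝕍.deg (t j)) → ∀ m, ∀ b ∈ 𝔹.deg m, ∀ j,
      op n c (Function.update x j (b • x j)) =
        (m * (e + 1 + ∑ i with i < j, t i)).negOnePow • b • op n c x
  op_smul_one : ∀ e, ∀ c ∈ (C.cx 1).deg e, ∀ x : V, ∀ m, ∀ b ∈ 𝔹.deg m,
    op 1 c (fun _ => b • x) =
      (m * (e + 1)).negOnePow • b • op 1 c (fun _ => x) + lam c • 𝔹.δ b • x

variable {C}

/-- The maps `T_r : C(n) → Hom((V × W)^{⊗n}, W)` with `T_0(c)(x) = α(c)(i(v_1) + w_1, …)` for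
`x_j = (v_j, w_j)`, and `T_{r+1} = T_r ⋆ φ`, where `φ` takes inputs in `V` and has values in `W`.
So `T_r(c)` restricted to inputs from `V` is the sum, over all ways to split off from `c` an ordered
family `c_1, …, c_r` of upper vertices on top of a common lower vertex `c'`, of
`± α(c')(…, φ(c_j)(…), …)` with `i` inserted into the remaining inputs of `c'`. -/
def compTerm (𝕍 : CompleteComplex k V) (𝕎 : CompleteComplex k W)
    (α : ∀ n, C.obj n → (Fin n → W) → W) (i : V → W) (φ : ∀ n, C.obj n → (Fin n → V) → W) :
    ℕ → ∀ n, C.obj n → (Fin n → V × W) → W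
  | 0 => fun n c x => α n c (fun j => i (x j).1 + (x j).2)
  | r + 1 => star C (fun e x => (𝕍.par e x.1, 𝕎.par e x.2)) 𝕎.fil 0
      (compTerm 𝕍 𝕎 α i φ r) (fun n c x => (0, φ n c (fun j => (x j).1)))

/-- `z = (α ⊚ (i + φ))(c)(x)`, where `α ⊚ f = γ ∘ (α ∘ f) ∘ Δ` is formed with the total
cocomposition `Δ : C → C ∘ C_+`, and `f : C_+ → Hom(V^{⊗n}, W)` is `i` on `I` and `φ` on `C`. The
sum runs over the number `r` of upper vertices that belong to `C`; the factor `1/r!` accounts for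
their orderings, and the sum converges in the filtration of `W`. -/
def IsComp (𝕍 : CompleteComplex k V) (𝕎 : CompleteComplex k W)
    (α : ∀ n, C.obj n → (Fin n → W) → W) (i : V → W) (φ : ∀ n, C.obj n → (Fin n → V) → W)
    (n : ℕ) (c : C.obj n) (x : Fin n → V) (z : W) : Prop :=
  ∀ N : ℤ, ∃ R₀ : ℕ, ∀ R, R₀ ≤ R →
    z - ∑ r ∈ Finset.range R,
      (r.factorial : k)⁻¹ • compTerm 𝕍 𝕎 α i φ r n c (fun j => (x j, 0)) ∈ 𝕎.fil N

/-- An infinity-morphism `v ⇝ w` of `P_B`-algebras: a map of dg `C`-coalgebras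
`C_+ ∘ V → C_+ ∘ W`, given by its components `f_c : V^{⊗n} → W` for `c ∈ C_+(n) = (C ⊕ I)(n)` (a
map into a cofree coalgebra is determined by its corestriction `C_+ ∘ V → W`), all of which are
`B`-multilinear. Here `lin` is the component of `I` and `op` is the restriction to `C`.
Compatibility with the differentials of the bar constructions says that `lin` is a chain map, and
`∂f = f ⋆ α_V - α_W ⊚ f` on `C`. -/
structure InftyMorphism {lam : C.obj 1 →ₗ[k] k} {𝕍 : CompleteDGModule 𝔹 V}
    {𝕎 : CompleteDGModule 𝔹 W} (v : PBAlgebra C lam 𝕍) (w : PBAlgebra C lam 𝕎) where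
  lin : V →ₗ[B] W
  lin_deg : ∀ n, ∀ x ∈ 𝕍.deg n, lin x ∈ 𝕎.deg n
  lin_fil : ∀ p, ∀ x ∈ 𝕍.fil p, lin x ∈ 𝕎.fil p
  lin_d : ∀ x, lin (𝕍.d x) = 𝕎.d (lin x)
  op : ∀ n, C.obj n →ₗ[k] MultilinearMap k (fun _ : Fin n => V) W
  op_deg : ∀ n e, ∀ c ∈ (C.cx n).deg e, ∀ (t : Fin n → ℤ) (x : Fin n → V),
    (∀ j, x j ∈ 𝕍.deg (t j)) → op n c x ∈ 𝕎.deg (e + ∑ j, t j)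
  op_fil : ∀ n p, ∀ c ∈ (C.cx n).fil p, ∀ (u : Fin n → ℤ) (x : Fin n → V),
    (∀ j, x j ∈ 𝕍.fil (u j)) → op n c x ∈ 𝕎.fil (p + ∑ j, u j)
  op_act : ∀ n c (ρ : Equiv.Perm (Fin n)) (t : Fin n → ℤ) (x : Fin n → V),
    (∀ j, x j ∈ 𝕍.deg (t j)) →
      op n (C.act n ρ c) (x ∘ ρ) = koszulSign ρ (fun j => (t j : ZMod 2)) • op n c x
  op_smul : ∀ n e, ∀ c ∈ (C.cx n).deg e, ∀ (t : Fin n → ℤ) (x : Fin n → V),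
    (∀ j, x j ∈ 𝕍.deg (t j)) → ∀ m, ∀ b ∈ 𝔹.deg m, ∀ j,
      op n c (Function.update x j (b • x j)) =
        (m * (e + ∑ i with i < j, t i)).negOnePow • b • op n c x
  equation : ∀ n e, ∀ c ∈ (C.cx n).deg e, ∀ (t : Fin n → ℤ) (x : Fin n → V),
    (∀ j, x j ∈ 𝕍.deg (t j)) →
      IsComp 𝕍.toCompleteComplex 𝕎.toCompleteComplex (fun n c x => w.op n c x) lin
        (fun n c x => op n c x) n c x
        (lin (v.op n c x)
          + star C 𝕍.par 𝕎.fil 1 (fun n c x => op n c x) (fun n c x => v.op n c x) n c x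
          - boundary C 𝕍.toCompleteComplex 𝕎.toCompleteComplex 0 (fun n c x => op n c x) n e c t x)

/-- A deformation retract of complete `B`-modules of `W` onto `V`: filtered `B`-linear chain maps
`i` and `p` and a filtered (graded) `B`-linear homotopy `h` of degree `-1` with
`i p - id = d h + h d` and `p i = id`. -/
structure DeformationRetract (𝕍 : CompleteDGModule 𝔹 V) (𝕎 : CompleteDGModule 𝔹 W) where
  i : V →ₗ[B] W
  p : W →ₗ[B] V
  h : W →ₗ[k] W
  i_deg : ∀ n, ∀ x ∈ 𝕍.deg n, i x ∈ 𝕎.deg n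
  i_fil : ∀ q, ∀ x ∈ 𝕍.fil q, i x ∈ 𝕎.fil q
  i_d : ∀ x, i (𝕍.d x) = 𝕎.d (i x)
  p_deg : ∀ n, ∀ x ∈ 𝕎.deg n, p x ∈ 𝕍.deg n
  p_fil : ∀ q, ∀ x ∈ 𝕎.fil q, p x ∈ 𝕍.fil q
  p_d : ∀ x, p (𝕎.d x) = 𝕍.d (p x)
  h_deg : ∀ n, ∀ x ∈ 𝕎.deg n, h x ∈ 𝕎.deg (n - 1)
  h_fil : ∀ q, ∀ x ∈ 𝕎.fil q, h x ∈ 𝕎.fil q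
  h_smul : ∀ m, ∀ b ∈ 𝔹.deg m, ∀ x, h (b • x) = m.negOnePow • b • h x
  homotopy : ∀ x, i (p x) - x = 𝕎.d (h x) + h (𝕎.d x)
  p_i : ∀ x, p (i x) = x

end Algebras

end FilteredHTT

end

/-!
The transferred structure is a sum over trees. It is handled without any trees, through
exponentials of the pre-Lie product `⋆` of the convolution algebra.

*Total compositions as exponentials.* Operations with inputs from `V` and `W` are regarded as
operations on `V × W`. Let `β(v + w) = α_W(i v + w)` (`base`), and let `φ` be a family of
operations from `V` to `W`, regarded as a family `φ̂` on `V × W` (`lift`). Nothing can be inserted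
in `φ̂` that takes values in `W`, so by the pre-Lie identity (`sstar_preLie`) the products
`β ⋆ φ̂ ⋆ ⋯ ⋆ φ̂` do not depend on an order of the factors, and the total composition
`α_W ⊚ (i + φ)` is the restriction to inputs from `V` of the series `Z(φ) = ∑ β ⋆ φ̂ ⋆ ⋯ ⋆ φ̂ / r!`
(`expSum`, `isComp_iff`). The pre-Lie identity says moreover that `- ⋆ φ̂` acts as a derivation on
the products that occur here. With the Maurer-Cartan equation for `α_W` this gives
`∂Z = - Z ⋆ Z - Z ⋆ ∂φ̂` (`bd_expSum`), and `Z ⋆ a = Z ⋆ (i a + φ ⋆ a)^` for families `a` of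
operations on `V` (`expSum_sstar_liftV`).

*Convergence.* A family has order `m` if it only sees iterated decompositions with more than `m`
vertices (`Order`), and `RightOrder` measures by how much a family raises the order as a second
factor of `⋆`. Orders of the second kind add up under composition (`RightOrder.sstar`), which is
again a consequence of the pre-Lie identity. Over a conilpotent cooperad a sequence of increasing
order converges to zero, and a family of infinite order vanishes.

*The fixed point.* Put `T(φ) = h Z(φ)`, restricted to inputs from `V` (`treeStep`). This map is a
contraction for the order, so it has a fixed point `φ` (`exists_treeStep_eq`), which consists of
the higher components of `i_∞`; put `a = p Z(φ)` for `α_V`. Let `e = i a + φ ⋆ a - ∂φ - Z` be the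
defect of the equation of an infinity-morphism. The formulas above and `ip - 1 = dh + hd` give
`e = h (Z ⋆ ê)`, restricted to `V`. Iterating this shows that `e` has infinite order, so `e = 0`.
The Maurer-Cartan equation for `a` follows, because `∂a + a ⋆ a = p (Z ⋆ ê)` (`transfer`).

*Linearity over `B`.* The operations of `W` fail to be `B`-linear only in arity one, by the terms
`λ δ(b)`. Let `K` be the intersection of the kernels of `h` and `p`. By the side conditions
`ph = 0` and `h² = 0` the values of `φ` lie in `K`, so if `φ` is `B`-linear, the only deviation of
`Z(φ)` from linearity that is not in `K` is the term `λ δ(b) i(v)` of the summand without any `φ`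
(`DeformationRetract.expSum_smul`). It is killed by `h`, since `hi = 0`, and becomes `λ δ(b) v`
under `p`. So all approximations of the fixed point are `B`-linear, hence `φ` is, and `a` satisfies
the condition on algebras over `B`.
-/

open scoped TensorProduct

noncomputable section

namespace FilteredHTT

/-! ### Signs and homogeneous elements of complete complexes -/

section Sign

variable (k : Type*) [Field k]

/-- The sign `(-1)^e` as a scalar. -/
def sg (e : ZMod 2) : k := if e = 1 then -1 else 1

variable {k}

@[simp] theorem sg_zero : sg k 0 = 1 := by simp [sg]

@[simp] theorem sg_one : sg k 1 = -1 := by simp [sg]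

theorem zmod_two_cases (e : ZMod 2) : e = 0 ∨ e = 1 := by revert e; decide

theorem sg_add (a b : ZMod 2) : sg k (a + b) = sg k a * sg k b := by
  rcases zmod_two_cases a with rfl | rfl <;> rcases zmod_two_cases b with rfl | rfl <;>
    simp [sg, show (1 : ZMod 2) + 1 = 0 by decide]

theorem sg_mul_self (a : ZMod 2) : sg k a * sg k a = 1 := by
  rcases zmod_two_cases a with rfl | rfl <;> simp

theorem intCast_eq_one_iff (n : ℤ) : (n : ZMod 2) = 1 ↔ Odd n := by
  rw [← ZMod.intCast_eq_one_iff_odd]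

variable {V : Type*} [AddCommGroup V] [Module k V]

theorem units_smul_eq (u : ℤˣ) (x : V) : u • x = (((u : ℤ) : k)) • x := by
  rw [Units.smul_def, Int.cast_smul_eq_zsmul]

theorem negOnePow_cast (n : ℤ) : ((n.negOnePow : ℤ) : k) = sg k (n : ZMod 2) := by
  rcases Int.even_or_odd n with h | h
  · rw [Int.negOnePow_even n h]
    have : (n : ZMod 2) = 0 := (ZMod.intCast_eq_zero_iff_even).2 h
    simp [this]
  · rw [Int.negOnePow_odd n h]
    have : (n : ZMod 2) = 1 := (intCast_eq_one_iff n).2 h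
    simp [this]

theorem negOnePow_smul (n : ℤ) (x : V) : n.negOnePow • x = sg k (n : ZMod 2) • x := by
  rw [units_smul_eq (k := k), negOnePow_cast]

end Sign

namespace CompleteComplex

variable {k V : Type*} [Field k] [AddCommGroup V] [Module k V] (X : CompleteComplex k V)

theorem iSup_deg : ⨆ n, X.deg n = ⊤ := X.isInternal.submodule_iSup_eq_top

/-- Induction on the decomposition into homogeneous elements. -/
theorem induction_deg {P : V → Prop} (hom : ∀ n, ∀ x ∈ X.deg n, P x)
    (add : ∀ x y, P x → P y → P (x + y)) (x : V) : P x := by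
  have hx : x ∈ ⨆ n, X.deg n := by rw [X.iSup_deg]; trivial
  induction hx using Submodule.iSup_induction' with
  | mem i x hx => exact hom i x hx
  | zero => exact hom 0 0 (Submodule.zero_mem _)
  | add x y _ _ hx hy => exact add x y hx hy

theorem odd_of_deg {n : ℤ} {x : V} (hx : x ∈ X.deg n) : X.odd x = if Odd n then x else 0 := by
  have h : (LinearEquiv.ofBijective (DirectSum.coeLinearMap X.deg) X.isInternal).symm x
      = DirectSum.lof k ℤ (fun n => X.deg n) n ⟨x, hx⟩ := by
    rw [LinearEquiv.symm_apply_eq]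
    exact (DirectSum.coeLinearMap_lof X.deg n ⟨x, hx⟩).symm
  simp only [odd, LinearMap.comp_apply, LinearEquiv.coe_coe, h, DirectSum.toModule_lof]
  split_ifs <;> simp

theorem sgn_of_deg {n : ℤ} {x : V} (hx : x ∈ X.deg n) : X.sgn x = sg k (n : ZMod 2) • x := by
  simp only [sgn, LinearMap.sub_apply, LinearMap.id_apply, LinearMap.smul_apply, X.odd_of_deg hx]
  by_cases h : Odd n
  · rw [if_pos h, (intCast_eq_one_iff n).2 h, sg_one, two_smul, neg_smul, one_smul]; abel
  · rw [if_neg h]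
    have : (n : ZMod 2) = 0 :=
      (zmod_two_cases _).resolve_right (fun e => h ((intCast_eq_one_iff n).1 e))
    simp [this]

theorem sgn_deg {n : ℤ} {x : V} (hx : x ∈ X.deg n) : X.sgn x ∈ X.deg n := by
  rw [X.sgn_of_deg hx]; exact Submodule.smul_mem _ _ hx

theorem sgn_pow_of_deg (s : ℕ) {n : ℤ} {x : V} (hx : x ∈ X.deg n) :
    (X.sgn ^ s) x = sg k (s * (n : ZMod 2)) • x := by
  induction s with
  | zero => simp
  | succ s ih =>
    rw [pow_succ', Module.End.mul_apply, ih, map_smul, X.sgn_of_deg hx, smul_smul, ← sg_add]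
    push_cast; ring_nf

theorem sgn_pow_deg (s : ℕ) {n : ℤ} {x : V} (hx : x ∈ X.deg n) : (X.sgn ^ s) x ∈ X.deg n := by
  rw [X.sgn_pow_of_deg s hx]; exact Submodule.smul_mem _ _ hx

/-- Induction on the decomposition of an element of `F^p` into homogeneous elements of `F^p`. -/
theorem induction_fil {P : V → Prop} {p : ℤ} (hom : ∀ n, ∀ x ∈ X.deg n, x ∈ X.fil p → P x)
    (add : ∀ x y, P x → P y → P (x + y)) {x : V} (hx : x ∈ X.fil p) : P x := by
  have hx' := X.fil_homog p hx
  clear hx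
  induction hx' using Submodule.iSup_induction' with
  | mem i x hx => exact hom i x hx.2 hx.1
  | zero => exact hom 0 0 (Submodule.zero_mem _) (Submodule.zero_mem _)
  | add x y _ _ hx hy => exact add x y hx hy

theorem sgn_fil {p : ℤ} {x : V} (hx : x ∈ X.fil p) : X.sgn x ∈ X.fil p := by
  refine X.induction_fil (P := fun x => X.sgn x ∈ X.fil p) (fun n x hn hp => ?_)
    (fun x y hx hy => by rw [map_add]; exact Submodule.add_mem _ hx hy) hx
  rw [X.sgn_of_deg hn]; exact Submodule.smul_mem _ _ hp

theorem sgn_pow_fil (s : ℕ) {p : ℤ} {x : V} (hx : x ∈ X.fil p) : (X.sgn ^ s) x ∈ X.fil p := by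
  induction s with
  | zero => simpa using hx
  | succ s ih => rw [pow_succ', Module.End.mul_apply]; exact X.sgn_fil ih

/-- `CompleteComplex.par` as a linear map. -/
def parL (e : ZMod 2) : V →ₗ[k] V := if e = 1 then X.odd else LinearMap.id - X.odd

theorem par_eq (e : ZMod 2) (x : V) : X.par e x = X.parL e x := by
  unfold par parL; split_ifs <;> rfl

theorem parL_of_deg (e : ZMod 2) {n : ℤ} {x : V} (hx : x ∈ X.deg n) :
    X.parL e x = if e = (n : ZMod 2) then x else 0 := by
  unfold parL
  by_cases h : Odd n
  · rw [(intCast_eq_one_iff n).2 h]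
    split_ifs <;> simp [X.odd_of_deg hx, h]
  · have h0 : (n : ZMod 2) = 0 :=
      (zmod_two_cases _).resolve_right (fun e => h ((intCast_eq_one_iff n).1 e))
    rw [h0]
    rcases zmod_two_cases e with rfl | rfl <;> simp [X.odd_of_deg hx, h]

/-- Convergence of Cauchy nets of homogeneous elements, with an estimate. -/
theorem exists_lim {n : ℤ} (y : ℤ → V) (hy : ∀ M, y M ∈ X.deg n) (s : ℤ)
    (hc : ∀ M N, M ≤ N → y N - y M ∈ X.fil (M + s)) :
    ∃ z ∈ X.deg n, ∀ M, z - y M ∈ X.fil (M + s) := by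
  obtain ⟨z, hz, h⟩ := X.fil_complete n (fun m => y (m - s)) (fun m => hy _) (fun m => by
    have := hc (m - s) ((m + 1 : ℕ) - s) (by push_cast; omega)
    simpa using this)
  refine ⟨z, hz, fun M => ?_⟩
  rcases le_total 0 (M + s) with h0 | h0
  · have := h (M + s).toNat
    rw [Int.toNat_of_nonneg h0] at this
    simpa using this
  · have h1 := h 0
    have h2 := hc M (0 - s) (by omega)
    have := Submodule.add_mem _ (X.fil_antitone h0 h1) (by simpa using h2)
    simpa using this

/-- Convergence of Cauchy sequences of homogeneous elements. -/
theorem exists_lim_seq {n : ℤ} (y : ℕ → V) (hy : ∀ m, y m ∈ X.deg n)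
    (hc : ∀ N : ℤ, ∃ m₀, ∀ m, m₀ ≤ m → y m - y m₀ ∈ X.fil N) :
    ∃ z ∈ X.deg n, ∀ N : ℤ, ∃ m₀, ∀ m, m₀ ≤ m → z - y m ∈ X.fil N := by
  choose m₀ hm using hc
  obtain ⟨z, hz, h⟩ := X.exists_lim (n := n) (fun N => y (m₀ N)) (fun N => hy _) 0 (by
    intro M N hMN
    have h1 := hm M (max (m₀ M) (m₀ N)) (le_max_left _ _)
    have h2 := X.fil_antitone hMN (hm N (max (m₀ M) (m₀ N)) (le_max_right _ _))
    have := Submodule.sub_mem _ h1 h2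
    simpa using this)
  refine ⟨z, hz, fun N => ⟨m₀ N, fun m hmm => ?_⟩⟩
  have := Submodule.sub_mem _ (h N) (by simpa using hm N m hmm)
  simpa using this

end CompleteComplex

section TensorExt

variable {k : Type*} [Field k] {X Y Z T : Type*} [AddCommGroup X] [Module k X] [AddCommGroup Y]
  [Module k Y] [AddCommGroup Z] [Module k Z] [AddCommGroup T] [Module k T]

theorem tensor_ext_deg (𝕏 : CompleteComplex k X) (𝕐 : CompleteComplex k Y)
    {f g : X ⊗[k] Y →ₗ[k] Z}
    (h : ∀ m n, ∀ x ∈ 𝕏.deg m, ∀ y ∈ 𝕐.deg n, f (x ⊗ₜ y) = g (x ⊗ₜ y)) : f = g := by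
  refine TensorProduct.ext' fun x y => ?_
  refine 𝕏.induction_deg (P := fun x => f (x ⊗ₜ y) = g (x ⊗ₜ y)) (fun m x hx => ?_)
    (fun x x' h1 h2 => by simp only [TensorProduct.add_tmul, map_add, h1, h2]) x
  exact 𝕐.induction_deg (P := fun y => f (x ⊗ₜ y) = g (x ⊗ₜ y)) (fun n y hy => h m n x hx y hy)
    (fun x x' h1 h2 => by simp only [TensorProduct.tmul_add, map_add, h1, h2]) y

/-- A linear map is filtered on a tensor product if it is so on pure tensors. -/
theorem tensorSum_le {F : ℤ → Submodule k X} {G : ℤ → Submodule k Y} {N : ℤ}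
    {S : Submodule k (X ⊗[k] Y)}
    (h : ∀ p, ∀ x ∈ F p, ∀ y ∈ G (N - p), x ⊗ₜ y ∈ S) : tensorSum F G N ≤ S :=
  iSup_le fun p => Submodule.map₂_le.2 fun x hx y hy => h p x hx y hy

/-- A multi-additive property holds if it holds for homogeneous arguments. -/
theorem CompleteComplex.induction_deg_pi {n : ℕ} (𝕏 : CompleteComplex k X) {P : (Fin n → X) → Prop}
    (hom : ∀ t : Fin n → ℤ, ∀ x : Fin n → X, (∀ j, x j ∈ 𝕏.deg (t j)) → P x)
    (add : ∀ x j a b, P (Function.update x j a) → P (Function.update x j b) →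
      P (Function.update x j (a + b))) (x : Fin n → X) : P x := by
  have key : ∀ (s : Finset (Fin n)) (x : Fin n → X), (∀ j, j ∉ s → ∃ t, x j ∈ 𝕏.deg t) → P x := by
    intro s
    induction s using Finset.induction_on with
    | empty =>
      intro x hx
      choose t ht using fun j => hx j (Finset.notMem_empty j)
      exact hom t x ht
    | insert j s hj ih =>
      intro x hx
      have : ∀ a, P (Function.update x j a) := by
        intro a
        refine 𝕏.induction_deg (P := fun a => P (Function.update x j a))
          (fun e a ha => ih _ fun i hi => ?_) (fun a b => add x j a b) a
        by_cases h : i = j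
        · subst h; exact ⟨e, by simpa using ha⟩
        · obtain ⟨t, ht⟩ := hx i (by simp [h, hi])
          exact ⟨t, by simpa [h] using ht⟩
      simpa using this (x j)
  exact key Finset.univ x (by simp)

theorem MultilinearMap.ext_deg {n : ℕ} (𝕏 : CompleteComplex k X)
    {f g : MultilinearMap k (fun _ : Fin n => X) Z}
    (h : ∀ t : Fin n → ℤ, ∀ x : Fin n → X, (∀ j, x j ∈ 𝕏.deg (t j)) → f x = g x) : f = g := by
  ext x
  refine 𝕏.induction_deg_pi (P := fun x => f x = g x) h (fun x j a b h1 h2 => ?_) x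
  rw [f.map_update_add, g.map_update_add, h1, h2]

/-- A continuous multilinear relation that is solvable on homogeneous elements is a multilinear
map. Here `R c x z` should be thought of as `z = F(c)(x)`. -/
theorem exists_op {n : ℕ} (𝕋 : CompleteComplex k T) (𝕏 : CompleteComplex k X)
    (R : T → (Fin n → X) → Z → Prop)
    (add_c : ∀ c c' x z z', R c x z → R c' x z' → R (c + c') x (z + z'))
    (smul_c : ∀ (r : k) c x z, R c x z → R (r • c) x (r • z))
    (add_x : ∀ c x j a b z z', R c (Function.update x j a) z → R c (Function.update x j b) z' →
      R c (Function.update x j (a + b)) (z + z'))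
    (smul_x : ∀ c x j (r : k) a z, R c (Function.update x j a) z →
      R c (Function.update x j (r • a)) (r • z))
    (uniq : ∀ c x z z', R c x z → R c x z' → z = z')
    (hom : ∀ e, ∀ c ∈ 𝕋.deg e, ∀ t : Fin n → ℤ, ∀ x : Fin n → X, (∀ j, x j ∈ 𝕏.deg (t j)) →
      ∃ z, R c x z) :
    ∃ F : T →ₗ[k] MultilinearMap k (fun _ : Fin n => X) Z, ∀ c x, R c x (F c x) := by
  have ex1 : ∀ c (t : Fin n → ℤ) (x : Fin n → X), (∀ j, x j ∈ 𝕏.deg (t j)) → ∃ z, R c x z := by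
    intro c t x hx
    refine 𝕋.induction_deg (P := fun c => ∃ z, R c x z) (fun e c hc => hom e c hc t x hx) ?_ c
    rintro c c' ⟨z, hz⟩ ⟨z', hz'⟩
    exact ⟨_, add_c _ _ _ _ _ hz hz'⟩
  have ex2 : ∀ c (x : Fin n → X), ∃ z, R c x z := by
    intro c
    refine 𝕏.induction_deg_pi (ex1 c) ?_
    rintro x j a b ⟨z, hz⟩ ⟨z', hz'⟩
    exact ⟨_, add_x _ _ _ _ _ _ _ hz hz'⟩
  choose F hF using ex2
  refine ⟨{
    toFun := fun c => {
      toFun := F c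
      map_update_add' := ?_
      map_update_smul' := ?_ }
    map_add' := ?_
    map_smul' := ?_ }, hF⟩
  · intro inst x j a b
    rw [Subsingleton.elim inst (instDecidableEqFin n)]
    exact uniq _ _ _ _ (hF _ _) (add_x _ _ _ _ _ _ _ (hF _ _) (hF _ _))
  · intro inst x j r a
    rw [Subsingleton.elim inst (instDecidableEqFin n)]
    exact uniq _ _ _ _ (hF _ _) (smul_x _ _ _ _ _ _ (hF _ _))
  · intro c c'
    ext x
    exact uniq _ _ _ _ (hF _ _) (add_c _ _ _ _ _ (hF _ _) (hF _ _))
  · intro r c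
    ext x
    exact uniq _ _ _ _ (hF _ _) (smul_c _ _ _ _ (hF _ _))

end TensorExt

/-! ### Evaluation of linear maps on completions -/

section Eval

variable {k : Type*} [Field k] {T T' Z Z' : Type*} [AddCommGroup T] [Module k T]
  [AddCommGroup T'] [Module k T'] [AddCommGroup Z] [Module k Z] [AddCommGroup Z'] [Module k Z']
  {FT : ℤ → Submodule k T} {F : ℤ → Submodule k Z}

/-- `z` is the value at `y ∈ T̂` of the continuous extension of the linear map `θ : T → Z`; the
approximation of `z` by values on representatives of `y` is required to be uniform. -/
def HasEval (F : ℤ → Submodule k Z) (θ : T →ₗ[k] Z) (y : Compl FT) (z : Z) : Prop :=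
  ∃ s : ℤ, ∀ M t, (FT M).mkQ t = y.1 M → z - θ t ∈ F (M + s)

namespace HasEval

theorem exists_rep (y : Compl FT) (M : ℤ) : ∃ t, (FT M).mkQ t = y.1 M :=
  (FT M).mkQ_surjective (y.1 M)

theorem mono_shift (hF : Antitone F) {θ : T →ₗ[k] Z} {y : Compl FT} {z : Z} {s s' : ℤ} (h : s' ≤ s)
    (H : ∀ M t, (FT M).mkQ t = y.1 M → z - θ t ∈ F (M + s)) :
    ∀ M t, (FT M).mkQ t = y.1 M → z - θ t ∈ F (M + s') :=
  fun M t ht => hF (by omega) (H M t ht)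

theorem uniq (hF : Antitone F) (hs : ∀ x, (∀ p, x ∈ F p) → x = 0) {θ : T →ₗ[k] Z}
    {y : Compl FT} {z z' : Z} (h : HasEval F θ y z) (h' : HasEval F θ y z') : z = z' := by
  obtain ⟨s, h⟩ := h
  obtain ⟨s', h'⟩ := h'
  refine sub_eq_zero.1 (hs _ fun p => ?_)
  obtain ⟨t, ht⟩ := exists_rep y (p - min s s')
  have := Submodule.sub_mem _ (mono_shift hF (min_le_left s s') h _ t ht)
    (mono_shift hF (min_le_right s s') h' _ t ht)
  simpa using this

theorem add (hF : Antitone F) {θ θ' : T →ₗ[k] Z} {y : Compl FT} {z z' : Z} (h : HasEval F θ y z)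
    (h' : HasEval F θ' y z') : HasEval F (θ + θ') y (z + z') := by
  obtain ⟨s, h⟩ := h
  obtain ⟨s', h'⟩ := h'
  refine ⟨min s s', fun M t ht => ?_⟩
  have := Submodule.add_mem _ (mono_shift hF (min_le_left s s') h _ t ht)
    (mono_shift hF (min_le_right s s') h' _ t ht)
  rw [LinearMap.add_apply]
  convert this using 1; abel

theorem smul (r : k) {θ : T →ₗ[k] Z} {y : Compl FT} {z : Z} (h : HasEval F θ y z) :
    HasEval F (r • θ) y (r • z) := by
  obtain ⟨s, h⟩ := h
  refine ⟨s, fun M t ht => ?_⟩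
  rw [LinearMap.smul_apply, ← smul_sub]
  exact Submodule.smul_mem _ _ (h M t ht)

theorem zero (y : Compl FT) : HasEval F (0 : T →ₗ[k] Z) y 0 :=
  ⟨0, fun M t _ => by simp⟩

theorem sub (hF : Antitone F) {θ θ' : T →ₗ[k] Z} {y : Compl FT} {z z' : Z} (h : HasEval F θ y z)
    (h' : HasEval F θ' y z') : HasEval F (θ - θ') y (z - z') := by
  have := h.add hF (h'.smul (-1))
  simpa [sub_eq_add_neg] using this

theorem sum (hF : Antitone F) {ι : Type*} (S : Finset ι) {θ : ι → T →ₗ[k] Z} {y : Compl FT}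
    {z : ι → Z} (h : ∀ i ∈ S, HasEval F (θ i) y (z i)) :
    HasEval F (∑ i ∈ S, θ i) y (∑ i ∈ S, z i) := by
  classical
  induction S using Finset.induction_on with
  | empty => simpa using zero y
  | insert i S hi ih =>
    rw [Finset.sum_insert hi, Finset.sum_insert hi]
    exact (h i (by simp)).add hF (ih fun j hj => h j (by simp [hj]))

theorem add_arg (hF : Antitone F) {θ : T →ₗ[k] Z} {y y' : Compl FT} {z z' : Z}
    (h : HasEval F θ y z) (h' : HasEval F θ y' z') : HasEval F θ (y + y') (z + z') := by
  obtain ⟨s, h⟩ := h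
  obtain ⟨s', h'⟩ := h'
  refine ⟨min s s', fun M t ht => ?_⟩
  obtain ⟨t₁, ht₁⟩ := exists_rep y M
  have e : (FT M).mkQ (t - t₁) = y'.1 M := by
    rw [map_sub, ht, ht₁]; simp
  have := Submodule.add_mem _ (mono_shift hF (min_le_left s s') h _ t₁ ht₁)
    (mono_shift hF (min_le_right s s') h' _ _ e)
  rw [map_sub] at this
  convert this using 1; abel

theorem smul_arg (hF : Antitone F) {θ : T →ₗ[k] Z} {y : Compl FT} {z : Z}
    (hθ : ∃ s, ∀ M, ∀ t ∈ FT M, θ t ∈ F (M + s)) (r : k) (h : HasEval F θ y z) :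
    HasEval F θ (r • y) (r • z) := by
  obtain ⟨s, h⟩ := h
  obtain ⟨s', hθ⟩ := hθ
  refine ⟨min s s', fun M t ht => ?_⟩
  obtain ⟨t₁, ht₁⟩ := exists_rep y M
  have e : t - r • t₁ ∈ FT M := by
    rw [← Submodule.Quotient.mk_eq_zero, ← Submodule.mkQ_apply, map_sub, map_smul, ht, ht₁]; simp
  have h1 := hF (show M + min s s' ≤ M + s' by omega) (hθ M _ e)
  have h2 := Submodule.smul_mem _ r (mono_shift hF (min_le_left s s') h _ t₁ ht₁)
  rw [map_sub, map_smul] at h1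
  convert Submodule.sub_mem _ h2 h1 using 1
  rw [smul_sub]; abel

/-- The estimate in `HasEval` holds with any shift for which `θ` is filtered. -/
theorem estimate (hF : Antitone F) (hFT : Antitone FT) {θ : T →ₗ[k] Z} {y : Compl FT} {z : Z}
    {s : ℤ} (hθ : ∀ M, ∀ t ∈ FT M, θ t ∈ F (M + s)) (h : HasEval F θ y z) (M : ℤ) (t : T)
    (ht : (FT M).mkQ t = y.1 M) : z - θ t ∈ F (M + s) := by
  obtain ⟨s', h⟩ := h
  have hM : M ≤ max M (M + s - s') := le_max_left _ _
  obtain ⟨t', ht'⟩ := exists_rep y (max M (M + s - s'))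
  have h1 := hF (show M + s ≤ _ by omega) (h _ t' ht')
  have h2 := hθ M _ (Compl.rep_sub hFT y hM ht ht')
  rw [map_sub] at h2
  convert Submodule.sub_mem _ h1 h2 using 1; abel

theorem map {G : ℤ → Submodule k Z'} {θ : T →ₗ[k] Z} {y : Compl FT} {z : Z} (L : Z →ₗ[k] Z')
    (hL : ∀ p, ∀ x ∈ F p, L x ∈ G p) (h : HasEval F θ y z) : HasEval G (L ∘ₗ θ) y (L z) := by
  obtain ⟨s, h⟩ := h
  refine ⟨s, fun M t ht => ?_⟩
  rw [LinearMap.comp_apply, ← map_sub]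
  exact hL _ _ (h M t ht)

/-- Evaluation at the image `y'` of `y` under a map of completions given on representatives. -/
theorem of_comp_arg {FT' : ℤ → Submodule k T'}
    {θ : T' →ₗ[k] Z} {g : T →ₗ[k] T'} {y : Compl FT} {y' : Compl FT'} {z : Z}
    (hg : ∀ M t, (FT M).mkQ t = y.1 M → (FT' M).mkQ (g t) = y'.1 M)
    (h : HasEval F θ y' z) : HasEval F (θ ∘ₗ g) y z := by
  obtain ⟨s, h⟩ := h
  exact ⟨s, fun M t ht => h M _ (hg M t ht)⟩

end HasEval

/-- Homogeneous evaluations exist. -/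
theorem exists_hasEval_deg (𝕫 : CompleteComplex k Z) (hFT : Antitone FT) {θ : T →ₗ[k] Z} {s : ℤ}
    (hθ : ∀ M, ∀ t ∈ FT M, θ t ∈ 𝕫.fil (M + s)) (y : Compl FT) (D : Submodule k T) {n : ℤ}
    (hD : ∀ t ∈ D, θ t ∈ 𝕫.deg n) (hy : ∀ N, y.1 N ∈ D.map (FT N).mkQ) :
    ∃ z ∈ 𝕫.deg n, HasEval 𝕫.fil θ y z := by
  choose t htD ht using hy
  obtain ⟨z, hz, h⟩ := 𝕫.exists_lim (n := n) (fun M => θ (t M)) (fun M => hD _ (htD M)) s (by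
    intro M N h
    rw [← map_sub, ← neg_sub, map_neg]
    exact Submodule.neg_mem _ (hθ M _ (Compl.rep_sub hFT y h (ht M) (ht N))))
  refine ⟨z, hz, s, fun M t' ht' => ?_⟩
  have h1 : t' - t M ∈ FT M := by
    rw [← Submodule.Quotient.mk_eq_zero, ← Submodule.mkQ_apply, map_sub, ht', ht M, sub_self]
  have h2 := hθ M _ h1
  rw [map_sub] at h2
  convert Submodule.sub_mem _ (h M) h2 using 1; abel

variable {A D : Type*} [AddCommGroup A] [Module k A] [AddCommGroup D] [Module k D]

theorem exists_list_tmul (t : A ⊗[k] D) :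
    ∃ L : List (A × D), (L.map fun u => u.1 ⊗ₜ[k] u.2).sum = t := by
  induction t with
  | zero => exact ⟨[], rfl⟩
  | tmul a b => exact ⟨[(a, b)], by simp⟩
  | add x y hx hy =>
    obtain ⟨L, hL⟩ := hx
    obtain ⟨L', hL'⟩ := hy
    exact ⟨L ++ L', by simp [hL, hL']⟩

/-- A value in the sense of `HasEval` is the value chosen by `evalCompl`. The function `β` need not
be known to be bilinear. -/
theorem HasEval.evalCompl_eq {FT : ℤ → Submodule k (A ⊗[k] D)}
    (hs : ∀ x, (∀ p, x ∈ F p) → x = 0) (hFT : Antitone FT)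
    {θ : A ⊗[k] D →ₗ[k] Z} {y : Compl FT} {z : Z} (h : HasEval F θ y z) (β : A → D → Z)
    (hβ : ∀ a b, θ (a ⊗ₜ b) = β a b) : evalCompl F β y = z := by
  have hsum : ∀ L : List (A × D), (L.map fun u => β u.1 u.2).sum
      = θ (L.map fun u => u.1 ⊗ₜ[k] u.2).sum := by
    intro L
    induction L with
    | nil => simp
    | cons u L ih => simp [ih, hβ]
  have h1 : IsEval F β y z := by
    obtain ⟨s, h⟩ := h
    intro N
    refine ⟨N - s, fun L hL => ?_⟩
    rw [hsum]
    simpa using h _ _ hL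
  have hex : ∃ z, IsEval F β y z := ⟨z, h1⟩
  rw [evalCompl, dif_pos hex]
  refine sub_eq_zero.1 (hs _ fun N => ?_)
  obtain ⟨M, hM⟩ := hex.choose_spec N
  obtain ⟨M', hM'⟩ := h1 N
  obtain ⟨t, ht⟩ := HasEval.exists_rep y (max M M')
  obtain ⟨L, rfl⟩ := exists_list_tmul t
  have low : ∀ m, m ≤ max M M' →
      (FT m).mkQ (L.map fun u => u.1 ⊗ₜ[k] u.2).sum = y.1 m := by
    intro m hm
    obtain ⟨t', ht'⟩ := HasEval.exists_rep y m
    rw [← ht']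
    exact ((Submodule.Quotient.eq _).2 (Compl.rep_sub hFT y hm ht' ht)).symm
  have := Submodule.sub_mem _ (hM L (low _ (le_max_left _ _))) (hM' L (low _ (le_max_right _ _)))
  simpa using this

end Eval

/-! ### Block permutations and Koszul signs -/

section Blocks

variable {α β : Type*} {p q n : ℕ}

/-- The first `q` entries of a family of length `q + p`. -/
def hd (h : q + p = n) (x : Fin n → α) : Fin q → α := fun j => x ⟨j, by omega⟩

/-- The last `p` entries of a family of length `q + p`. -/
def tl (h : q + p = n) (x : Fin n → α) : Fin p → α := fun j => x ⟨q + j, by omega⟩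

/-- The splitting of `q + p` positions into a block of length `q` and a block of length `p`. -/
def splitEquiv (h : q + p = n) : Fin q ⊕ Fin p ≃ Fin n := finSumFinEquiv.trans (finCongr h)

theorem splitEquiv_inl (h : q + p = n) (j : Fin q) : splitEquiv h (.inl j) = ⟨j, by omega⟩ := by
  ext; simp [splitEquiv]

theorem splitEquiv_inr (h : q + p = n) (j : Fin p) : splitEquiv h (.inr j) = ⟨q + j, by omega⟩ := by
  ext; simp [splitEquiv]

theorem sum_split {M : Type*} [AddCommMonoid M] (h : q + p = n) (f : Fin n → M) :
    ∑ i, f i = ∑ i, hd h f i + ∑ i, tl h f i := by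
  rw [← Equiv.sum_comp (splitEquiv h), Fintype.sum_sum_type]
  simp only [splitEquiv_inl, splitEquiv_inr]; rfl

theorem forall_split (h : q + p = n) {P : Fin n → Prop} :
    (∀ i, P i) ↔ (∀ j : Fin q, P ⟨j, by omega⟩) ∧ ∀ j : Fin p, P ⟨q + j, by omega⟩ := by
  rw [← (splitEquiv h).forall_congr_right, Sum.forall]
  simp only [splitEquiv_inl, splitEquiv_inr]

theorem hd_update_lt (h : q + p = n) (x : Fin n → α) (j : Fin q) (a : α) :
    hd h (Function.update x ⟨j, by omega⟩ a) = Function.update (hd h x) j a := by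
  ext i
  by_cases hij : i = j
  · subst hij; simp [hd]
  · have : (i : ℕ) ≠ j := fun e => hij (Fin.ext e)
    simp [hd, Function.update, this, hij]

theorem tl_update_lt (h : q + p = n) (x : Fin n → α) (j : Fin q) (a : α) :
    tl h (Function.update x ⟨j, by omega⟩ a) = tl h x := by
  ext i
  have : q + (i : ℕ) ≠ j := by omega
  simp [tl, Function.update, this]

theorem hd_update_ge (h : q + p = n) (x : Fin n → α) (j : Fin p) (a : α) :
    hd h (Function.update x ⟨q + j, by omega⟩ a) = hd h x := by
  ext i
  have : (i : ℕ) ≠ q + j := by omega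
  simp [hd, Function.update, this]

theorem tl_update_ge (h : q + p = n) (x : Fin n → α) (j : Fin p) (a : α) :
    tl h (Function.update x ⟨q + j, by omega⟩ a) = Function.update (tl h x) j a := by
  ext i
  by_cases hij : i = j
  · subst hij; simp [tl]
  · have : (i : ℕ) ≠ j := fun e => hij (Fin.ext e)
    simp [tl, Function.update, this, hij]

/-- The permutation of `q + p` positions that is `σ` on the first block and `μ` on the second. -/
def blk (h : q + p = n) (σ : Equiv.Perm (Fin q)) (μ : Equiv.Perm (Fin p)) : Equiv.Perm (Fin n) :=
  (splitEquiv h).permCongr (Equiv.Perm.sumCongr σ μ)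

theorem blk_lt (h : q + p = n) (σ : Equiv.Perm (Fin q)) (μ : Equiv.Perm (Fin p)) (j : Fin q) :
    blk h σ μ ⟨j, by omega⟩ = ⟨σ j, by omega⟩ := by
  rw [← splitEquiv_inl h, ← splitEquiv_inl h]; simp [blk, Equiv.permCongr_apply]

theorem blk_ge (h : q + p = n) (σ : Equiv.Perm (Fin q)) (μ : Equiv.Perm (Fin p)) (j : Fin p) :
    blk h σ μ ⟨q + j, by omega⟩ = ⟨q + μ j, by omega⟩ := by
  rw [← splitEquiv_inr h, ← splitEquiv_inr h]; simp [blk, Equiv.permCongr_apply]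

theorem hd_comp_blk (h : q + p = n) (σ : Equiv.Perm (Fin q)) (μ : Equiv.Perm (Fin p))
    (x : Fin n → α) : hd h (x ∘ blk h σ μ) = hd h x ∘ σ := by
  ext j; simp only [hd, Function.comp_apply, blk_lt]

theorem tl_comp_blk (h : q + p = n) (σ : Equiv.Perm (Fin q)) (μ : Equiv.Perm (Fin p))
    (x : Fin n → α) : tl h (x ∘ blk h σ μ) = tl h x ∘ μ := by
  ext j; simp only [tl, Function.comp_apply, blk_ge]

/-- The permutation of `p + 1` positions that fixes `0` and is `μ` on the others. -/
def fix0 (μ : Equiv.Perm (Fin p)) : Equiv.Perm (Fin (p + 1)) := Equiv.Perm.decomposeFin.symm (0, μ)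

@[simp] theorem fix0_zero (μ : Equiv.Perm (Fin p)) : fix0 μ 0 = 0 := by simp [fix0]

@[simp] theorem fix0_succ (μ : Equiv.Perm (Fin p)) (j : Fin p) : fix0 μ j.succ = (μ j).succ := by
  simp [fix0]

theorem cons_comp_fix0 (μ : Equiv.Perm (Fin p)) (a : α) (x : Fin p → α) :
    (Fin.cons a x : Fin (p + 1) → α) ∘ fix0 μ = Fin.cons a (x ∘ μ) := by
  ext j
  refine Fin.cases ?_ (fun j => ?_) j <;> simp

end Blocks

section Koszul

variable {n : ℕ}

/-- The exponent of the Koszul sign. -/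
def kosExp (ρ : Equiv.Perm (Fin n)) (e : Fin n → ZMod 2) : ZMod 2 :=
  ∑ i : Fin n, ∑ j : Fin n, if i < j ∧ ρ j < ρ i then e (ρ i) * e (ρ j) else 0

theorem sg_sum {k : Type*} [Field k] {ι : Type*} (s : Finset ι) (f : ι → ZMod 2) :
    sg k (∑ i ∈ s, f i) = ∏ i ∈ s, sg k (f i) := by
  classical
  induction s using Finset.induction_on with
  | empty => simp
  | insert a s ha ih => rw [Finset.sum_insert ha, Finset.prod_insert ha, sg_add, ih]

theorem koszulSign_cast (k : Type*) [Field k] (ρ : Equiv.Perm (Fin n)) (e : Fin n → ZMod 2) :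
    ((koszulSign ρ e : ℤ) : k) = sg k (kosExp ρ e) := by
  simp only [koszulSign, kosExp, sg_sum, Units.coe_prod, Int.cast_prod]
  refine Finset.prod_congr rfl fun i _ => Finset.prod_congr rfl fun j _ => ?_
  by_cases h : i < j ∧ ρ j < ρ i
  · rcases zmod_two_cases (e (ρ i)) with h1 | h1 <;>
      rcases zmod_two_cases (e (ρ j)) with h2 | h2 <;>
      simp [h, h1, h2]
  · simp only [← and_assoc, h, false_and, if_false]; simp

theorem koszulSign_smul {k V : Type*} [Field k] [AddCommGroup V] [Module k V]
    (ρ : Equiv.Perm (Fin n)) (e : Fin n → ZMod 2) (x : V) :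
    koszulSign ρ e • x = sg k (kosExp ρ e) • x := by
  rw [units_smul_eq (k := k), koszulSign_cast]

theorem sum_sum_eq_zero_of_antisymm {f : Fin n → Fin n → ZMod 2} (h : ∀ i j, f i j + f j i = 0)
    (h0 : ∀ i, f i i = 0) : ∑ i, ∑ j, f i j = 0 := by
  rw [← Finset.sum_product']
  refine Finset.sum_involution (fun a _ => (a.2, a.1)) (fun a _ => h _ _) (fun a _ ha e => ha ?_)
    (fun a _ => by simp) (fun a _ => rfl)
  have : a.2 = a.1 := (Prod.ext_iff.1 e).1
  rw [this]; exact h0 _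

theorem zmod_two_eq_of_add {a b : ZMod 2} (h : a + b = 0) : a = b := by
  revert a b; decide

/-- The cocycle property of Koszul signs. -/
theorem kosExp_mul (ρ σ : Equiv.Perm (Fin n)) (e : Fin n → ZMod 2) :
    kosExp (ρ * σ) e = kosExp ρ e + kosExp σ (e ∘ ρ) := by
  refine zmod_two_eq_of_add ?_
  have h1 : kosExp ρ e = ∑ i, ∑ j, if σ i < σ j ∧ ρ (σ j) < ρ (σ i) then
      e (ρ (σ i)) * e (ρ (σ j)) else 0 := by
    rw [kosExp, ← Equiv.sum_comp σ]
    refine Finset.sum_congr rfl fun i _ => ?_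
    rw [← Equiv.sum_comp σ]
  rw [h1, kosExp, kosExp, ← Finset.sum_add_distrib, ← Finset.sum_add_distrib]
  simp only [← Finset.sum_add_distrib, Equiv.Perm.mul_apply, Function.comp_apply]
  refine sum_sum_eq_zero_of_antisymm (fun i j => ?_) (fun i => by simp)
  rcases eq_or_ne i j with rfl | hij
  · simp
  have hs : σ i ≠ σ j := fun h => hij (σ.injective h)
  have hr : ρ (σ i) ≠ ρ (σ j) := fun h => hs (ρ.injective h)
  generalize e (ρ (σ i)) = a
  generalize e (ρ (σ j)) = b
  rcases lt_or_gt_of_ne hij with h1 | h1 <;> rcases lt_or_gt_of_ne hs with h2 | h2 <;>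
    rcases lt_or_gt_of_ne hr with h3 | h3 <;>
    simp only [h1, h2, h3, h1.not_gt, h2.not_gt, h3.not_gt, and_true, and_false, if_true,
      if_false] <;> revert a b <;> decide

@[simp] theorem kosExp_one (e : Fin n → ZMod 2) : kosExp 1 e = 0 := by
  refine Finset.sum_eq_zero fun i _ => Finset.sum_eq_zero fun j _ => if_neg ?_
  rintro ⟨h1, h2⟩
  exact absurd h1 (not_lt_of_gt h2)

theorem kosExp_blk {p q : ℕ} (h : q + p = n) (σ : Equiv.Perm (Fin q)) (μ : Equiv.Perm (Fin p))
    (e : Fin n → ZMod 2) : kosExp (blk h σ μ) e = kosExp σ (hd h e) + kosExp μ (tl h e) := by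
  rw [kosExp, sum_split h]
  simp only [hd, tl, sum_split h, kosExp]
  simp only [blk_lt, blk_ge, Fin.mk_lt_mk, Finset.sum_add_distrib]
  have e1 : ∀ (i : Fin q) (j : Fin p), ¬ ((i : ℕ) < q + j ∧ q + (μ j : ℕ) < σ i) := by
    intro i j; omega
  have e2 : ∀ (i : Fin p) (j : Fin q), ¬ (q + (i : ℕ) < j ∧ (σ j : ℕ) < q + μ i) := by
    intro i j; omega
  simp only [e1, e2, if_false, Finset.sum_const_zero, add_zero, zero_add, add_lt_add_iff_left,
    Fin.val_fin_lt]

theorem kosExp_fix0 {p : ℕ} (μ : Equiv.Perm (Fin p)) (a : ZMod 2) (e : Fin p → ZMod 2) :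
    kosExp (fix0 μ) (Fin.cons a e) = kosExp μ e := by
  simp [kosExp, Fin.sum_univ_succ]

/-- The change of the Koszul sign when an entry changes its parity. -/
theorem kosExp_update (ρ : Equiv.Perm (Fin n)) (e : Fin n → ZMod 2) (j : Fin n) (m : ZMod 2) :
    kosExp ρ (Function.update e (ρ j) (e (ρ j) + m)) =
      kosExp ρ e + (m * (∑ i with i < ρ j, e i) + m * ∑ i with i < j, e (ρ i)) := by
  have hu : ∀ i, Function.update e (ρ j) (e (ρ j) + m) (ρ i) =
      e (ρ i) + if i = j then m else 0 := by
    intro i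
    by_cases hij : i = j
    · subst hij; simp
    · rw [Function.update_of_ne (fun h => hij (ρ.injective h)), if_neg hij, add_zero]
  have h1 : kosExp ρ (Function.update e (ρ j) (e (ρ j) + m)) = kosExp ρ e +
      ((∑ i, ∑ i', if i = j then (if i < i' ∧ ρ i' < ρ i then m * e (ρ i') else 0) else 0) +
      (∑ i, ∑ i', if i' = j then (if i < i' ∧ ρ i' < ρ i then m * e (ρ i) else 0) else 0)) := by
    simp only [kosExp, hu, ← Finset.sum_add_distrib]
    refine Finset.sum_congr rfl fun i _ => Finset.sum_congr rfl fun i' _ => ?_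
    by_cases h : i < i' ∧ ρ i' < ρ i
    · have hne : i ≠ i' := h.1.ne
      simp only [if_pos h]
      by_cases h1 : i = j
      · have h2 : ¬ i' = j := fun h2 => hne (h1.trans h2.symm)
        simp only [if_pos h1, if_neg h2]; ring
      · by_cases h2 : i' = j
        · simp only [if_neg h1, if_pos h2]; ring
        · simp only [if_neg h1, if_neg h2]; ring
    · simp [h]
  rw [h1]
  congr 1
  have h2 : ∑ i with i < ρ j, e i = ∑ i, if ρ i < ρ j then e (ρ i) else 0 := by
    rw [Finset.sum_filter, ← Equiv.sum_comp ρ]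
  rw [h2, Finset.sum_filter, Finset.mul_sum, Finset.mul_sum,
    Finset.sum_comm (f := fun i i' => if i' = j then _ else _)]
  simp only [Finset.sum_ite_irrel, Finset.sum_const_zero, Finset.sum_ite_eq', Finset.mem_univ,
    if_true]
  rw [← Finset.sum_add_distrib, ← Finset.sum_add_distrib]
  refine Finset.sum_congr rfl fun i _ => ?_
  rcases eq_or_ne i j with rfl | hij
  · simp
  have hr : ρ i ≠ ρ j := fun h => hij (ρ.injective h)
  have two : (2 : ZMod 2) = 0 := rfl
  rcases lt_or_gt_of_ne hij with h1 | h1 <;> rcases lt_or_gt_of_ne hr with h3 | h3 <;>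
    simp only [h1, h3, h1.not_gt, h3.not_gt, and_true, and_false,
      if_true, if_false] <;> first | ring1 | linear_combination (-(m * e (ρ i))) * two

/-- The Koszul sign of the exchange of two blocks. -/
theorem kosExp_blockSwap {a b : ℕ} (hab : a + b ≤ n) {ρ : Equiv.Perm (Fin n)}
    (hρ : IsBlockSwap a b ρ) (e : Fin n → ZMod 2) :
    kosExp ρ e = (∑ i : Fin a, e ⟨i, by omega⟩) * ∑ i : Fin b, e ⟨a + i, by omega⟩ := by
  have hinv : ∀ i j : Fin n, (i < j ∧ ρ j < ρ i) ↔
      ((i : ℕ) < b ∧ (b ≤ (j : ℕ) ∧ (j : ℕ) < a + b)) := by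
    intro i j
    rw [Fin.lt_def, Fin.lt_def, hρ i, hρ j]
    split_ifs <;> omega
  have h1 : kosExp ρ e = (∑ i : Fin n, if (i : ℕ) < b then e (ρ i) else 0) *
      ∑ j : Fin n, if b ≤ (j : ℕ) ∧ (j : ℕ) < a + b then e (ρ j) else 0 := by
    rw [kosExp, Finset.sum_mul]
    refine Finset.sum_congr rfl fun i _ => ?_
    rw [Finset.mul_sum]
    refine Finset.sum_congr rfl fun j _ => ?_
    simp only [hinv]
    by_cases h1 : (i : ℕ) < b <;> by_cases h2 : b ≤ (j : ℕ) ∧ (j : ℕ) < a + b <;> simp [h1, h2]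
  have h2 : (∑ i : Fin n, if (i : ℕ) < b then e (ρ i) else 0) =
      ∑ i : Fin b, e ⟨a + i, by omega⟩ := by
    rw [sum_split (p := n - b) (q := b) (by omega)]
    simp only [hd, tl]
    rw [Finset.sum_eq_zero (s := (Finset.univ : Finset (Fin (n - b))))
      (fun i _ => if_neg (by simp)),
      add_zero]
    refine Finset.sum_congr rfl fun i _ => ?_
    rw [if_pos i.2]
    congr 1
    ext
    rw [hρ, if_pos i.2]
  have h3 : (∑ j : Fin n, if b ≤ (j : ℕ) ∧ (j : ℕ) < a + b then e (ρ j) else 0) =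
      ∑ i : Fin a, e ⟨i, by omega⟩ := by
    rw [sum_split (p := n - b) (q := b) (by omega)]
    simp only [hd, tl]
    rw [Finset.sum_eq_zero (s := (Finset.univ : Finset (Fin b)))
      (fun i _ => if_neg (by simp)), zero_add,
      sum_split (p := n - b - a) (q := a) (by omega)]
    simp only [hd, tl]
    rw [Finset.sum_eq_zero (s := (Finset.univ : Finset (Fin (n - b - a))))
      (fun i _ => if_neg (by simp; omega)), add_zero]
    refine Finset.sum_congr rfl fun i _ => ?_
    rw [if_pos (by simp; omega)]
    congr 1
    ext
    rw [hρ]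
    simp only
    rw [if_neg (by omega), if_pos (by omega)]
    omega
  rw [h1, h2, h3, mul_comm]

end Koszul

/-! ### Families of operations and partial compositions -/

section Multi

variable {k : Type*} [Field k] {X Z Z' : Type*} [AddCommGroup X] [Module k X] [AddCommGroup Z]
  [Module k Z] [AddCommGroup Z'] [Module k Z'] {p q n : ℕ}

/-- Evaluation of multilinear maps at `x`. -/
def evalAt (x : Fin n → X) : MultilinearMap k (fun _ : Fin n => X) Z →ₗ[k] Z where
  toFun f := f x
  map_add' _ _ := rfl
  map_smul' _ _ := rfl

@[simp] theorem evalAt_apply (x : Fin n → X) (f : MultilinearMap k (fun _ : Fin n => X) Z) :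
    evalAt x f = f x := rfl

/-- The composition `f ∘_1 g`, with the inputs of `g` listed first. -/
def ins (h : q + p = n) (f : MultilinearMap k (fun _ : Fin (p + 1) => X) Z)
    (g : MultilinearMap k (fun _ : Fin q => X) X) : MultilinearMap k (fun _ : Fin n => X) Z where
  toFun x := f (Fin.cons (g (hd h x)) (tl h x))
  map_update_add' := by
    intro inst x j
    rw [Subsingleton.elim inst (instDecidableEqFin n)]
    revert j
    rw [forall_split h]
    refine ⟨fun j a b => ?_, fun j a b => ?_⟩
    · simp only [hd_update_lt, tl_update_lt, MultilinearMap.map_update_add]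
      exact f.cons_add _ _ _
    · simp only [hd_update_ge, tl_update_ge, Fin.cons_update, MultilinearMap.map_update_add]
  map_update_smul' := by
    intro inst x j
    rw [Subsingleton.elim inst (instDecidableEqFin n)]
    revert j
    rw [forall_split h]
    refine ⟨fun j r a => ?_, fun j r a => ?_⟩
    · simp only [hd_update_lt, tl_update_lt, MultilinearMap.map_update_smul]
      exact f.cons_smul _ _ _
    · simp only [hd_update_ge, tl_update_ge, Fin.cons_update, MultilinearMap.map_update_smul]

theorem ins_apply (h : q + p = n) (f : MultilinearMap k (fun _ : Fin (p + 1) => X) Z)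
    (g : MultilinearMap k (fun _ : Fin q => X) X) (x : Fin n → X) :
    ins h f g x = f (Fin.cons (g (hd h x)) (tl h x)) := rfl

/-- `f ↦ ± f(x ∘ ρ)` with the Koszul sign of `ρ`. -/
def permM (𝕏 : CompleteComplex k X) (ρ : Equiv.Perm (Fin n)) :
    MultilinearMap k (fun _ : Fin n => X) Z →ₗ[k] MultilinearMap k (fun _ : Fin n => X) Z where
  toFun f := ∑ e : Fin n → ZMod 2, sg k (kosExp ρ e) •
    (f.compLinearMap fun i => 𝕏.parL (e (ρ i))).domDomCongr ρ
  map_add' f g := by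
    ext x; simp [Finset.sum_add_distrib]
  map_smul' r f := by
    ext x; simp [Finset.smul_sum, smul_comm r]

theorem permM_apply (𝕏 : CompleteComplex k X) (ρ : Equiv.Perm (Fin n))
    (f : MultilinearMap k (fun _ : Fin n => X) Z) (x : Fin n → X) :
    permM 𝕏 ρ f x = ∑ e : Fin n → ZMod 2, sg k (kosExp ρ e) •
      f (fun i => 𝕏.parL (e (ρ i)) (x (ρ i))) := by
  simp [permM]

theorem permM_of_deg (𝕏 : CompleteComplex k X) (ρ : Equiv.Perm (Fin n))
    (f : MultilinearMap k (fun _ : Fin n => X) Z) {t : Fin n → ℤ} {x : Fin n → X}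
    (hx : ∀ j, x j ∈ 𝕏.deg (t j)) :
    permM 𝕏 ρ f x = sg k (kosExp ρ fun j => (t j : ZMod 2)) • f (x ∘ ρ) := by
  rw [permM_apply, Finset.sum_eq_single fun j => (t j : ZMod 2)]
  · congr 2
    ext i
    simp [𝕏.parL_of_deg _ (hx _)]
  · intro e _ he
    obtain ⟨j, hj⟩ := Function.ne_iff.1 he
    rw [f.map_coord_zero (ρ.symm j), smul_zero]
    simp only [Equiv.apply_symm_apply]
    rw [𝕏.parL_of_deg _ (hx j), if_neg hj]
  · intro h; exact absurd (Finset.mem_univ _) h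

end Multi

theorem CompleteComplex.parL_fil {k V : Type*} [Field k] [AddCommGroup V] [Module k V]
    (X : CompleteComplex k V) (e : ZMod 2) {p : ℤ} {x : V} (hx : x ∈ X.fil p) :
    X.parL e x ∈ X.fil p := by
  refine X.induction_fil (P := fun x => X.parL e x ∈ X.fil p) (fun n x hn hp => ?_)
    (fun x y hx hy => by rw [map_add]; exact Submodule.add_mem _ hx hy) hx
  rw [X.parL_of_deg _ hn]
  split_ifs
  exacts [hp, Submodule.zero_mem _]

section Cons

variable {k X : Type*} [Field k] [AddCommGroup X] [Module k X] {p q n : ℕ}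

theorem cons_mem (S : ℤ → Submodule k X) {a : X} {y : Fin p → X} {u : ℤ} {t : Fin p → ℤ}
    (ha : a ∈ S u) (hy : ∀ j, y j ∈ S (t j)) (j : Fin (p + 1)) :
    (Fin.cons a y : Fin (p + 1) → X) j ∈ S ((Fin.cons u t : Fin (p + 1) → ℤ) j) := by
  refine Fin.cases ?_ (fun j => ?_) j
  · simpa using ha
  · simpa using hy j

theorem hd_mem (S : ℤ → Submodule k X) (h : q + p = n) {x : Fin n → X} {t : Fin n → ℤ}
    (hx : ∀ j, x j ∈ S (t j)) (j : Fin q) : hd h x j ∈ S (hd h t j) := hx _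

theorem tl_mem (S : ℤ → Submodule k X) (h : q + p = n) {x : Fin n → X} {t : Fin n → ℤ}
    (hx : ∀ j, x j ∈ S (t j)) (j : Fin p) : tl h x j ∈ S (tl h t j) := hx _

theorem comp_mem (S : ℤ → Submodule k X) {x : Fin n → X} {t : Fin n → ℤ}
    (hx : ∀ j, x j ∈ S (t j)) (ρ : Equiv.Perm (Fin n)) (j : Fin n) : (x ∘ ρ) j ∈ S ((t ∘ ρ) j) :=
  hx _

end Cons

section Op

variable {k : Type*} [Field k] (C : CompleteCooperad k)

/-- Operations of arity `n` parametrized by `C(n)`. -/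
abbrev Op (n : ℕ) (X Z : Type*) [AddCommGroup X] [Module k X] [AddCommGroup Z] [Module k Z] :=
  C.obj n →ₗ[k] MultilinearMap k (fun _ : Fin n => X) Z

/-- Families of operations of all arities, i.e. maps `C → Hom(X^{⊗ n}, Z)`. -/
abbrev Fam (X Z : Type*) [AddCommGroup X] [Module k X] [AddCommGroup Z] [Module k Z] :=
  ∀ n, Op C n X Z

variable {C} {X X' Y Z Z' : Type*} [AddCommGroup X] [Module k X] [AddCommGroup Z] [Module k Z]
  [AddCommGroup X'] [Module k X'] [AddCommGroup Z'] [Module k Z'] [AddCommGroup Y] [Module k Y]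
  {𝕏 : CompleteComplex k X} {𝕏' : CompleteComplex k X'} {𝕫 : CompleteComplex k Z}
  {𝕫' : CompleteComplex k Z'} {n p q : ℕ}

variable (𝕏 𝕫) in
/-- A filtered operation of degree `s`. -/
structure IsOp (s : ℤ) (F : Op C n X Z) : Prop where
  deg : ∀ e, ∀ c ∈ (C.cx n).deg e, ∀ (t : Fin n → ℤ) (x : Fin n → X),
    (∀ j, x j ∈ 𝕏.deg (t j)) → F c x ∈ 𝕫.deg (e + s + ∑ j, t j)
  fil : ∀ p, ∀ c ∈ (C.cx n).fil p, ∀ (w : Fin n → ℤ) (x : Fin n → X),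
    (∀ j, x j ∈ 𝕏.fil (w j)) → F c x ∈ 𝕫.fil (p + ∑ j, w j)

theorem Op.ext_deg (𝕏 : CompleteComplex k X) {F G : Op C n X Z}
    (h : ∀ c, ∀ t : Fin n → ℤ, ∀ x : Fin n → X, (∀ j, x j ∈ 𝕏.deg (t j)) → F c x = G c x) :
    F = G :=
  LinearMap.ext fun c => MultilinearMap.ext_deg 𝕏 (h c)

theorem IsOp.zero (s : ℤ) : IsOp 𝕏 𝕫 s (0 : Op C n X Z) :=
  ⟨fun _ _ _ _ _ _ => Submodule.zero_mem _, fun _ _ _ _ _ _ => Submodule.zero_mem _⟩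

theorem IsOp.add {s : ℤ} {F G : Op C n X Z} (hF : IsOp 𝕏 𝕫 s F) (hG : IsOp 𝕏 𝕫 s G) :
    IsOp 𝕏 𝕫 s (F + G) :=
  ⟨fun e c hc t x hx => Submodule.add_mem _ (hF.deg e c hc t x hx) (hG.deg e c hc t x hx),
    fun p c hc t x hx => Submodule.add_mem _ (hF.fil p c hc t x hx) (hG.fil p c hc t x hx)⟩

theorem IsOp.smul {s : ℤ} (r : k) {F : Op C n X Z} (hF : IsOp 𝕏 𝕫 s F) : IsOp 𝕏 𝕫 s (r • F) :=
  ⟨fun e c hc t x hx => Submodule.smul_mem _ _ (hF.deg e c hc t x hx),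
    fun p c hc t x hx => Submodule.smul_mem _ _ (hF.fil p c hc t x hx)⟩

theorem IsOp.sum {s : ℤ} {ι : Type*} (S : Finset ι) {F : ι → Op C n X Z}
    (hF : ∀ i ∈ S, IsOp 𝕏 𝕫 s (F i)) : IsOp 𝕏 𝕫 s (∑ i ∈ S, F i) :=
  Finset.sum_induction _ (IsOp 𝕏 𝕫 s) (fun _ _ => IsOp.add) (IsOp.zero s) hF

/-- The right action of permutations on operations. -/
def perm (𝕏 : CompleteComplex k X) (ρ : Equiv.Perm (Fin n)) : Op C n X Z →ₗ[k] Op C n X Z where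
  toFun F := permM 𝕏 ρ ∘ₗ F ∘ₗ C.act n ρ
  map_add' F G := by ext; simp
  map_smul' r F := by ext; simp

theorem perm_apply (ρ : Equiv.Perm (Fin n)) (F : Op C n X Z) (c : C.obj n) :
    perm 𝕏 ρ F c = permM 𝕏 ρ (F (C.act n ρ c)) := rfl

theorem perm_of_deg (ρ : Equiv.Perm (Fin n)) (F : Op C n X Z) (c : C.obj n) {t : Fin n → ℤ}
    {x : Fin n → X} (hx : ∀ j, x j ∈ 𝕏.deg (t j)) :
    perm 𝕏 ρ F c x = sg k (kosExp ρ fun j => (t j : ZMod 2)) • F (C.act n ρ c) (x ∘ ρ) :=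
  permM_of_deg 𝕏 ρ _ hx

theorem perm_perm (σ ρ : Equiv.Perm (Fin n)) (F : Op C n X Z) :
    perm 𝕏 σ (perm 𝕏 ρ F) = perm 𝕏 (σ * ρ) F := by
  refine Op.ext_deg 𝕏 fun c t x hx => ?_
  rw [perm_of_deg σ _ c hx, perm_of_deg ρ _ _ (comp_mem 𝕏.deg hx σ), perm_of_deg _ _ _ hx,
    kosExp_mul, sg_add, smul_smul, C.act_mul]
  rfl

theorem perm_one (F : Op C n X Z) : perm 𝕏 1 F = F := by
  refine Op.ext_deg 𝕏 fun c t x hx => ?_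
  rw [perm_of_deg _ _ c hx, C.act_one]
  simp

theorem IsOp.perm {s : ℤ} {F : Op C n X Z} (hF : IsOp 𝕏 𝕫 s F) (ρ : Equiv.Perm (Fin n)) :
    IsOp 𝕏 𝕫 s (perm 𝕏 ρ F) := by
  constructor
  · intro e c hc t x hx
    rw [perm_of_deg _ _ _ hx]
    have := hF.deg e _ (C.act_deg n ρ e c hc) _ _ (comp_mem 𝕏.deg hx ρ)
    simp only [Function.comp_apply, Equiv.sum_comp ρ t] at this
    exact Submodule.smul_mem _ _ this
  · intro p c hc w x hx
    rw [perm_apply, permM_apply]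
    refine Submodule.sum_mem _ fun e _ => Submodule.smul_mem _ _ ?_
    have := hF.fil p _ (C.act_fil n ρ p c hc) (w ∘ ρ) (fun i => 𝕏.parL (e (ρ i)) (x (ρ i)))
      (fun i => 𝕏.parL_fil _ (hx _))
    simpa only [Function.comp_apply, Equiv.sum_comp ρ w] using this

/-- Postcomposition with a linear map. -/
def post (L : Z →ₗ[k] Z') : Op C n X Z →ₗ[k] Op C n X Z' where
  toFun F :=
    { toFun := fun c => L.compMultilinearMap (F c)
      map_add' := fun a b => by ext; simp
      map_smul' := fun r a => by ext; simp }
  map_add' F G := by ext; simp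
  map_smul' r F := by ext; simp

@[simp] theorem post_apply (L : Z →ₗ[k] Z') (F : Op C n X Z) (c : C.obj n) (x : Fin n → X) :
    post L F c x = L (F c x) := rfl

/-- Precomposition with a linear map in each argument. -/
def pre (u : X' →ₗ[k] X) : Op C n X Z →ₗ[k] Op C n X' Z where
  toFun F := MultilinearMap.compLinearMapₗ (fun _ : Fin n => u) ∘ₗ F
  map_add' F G := by ext; simp
  map_smul' r F := by ext; simp

@[simp] theorem pre_apply (u : X' →ₗ[k] X) (F : Op C n X Z) (c : C.obj n) (x : Fin n → X') :
    pre u F c x = F c (fun j => u (x j)) := rfl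

/-- A filtered linear map of degree `r` between complete complexes. -/
structure IsMap (𝕏 : CompleteComplex k X) (𝕫 : CompleteComplex k Z) (r : ℤ) (L : X →ₗ[k] Z) :
    Prop where
  deg : ∀ n, ∀ x ∈ 𝕏.deg n, L x ∈ 𝕫.deg (n + r)
  fil : ∀ p, ∀ x ∈ 𝕏.fil p, L x ∈ 𝕫.fil p

theorem IsMap.deg_zero {L : X →ₗ[k] Z} (hL : IsMap 𝕏 𝕫 0 L) {n : ℤ} {x : X} (hx : x ∈ 𝕏.deg n) :
    L x ∈ 𝕫.deg n := by simpa using hL.deg n x hx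

theorem IsOp.post {s r s' : ℤ} {F : Op C n X Z} (hF : IsOp 𝕏 𝕫 s F) {L : Z →ₗ[k] Z'}
    (hL : IsMap 𝕫 𝕫' r L) (hs : s + r = s') : IsOp 𝕏 𝕫' s' (post L F) :=
  ⟨fun e c hc t x hx => by
      have := hL.deg _ _ (hF.deg e c hc t x hx)
      rw [post_apply]
      convert this using 2
      rw [← hs]; ring,
    fun p c hc t x hx => hL.fil _ _ (hF.fil p c hc t x hx)⟩

theorem IsOp.pre {s : ℤ} {F : Op C n X Z} (hF : IsOp 𝕏 𝕫 s F) {u : X' →ₗ[k] X}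
    (hu : IsMap 𝕏' 𝕏 0 u) : IsOp 𝕏' 𝕫 s (pre u F) :=
  ⟨fun e c hc t _ hx => hF.deg e c hc t _ fun j => hu.deg_zero (hx j),
    fun p c hc t _ hx => hF.fil p c hc t _ fun j => hu.fil _ _ (hx j)⟩

theorem perm_post (ρ : Equiv.Perm (Fin n)) (L : Z →ₗ[k] Z') (F : Op C n X Z) :
    perm 𝕏 ρ (post L F) = post L (perm 𝕏 ρ F) := by
  refine Op.ext_deg 𝕏 fun c t x hx => ?_
  rw [perm_of_deg _ _ c hx, post_apply, post_apply, perm_of_deg _ _ c hx, map_smul]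

theorem perm_pre {u : X' →ₗ[k] X} (hu : IsMap 𝕏' 𝕏 0 u) (ρ : Equiv.Perm (Fin n))
    (F : Op C n X Z) : perm 𝕏' ρ (pre u F) = pre u (perm 𝕏 ρ F) := by
  refine Op.ext_deg 𝕏' fun c t x hx => ?_
  rw [perm_of_deg _ _ c hx, pre_apply, pre_apply, perm_of_deg _ _ c fun j => hu.deg_zero (hx j)]
  rfl

/-- The composition `a ⊗ b ↦ (-1)^{s|a|} F(a) ∘_1 G(b)`. -/
def theta (h : q + p = n) (s : ℕ) (F : Op C (p + 1) X Z) (G : Op C q X X) :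
    C.obj (p + 1) ⊗[k] C.obj q →ₗ[k] MultilinearMap k (fun _ : Fin n => X) Z :=
  TensorProduct.lift (LinearMap.mk₂ k
    (fun a b => ins h (F (((C.cx (p + 1)).sgn ^ s) a)) (G b))
    (fun a a' b => by ext x; simp [ins_apply])
    (fun r a b => by ext x; simp [ins_apply])
    (fun a b b' => by
      ext x
      simp only [ins_apply, map_add, add_apply]
      exact MultilinearMap.cons_add _ _ _ _)
    (fun r a b => by
      ext x
      simp only [ins_apply, map_smul, smul_apply]
      exact MultilinearMap.cons_smul _ _ _ _))

theorem theta_tmul (h : q + p = n) (s : ℕ) (F : Op C (p + 1) X Z) (G : Op C q X X)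
    (a : C.obj (p + 1)) (b : C.obj q) (x : Fin n → X) : theta h s F G (a ⊗ₜ b) x =
      F (((C.cx (p + 1)).sgn ^ s) a) (Fin.cons (G b (hd h x)) (tl h x)) := rfl

theorem theta_fil {r r' : ℤ} (h : q + p = n) (s : ℕ) {F : Op C (p + 1) X Z} {G : Op C q X X}
    (hF : IsOp 𝕏 𝕫 r F) (hG : IsOp 𝕏 𝕏 r' G) {w : Fin n → ℤ} {x : Fin n → X}
    (hx : ∀ j, x j ∈ 𝕏.fil (w j)) (M : ℤ) (t : C.obj (p + 1) ⊗[k] C.obj q)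
    (ht : t ∈ C.fil₂ (p + 1) q M) : theta h s F G t x ∈ 𝕫.fil (M + ∑ j, w j) := by
  suffices H : C.fil₂ (p + 1) q M ≤
      (𝕫.fil (M + ∑ j, w j)).comap (evalAt x ∘ₗ theta h s F G) from H ht
  refine tensorSum_le fun i a ha b hb => ?_
  have h1 := hG.fil _ b hb _ _ (hd_mem 𝕏.fil h hx)
  have h2 := hF.fil _ _ ((C.cx (p + 1)).sgn_pow_fil s ha) _ _
    (cons_mem 𝕏.fil h1 (tl_mem 𝕏.fil h hx))
  change theta h s F G (a ⊗ₜ b) x ∈ 𝕫.fil (M + ∑ j, w j)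
  rw [theta_tmul]
  convert h2 using 2
  rw [Fin.sum_univ_succ, sum_split h w]
  simp only [Fin.cons_zero, Fin.cons_succ]
  ring

theorem theta_deg {r r' : ℤ} (h : q + p = n) (s : ℕ) {F : Op C (p + 1) X Z} {G : Op C q X X}
    (hF : IsOp 𝕏 𝕫 r F) (hG : IsOp 𝕏 𝕏 r' G) {w : Fin n → ℤ} {x : Fin n → X}
    (hx : ∀ j, x j ∈ 𝕏.deg (w j)) (M : ℤ) (t : C.obj (p + 1) ⊗[k] C.obj q)
    (ht : t ∈ tensorSum (C.cx (p + 1)).deg (C.cx q).deg M) :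
    theta h s F G t x ∈ 𝕫.deg (M + (r + r') + ∑ j, w j) := by
  suffices H : tensorSum (C.cx (p + 1)).deg (C.cx q).deg M ≤
      (𝕫.deg (M + (r + r') + ∑ j, w j)).comap (evalAt x ∘ₗ theta h s F G) from H ht
  refine tensorSum_le fun i a ha b hb => ?_
  have h1 := hG.deg _ b hb _ _ (hd_mem 𝕏.deg h hx)
  have h2 := hF.deg _ _ ((C.cx (p + 1)).sgn_pow_deg s ha) _ _
    (cons_mem 𝕏.deg h1 (tl_mem 𝕏.deg h hx))
  change theta h s F G (a ⊗ₜ b) x ∈ 𝕫.deg (M + (r + r') + ∑ j, w j)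
  rw [theta_tmul]
  convert h2 using 2
  rw [Fin.sum_univ_succ, sum_split h w]
  simp only [Fin.cons_zero, Fin.cons_succ]
  ring

theorem theta_fil_exists {r r' : ℤ} (h : q + p = n) (s : ℕ) {F : Op C (p + 1) X Z}
    {G : Op C q X X} (hF : IsOp 𝕏 𝕫 r F) (hG : IsOp 𝕏 𝕏 r' G) (x : Fin n → X) :
    ∃ u, ∀ M, ∀ t ∈ C.fil₂ (p + 1) q M, (evalAt x ∘ₗ theta h s F G) t ∈ 𝕫.fil (M + u) := by
  choose w hw using fun j => 𝕏.fil_exhaustive (x j)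
  exact ⟨_, fun M t ht => theta_fil h s hF hG hw M t ht⟩

open Classical in
/-- The operation `c ↦ θ(dec c)` for a linear map `θ : C(p + 1) ⊗ C(q) → Hom(X^{⊗ n}, Z)`, extended
by continuity. -/
def evalDec (𝕫 : CompleteComplex k Z) (h : q + p = n)
    (θ : C.obj (p + 1) ⊗[k] C.obj q →ₗ[k] MultilinearMap k (fun _ : Fin n => X) Z) : Op C n X Z :=
  if H : ∃ P : Op C n X Z, ∀ c x,
    HasEval 𝕫.fil (evalAt x ∘ₗ θ) (C.dec p q n h c) (P c x) then H.choose else 0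

/-- The partial composition `c ↦ ∑ (-1)^{s|c'|} F(c') ∘_1 G(c'')`, where `∑ c' ⊗ c''` is the
component of the infinitesimal cocomposition of `c` given by `dec p q n h`. -/
def pc (𝕫 : CompleteComplex k Z) (h : q + p = n) (s : ℕ) (F : Op C (p + 1) X Z) (G : Op C q X X) :
    Op C n X Z :=
  evalDec 𝕫 h (theta h s F G)

theorem pc_spec {r r' : ℤ} (h : q + p = n) (s : ℕ) {F : Op C (p + 1) X Z} {G : Op C q X X}
    (hF : IsOp 𝕏 𝕫 r F) (hG : IsOp 𝕏 𝕏 r' G) (c : C.obj n) (x : Fin n → X) :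
    HasEval 𝕫.fil (evalAt x ∘ₗ theta h s F G) (C.dec p q n h c) (pc 𝕫 h s F G c x) := by
  have H : ∃ P : Op C n X Z, ∀ c x,
      HasEval 𝕫.fil (evalAt x ∘ₗ theta h s F G) (C.dec p q n h c) (P c x) := by
    refine exists_op (C.cx n) 𝕏 (fun c x z =>
      HasEval 𝕫.fil (evalAt x ∘ₗ theta h s F G) (C.dec p q n h c) z) ?_ ?_ ?_ ?_ ?_ ?_
    · intro c c' x z z' h1 h2
      rw [map_add]; exact h1.add_arg 𝕫.fil_antitone h2
    · intro r c x z h1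
      rw [map_smul]
      exact h1.smul_arg 𝕫.fil_antitone (theta_fil_exists h s hF hG x) r
    · intro c x j a b z z' h1 h2
      convert h1.add 𝕫.fil_antitone h2 using 1
      ext t; simp
    · intro c x j r a z h1
      convert h1.smul r using 1
      ext t; simp
    · intro c x z z' h1 h2
      exact h1.uniq 𝕫.fil_antitone 𝕫.fil_separated h2
    · intro e c hc t x hx
      obtain ⟨w, hw⟩ := theta_fil_exists h s hF hG x
      obtain ⟨z, -, hz⟩ := exists_hasEval_deg 𝕫 (C.fil₂_antitone (p + 1) q) hw (C.dec p q n h c)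
        _ (theta_deg h s hF hG hx e) (C.dec_deg p q n h e c hc)
      exact ⟨z, hz⟩
  rw [pc, evalDec, dif_pos H]
  exact H.choose_spec c x

theorem pc_estimate {r r' : ℤ} (h : q + p = n) (s : ℕ) {F : Op C (p + 1) X Z} {G : Op C q X X}
    (hF : IsOp 𝕏 𝕫 r F) (hG : IsOp 𝕏 𝕏 r' G) (c : C.obj n) {w : Fin n → ℤ} {x : Fin n → X}
    (hx : ∀ j, x j ∈ 𝕏.fil (w j)) (M : ℤ) (t : C.obj (p + 1) ⊗[k] C.obj q)
    (ht : (C.fil₂ (p + 1) q M).mkQ t = (C.dec p q n h c).1 M) :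
    pc 𝕫 h s F G c x - theta h s F G t x ∈ 𝕫.fil (M + ∑ j, w j) :=
  (pc_spec h s hF hG c x).estimate 𝕫.fil_antitone (C.fil₂_antitone _ _)
    (theta_fil h s hF hG hx) M t ht

theorem IsOp.pc {r r' r'' : ℤ} (h : q + p = n) (s : ℕ) {F : Op C (p + 1) X Z} {G : Op C q X X}
    (hF : IsOp 𝕏 𝕫 r F) (hG : IsOp 𝕏 𝕏 r' G) (hr : r + r' = r'') :
    IsOp 𝕏 𝕫 r'' (pc 𝕫 h s F G) := by
  subst hr
  constructor
  · intro e c hc t x hx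
    obtain ⟨w, hw⟩ := theta_fil_exists h s hF hG x
    obtain ⟨z, hz', hz⟩ := exists_hasEval_deg 𝕫 (C.fil₂_antitone (p + 1) q) hw (C.dec p q n h c)
      _ (theta_deg h s hF hG hx e) (C.dec_deg p q n h e c hc)
    rwa [(pc_spec h s hF hG c x).uniq 𝕫.fil_antitone 𝕫.fil_separated hz]
  · intro M c hc w x hx
    have := pc_estimate h s hF hG c hx M 0 (by
      rw [map_zero]; exact (C.dec_fil p q n h M c hc).symm)
    simpa using this

/-- Partial compositions are characterized by their evaluations at homogeneous arguments. -/
theorem eq_pc {r r' : ℤ} (h : q + p = n) (s : ℕ) {F : Op C (p + 1) X Z} {G : Op C q X X}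
    (hF : IsOp 𝕏 𝕫 r F) (hG : IsOp 𝕏 𝕏 r' G) {P : Op C n X Z}
    (H : ∀ c (t : Fin n → ℤ) x, (∀ j, x j ∈ 𝕏.deg (t j)) →
      HasEval 𝕫.fil (evalAt x ∘ₗ theta h s F G) (C.dec p q n h c) (P c x)) :
    P = pc 𝕫 h s F G :=
  Op.ext_deg 𝕏 fun c t x hx =>
    (H c t x hx).uniq 𝕫.fil_antitone 𝕫.fil_separated (pc_spec h s hF hG c x)

theorem pc_congr {h : q + p = n} {s s' : ℕ} {F F' : Op C (p + 1) X Z}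
    {G G' : Op C q X X} (H : theta h s F G = theta h s' F' G') :
    pc 𝕫 h s F G = pc 𝕫 h s' F' G' := by
  unfold pc; rw [H]

section Linear

variable {r r' : ℤ} (h : q + p = n) (s : ℕ) {F F' : Op C (p + 1) X Z} {G G' : Op C q X X}

theorem pc_add_left (hF : IsOp 𝕏 𝕫 r F) (hF' : IsOp 𝕏 𝕫 r F') (hG : IsOp 𝕏 𝕏 r' G) :
    pc 𝕫 h s (F + F') G = pc 𝕫 h s F G + pc 𝕫 h s F' G := by
  refine (eq_pc h s (hF.add hF') hG fun c _ x _ => ?_).symm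
  change HasEval _ _ _ (pc 𝕫 h s F G c x + pc 𝕫 h s F' G c x)
  convert (pc_spec h s hF hG c x).add 𝕫.fil_antitone (pc_spec h s hF' hG c x) using 1
  refine TensorProduct.ext' fun a b => ?_
  simp [theta_tmul]

theorem pc_smul_left (a : k) (hF : IsOp 𝕏 𝕫 r F) (hG : IsOp 𝕏 𝕏 r' G) :
    pc 𝕫 h s (a • F) G = a • pc 𝕫 h s F G := by
  refine (eq_pc h s (hF.smul a) hG fun c _ x _ => ?_).symm
  change HasEval _ _ _ (a • pc 𝕫 h s F G c x)
  convert (pc_spec h s hF hG c x).smul a using 1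
  refine TensorProduct.ext' fun a b => ?_
  simp [theta_tmul]

theorem pc_add_right (hF : IsOp 𝕏 𝕫 r F) (hG : IsOp 𝕏 𝕏 r' G) (hG' : IsOp 𝕏 𝕏 r' G') :
    pc 𝕫 h s F (G + G') = pc 𝕫 h s F G + pc 𝕫 h s F G' := by
  refine (eq_pc h s hF (hG.add hG') fun c _ x _ => ?_).symm
  change HasEval _ _ _ (pc 𝕫 h s F G c x + pc 𝕫 h s F G' c x)
  convert (pc_spec h s hF hG c x).add 𝕫.fil_antitone (pc_spec h s hF hG' c x) using 1
  refine TensorProduct.ext' fun a b => ?_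
  simp only [LinearMap.comp_apply, LinearMap.add_apply, evalAt_apply, theta_tmul,
    add_apply]
  exact MultilinearMap.cons_add _ _ _ _

theorem pc_smul_right (a : k) (hF : IsOp 𝕏 𝕫 r F) (hG : IsOp 𝕏 𝕏 r' G) :
    pc 𝕫 h s F (a • G) = a • pc 𝕫 h s F G := by
  refine (eq_pc h s hF (hG.smul a) fun c _ x _ => ?_).symm
  change HasEval _ _ _ (a • pc 𝕫 h s F G c x)
  convert (pc_spec h s hF hG c x).smul a using 1
  refine TensorProduct.ext' fun a b => ?_
  simp only [LinearMap.comp_apply, LinearMap.smul_apply, evalAt_apply, theta_tmul,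
    smul_apply]
  exact MultilinearMap.cons_smul _ _ _ _

theorem pc_zero_left (hG : IsOp 𝕏 𝕏 r' G) : pc 𝕫 h s (0 : Op C (p + 1) X Z) G = 0 := by
  simpa using pc_smul_left (𝕫 := 𝕫) h s (0 : k) (IsOp.zero 0 : IsOp 𝕏 𝕫 0 (0 : Op C (p + 1) X Z)) hG

theorem pc_zero_right (hF : IsOp 𝕏 𝕫 r F) : pc 𝕫 h s F (0 : Op C q X X) = 0 := by
  simpa using pc_smul_right (𝕫 := 𝕫) h s (0 : k) hF (IsOp.zero 0 : IsOp 𝕏 𝕏 0 (0 : Op C q X X))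

theorem pc_sum_left {ι : Type*} (S : Finset ι) {F : ι → Op C (p + 1) X Z}
    (hF : ∀ i ∈ S, IsOp 𝕏 𝕫 r (F i)) (hG : IsOp 𝕏 𝕏 r' G) :
    pc 𝕫 h s (∑ i ∈ S, F i) G = ∑ i ∈ S, pc 𝕫 h s (F i) G := by
  classical
  induction S using Finset.induction_on with
  | empty => simpa using pc_zero_left h s hG
  | insert i S hi ih =>
    have h1 : ∀ j ∈ S, IsOp 𝕏 𝕫 r (F j) := fun j hj => hF j (by simp [hj])
    rw [Finset.sum_insert hi, Finset.sum_insert hi,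
      pc_add_left h s (hF i (by simp)) (IsOp.sum S h1) hG, ih h1]

theorem pc_sum_right {ι : Type*} (S : Finset ι) (hF : IsOp 𝕏 𝕫 r F) {G : ι → Op C q X X}
    (hG : ∀ i ∈ S, IsOp 𝕏 𝕏 r' (G i)) :
    pc 𝕫 h s F (∑ i ∈ S, G i) = ∑ i ∈ S, pc 𝕫 h s F (G i) := by
  classical
  induction S using Finset.induction_on with
  | empty => simpa using pc_zero_right h s hF
  | insert i S hi ih =>
    have h1 : ∀ j ∈ S, IsOp 𝕏 𝕏 r' (G j) := fun j hj => hG j (by simp [hj])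
    rw [Finset.sum_insert hi, Finset.sum_insert hi,
      pc_add_right h s hF (hG i (by simp)) (IsOp.sum S h1), ih h1]

theorem pc_post {u u' : ℤ} {L : Z →ₗ[k] Z'} (hL : IsMap 𝕫 𝕫' u L) (hF : IsOp 𝕏 𝕫 r F)
    (hG : IsOp 𝕏 𝕏 r' G) (hu : r + u = u') :
    pc 𝕫' h s (post L F) G = post L (pc 𝕫 h s F G) := by
  refine (eq_pc h s (hF.post hL hu) hG fun c _ x _ => ?_).symm
  change HasEval _ _ _ (L (pc 𝕫 h s F G c x))
  convert (pc_spec h s hF hG c x).map L hL.fil using 1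
  exact TensorProduct.ext' fun a b => rfl

end Linear

/-! ### The convolution product of families -/

variable (𝕏 𝕫) in
/-- An equivariant filtered family of operations of degree `s`, i.e. an element of degree `s` of the
convolution complex. -/
structure IsFam (s : ℤ) (f : Fam C X Z) : Prop where
  op : ∀ n, IsOp 𝕏 𝕫 s (f n)
  act : ∀ n ρ, perm 𝕏 ρ (f n) = f n

open Classical in
/-- The convolution product as a family of multilinear maps. -/
def sstar (𝕏 : CompleteComplex k X) (𝕫 : CompleteComplex k Z) (s : ℕ) (f : Fam C X Z)
    (g : Fam C X X) : Fam C X Z := fun n =>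
  ∑ q : Fin (n + 1), ∑ ρ : Equiv.Perm (Fin n) with IsUnshuffle q ρ,
    perm 𝕏 ρ (pc 𝕫 (show (q : ℕ) + (n - q) = n by omega) s (f (n - q + 1)) (g q))

theorem star_eq_sstar {r r' : ℤ} {f : Fam C X Z} {g : Fam C X X} (hf : ∀ n, IsOp 𝕏 𝕫 r (f n))
    (hg : ∀ n, IsOp 𝕏 𝕏 r' (g n)) (s n : ℕ) (c : C.obj n) (x : Fin n → X) :
    star C 𝕏.par 𝕫.fil s (fun n c x => f n c x) (fun n c x => g n c x) n c x
      = sstar 𝕏 𝕫 s f g n c x := by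
  simp only [star, sstar, LinearMap.sum_apply, sum_apply]
  refine Finset.sum_congr rfl fun q _ => Finset.sum_congr rfl fun ρ _ => ?_
  rw [perm_apply, permM_apply]
  refine Finset.sum_congr rfl fun e _ => ?_
  rw [koszulSign_smul (k := k)]
  congr 1
  refine (pc_spec (show (q : ℕ) + (n - q) = n by omega) s (hf _) (hg _) _ _).evalCompl_eq
    𝕫.fil_separated (C.fil₂_antitone _ _) _ fun a b => ?_
  simp only [CompleteComplex.par_eq]
  rfl

end Op

/-! ### Symmetrization -/

section BlockPerm

variable {p q n : ℕ}

theorem blk_mul (h : q + p = n) (σ σ' : Equiv.Perm (Fin q)) (μ μ' : Equiv.Perm (Fin p)) :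
    blk h (σ * σ') (μ * μ') = blk h σ μ * blk h σ' μ' := by
  ext i; revert i
  rw [forall_split h]
  refine ⟨fun j => ?_, fun j => ?_⟩
  · rw [Equiv.Perm.mul_apply, blk_lt, blk_lt, blk_lt]; rfl
  · rw [Equiv.Perm.mul_apply, blk_ge, blk_ge, blk_ge]; rfl

theorem blk_one (h : q + p = n) : blk h 1 1 = 1 := by
  ext i; revert i
  rw [forall_split h]
  refine ⟨fun j => ?_, fun j => ?_⟩
  · rw [blk_lt]; rfl
  · rw [blk_ge]; rfl

theorem isUnshuffle_iff (h : q + p = n) (ρ : Equiv.Perm (Fin n)) :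
    IsUnshuffle q ρ ↔ StrictMono (hd h ρ) ∧ StrictMono (tl h ρ) := by
  constructor
  · intro H
    exact ⟨fun i j hij => H _ _ hij (.inl j.2),
      fun i j hij => H _ _ (by simpa using hij) (.inr (by simp))⟩
  · rintro ⟨h1, h2⟩ i j hij hq
    rcases hq with hq | hq
    · exact h1 (show (⟨i, by omega⟩ : Fin q) < ⟨j, hq⟩ from hij)
    · have := h2 (show (⟨i - q, by omega⟩ : Fin p) < ⟨j - q, by omega⟩ by
        rw [Fin.mk_lt_mk]; omega)
      simp only [tl] at this
      rwa [show (⟨q + ((i : ℕ) - q), by omega⟩ : Fin n) = i from Fin.ext (by simp only; omega),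
        show (⟨q + ((j : ℕ) - q), by omega⟩ : Fin n) = j from Fin.ext (by simp only; omega)] at this

/-- Every permutation is, in a unique way, an unshuffle times a block permutation. -/
theorem sum_unshuffle {M : Type*} [AddCommGroup M] (h : q + p = n)
    [DecidablePred fun ρ : Equiv.Perm (Fin n) => IsUnshuffle q ρ]
    (Φ : Equiv.Perm (Fin n) → M) (hΦ : ∀ ρ σ μ, Φ (ρ * blk h σ μ) = Φ ρ) :
    ∑ ρ, Φ ρ = (q.factorial * p.factorial) • ∑ ρ with IsUnshuffle q ρ, Φ ρ := by
  have h1 : ∑ x ∈ (Finset.univ.filter fun ρ : Equiv.Perm (Fin n) => IsUnshuffle q ρ) ×ˢ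
      (Finset.univ : Finset (Equiv.Perm (Fin q) × Equiv.Perm (Fin p))), Φ x.1 =
      ∑ ρ, Φ ρ := by
    refine Finset.sum_bij (fun x _ => x.1 * blk h x.2.1 x.2.2) (fun _ _ => Finset.mem_univ _)
      ?_ ?_ (fun x _ => (hΦ _ _ _).symm)
    · rintro ⟨u, σ, μ⟩ hu ⟨u', σ', μ'⟩ hu' e
      simp only [Finset.mem_product, Finset.mem_filter, Finset.mem_univ, true_and, and_true,
        isUnshuffle_iff h] at hu hu'
      simp only at e
      have hs : hd h u ∘ σ = hd h u' ∘ σ' := by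
        rw [← hd_comp_blk h σ μ, ← hd_comp_blk h σ' μ']
        congr 1
        exact congrArg (fun f : Equiv.Perm (Fin n) => (f : Fin n → Fin n)) e
      have ht : tl h u ∘ μ = tl h u' ∘ μ' := by
        rw [← tl_comp_blk h σ μ, ← tl_comp_blk h σ' μ']
        congr 1
        exact congrArg (fun f : Equiv.Perm (Fin n) => (f : Fin n → Fin n)) e
      -- Sorting an injective family is possible in only one way.
      have key : ∀ {m : ℕ} (f f' : Fin m → Fin n) (τ τ' : Equiv.Perm (Fin m)), StrictMono f →
          StrictMono f' → f ∘ τ = f' ∘ τ' → τ = τ' := by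
        intro m f f' τ τ' hf hf' he
        have h1 : (f ∘ τ) ∘ (τ⁻¹ : Equiv.Perm (Fin m)) = f := by
          ext i; simp
        have h2 : (f ∘ τ) ∘ (τ'⁻¹ : Equiv.Perm (Fin m)) = f' := by
          rw [he]; ext i; simp
        have h3 := Tuple.unique_monotone (f := f ∘ τ) (σ := τ⁻¹) (τ := τ'⁻¹)
          (by rw [h1]; exact hf.monotone) (by rw [h2]; exact hf'.monotone)
        rw [h1, h2] at h3
        subst h3
        ext i
        have := hf.injective (congrFun he i)
        rw [this]
      have e1 := key _ _ σ σ' hu.1 hu'.1 hs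
      have e2 := key _ _ μ μ' hu.2 hu'.2 ht
      subst e1; subst e2
      simpa using e
    · intro ρ _
      refine ⟨(ρ * blk h (Tuple.sort (hd h ρ)) (Tuple.sort (tl h ρ)),
        (Tuple.sort (hd h ρ))⁻¹, (Tuple.sort (tl h ρ))⁻¹), ?_, ?_⟩
      · simp only [Finset.mem_product, Finset.mem_filter, Finset.mem_univ, true_and, and_true,
          isUnshuffle_iff h]
        have i1 : Function.Injective (hd h ρ) := fun a b hab => by
          have := congrArg Fin.val (ρ.injective hab)
          exact Fin.ext this
        have i2 : Function.Injective (tl h ρ) := fun a b hab => by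
          have := congrArg Fin.val (ρ.injective hab)
          simp only at this
          exact Fin.ext (by omega)
        rw [Equiv.Perm.coe_mul, hd_comp_blk, tl_comp_blk]
        exact ⟨(Tuple.monotone_sort _).strictMono_of_injective
            (i1.comp (Tuple.sort (hd h ρ)).injective),
          (Tuple.monotone_sort _).strictMono_of_injective
            (i2.comp (Tuple.sort (tl h ρ)).injective)⟩
      · simp only
        rw [mul_assoc, ← blk_mul]
        simp [blk_one]
  rw [← h1, Finset.sum_product]
  simp only [Finset.sum_const, Finset.card_univ, Fintype.card_prod, Fintype.card_perm,
    Fintype.card_fin]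
  rw [Finset.smul_sum]

/-- The sum over a group of permutations of `p + 1` positions, arranged by the position of `0`. -/
theorem sum_perm_succ {M : Type*} [AddCommMonoid M] (Φ : Equiv.Perm (Fin (p + 1)) → M)
    (κ : Fin (p + 1) → Equiv.Perm (Fin (p + 1))) (hκ : ∀ j, κ j j = 0) :
    ∑ ρ, Φ ρ = ∑ j, ∑ μ : Equiv.Perm (Fin p), Φ (fix0 μ * κ j) := by
  rw [← Fintype.sum_prod_type' (f := fun j μ => Φ (fix0 μ * κ j))]
  symm
  refine Fintype.sum_bijective (fun x : Fin (p + 1) × Equiv.Perm (Fin p) => fix0 x.2 * κ x.1) ?_ _ _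
    (fun _ => rfl)
  rw [Fintype.bijective_iff_injective_and_card]
  refine ⟨?_, ?_⟩
  · rintro ⟨j, μ⟩ ⟨j', μ'⟩ e
    simp only at e
    have h1 : (fix0 μ * κ j) j = 0 := by simp [hκ]
    have h2 : (fix0 μ' * κ j') j' = 0 := by simp [hκ]
    rw [e] at h1
    have : j = j' := (fix0 μ' * κ j').injective (h1.trans h2.symm)
    subst this
    have e := mul_right_cancel e
    have : μ = μ' := by
      have := (Equiv.Perm.decomposeFin (n := p)).symm.injective e
      simpa using this
    rw [this]
  · simp [Fintype.card_perm, Nat.factorial_succ]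

end BlockPerm

section Sym

variable {k : Type*} [Field k] {C : CompleteCooperad k} {X Z : Type*} [AddCommGroup X] [Module k X]
  [AddCommGroup Z] [Module k Z] {𝕏 : CompleteComplex k X} {𝕫 : CompleteComplex k Z} {n p q : ℕ}

theorem act_sgn_pow (m s : ℕ) (ρ : Equiv.Perm (Fin m)) (c : C.obj m) :
    C.act m ρ (((C.cx m).sgn ^ s) c) = ((C.cx m).sgn ^ s) (C.act m ρ c) := by
  refine (C.cx m).induction_deg (P := fun c => C.act m ρ (((C.cx m).sgn ^ s) c) =
    ((C.cx m).sgn ^ s) (C.act m ρ c)) (fun e c hc => ?_)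
    (fun x y hx hy => by simp only [map_add, hx, hy]) c
  rw [(C.cx m).sgn_pow_of_deg s hc, (C.cx m).sgn_pow_of_deg s (C.act_deg m ρ e c hc), map_smul]

/-- Partial compositions are equivariant for block permutations. -/
theorem perm_blk_pc {r r' : ℤ} (h : q + p = n) (s : ℕ) {F : Op C (p + 1) X Z} {G : Op C q X X}
    (hF : IsOp 𝕏 𝕫 r F) (hG : IsOp 𝕏 𝕏 r' G) (σ : Equiv.Perm (Fin q)) (μ : Equiv.Perm (Fin p)) :
    perm 𝕏 (blk h σ μ) (pc 𝕫 h s F G) = pc 𝕫 h s (perm 𝕏 (fix0 μ) F) (perm 𝕏 σ G) := by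
  refine eq_pc h s (hF.perm _) (hG.perm _) fun c t x hx => ?_
  rw [perm_of_deg _ _ c hx]
  have h1 := HasEval.of_comp_arg (g := TensorProduct.map (C.act (p + 1) (fix0 μ)) (C.act q σ))
    (C.dec_act p q n h c (blk h σ μ) σ (fix0 μ) (fun j => by rw [blk_lt]) (by simp)
      (fun j => by rw [blk_ge, fix0_succ, Fin.val_succ]; simp; ring))
    (pc_spec (𝕫 := 𝕫) h s hF hG (C.act n (blk h σ μ) c) (x ∘ blk h σ μ))
  convert h1.smul (sg k (kosExp (blk h σ μ) fun j => (t j : ZMod 2))) using 1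
  refine tensor_ext_deg (C.cx (p + 1)) (C.cx q) fun ea eb a ha b hb => ?_
  have hG' : perm 𝕏 σ G b (hd h x) ∈ 𝕏.deg _ := (hG.perm σ).deg eb b hb _ _ (hd_mem 𝕏.deg h hx)
  simp only [LinearMap.comp_apply, LinearMap.smul_apply, evalAt_apply, TensorProduct.map_tmul,
    theta_tmul]
  rw [perm_of_deg _ _ _ (cons_mem 𝕏.deg hG' (tl_mem 𝕏.deg h hx)), cons_comp_fix0,
    hd_comp_blk, tl_comp_blk, perm_of_deg _ _ _ (hd_mem 𝕏.deg h hx), MultilinearMap.cons_smul,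
    smul_smul, ← sg_add, act_sgn_pow]
  congr 2
  rw [kosExp_blk, add_comm]
  congr 1
  rw [← kosExp_fix0 μ ((eb + r' + ∑ j, hd h t j : ℤ) : ZMod 2) (tl h fun j => (t j : ZMod 2))]
  congr 1
  ext j
  refine Fin.cases ?_ (fun j => ?_) j <;> simp [tl]

/-- The sum over all permutations. -/
def symm (𝕏 : CompleteComplex k X) : Op C n X Z →ₗ[k] Op C n X Z := ∑ ρ, perm 𝕏 ρ

theorem symm_apply (F : Op C n X Z) : symm 𝕏 F = ∑ ρ, perm 𝕏 ρ F := by simp [symm]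

theorem perm_symm (σ : Equiv.Perm (Fin n)) (F : Op C n X Z) :
    perm 𝕏 σ (symm 𝕏 F) = symm 𝕏 F := by
  simp only [symm_apply, map_sum, perm_perm]
  exact Fintype.sum_equiv (Equiv.mulLeft σ) _ _ (fun _ => rfl)

theorem symm_perm (σ : Equiv.Perm (Fin n)) (F : Op C n X Z) :
    symm 𝕏 (perm 𝕏 σ F) = symm 𝕏 F := by
  simp only [symm_apply, perm_perm]
  exact Fintype.sum_equiv (Equiv.mulRight σ) _ _ (fun _ => rfl)

/-- `pc` of two members of families. It vanishes unless the arities match. -/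
def pcFam (𝕫 : CompleteComplex k Z) (s : ℕ) (f : Fam C X Z) (g : Fam C X X) (n q p : ℕ) :
    Op C n X Z :=
  if h : q + p = n then pc 𝕫 h s (f (p + 1)) (g q) else 0

theorem pcFam_eq (s : ℕ) (f : Fam C X Z) (g : Fam C X X) (h : q + p = n) :
    pcFam 𝕫 s f g n q p = pc 𝕫 h s (f (p + 1)) (g q) := dif_pos h

theorem IsOp.pcFam {r r' r'' : ℤ} (s : ℕ) {f : Fam C X Z} {g : Fam C X X}
    (hf : ∀ n, IsOp 𝕏 𝕫 r (f n)) (hg : ∀ n, IsOp 𝕏 𝕏 r' (g n)) (hr : r + r' = r'') (n q p : ℕ) :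
    IsOp 𝕏 𝕫 r'' (pcFam 𝕫 s f g n q p) := by
  unfold FilteredHTT.pcFam
  split_ifs with h
  exacts [IsOp.pc h s (hf _) (hg _) hr, IsOp.zero _]

theorem isOp_sstar {r r' r'' : ℤ} (s : ℕ) {f : Fam C X Z} {g : Fam C X X}
    (hf : ∀ n, IsOp 𝕏 𝕫 r (f n)) (hg : ∀ n, IsOp 𝕏 𝕏 r' (g n)) (hr : r + r' = r'') (n : ℕ) :
    IsOp 𝕏 𝕫 r'' (sstar 𝕏 𝕫 s f g n) :=
  IsOp.sum _ fun _ _ => IsOp.sum _ fun _ _ => (IsOp.pc _ s (hf _) (hg _) hr).perm _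

/-- The convolution product of equivariant families as a sum over all permutations. -/
theorem sstar_eq_symm [CharZero k] {r r' : ℤ} (s : ℕ) {f : Fam C X Z} {g : Fam C X X}
    (hf : IsFam 𝕏 𝕫 r f) (hg : IsFam 𝕏 𝕏 r' g) (n : ℕ) :
    sstar 𝕏 𝕫 s f g n = ∑ a ∈ Finset.HasAntidiagonal.antidiagonal n,
      ((a.1.factorial : k)⁻¹ * (a.2.factorial : k)⁻¹) • symm 𝕏 (pcFam 𝕫 s f g n a.1 a.2) := by
  rw [Finset.Nat.sum_antidiagonal_eq_sum_range_succ_mk, Finset.sum_range]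
  refine Finset.sum_congr rfl fun q _ => ?_
  have h : (q : ℕ) + (n - q) = n := by omega
  have hinv : ∀ ρ σ μ, perm 𝕏 (ρ * blk h σ μ) (pc 𝕫 h s (f (n - q + 1)) (g q)) =
      perm 𝕏 ρ (pc 𝕫 h s (f (n - q + 1)) (g q)) := by
    intro ρ σ μ
    rw [← perm_perm, perm_blk_pc h s (hf.op _) (hg.op _), hf.act, hg.act]
  classical
  rw [symm_apply, pcFam_eq s f g h, sum_unshuffle h _ hinv]
  rw [← Nat.cast_smul_eq_nsmul k, smul_smul, ← mul_inv]
  have : ((q : ℕ).factorial : k) * ((n - q).factorial : k) ≠ 0 := by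
    exact_mod_cast (Nat.mul_pos (Nat.factorial_pos _) (Nat.factorial_pos _)).ne'
  push_cast
  rw [inv_mul_cancel₀ this, one_smul]

theorem isFam_sstar [CharZero k] {r r' r'' : ℤ} (s : ℕ) {f : Fam C X Z} {g : Fam C X X}
    (hf : IsFam 𝕏 𝕫 r f) (hg : IsFam 𝕏 𝕏 r' g) (hr : r + r' = r'') :
    IsFam 𝕏 𝕫 r'' (sstar 𝕏 𝕫 s f g) := by
  refine ⟨isOp_sstar s hf.op hg.op hr, fun n ρ => ?_⟩
  rw [sstar_eq_symm s hf hg]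
  simp only [map_sum, map_smul, perm_symm]

end Sym

/-! ### Evaluation on completed tensor products -/

section NestedEval

variable {k : Type*} [Field k] {X Y Z A D : Type*} [AddCommGroup X] [Module k X] [AddCommGroup Y]
  [Module k Y] [AddCommGroup Z] [Module k Z] [AddCommGroup A] [Module k A] [AddCommGroup D]
  [Module k D] {F : ℤ → Submodule k X} {G : ℤ → Submodule k Y} {FZ : ℤ → Submodule k Z}
  {FA : ℤ → Submodule k A} {FD : ℤ → Submodule k D}

/-- The components of `y ⊗̂ b` can be computed from representatives of `y`. -/
theorem Compl.mkQ_tmul_of (hF : Antitone F) (hF' : ∀ x, ∃ p, x ∈ F p) (hG : Antitone G)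
    (hG' : ∀ x, ∃ p, x ∈ G p) (y : Compl F) {b : Y} {q N : ℤ} (hb : b ∈ G q) {s : X}
    (hs : (F (N - q)).mkQ s = y.1 (N - q)) :
    (tensorSum F G N).mkQ (s ⊗ₜ b) = (Compl.tmul hF hF' hG hG' y (Compl.of G b)).1 N := by
  obtain ⟨L₀, hL₀⟩ := (Compl.exists_tmul hF hF' hG hG' y (Compl.of G b) N).choose_spec
  obtain ⟨s', hs'⟩ := HasEval.exists_rep y (max L₀ (N - q))
  refine Eq.trans ?_ (hL₀ (max L₀ (N - q)) (le_max_left _ _) s' b hs' rfl)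
  refine (Submodule.Quotient.eq (tensorSum F G N)).2 ?_
  rw [← TensorProduct.sub_tmul]
  exact tmul_mem_tensorSum (p := N - q) (q := q) (by ring)
    (Compl.rep_sub hF y (le_max_right _ _) hs hs') hb

/-- The components of `a ⊗̂ y` can be computed from representatives of `y`. -/
theorem Compl.mkQ_of_tmul (hF : Antitone F) (hF' : ∀ x, ∃ p, x ∈ F p) (hG : Antitone G)
    (hG' : ∀ x, ∃ p, x ∈ G p) (y : Compl G) {a : X} {q N : ℤ} (ha : a ∈ F q) {s : Y}
    (hs : (G (N - q)).mkQ s = y.1 (N - q)) :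
    (tensorSum F G N).mkQ (a ⊗ₜ s) = (Compl.tmul hF hF' hG hG' (Compl.of F a) y).1 N := by
  obtain ⟨L₀, hL₀⟩ := (Compl.exists_tmul hF hF' hG hG' (Compl.of F a) y N).choose_spec
  obtain ⟨s', hs'⟩ := HasEval.exists_rep y (max L₀ (N - q))
  refine Eq.trans ?_ (hL₀ (max L₀ (N - q)) (le_max_left _ _) a s' rfl hs')
  refine (Submodule.Quotient.eq (tensorSum F G N)).2 ?_
  rw [← TensorProduct.tmul_sub]
  exact tmul_mem_tensorSum (p := q) (q := N - q) (by ring) ha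
    (Compl.rep_sub hG y (le_max_right _ _) hs hs')

variable {θ : X ⊗[k] Y →ₗ[k] Z}

theorem HasEval.tmul_of (hFZ : Antitone FZ) (hF : Antitone F) (hF' : ∀ x, ∃ p, x ∈ F p)
    (hG : Antitone G)
    (hG' : ∀ x, ∃ p, x ∈ G p) (hθ : ∃ u, ∀ M, ∀ t ∈ tensorSum F G M, θ t ∈ FZ (M + u))
    {y : Compl F} {b : Y} {z : Z} (h : HasEval FZ (θ ∘ₗ (TensorProduct.mk k X Y).flip b) y z) :
    HasEval FZ θ (Compl.tmul hF hF' hG hG' y (Compl.of G b)) z := by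
  obtain ⟨u, hθ⟩ := hθ
  obtain ⟨q, hb⟩ := hG' b
  obtain ⟨v, h⟩ := h
  refine ⟨min u (v - q), fun M t ht => ?_⟩
  obtain ⟨s, hs⟩ := HasEval.exists_rep y (M - q)
  have e : t - s ⊗ₜ b ∈ tensorSum F G M := by
    rw [← Submodule.Quotient.mk_eq_zero, ← Submodule.mkQ_apply, map_sub, ht,
      Compl.mkQ_tmul_of hF hF' hG hG' y hb hs, sub_self]
  have h1 := hFZ (show M + min u (v - q) ≤ M + u by omega) (hθ M _ e)
  have h2 := hFZ (show M + min u (v - q) ≤ M - q + v by omega) (h _ s hs)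
  rw [map_sub] at h1
  simp only [LinearMap.comp_apply, LinearMap.flip_apply, TensorProduct.mk_apply] at h2
  convert Submodule.sub_mem _ h2 h1 using 1; abel

theorem HasEval.of_tmul (hFZ : Antitone FZ) (hF : Antitone F) (hF' : ∀ x, ∃ p, x ∈ F p)
    (hG : Antitone G)
    (hG' : ∀ x, ∃ p, x ∈ G p) (hθ : ∃ u, ∀ M, ∀ t ∈ tensorSum F G M, θ t ∈ FZ (M + u))
    {y : Compl G} {a : X} {z : Z} (h : HasEval FZ (θ ∘ₗ TensorProduct.mk k X Y a) y z) :
    HasEval FZ θ (Compl.tmul hF hF' hG hG' (Compl.of F a) y) z := by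
  obtain ⟨u, hθ⟩ := hθ
  obtain ⟨q, ha⟩ := hF' a
  obtain ⟨v, h⟩ := h
  refine ⟨min u (v - q), fun M t ht => ?_⟩
  obtain ⟨s, hs⟩ := HasEval.exists_rep y (M - q)
  have e : t - a ⊗ₜ s ∈ tensorSum F G M := by
    rw [← Submodule.Quotient.mk_eq_zero, ← Submodule.mkQ_apply, map_sub, ht,
      Compl.mkQ_of_tmul hF hF' hG hG' y ha hs, sub_self]
  have h1 := hFZ (show M + min u (v - q) ≤ M + u by omega) (hθ M _ e)
  have h2 := hFZ (show M + min u (v - q) ≤ M - q + v by omega) (h _ s hs)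
  rw [map_sub] at h1
  simp only [LinearMap.comp_apply, TensorProduct.mk_apply] at h2
  convert Submodule.sub_mem _ h2 h1 using 1; abel

/-- Evaluation at `(f ⊗̂ g)(y)` is evaluation at `y` of the map `a ⊗ b ↦ θ(f(a) ⊗̂ g(b))`. -/
theorem HasEval.tmap (hFZ : Antitone FZ) (hF : Antitone F) (hF' : ∀ x, ∃ p, x ∈ F p)
    (hG : Antitone G) (hG' : ∀ x, ∃ p, x ∈ G p)
    (hθ : ∃ u, ∀ M, ∀ t ∈ tensorSum F G M, θ t ∈ FZ (M + u))
    {f : A →ₗ[k] Compl F} (hf : IsFiltered FA F f) {g : D →ₗ[k] Compl G} (hg : IsFiltered FD G g)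
    {β : A ⊗[k] D →ₗ[k] Z}
    (hβ : ∀ a b, HasEval FZ θ (Compl.tmul hF hF' hG hG' (f a) (g b)) (β (a ⊗ₜ b)))
    {y : Compl (tensorSum FA FD)} {z : Z} (h : HasEval FZ β y z) :
    HasEval FZ θ (Compl.tmap hF hF' hG hG' f hf g hg y) z := by
  have hT : Antitone (tensorSum F G) := fun _ _ h =>
    iSup_mono fun _ => Submodule.map₂_le_map₂ le_rfl (hG (by omega))
  have key : ∀ t₀ : A ⊗[k] D, HasEval FZ θ
      (TensorProduct.lift ((Compl.tmul hF hF' hG hG').compl₁₂ f g) t₀) (β t₀) := by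
    intro t₀
    induction t₀ with
    | zero =>
      rw [map_zero, map_zero]
      obtain ⟨u, hθ⟩ := hθ
      refine ⟨u, fun M t ht => ?_⟩
      rw [zero_sub]
      exact Submodule.neg_mem _ (hθ M t ((Submodule.Quotient.mk_eq_zero _).1 ht))
    | tmul a b => exact hβ a b
    | add s t hs ht => rw [map_add, map_add]; exact hs.add_arg hFZ ht
  obtain ⟨v, h⟩ := h
  obtain ⟨u, hθ⟩ := hθ
  refine ⟨min u v, fun M t ht => ?_⟩
  obtain ⟨t₀, ht₀⟩ := HasEval.exists_rep y M
  have e : (Compl.tmap hF hF' hG hG' f hf g hg y).1 M =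
      (TensorProduct.lift ((Compl.tmul hF hF' hG hG').compl₁₂ f g) t₀).1 M := by
    change Submodule.liftQ _ _ _ (y.1 M) = _
    rw [← ht₀]; rfl
  have h1 := (key t₀).estimate hFZ hT hθ M t (ht.trans e)
  have h2 := h M t₀ ht₀
  have := Submodule.add_mem _ (hFZ (show M + min u v ≤ M + u by omega) h1)
    (hFZ (show M + min u v ≤ M + v by omega) h2)
  convert this using 1; abel

end NestedEval

section Nested

variable {k : Type*} [Field k] {C : CompleteCooperad k} {X Z : Type*} [AddCommGroup X] [Module k X]
  [AddCommGroup Z] [Module k Z] {𝕏 : CompleteComplex k X} {𝕫 : CompleteComplex k Z} {n p q : ℕ}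

/-- The infinitesimal cocomposition commutes with the sign involutions. -/
theorem dec_sgn (h : q + p = n) (c : C.obj n) (N : ℤ) (t : C.obj (p + 1) ⊗[k] C.obj q)
    (ht : (C.fil₂ (p + 1) q N).mkQ t = (C.dec p q n h c).1 N) :
    (C.fil₂ (p + 1) q N).mkQ (TensorProduct.map (C.cx (p + 1)).sgn (C.cx q).sgn t) =
      (C.dec p q n h ((C.cx n).sgn c)).1 N := by
  have hS : ∀ t ∈ C.fil₂ (p + 1) q N,
      TensorProduct.map (C.cx (p + 1)).sgn (C.cx q).sgn t ∈ C.fil₂ (p + 1) q N := by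
    intro t ht
    suffices H : C.fil₂ (p + 1) q N ≤ (C.fil₂ (p + 1) q N).comap
      (TensorProduct.map (C.cx (p + 1)).sgn (C.cx q).sgn) from H ht
    exact tensorSum_le fun i a ha b hb => tmul_mem_tensorSum (by ring)
      ((C.cx (p + 1)).sgn_fil ha) ((C.cx q).sgn_fil hb)
  revert t
  refine (C.cx n).induction_deg (P := fun c => ∀ t,
    (C.fil₂ (p + 1) q N).mkQ t = (C.dec p q n h c).1 N →
    (C.fil₂ (p + 1) q N).mkQ (TensorProduct.map (C.cx (p + 1)).sgn (C.cx q).sgn t) =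
      (C.dec p q n h ((C.cx n).sgn c)).1 N) (fun e c hc t ht => ?_) (fun c c' hc hc' t ht => ?_) c
  · obtain ⟨t', ht', e'⟩ := C.dec_deg p q n h e c hc N
    have h1 := hS _ ((Submodule.Quotient.eq _).1 (ht.trans e'.symm))
    rw [map_sub] at h1
    refine ((Submodule.Quotient.eq _).2 h1).trans ?_
    have h2 : TensorProduct.map (C.cx (p + 1)).sgn (C.cx q).sgn t' = sg k (e : ZMod 2) • t' := by
      suffices H : tensorSum (C.cx (p + 1)).deg (C.cx q).deg e ≤ LinearMap.ker
        (TensorProduct.map (C.cx (p + 1)).sgn (C.cx q).sgn - sg k (e : ZMod 2) • LinearMap.id) by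
        have := H ht'
        rwa [LinearMap.mem_ker, LinearMap.sub_apply, sub_eq_zero] at this
      refine tensorSum_le fun i a ha b hb => ?_
      rw [LinearMap.mem_ker, LinearMap.sub_apply, sub_eq_zero, TensorProduct.map_tmul,
        (C.cx (p + 1)).sgn_of_deg ha, (C.cx q).sgn_of_deg hb]
      rw [TensorProduct.smul_tmul_smul, ← sg_add]
      simp
    rw [← Submodule.mkQ_apply, h2, map_smul, e', (C.cx n).sgn_of_deg hc, map_smul]
    rfl
  · obtain ⟨t₁, ht₁⟩ := HasEval.exists_rep (C.dec p q n h c) N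
    have e : (C.fil₂ (p + 1) q N).mkQ (t - t₁) = (C.dec p q n h c').1 N := by
      rw [map_sub, ht, ht₁, map_add]; simp
    have h1 := hc t₁ ht₁
    have h2 := hc' _ e
    rw [map_add, map_add]
    have : t = t₁ + (t - t₁) := by abel
    rw [this, map_add, map_add, h1, h2]; rfl

theorem dec_sgn_pow (s : ℕ) (h : q + p = n) (c : C.obj n) (N : ℤ)
    (t : C.obj (p + 1) ⊗[k] C.obj q)
    (ht : (C.fil₂ (p + 1) q N).mkQ t = (C.dec p q n h c).1 N) :
    (C.fil₂ (p + 1) q N).mkQ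
      (TensorProduct.map ((C.cx (p + 1)).sgn ^ s) ((C.cx q).sgn ^ s) t) =
      (C.dec p q n h (((C.cx n).sgn ^ s) c)).1 N := by
  induction s with
  | zero =>
    simp only [pow_zero, Module.End.one_apply]
    rw [← ht]
    congr 1
    exact congrArg (fun f => f t) (TensorProduct.map_id (R := k))
  | succ s ih =>
    rw [pow_succ' ((C.cx n).sgn), Module.End.mul_apply, ← dec_sgn h _ N _ ih,
      pow_succ', pow_succ', Module.End.mul_eq_comp, Module.End.mul_eq_comp,
      TensorProduct.map_comp, LinearMap.comp_apply]

/-- The composition `t ⊗ b ↦ θ(t)(G(b)(x_1, …), x_q, …)`. -/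
def nest {T : Type*} [AddCommGroup T] [Module k T] (h : q + p = n)
    (θ : T →ₗ[k] MultilinearMap k (fun _ : Fin (p + 1) => X) Z)
    (G : Op C q X X) (x : Fin n → X) : T ⊗[k] C.obj q →ₗ[k] Z :=
  TensorProduct.lift (LinearMap.mk₂ k
    (fun t b => θ t (Fin.cons (G b (hd h x)) (tl h x)))
    (fun a a' b => by simp) (fun r a b => by simp)
    (fun a b b' => by
      simp only [map_add, add_apply]
      exact MultilinearMap.cons_add _ _ _ _)
    (fun r a b => by
      simp only [map_smul, smul_apply]
      exact MultilinearMap.cons_smul _ _ _ _))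

theorem nest_tmul {T : Type*} [AddCommGroup T] [Module k T] (h : q + p = n)
    (θ : T →ₗ[k] MultilinearMap k (fun _ : Fin (p + 1) => X) Z)
    (G : Op C q X X) (x : Fin n → X) (t : T) (b : C.obj q) :
    nest h θ G x (t ⊗ₜ b) = θ t (Fin.cons (G b (hd h x)) (tl h x)) := rfl

theorem nest_fil {T : Type*} [AddCommGroup T] [Module k T] {FT : ℤ → Submodule k T} {r : ℤ}
    (h : q + p = n) {θ : T →ₗ[k] MultilinearMap k (fun _ : Fin (p + 1) => X) Z}
    (hθ : ∀ (w : Fin (p + 1) → ℤ) (x : Fin (p + 1) → X), (∀ j, x j ∈ 𝕏.fil (w j)) →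
      ∀ M, ∀ t ∈ FT M, θ t x ∈ 𝕫.fil (M + ∑ j, w j)) {G : Op C q X X} (hG : IsOp 𝕏 𝕏 r G)
    (x : Fin n → X) :
    ∃ u, ∀ M, ∀ t ∈ tensorSum FT (C.cx q).fil M, nest h θ G x t ∈ 𝕫.fil (M + u) := by
  choose w hw using fun j => 𝕏.fil_exhaustive (x j)
  refine ⟨∑ j, w j, fun M t ht => ?_⟩
  suffices H : tensorSum FT (C.cx q).fil M ≤ (𝕫.fil (M + ∑ j, w j)).comap (nest h θ G x) from H ht
  refine tensorSum_le fun i a ha b hb => ?_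
  have h1 := hG.fil _ b hb _ _ (hd_mem 𝕏.fil h hw)
  have h2 := hθ _ _ (cons_mem 𝕏.fil h1 (tl_mem 𝕏.fil h hw)) _ _ ha
  change nest h θ G x (a ⊗ₜ b) ∈ 𝕫.fil (M + ∑ j, w j)
  rw [nest_tmul]
  convert h2 using 2
  rw [Fin.sum_univ_succ, sum_split h w]
  simp only [Fin.cons_zero, Fin.cons_succ]
  ring

theorem permM_fil {m : ℕ} {ρ : Equiv.Perm (Fin m)} {f : MultilinearMap k (fun _ : Fin m => X) Z}
    {N : ℤ} {w : Fin m → ℤ} {x : Fin m → X} (hx : ∀ j, x j ∈ 𝕏.fil (w j))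
    (hf : ∀ y, (∀ j, y j ∈ 𝕏.fil ((w ∘ ρ) j)) → f y ∈ 𝕫.fil N) : permM 𝕏 ρ f x ∈ 𝕫.fil N := by
  rw [permM_apply]
  exact Submodule.sum_mem _ fun e _ => Submodule.smul_mem _ _
    (hf _ fun j => 𝕏.parL_fil _ (hx _))

/-- The evaluation that computes a permuted partial composition with signs. -/
theorem perm_pc_spec {r r' : ℤ} (h : q + p = n) (s s' : ℕ) (ρ : Equiv.Perm (Fin n))
    {F : Op C (p + 1) X Z}
    {G : Op C q X X} (hF : IsOp 𝕏 𝕫 r F) (hG : IsOp 𝕏 𝕏 r' G) (c : C.obj n) (x : Fin n → X) :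
    HasEval 𝕫.fil (evalAt x ∘ₗ permM 𝕏 ρ ∘ₗ theta h s F G ∘ₗ
      TensorProduct.map ((C.cx (p + 1)).sgn ^ s') ((C.cx q).sgn ^ s'))
      (C.dec p q n h (C.act n ρ c)) (perm 𝕏 ρ (pc 𝕫 h s F G) (((C.cx n).sgn ^ s') c) x) := by
  have h1 : ∀ y, HasEval 𝕫.fil (evalAt y ∘ₗ theta h s F G ∘ₗ
      TensorProduct.map ((C.cx (p + 1)).sgn ^ s') ((C.cx q).sgn ^ s'))
      (C.dec p q n h (C.act n ρ c)) (pc 𝕫 h s F G (((C.cx n).sgn ^ s') (C.act n ρ c)) y) := by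
    intro y
    rw [← LinearMap.comp_assoc]
    exact HasEval.of_comp_arg (dec_sgn_pow s' h (C.act n ρ c)) (pc_spec (𝕫 := 𝕫) h s hF hG _ y)
  rw [perm_apply, permM_apply, act_sgn_pow]
  convert HasEval.sum 𝕫.fil_antitone Finset.univ (fun (e : Fin n → ZMod 2) _ =>
    (h1 fun i => 𝕏.parL (e (ρ i)) (x (ρ i))).smul (sg k (kosExp ρ e))) using 1
  ext t
  simp [permM_apply]

end Nested

/-! ### The two associativity laws for partial compositions -/

section Assoc

variable {k : Type*} [Field k] {C : CompleteCooperad k} {X Z : Type*} [AddCommGroup X] [Module k X]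
  [AddCommGroup Z] [Module k Z] {𝕏 : CompleteComplex k X} {𝕫 : CompleteComplex k Z} {n p q : ℕ}

/-- The composition `a ⊗ t ↦ (-1)^{s|a|} F(a)(θ(t)(x_1, …), x_q, …)`. -/
def nestR {T : Type*} [AddCommGroup T] [Module k T] (h : q + p = n) (s : ℕ)
    (F : Op C (p + 1) X Z) (θ : T →ₗ[k] MultilinearMap k (fun _ : Fin q => X) X)
    (x : Fin n → X) : C.obj (p + 1) ⊗[k] T →ₗ[k] Z :=
  TensorProduct.lift (LinearMap.mk₂ k
    (fun a t => F (((C.cx (p + 1)).sgn ^ s) a) (Fin.cons (θ t (hd h x)) (tl h x)))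
    (fun a a' b => by simp) (fun r a b => by simp)
    (fun a b b' => by
      simp only [map_add, add_apply]
      exact MultilinearMap.cons_add _ _ _ _)
    (fun r a b => by
      simp only [map_smul, smul_apply]
      exact MultilinearMap.cons_smul _ _ _ _))

theorem nestR_tmul {T : Type*} [AddCommGroup T] [Module k T] (h : q + p = n) (s : ℕ)
    (F : Op C (p + 1) X Z) (θ : T →ₗ[k] MultilinearMap k (fun _ : Fin q => X) X)
    (x : Fin n → X) (a : C.obj (p + 1)) (t : T) : nestR h s F θ x (a ⊗ₜ t) =
      F (((C.cx (p + 1)).sgn ^ s) a) (Fin.cons (θ t (hd h x)) (tl h x)) := rfl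

theorem nestR_fil {T : Type*} [AddCommGroup T] [Module k T] {FT : ℤ → Submodule k T} {r : ℤ}
    (h : q + p = n) (s : ℕ) {F : Op C (p + 1) X Z} (hF : IsOp 𝕏 𝕫 r F)
    {θ : T →ₗ[k] MultilinearMap k (fun _ : Fin q => X) X}
    (hθ : ∀ (w : Fin q → ℤ) (x : Fin q → X), (∀ j, x j ∈ 𝕏.fil (w j)) →
      ∀ M, ∀ t ∈ FT M, θ t x ∈ 𝕏.fil (M + ∑ j, w j)) (x : Fin n → X) :
    ∃ u, ∀ M, ∀ t ∈ tensorSum (C.cx (p + 1)).fil FT M, nestR h s F θ x t ∈ 𝕫.fil (M + u) := by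
  choose w hw using fun j => 𝕏.fil_exhaustive (x j)
  refine ⟨∑ j, w j, fun M t ht => ?_⟩
  suffices H : tensorSum (C.cx (p + 1)).fil FT M ≤
    (𝕫.fil (M + ∑ j, w j)).comap (nestR h s F θ x) from H ht
  refine tensorSum_le fun i a ha b hb => ?_
  have h1 := hθ _ _ (hd_mem 𝕏.fil h hw) _ b hb
  have h2 := hF.fil _ _ ((C.cx (p + 1)).sgn_pow_fil s ha) _ _
    (cons_mem 𝕏.fil h1 (tl_mem 𝕏.fil h hw))
  change nestR h s F θ x (a ⊗ₜ b) ∈ 𝕫.fil (M + ∑ j, w j)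
  rw [nestR_tmul]
  convert h2 using 2
  rw [Fin.sum_univ_succ, sum_split h w]
  simp only [Fin.cons_zero, Fin.cons_succ]
  ring

/-- Evaluation at `(f ⊗̂ 1)(y)`, where the values of `θ` at `f(c)` are the values of an operation
`F`. -/
theorem mapLeft_eval {a b m : ℕ} {u : ℤ} {f : C.obj (a + 1) →ₗ[k] C.tensor₂ m q}
    (hf : IsFiltered (C.cx (a + 1)).fil (C.fil₂ m q) f) (h : b + a = n)
    {θ : C.obj m ⊗[k] C.obj q →ₗ[k] MultilinearMap k (fun _ : Fin (a + 1) => X) Z}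
    (hθ : ∀ (w : Fin (a + 1) → ℤ) (x : Fin (a + 1) → X), (∀ j, x j ∈ 𝕏.fil (w j)) →
      ∀ M, ∀ t ∈ C.fil₂ m q M, θ t x ∈ 𝕫.fil (M + ∑ j, w j))
    {s : ℕ} {F : Op C (a + 1) X Z} {H : Op C b X X} (hH : IsOp 𝕏 𝕏 u H)
    (hβ : ∀ c y, HasEval 𝕫.fil (evalAt y ∘ₗ θ) (f c) (F (((C.cx (a + 1)).sgn ^ s) c) y))
    {x : Fin n → X} {y : C.tensor₂ (a + 1) b} {z : Z}
    (hz : HasEval 𝕫.fil (evalAt x ∘ₗ theta h s F H) y z) :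
    HasEval 𝕫.fil (nest h θ H x) (C.mapLeft b f hf y) z := by
  refine HasEval.tmap 𝕫.fil_antitone (C.fil₂_antitone m q) (C.fil₂_exhaustive m q)
    (C.cx b).fil_antitone (C.cx b).fil_exhaustive (nest_fil h hθ hH x) hf (isFiltered_of _)
    (fun c d => ?_) hz
  refine HasEval.tmul_of 𝕫.fil_antitone (C.fil₂_antitone m q) (C.fil₂_exhaustive m q)
    (C.cx b).fil_antitone (C.cx b).fil_exhaustive (nest_fil h hθ hH x) ?_
  exact hβ c (Fin.cons (H d (hd h x)) (tl h x))

theorem cons_hd_tl_left {P a b : ℕ} (h : b + a + P = n) (h1 : b + (a + P) = n)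
    (h2 : a + 1 + P = a + P + 1) {α : Type*} (y : α) (x : Fin n → α) :
    hd h2 (Fin.cons y (tl h1 x) : Fin (a + P + 1) → α) =
      Fin.cons y (tl (show b + a = b + a from rfl) (hd h x)) := by
  funext j
  refine Fin.cases rfl (fun j => ?_) j
  rw [Fin.cons_succ]
  exact Fin.cons_succ (α := fun _ => α) y (tl h1 x) ⟨j, by omega⟩

theorem cons_hd_tl_right {P a b : ℕ} (h : b + a + P = n) (h1 : b + (a + P) = n)
    (h2 : a + 1 + P = a + P + 1) {α : Type*} (y : α) (x : Fin n → α) :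
    tl h2 (Fin.cons y (tl h1 x) : Fin (a + P + 1) → α) = tl h x := by
  funext j
  have : (⟨a + 1 + j, by omega⟩ : Fin (a + P + 1)) = Fin.succ ⟨a + j, by omega⟩ := by
    ext; simp only [Fin.succ_mk]; omega
  simp only [tl]
  rw [this, Fin.cons_succ]
  exact congrArg x (Fin.ext (by simp only; omega))

/-- Sequential associativity of partial compositions. -/
theorem pc_pc_seq {P a b : ℕ} {r₁ r₂ r₃ : ℤ} (h : b + a + P = n) (h1 : b + (a + P) = n)
    (h2 : a + 1 + P = a + P + 1) (s₁ s₂ : ℕ) {F : Op C (P + 1) X Z} {G : Op C (a + 1) X X}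
    {H : Op C b X X} (hF : IsOp 𝕏 𝕫 r₁ F) (hG : IsOp 𝕏 𝕏 r₂ G) (hH : IsOp 𝕏 𝕏 r₃ H) :
    pc 𝕫 h1 s₂ (pc 𝕫 h2 s₁ F G) H =
      pc 𝕫 h (s₁ + s₂) F (pc 𝕏 (show b + a = b + a from rfl) s₂ G H) := by
  have hGH : IsOp 𝕏 𝕏 (r₂ + r₃) (pc 𝕏 (show b + a = b + a from rfl) s₂ G H) := IsOp.pc _ _ hG hH rfl
  have hFG : IsOp 𝕏 𝕫 (r₁ + r₂) (pc 𝕫 h2 s₁ F G) := IsOp.pc _ _ hF hG rfl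
  refine Op.ext_deg 𝕏 fun c t x _ => ?_
  -- On the left hand side, the sign of `H` depends on the total degree of `a₁ ⊗ a₂`, so it is
  -- distributed over both factors.
  have L := mapLeft_eval (𝕏 := 𝕏) (𝕫 := 𝕫) (C.dec_fil P (a + 1) (a + P + 1) (by omega)) h1
    (θ := theta h2 s₁ F G ∘ₗ
      TensorProduct.map ((C.cx (P + 1)).sgn ^ s₂) ((C.cx (a + 1)).sgn ^ s₂))
    (fun w y hy M t ht => theta_fil h2 s₁ hF hG hy M _ (by
      suffices H : C.fil₂ (P + 1) (a + 1) M ≤ (C.fil₂ (P + 1) (a + 1) M).comap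
        (TensorProduct.map ((C.cx (P + 1)).sgn ^ s₂) ((C.cx (a + 1)).sgn ^ s₂)) from H ht
      exact tensorSum_le fun i a ha b hb => tmul_mem_tensorSum (by ring)
        (CompleteComplex.sgn_pow_fil _ _ ha) (CompleteComplex.sgn_pow_fil _ _ hb)))
    hH
    (fun c y => by
      rw [← LinearMap.comp_assoc]
      exact HasEval.of_comp_arg (dec_sgn_pow s₂ h2 c) (pc_spec (𝕫 := 𝕫) h2 s₁ hF hG _ y))
    (pc_spec h1 s₂ hFG hH c x)
  set θR := nestR h (s₁ + s₂) F (theta (show b + a = b + a from rfl) s₂ G H) x with hθRdef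
  have hθR : ∃ u, ∀ M, ∀ t ∈ tensorSum (C.cx (P + 1)).fil (C.fil₂ (a + 1) b) M,
      θR t ∈ 𝕫.fil (M + u) :=
    nestR_fil h _ hF (fun w y hy M t ht => theta_fil _ s₂ hG hH hy M t ht) x
  have R : HasEval 𝕫.fil θR (C.mapRight (P + 1) (C.dec a b (b + a) rfl) (C.dec_fil _ _ _ _)
      (C.dec P (b + a) n h c))
      (pc 𝕫 h (s₁ + s₂) F (pc 𝕏 (show b + a = b + a from rfl) s₂ G H) c x) := by
    refine HasEval.tmap 𝕫.fil_antitone (C.cx (P + 1)).fil_antitone (C.cx (P + 1)).fil_exhaustive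
      (C.fil₂_antitone _ _) (C.fil₂_exhaustive _ _) hθR (isFiltered_of _) (C.dec_fil _ _ _ _)
      (fun a₁ d => ?_) (pc_spec h (s₁ + s₂) hF hGH c x)
    refine HasEval.of_tmul 𝕫.fil_antitone (C.cx (P + 1)).fil_antitone (C.cx (P + 1)).fil_exhaustive
      (C.fil₂_antitone _ _) (C.fil₂_exhaustive _ _) hθR ?_
    obtain ⟨v, hv⟩ := pc_spec (𝕫 := 𝕏) (show b + a = b + a from rfl) s₂ hG hH d (hd h x)
    obtain ⟨i, hi⟩ := (C.cx (P + 1)).fil_exhaustive (((C.cx (P + 1)).sgn ^ (s₁ + s₂)) a₁)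
    choose w hw using fun j => 𝕏.fil_exhaustive (x j)
    refine ⟨i + v + ∑ j, tl h w j, fun M t ht => ?_⟩
    have h1 := hF.fil _ _ hi _ _ (cons_mem 𝕏.fil (hv M t ht) (tl_mem 𝕏.fil h hw))
    rw [Fin.sum_univ_succ] at h1
    simp only [Fin.cons_zero, Fin.cons_succ] at h1
    change F (((C.cx (P + 1)).sgn ^ (s₁ + s₂)) a₁)
        (Fin.cons (pc 𝕏 (show b + a = b + a from rfl) s₂ G H d (hd h x)) (tl h x)) -
      F (((C.cx (P + 1)).sgn ^ (s₁ + s₂)) a₁)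
        (Fin.cons (theta (show b + a = b + a from rfl) s₂ G H t (hd h x)) (tl h x)) ∈ 𝕫.fil _
    have e := (F (((C.cx (P + 1)).sgn ^ (s₁ + s₂)) a₁)).cons_add (tl h x)
      (pc 𝕏 (show b + a = b + a from rfl) s₂ G H d (hd h x) -
        theta (show b + a = b + a from rfl) s₂ G H t (hd h x))
      (theta (show b + a = b + a from rfl) s₂ G H t (hd h x))
    rw [sub_add_cancel] at e
    rw [e, add_sub_cancel_right]
    have e2 : i + (M + v + ∑ j, tl h w j) = M + (i + v + ∑ j, tl h w j) := by ring
    rw [e2] at h1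
    exact h1
  -- Coassociativity makes both sides values at the same element of a completed tensor product.
  have R' := HasEval.of_comp_arg (g := (TensorProduct.assoc k _ _ _).toLinearMap)
    (C.coassoc_seq P a b n h c) R
  refine L.uniq 𝕫.fil_antitone 𝕫.fil_separated ?_
  convert R' using 1
  refine TensorProduct.ext_threefold fun a₁ a₂ d => ?_
  simp only [LinearMap.comp_apply, nest_tmul, TensorProduct.map_tmul, theta_tmul,
    LinearEquiv.coe_coe, TensorProduct.assoc_tmul, θR, nestR_tmul]
  rw [cons_hd_tl_left h, cons_hd_tl_right h, pow_add]
  rfl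

/-- The permutation that exchanges a block of length `a` and a block of length `b`. -/
def blockSwap (a b : ℕ) {n : ℕ} (h : a + b ≤ n) : Equiv.Perm (Fin n) where
  toFun i := ⟨if (i : ℕ) < b then a + i else if (i : ℕ) < a + b then i - b else i, by
    split_ifs <;> omega⟩
  invFun i := ⟨if (i : ℕ) < a then b + i else if (i : ℕ) < a + b then i - a else i, by
    split_ifs <;> omega⟩
  left_inv i := by ext; simp only; split_ifs <;> omega
  right_inv i := by ext; simp only; split_ifs <;> omega

theorem isBlockSwap_blockSwap (a b : ℕ) {n : ℕ} (h : a + b ≤ n) :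
    IsBlockSwap a b (blockSwap a b h) := fun _ => rfl

theorem comp_blockSwap_lt {a b : ℕ} (h : a + b ≤ n) {α : Type*} (x : Fin n → α) (i : ℕ)
    (hi : i < b) : (x ∘ blockSwap a b h) ⟨i, by omega⟩ = x ⟨a + i, by omega⟩ :=
  congrArg x (Fin.ext (if_pos hi))

theorem comp_blockSwap_mid {a b : ℕ} (h : a + b ≤ n) {α : Type*} (x : Fin n → α) (i : ℕ)
    (hi : i < a) : (x ∘ blockSwap a b h) ⟨b + i, by omega⟩ = x ⟨i, by omega⟩ :=
  congrArg x (Fin.ext (by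
    change (if b + i < b then a + (b + i) else if b + i < a + b then b + i - b else b + i) = i
    rw [if_neg (by omega), if_pos (by omega)]; omega))

theorem comp_blockSwap_ge {a b : ℕ} (h : a + b ≤ n) {α : Type*} (x : Fin n → α) (i : ℕ)
    (hi : a + b + i < n) : (x ∘ blockSwap a b h) ⟨a + b + i, hi⟩ = x ⟨a + b + i, hi⟩ :=
  congrArg x (Fin.ext (by
    change (if a + b + i < b then a + (a + b + i) else if a + b + i < a + b then a + b + i - b
      else a + b + i) = a + b + i
    rw [if_neg (by omega), if_neg (by omega)]))

end Assoc

section AssocPar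

variable {k : Type*} [Field k] {C : CompleteCooperad k} {X Z : Type*} [AddCommGroup X] [Module k X]
  [AddCommGroup Z] [Module k Z] {𝕏 : CompleteComplex k X} {𝕫 : CompleteComplex k Z} {n p q : ℕ}

theorem tensor_ext_deg₃ {A D E : Type*} [AddCommGroup A] [Module k A] [AddCommGroup D] [Module k D]
    [AddCommGroup E] [Module k E] (𝔸 : CompleteComplex k A) (𝔻 : CompleteComplex k D)
    (𝔼 : CompleteComplex k E) {f g : (A ⊗[k] D) ⊗[k] E →ₗ[k] Z}
    (h : ∀ l m n, ∀ a ∈ 𝔸.deg l, ∀ b ∈ 𝔻.deg m, ∀ c ∈ 𝔼.deg n,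
      f ((a ⊗ₜ b) ⊗ₜ c) = g ((a ⊗ₜ b) ⊗ₜ c)) : f = g := by
  refine TensorProduct.ext_threefold fun a b c => ?_
  refine 𝔸.induction_deg (P := fun a => f ((a ⊗ₜ b) ⊗ₜ c) = g ((a ⊗ₜ b) ⊗ₜ c)) (fun l a ha => ?_)
    (fun x x' h1 h2 => by simp only [TensorProduct.add_tmul, map_add, h1, h2]) a
  refine 𝔻.induction_deg (P := fun b => f ((a ⊗ₜ b) ⊗ₜ c) = g ((a ⊗ₜ b) ⊗ₜ c)) (fun m b hb => ?_)
    (fun x x' h1 h2 => by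
      simp only [TensorProduct.tmul_add, TensorProduct.add_tmul, map_add, h1, h2]) b
  exact 𝔼.induction_deg (P := fun c => f ((a ⊗ₜ b) ⊗ₜ c) = g ((a ⊗ₜ b) ⊗ₜ c))
    (fun n c hc => h l m n a ha b hb c hc)
    (fun x x' h1 h2 => by simp only [TensorProduct.tmul_add, map_add, h1, h2]) c

theorem tensorSwap_of_deg {A D : Type*} [AddCommGroup A] [Module k A] [AddCommGroup D] [Module k D]
    (𝔸 : CompleteComplex k A) (𝔻 : CompleteComplex k D) {m n : ℤ} {a : A} {b : D}
    (ha : a ∈ 𝔸.deg m) (hb : b ∈ 𝔻.deg n) :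
    tensorSwap 𝔸 𝔻 (a ⊗ₜ b) = sg k ((m : ZMod 2) * n) • b ⊗ₜ[k] a := by
  simp only [tensorSwap, LinearMap.comp_apply, LinearMap.sub_apply, LinearMap.id_apply,
    LinearMap.smul_apply, TensorProduct.map_tmul, 𝔸.odd_of_deg ha, 𝔻.odd_of_deg hb]
  by_cases hm : Odd m
  · by_cases hn : Odd n
    · simp [(intCast_eq_one_iff m).2 hm, (intCast_eq_one_iff n).2 hn, hm, hn, two_smul]
    · have : (n : ZMod 2) = 0 :=
        (zmod_two_cases _).resolve_right (fun e => hn ((intCast_eq_one_iff n).1 e))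
      simp [hn, this]
  · have : (m : ZMod 2) = 0 :=
      (zmod_two_cases _).resolve_right (fun e => hm ((intCast_eq_one_iff m).1 e))
    simp [hm, this]

theorem hd_cons_comp_blockSwap {P a : ℕ} {α : Type*} (y : α) (z : Fin (a + P) → α) :
    hd (show a + (P + 1) = a + P + 1 by omega)
      ((Fin.cons y z : Fin (a + P + 1) → α) ∘ blockSwap 1 a (by omega)) =
      hd (show a + P = a + P from rfl) z := by
  funext i
  refine (comp_blockSwap_lt (a := 1) (b := a) (n := a + P + 1) (by omega) _ i i.2).trans ?_
  have : (⟨1 + i, by omega⟩ : Fin (a + P + 1)) = Fin.succ ⟨i, by omega⟩ := by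
    ext; simp only [Fin.succ_mk]; omega
  rw [this, Fin.cons_succ]
  rfl

theorem tl_cons_comp_blockSwap {P a : ℕ} {α : Type*} (y : α) (z : Fin (a + P) → α) :
    tl (show a + (P + 1) = a + P + 1 by omega)
      ((Fin.cons y z : Fin (a + P + 1) → α) ∘ blockSwap 1 a (by omega)) =
      Fin.cons y (tl (show a + P = a + P from rfl) z) := by
  funext i
  refine Fin.cases ?_ (fun i => ?_) i
  · exact comp_blockSwap_mid (a := 1) (b := a) (n := a + P + 1) (by omega) _ 0 (by omega)
  · have h1 := comp_blockSwap_ge (a := 1) (b := a) (n := a + P + 1) (by omega)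
      (Fin.cons y z : Fin (a + P + 1) → α) i (by omega)
    have h2 : (⟨1 + a + i, by omega⟩ : Fin (a + P + 1)) = Fin.succ ⟨a + i, by omega⟩ := by
      ext; simp only [Fin.succ_mk]; omega
    have h3 : (⟨a + (i.succ : Fin (P + 1)), by simp only [Fin.val_succ]; omega⟩ :
        Fin (a + P + 1)) = ⟨1 + a + i, by omega⟩ := by
      ext; simp only [Fin.val_succ]; omega
    rw [Fin.cons_succ]
    refine (congrArg ((Fin.cons y z : Fin (a + P + 1) → α) ∘ blockSwap 1 a (by omega)) h3).trans ?_
    rw [h1, h2, Fin.cons_succ]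
    rfl

theorem cons_cons_comp_blockSwap {P : ℕ} {α : Type*} (y y' : α) (z : Fin P → α) :
    (Fin.cons y (Fin.cons y' z) : Fin (P + 1 + 1) → α) ∘ blockSwap 1 1 (by omega) =
      Fin.cons y' (Fin.cons y z) := by
  funext i
  refine Fin.cases ?_ (fun i => Fin.cases ?_ (fun i => ?_) i) i
  · exact comp_blockSwap_lt (a := 1) (b := 1) (n := P + 1 + 1) (by omega) _ 0 (by omega)
  · exact comp_blockSwap_mid (a := 1) (b := 1) (n := P + 1 + 1) (by omega) _ 0 (by omega)
  · have h1 := comp_blockSwap_ge (a := 1) (b := 1) (n := P + 1 + 1) (by omega)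
      (Fin.cons y (Fin.cons y' z) : Fin (P + 1 + 1) → α) i (by omega)
    have h2 : (⟨1 + 1 + i, by omega⟩ : Fin (P + 1 + 1)) = i.succ.succ := by
      ext; simp only [Fin.val_succ]; omega
    rw [h2] at h1
    exact h1

/-- A partial composition whose first input is moved behind the inputs of the inner operation, so
that it becomes the first input of the outer operation that is left free. -/
theorem permM_theta_cons {P a : ℕ} (s : ℕ) {F : Op C (P + 1 + 1) X Z} {G : Op C a X X}
    {z : Fin (a + P) → X} {tz : Fin (a + P) → ℤ} (hz : ∀ j, z j ∈ 𝕏.deg (tz j))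
    {y : X} {ty : ℤ} (hy : y ∈ 𝕏.deg ty) {A : C.obj (P + 1 + 1)} {α : ℤ}
    (hA : A ∈ (C.cx _).deg α) (b : C.obj a) :
    permM 𝕏 (blockSwap 1 a (by omega))
      (theta (show a + (P + 1) = a + P + 1 by omega) s F G (A ⊗ₜ b)) (Fin.cons y z) =
    sg k (ty * ∑ j, ((hd (show a + P = a + P from rfl) tz j : ℤ) : ZMod 2) + s * α) •
      F A (Fin.cons (G b (hd rfl z)) (Fin.cons y (tl rfl z))) := by
  rw [permM_of_deg 𝕏 _ _ (cons_mem 𝕏.deg hy hz), theta_tmul, hd_cons_comp_blockSwap,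
    tl_cons_comp_blockSwap, (C.cx _).sgn_pow_of_deg s hA,
    kosExp_blockSwap (by omega) (isBlockSwap_blockSwap 1 a _)]
  simp only [map_smul, smul_apply]
  rw [smul_smul, ← sg_add]
  congr 2
  congr 1
  congr 1
  · simp
  · refine Finset.sum_congr rfl fun i _ => ?_
    have : (⟨1 + i, by omega⟩ : Fin (a + P + 1)) = Fin.succ ⟨i, by omega⟩ := by
      ext; simp only [Fin.succ_mk]; omega
    rw [this, Fin.cons_succ]
    rfl

/-- Parallel associativity of partial compositions. -/
theorem pc_pc_par {P q r : ℕ} {u dr dq : ℤ} {sr sq : ℕ} (hsr : (dr : ZMod 2) = sr)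
    (hsq : (dq : ZMod 2) = sq) (hq : q + (r + P) = n)
    (hr : r + (q + P) = n) {F : Op C (P + 1 + 1) X Z} {G : Op C r X X} {Φ : Op C q X X}
    (hF : IsOp 𝕏 𝕫 u F) (hG : IsOp 𝕏 𝕏 dr G) (hΦ : IsOp 𝕏 𝕏 dq Φ)
    (hτ : perm 𝕏 (blockSwap 1 1 (by omega)) F = F) :
    perm 𝕏 (blockSwap r q (by omega)) (pc 𝕫 hq sq (perm 𝕏 (blockSwap 1 r (by omega))
      (pc 𝕫 (show r + (P + 1) = r + P + 1 by omega) sr F G)) Φ) =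
    sg k (sr * sq) • pc 𝕫 hr sr (perm 𝕏 (blockSwap 1 q (by omega))
      (pc 𝕫 (show q + (P + 1) = q + P + 1 by omega) sq F Φ)) G := by
  have hA : IsOp 𝕏 𝕫 (u + dr) (perm 𝕏 (blockSwap 1 r (by omega))
      (pc 𝕫 (show r + (P + 1) = r + P + 1 by omega) sr F G)) := (IsOp.pc _ _ hF hG rfl).perm _
  have hB : IsOp 𝕏 𝕫 (u + dq) (perm 𝕏 (blockSwap 1 q (by omega))
      (pc 𝕫 (show q + (P + 1) = q + P + 1 by omega) sq F Φ)) := (IsOp.pc _ _ hF hΦ rfl).perm _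
  have key : ∀ {a : ℕ} {v : ℤ} (s s' : ℕ) {H : Op C a X X} (hH : IsOp 𝕏 𝕏 v H)
      (w : Fin (a + P + 1) → ℤ) (y : Fin (a + P + 1) → X), (∀ j, y j ∈ 𝕏.fil (w j)) →
      ∀ M, ∀ t ∈ C.fil₂ (P + 1 + 1) a M, (permM 𝕏 (blockSwap 1 a (by omega)) ∘ₗ
        theta (show a + (P + 1) = a + P + 1 by omega) s F H ∘ₗ
        TensorProduct.map ((C.cx (P + 1 + 1)).sgn ^ s') ((C.cx a).sgn ^ s')) t y ∈
          𝕫.fil (M + ∑ j, w j) := by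
    intro a v s s' H hH w y hy M t ht
    refine permM_fil hy fun y' hy' => ?_
    rw [← Equiv.sum_comp (blockSwap 1 a (by omega)) w]
    refine theta_fil _ s hF hH hy' M _ ?_
    suffices H : C.fil₂ (P + 1 + 1) a M ≤ (C.fil₂ (P + 1 + 1) a M).comap
      (TensorProduct.map ((C.cx (P + 1 + 1)).sgn ^ s') ((C.cx a).sgn ^ s')) from H ht
    exact tensorSum_le fun i a ha b hb => tmul_mem_tensorSum (by ring)
      (CompleteComplex.sgn_pow_fil _ _ ha) (CompleteComplex.sgn_pow_fil _ _ hb)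
  refine Op.ext_deg 𝕏 fun c t x hx => ?_
  -- Both sides are values at elements of completed tensor products, which parallel coassociativity
  -- identifies up to the exchange of the two upper vertices and their inputs.
  have L := mapLeft_eval (𝕏 := 𝕏) (𝕫 := 𝕫) (f := C.dec (P + 1) r (r + P + 1) (by omega) ∘ₗ
      C.act (r + P + 1) (blockSwap 1 r (by omega)))
    (fun N x hx => C.dec_fil _ _ _ _ N _ (C.act_fil _ _ _ _ hx)) hq (key sr sq hG) hΦ
    (fun c y => perm_pc_spec _ sr sq _ hF hG c y)
    (pc_spec hq sq hA hΦ (C.act n (blockSwap r q (by omega)) c) (x ∘ blockSwap r q (by omega)))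
  have R := mapLeft_eval (𝕏 := 𝕏) (𝕫 := 𝕫) (f := C.dec (P + 1) q (q + P + 1) (by omega) ∘ₗ
      C.act (q + P + 1) (blockSwap 1 q (by omega)))
    (fun N x hx => C.dec_fil _ _ _ _ N _ (C.act_fil _ _ _ _ hx)) hr (key sq sr hΦ) hG
    (fun c y => perm_pc_spec _ sq sr _ hF hΦ c y)
    (pc_spec hr sr hB hG c x)
  have R' := HasEval.of_comp_arg (g := (TensorProduct.assoc k _ _ _).symm.toLinearMap ∘ₗ
      TensorProduct.map (C.act (P + 1 + 1) (blockSwap 1 1 (by omega)))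
        (tensorSwap (C.cx r) (C.cx q)) ∘ₗ (TensorProduct.assoc k _ _ _).toLinearMap)
    (fun N t ht => C.coassoc_par P q r n (by omega) (blockSwap 1 q (by omega))
      (blockSwap r q (by omega)) (blockSwap 1 r (by omega)) (blockSwap 1 1 (by omega))
      (isBlockSwap_blockSwap _ _ _) (isBlockSwap_blockSwap _ _ _) (isBlockSwap_blockSwap _ _ _)
      (isBlockSwap_blockSwap _ _ _) c N (TensorProduct.assoc k _ _ _ t) (by
        rw [LinearEquiv.symm_apply_apply]; exact ht)) R
  have h2 : (2 : ZMod 2) = 0 := by decide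
  set Tr : ZMod 2 := ∑ i : Fin r, ((t ⟨i, by omega⟩ : ℤ) : ZMod 2) with hTr
  set Tq : ZMod 2 := ∑ i : Fin q, ((t ⟨r + i, by omega⟩ : ℤ) : ZMod 2) with hTq
  have hxL := tl_mem 𝕏.deg hq (comp_mem 𝕏.deg hx (blockSwap r q (by omega)))
  have hxR := tl_mem 𝕏.deg hr hx
  have e1 : hd rfl (tl hq (x ∘ blockSwap r q (by omega))) = hd hr x :=
    funext fun i => comp_blockSwap_mid _ x i i.2
  have e1t : hd rfl (tl hq (t ∘ blockSwap r q (by omega))) = hd hr t :=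
    funext fun i => comp_blockSwap_mid _ t i i.2
  have e2 : hd hq (x ∘ blockSwap r q (by omega)) = hd rfl (tl hr x) :=
    funext fun i => comp_blockSwap_lt _ x i i.2
  have e2t : hd hq (t ∘ blockSwap r q (by omega)) = hd rfl (tl hr t) :=
    funext fun i => comp_blockSwap_lt _ t i i.2
  have e3 : tl rfl (tl hq (x ∘ blockSwap r q (by omega))) = tl rfl (tl hr x) := by
    funext i
    have h1 := comp_blockSwap_ge (a := r) (b := q) (n := n) (by omega) x i (by omega)
    have h2 : (⟨r + q + i, by omega⟩ : Fin n) = ⟨q + (r + i), by omega⟩ := by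
      ext; simp only; omega
    have h3 : (⟨r + q + i, by omega⟩ : Fin n) = ⟨r + (q + i), by omega⟩ := by
      ext; simp only; omega
    change (x ∘ blockSwap r q (by omega)) ⟨q + (r + i), by omega⟩ = x ⟨r + (q + i), by omega⟩
    rw [← h2, ← h3, h1]
  rw [perm_of_deg _ _ _ hx, kosExp_blockSwap (by omega) (isBlockSwap_blockSwap r q _)]
  change sg k (Tr * Tq) • (_ : Z) = sg k (sr * sq) • (pc 𝕫 hr sr (perm 𝕏 (blockSwap 1 q (by omega))
      (pc 𝕫 (show q + (P + 1) = q + P + 1 by omega) sq F Φ)) G c x)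
  generalize pc 𝕫 hq sq (perm 𝕏 (blockSwap 1 r (by omega))
      (pc 𝕫 (show r + (P + 1) = r + P + 1 by omega) sr F G)) Φ
      (C.act n (blockSwap r q (by omega)) c) (x ∘ blockSwap r q (by omega)) = zL at L ⊢
  -- It remains to compare the two evaluations on homogeneous pure tensors, including signs.
  have e := R'.uniq 𝕫.fil_antitone 𝕫.fil_separated (z' := sg k (Tr * Tq + sr * sq) • zL) ?_
  · rw [e, smul_smul, ← sg_add]
    congr 2
    linear_combination (-(sr : ZMod 2) * sq) * h2
  · convert L.smul (sg k (Tr * Tq + sr * sq)) using 1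
    refine tensor_ext_deg₃ (C.cx (P + 1 + 1)) (C.cx r) (C.cx q) fun α β γ a ha b hb b' hb' => ?_
    have hy := hG.deg _ _ hb _ _ (hd_mem 𝕏.deg hr hx)
    have hy' := hΦ.deg _ _ hb' _ _ (hd_mem 𝕏.deg rfl hxR)
    -- By equivariance of `F`, its first two inputs may be exchanged.
    have hF' : F (C.act _ (blockSwap 1 1 (by omega)) a) (Fin.cons (Φ b' (hd rfl (tl hr x)))
        (Fin.cons (G b (hd hr x)) (tl rfl (tl hr x)))) =
        sg k ((β + sr + Tr) * (γ + sq + Tq)) • F a (Fin.cons (G b (hd hr x))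
          (Fin.cons (Φ b' (hd rfl (tl hr x))) (tl rfl (tl hr x)))) := by
      conv_rhs => rw [← hτ, perm_of_deg _ _ _
        (cons_mem 𝕏.deg hy (cons_mem 𝕏.deg hy' (tl_mem 𝕏.deg rfl hxR))), smul_smul,
        kosExp_blockSwap (by omega) (isBlockSwap_blockSwap 1 1 _)]
      simp [hsr, hsq]
      change _ = (sg k ((β + sr + Tr) * (γ + sq + Tq)) * sg k ((β + sr + Tr) * (γ + sq + Tq))) • _
      rw [sg_mul_self, one_smul, cons_cons_comp_blockSwap]
    simp only [LinearMap.comp_apply, LinearEquiv.coe_coe, TensorProduct.assoc_tmul,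
      TensorProduct.map_tmul, LinearMap.smul_apply, nest_tmul, tensorSwap_of_deg _ _ hb hb',
      TensorProduct.tmul_smul, map_smul, TensorProduct.assoc_symm_tmul,
      CompleteComplex.sgn_pow_of_deg _ _ (C.act_deg _ _ _ _ ha),
      CompleteComplex.sgn_pow_of_deg _ _ hb, CompleteComplex.sgn_pow_of_deg _ _ hb',
      CompleteComplex.sgn_pow_of_deg _ _ ha, ← TensorProduct.smul_tmul', smul_apply]
    rw [e2]
    rw [permM_theta_cons sq hxR hy (C.act_deg _ _ _ _ ha), permM_theta_cons sr hxL hy' ha]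
    rw [e1, e3, e1t, hF']
    simp only [smul_smul, ← sg_add]
    congr 2
    simp only [Int.cast_add, Int.cast_sum, hsr, hsq]
    change _ + (_ + (_ + ((_ + Tr) * Tq + _ + _))) = _ + (_ + (_ + ((_ + Tq) * Tr + _)))
    linear_combination ((β : ZMod 2) * γ + sr * γ + β * Tq + sr * Tq) * h2

end AssocPar

/-! ### The pre-Lie identity for the convolution product -/

section Sums

open Finset.HasAntidiagonal (antidiagonal)

variable {M : Type*} [AddCommMonoid M]

theorem sum_antidiagonal_assoc (f : ℕ → ℕ → ℕ → M) (n : ℕ) :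
    ∑ x ∈ antidiagonal n, ∑ y ∈ antidiagonal x.2, f x.1 y.1 y.2 =
      ∑ x ∈ antidiagonal n, ∑ y ∈ antidiagonal x.1, f y.1 y.2 x.2 := by
  rw [Finset.sum_sigma', Finset.sum_sigma']
  refine Finset.sum_nbij' (fun z => ⟨(z.1.1 + z.2.1, z.2.2), (z.1.1, z.2.1)⟩)
    (fun z => ⟨(z.2.1, z.2.2 + z.1.2), (z.2.2, z.1.2)⟩) ?_ ?_ ?_ ?_ ?_
  · rintro ⟨⟨a, b⟩, ⟨c, d⟩⟩ h
    simp only [Finset.mem_sigma, Finset.HasAntidiagonal.mem_antidiagonal] at h ⊢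
    constructor <;> [omega; trivial]
  · rintro ⟨⟨a, b⟩, ⟨c, d⟩⟩ h
    simp only [Finset.mem_sigma, Finset.HasAntidiagonal.mem_antidiagonal] at h ⊢
    constructor <;> [omega; trivial]
  · rintro ⟨⟨a, b⟩, ⟨c, d⟩⟩ h
    simp only [Finset.mem_sigma, Finset.HasAntidiagonal.mem_antidiagonal] at h
    obtain ⟨h1, rfl⟩ := h
    rfl
  · rintro ⟨⟨a, b⟩, ⟨c, d⟩⟩ h
    simp only [Finset.mem_sigma, Finset.HasAntidiagonal.mem_antidiagonal] at h
    obtain ⟨h1, rfl⟩ := h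
    rfl
  · intros; rfl

theorem sum_antidiagonal_comm (f : ℕ → ℕ → ℕ → M) (n : ℕ) :
    ∑ x ∈ antidiagonal n, ∑ y ∈ antidiagonal x.2, f x.1 y.1 y.2 =
      ∑ x ∈ antidiagonal n, ∑ y ∈ antidiagonal x.2, f y.1 x.1 y.2 := by
  rw [sum_antidiagonal_assoc, sum_antidiagonal_assoc (fun a b c => f b a c)]
  refine Finset.sum_congr rfl fun x _ => ?_
  rw [← Finset.Nat.sum_antidiagonal_swap]
  rfl

end Sums

section PreLie

open Finset.HasAntidiagonal (antidiagonal)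

variable {k : Type*} [Field k] {C : CompleteCooperad k} {X Z : Type*} [AddCommGroup X] [Module k X]
  [AddCommGroup Z] [Module k Z] {𝕏 : CompleteComplex k X} {𝕫 : CompleteComplex k Z} {n p q r : ℕ}

theorem blk_swap_left (h : q + p = n) (a b : Fin q) :
    blk h (Equiv.swap a b) 1 = Equiv.swap ⟨a, by omega⟩ ⟨b, by omega⟩ := by
  refine Equiv.ext ((forall_split h).2 ⟨fun j => ?_, fun j => ?_⟩)
  · rw [blk_lt]
    apply Fin.ext
    simp only [Equiv.swap_apply_def, Fin.ext_iff]
    split_ifs <;> rfl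
  · rw [blk_ge, Equiv.swap_apply_of_ne_of_ne] <;> simp [Fin.ext_iff] <;> omega

theorem blk_swap_right (h : q + p = n) (a b : Fin p) :
    blk h 1 (Equiv.swap a b) = Equiv.swap ⟨q + a, by omega⟩ ⟨q + b, by omega⟩ := by
  refine Equiv.ext ((forall_split h).2 ⟨fun j => ?_, fun j => ?_⟩)
  · rw [blk_lt, Equiv.swap_apply_of_ne_of_ne] <;> simp [Fin.ext_iff] <;> omega
  · rw [blk_ge]
    apply Fin.ext
    simp only [Equiv.swap_apply_def, Fin.ext_iff, add_right_inj]
    split_ifs <;> rfl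

/-- The symmetrization of a block invariant operation, arranged by the block that contains the input
which is moved to the first position. -/
theorem symm_succ (h : r + q = p + 1) {F F' : Op C (p + 1) X Z}
    (hF : ∀ σ μ, perm 𝕏 (blk h σ μ) F = F)
    (hF' : ∀ h1 : 1 + r ≤ p + 1, F' = perm 𝕏 (blockSwap 1 r h1) F) :
    symm 𝕏 F = ∑ μ, perm 𝕏 (fix0 μ) ((r : k) • F + (q : k) • F') := by
  let κ : Fin (p + 1) → Equiv.Perm (Fin (p + 1)) := fun j => if hj : (j : ℕ) < r
    then Equiv.swap 0 j
    else blockSwap 1 r (by omega) * Equiv.swap ⟨r, by omega⟩ j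
  have hκ : ∀ j, κ j j = 0 := by
    intro j
    by_cases hj : (j : ℕ) < r
    · simp only [κ, dif_pos hj, Equiv.swap_apply_right]
    · simp only [κ, dif_neg hj, Equiv.Perm.mul_apply, Equiv.swap_apply_right]
      ext
      rw [isBlockSwap_blockSwap 1 r]
      simp
  rw [symm_apply, sum_perm_succ _ κ hκ, Finset.sum_comm]
  refine Finset.sum_congr rfl fun μ _ => ?_
  simp only [← perm_perm, ← map_sum]
  congr 1
  rw [sum_split h]
  congr 1
  · rw [Nat.cast_smul_eq_nsmul, Finset.sum_congr rfl (g := fun _ => F), Finset.sum_const,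
      Finset.card_univ, Fintype.card_fin]
    intro j _
    have hj := j.2
    simp only [hd, κ]
    rw [dif_pos j.2]
    exact (congrArg (fun ρ => perm 𝕏 ρ F) (blk_swap_left h ⟨0, by omega⟩ j).symm).trans (hF _ _)
  · rw [Nat.cast_smul_eq_nsmul, Finset.sum_congr rfl (g := fun _ => F'), Finset.sum_const,
      Finset.card_univ, Fintype.card_fin]
    intro j _
    have hj := j.2
    simp only [tl, κ]
    rw [dif_neg (show ¬ r + (j : ℕ) < r by omega), ← perm_perm, hF' (by omega)]
    congr 1
    exact (congrArg (fun ρ => perm 𝕏 ρ F) (blk_swap_right h ⟨0, by omega⟩ j).symm).trans (hF _ _)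

variable {u v : ℤ} (s : ℕ)

/-- Symmetrization of the free inputs of the outer operation is absorbed by the symmetrization of a
partial composition. -/
theorem symm_pc_left (h : q + p = n) {F : Op C (p + 1) X Z} {G : Op C q X X}
    (hF : IsOp 𝕏 𝕫 u F) (hG : IsOp 𝕏 𝕏 v G) :
    symm 𝕏 (pc 𝕫 h s (∑ μ, perm 𝕏 (fix0 μ) F) G) = (p.factorial : k) • symm 𝕏 (pc 𝕫 h s F G) := by
  rw [pc_sum_left h s _ (fun μ _ => hF.perm _) hG, map_sum, Finset.sum_congr rfl
    (g := fun _ => symm 𝕏 (pc 𝕫 h s F G)), Finset.sum_const, Finset.card_univ, Fintype.card_perm,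
    Fintype.card_fin, Nat.cast_smul_eq_nsmul]
  intro μ _
  rw [← symm_perm (blk h 1 μ) (pc 𝕫 h s F G), perm_blk_pc h s hF hG, perm_one]

/-- Symmetrization of the inner operation is absorbed by the symmetrization of a partial
composition. -/
theorem symm_pc_right (h : q + p = n) {F : Op C (p + 1) X Z} {G : Op C q X X}
    (hF : IsOp 𝕏 𝕫 u F) (hG : IsOp 𝕏 𝕏 v G) :
    symm 𝕏 (pc 𝕫 h s F (symm 𝕏 G)) = (q.factorial : k) • symm 𝕏 (pc 𝕫 h s F G) := by
  rw [symm_apply G, pc_sum_right h s _ hF (fun μ _ => hG.perm _), map_sum, Finset.sum_congr rfl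
    (g := fun _ => symm 𝕏 (pc 𝕫 h s F G)), Finset.sum_const, Finset.card_univ, Fintype.card_perm,
    Fintype.card_fin, Nat.cast_smul_eq_nsmul]
  intro σ _
  have : fix0 (1 : Equiv.Perm (Fin p)) = 1 := by
    ext i; refine Fin.cases ?_ (fun i => ?_) i <;> simp
  rw [← symm_perm (blk h σ 1) (pc 𝕫 h s F G), perm_blk_pc h s hF hG, this, perm_one]

/-- The composition of three families along the tree whose vertices lie on top of each other. -/
def seqComp (𝕏 : CompleteComplex k X) (𝕫 : CompleteComplex k Z) (s₁ s₂ : ℕ) (f : Fam C X Z)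
    (g φ : Fam C X X) (n q a m : ℕ) : Op C n X Z :=
  if h : q + a + m = n then
    pc 𝕫 h (s₁ + s₂) (f (m + 1)) (pc 𝕏 (show q + a = q + a from rfl) s₂ (g (a + 1)) (φ q)) else 0

/-- The composition of three families along the tree with two vertices on top of a third one. -/
def parComp (𝕏 : CompleteComplex k X) (𝕫 : CompleteComplex k Z) (s₁ s₂ : ℕ) (f : Fam C X Z)
    (g φ : Fam C X X) (n q r m : ℕ) : Op C n X Z :=
  if h : q + (r + m) = n then
    pc 𝕫 h s₂ (perm 𝕏 (blockSwap 1 r (by omega))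
      (pc 𝕫 (show r + (m + 1) = r + m + 1 by omega) s₁ (f (m + 1 + 1)) (g r))) (φ q) else 0

variable {d₁ d₂ : ℤ} {s₁ s₂ : ℕ} {f : Fam C X Z} {g φ : Fam C X X}

/-- Up to sign, the two upper vertices of the tree in `parComp` play symmetric roles. -/
theorem symm_parComp (hf : IsFam 𝕏 𝕫 u f) (hd₁ : (d₁ : ZMod 2) = s₁) (hd₂ : (d₂ : ZMod 2) = s₂)
    (hg : IsFam 𝕏 𝕏 d₁ g) (hφ : IsFam 𝕏 𝕏 d₂ φ) (n q r m : ℕ) :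
    symm 𝕏 (parComp 𝕏 𝕫 s₁ s₂ f g φ n q r m) =
      sg k (s₁ * s₂) • symm 𝕏 (parComp 𝕏 𝕫 s₂ s₁ f φ g n r q m) := by
  by_cases h : q + (r + m) = n
  · have h' : r + (q + m) = n := by omega
    rw [parComp, parComp, dif_pos h, dif_pos h', ← symm_perm (blockSwap r q (by omega)),
      pc_pc_par hd₁ hd₂ h h' (hf.op _) (hg.op _) (hφ.op _) (hf.act _ _), map_smul]
  · have h' : ¬ r + (q + m) = n := by omega
    rw [parComp, parComp, dif_neg h, dif_neg h', map_zero, smul_zero]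

theorem IsOp.symm {F : Op C n X Z} (hF : IsOp 𝕏 𝕫 u F) : IsOp 𝕏 𝕫 u (symm 𝕏 F) := by
  rw [symm_apply]; exact IsOp.sum _ fun ρ _ => hF.perm ρ

variable [CharZero k]

theorem factorial_cast_ne_zero (m : ℕ) : (m.factorial : k) ≠ 0 := by
  exact_mod_cast m.factorial_ne_zero

/-- The product `f ⋆ (g ⋆ φ)` as a sum over trees whose vertices lie on top of each other. -/
theorem sstar_sstar_right (hf : IsFam 𝕏 𝕫 u f) (hg : IsFam 𝕏 𝕏 d₁ g) (hφ : IsFam 𝕏 𝕏 d₂ φ) :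
    sstar 𝕏 𝕫 (s₁ + s₂) f (sstar 𝕏 𝕏 s₂ g φ) n =
      ∑ x ∈ antidiagonal n, ∑ y ∈ antidiagonal x.1,
        ((y.1.factorial : k)⁻¹ * (y.2.factorial : k)⁻¹ * (x.2.factorial : k)⁻¹) •
          symm 𝕏 (seqComp 𝕏 𝕫 s₁ s₂ f g φ n y.1 y.2 x.2) := by
  have hgφ := isFam_sstar s₂ hg hφ rfl
  rw [sstar_eq_symm _ hf hgφ]
  refine Finset.sum_congr rfl fun x hx => ?_
  have hx' : x.1 + x.2 = n := by simpa using hx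
  have h1 := fun y : ℕ × ℕ => IsOp.pcFam (𝕫 := 𝕏) s₂ hg.op hφ.op rfl x.1 y.1 y.2
  rw [pcFam_eq _ _ _ hx', sstar_eq_symm _ hg hφ, pc_sum_right hx' _ _ (hf.op _)
    (fun y _ => (h1 y).symm.smul _), map_sum, Finset.smul_sum]
  refine Finset.sum_congr rfl fun y hy => ?_
  have hy' : y.1 + y.2 = x.1 := by simpa using hy
  rw [pc_smul_right hx' _ _ (hf.op _) (h1 y).symm, map_smul, symm_pc_right _ hx' (hf.op _) (h1 y),
    smul_smul, smul_smul]
  congr 1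
  · have := factorial_cast_ne_zero (k := k) x.1
    field_simp
  · obtain ⟨x₁, x₂⟩ := x
    obtain ⟨y₁, y₂⟩ := y
    simp only at hx' hy'
    subst hy'
    rw [pcFam_eq _ _ _ rfl, seqComp, dif_pos hx']

/-- In `(f ⋆ g) ⋆ φ`, the family `φ` is inserted in an input of `g`, or in an input of `f`. These
cases give the two kinds of trees with three vertices. -/
theorem sstar_sstar_left (hf : IsFam 𝕏 𝕫 u f) (hg : IsFam 𝕏 𝕏 d₁ g) (hφ : IsFam 𝕏 𝕏 d₂ φ) :
    sstar 𝕏 𝕫 s₂ (sstar 𝕏 𝕫 s₁ f g) φ n =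
      ∑ x ∈ antidiagonal n, ∑ y ∈ antidiagonal x.2,
        (((x.1.factorial : k)⁻¹ * (y.1.factorial : k)⁻¹ * (y.2.factorial : k)⁻¹) •
          symm 𝕏 (seqComp 𝕏 𝕫 s₁ s₂ f g φ n x.1 y.1 y.2) +
        ((x.1.factorial : k)⁻¹ * (y.1.factorial : k)⁻¹ * (y.2.factorial : k)⁻¹) •
          symm 𝕏 (parComp 𝕏 𝕫 s₁ s₂ f g φ n x.1 y.1 y.2)) := by
  have hfg := isFam_sstar s₁ hf hg rfl
  rw [sstar_eq_symm _ hfg hφ]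
  refine Finset.sum_congr rfl fun x hx => ?_
  obtain ⟨q, p⟩ := x
  have hx' : q + p = n := by simpa using hx
  simp only
  have h1 := fun y : ℕ × ℕ => IsOp.pcFam (𝕫 := 𝕫) s₁ hf.op hg.op rfl (p + 1) y.1 y.2
  -- `F' y` is `f ∘ g` with an input of `f` in the first position, where `φ` will be inserted.
  let F' : ℕ × ℕ → Op C (p + 1) X Z := fun y => if h : 1 + y.1 ≤ p + 1 then
    perm 𝕏 (blockSwap 1 y.1 h) (pcFam 𝕫 s₁ f g (p + 1) y.1 y.2) else 0
  have hF' : ∀ y, IsOp 𝕏 𝕫 (u + d₁) (F' y) := by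
    intro y
    simp only [F']
    split_ifs
    exacts [(h1 y).perm _, IsOp.zero _]
  rw [pcFam_eq _ _ _ hx', sstar_eq_symm _ hf hg, pc_sum_left hx' _ _
    (fun y _ => (h1 y).symm.smul _) (hφ.op _), map_sum, Finset.smul_sum]
  have key : ∀ y ∈ antidiagonal (p + 1), ((q.factorial : k)⁻¹ * (p.factorial : k)⁻¹) •
      symm 𝕏 (pc 𝕫 hx' s₂ (((y.1.factorial : k)⁻¹ * (y.2.factorial : k)⁻¹) •
        symm 𝕏 (pcFam 𝕫 s₁ f g (p + 1) y.1 y.2)) (φ q)) =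
      ((q.factorial : k)⁻¹ * (y.1.factorial : k)⁻¹ * (y.2.factorial : k)⁻¹ * y.1) •
        symm 𝕏 (pc 𝕫 hx' s₂ (pcFam 𝕫 s₁ f g (p + 1) y.1 y.2) (φ q)) +
      ((q.factorial : k)⁻¹ * (y.1.factorial : k)⁻¹ * (y.2.factorial : k)⁻¹ * y.2) •
        symm 𝕏 (pc 𝕫 hx' s₂ (F' y) (φ q)) := by
    intro y hy
    have hy' : y.1 + y.2 = p + 1 := by simpa using hy
    rw [pc_smul_left hx' _ _ (h1 y).symm (hφ.op _), map_smul,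
      symm_succ hy' (F' := F' y) ?_ (fun h => dif_pos h),
      symm_pc_left _ hx' (((h1 y).smul _).add ((hF' y).smul _)) (hφ.op _),
      pc_add_left hx' _ ((h1 y).smul _) ((hF' y).smul _) (hφ.op _),
      pc_smul_left hx' _ _ (h1 y) (hφ.op _), pc_smul_left hx' _ _ (hF' y) (hφ.op _), map_add,
      map_smul,
      map_smul, smul_add, smul_add, smul_add, smul_smul, smul_smul, smul_smul, smul_smul, smul_smul,
      smul_smul]
    · have := factorial_cast_ne_zero (k := k) p
      congr 2
      · field_simp
      · field_simp
    · intro σ μ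
      rw [pcFam_eq _ _ _ hy', perm_blk_pc hy' _ (hf.op _) (hg.op _), hf.act, hg.act]
  rw [Finset.sum_congr rfl key, Finset.sum_add_distrib, Finset.sum_add_distrib,
    Finset.Nat.sum_antidiagonal_succ, Finset.Nat.sum_antidiagonal_succ']
  simp only [Nat.cast_zero, mul_zero, zero_smul, zero_add]
  congr 1
  · refine Finset.sum_congr rfl fun y hy => ?_
    have hy' : y.1 + y.2 = p := by simpa using hy
    congr 1
    · have := factorial_cast_ne_zero (k := k) y.1
      have h2 : ((y.1 : k) + 1) ≠ 0 := by exact_mod_cast y.1.succ_ne_zero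
      rw [Nat.factorial_succ]
      push_cast
      field_simp
    · have h2 : y.1 + 1 + y.2 = p + 1 := by omega
      rw [pcFam_eq _ _ _ h2, seqComp, dif_pos (by omega)]
      congr 1
      subst hy'
      exact pc_pc_seq _ _ _ _ _ (hf.op _) (hg.op _) (hφ.op _)
  · refine Finset.sum_congr rfl fun y hy => ?_
    have hy' : y.1 + y.2 = p := by simpa using hy
    congr 1
    · have := factorial_cast_ne_zero (k := k) y.2
      have h2 : ((y.2 : k) + 1) ≠ 0 := by exact_mod_cast y.2.succ_ne_zero
      rw [Nat.factorial_succ]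
      push_cast
      field_simp
    · have h2 : y.1 + (y.2 + 1) = p + 1 := by omega
      simp only [F']
      rw [dif_pos (by omega), pcFam_eq _ _ _ h2, parComp, dif_pos (by omega)]
      subst hy'
      rfl

/-- The pre-Lie identity: the associator of the convolution product is symmetric in its last two
arguments. -/
theorem sstar_preLie (hd₁ : (d₁ : ZMod 2) = s₁) (hd₂ : (d₂ : ZMod 2) = s₂)
    (hf : IsFam 𝕏 𝕫 u f) (hg : IsFam 𝕏 𝕏 d₁ g) (hφ : IsFam 𝕏 𝕏 d₂ φ) :
    sstar 𝕏 𝕫 s₂ (sstar 𝕏 𝕫 s₁ f g) φ - sstar 𝕏 𝕫 (s₁ + s₂) f (sstar 𝕏 𝕏 s₂ g φ) =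
      sg k (s₁ * s₂) • (sstar 𝕏 𝕫 s₁ (sstar 𝕏 𝕫 s₂ f φ) g -
        sstar 𝕏 𝕫 (s₂ + s₁) f (sstar 𝕏 𝕏 s₁ φ g)) := by
  have H : ∀ {d₁ d₂ : ℤ} {s₁ s₂ : ℕ} {g φ : Fam C X X} (hg : IsFam 𝕏 𝕏 d₁ g)
      (hφ : IsFam 𝕏 𝕏 d₂ φ) (n : ℕ),
      sstar 𝕏 𝕫 s₂ (sstar 𝕏 𝕫 s₁ f g) φ n - sstar 𝕏 𝕫 (s₁ + s₂) f (sstar 𝕏 𝕏 s₂ g φ) n =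
      ∑ x ∈ antidiagonal n, ∑ y ∈ antidiagonal x.2,
        ((x.1.factorial : k)⁻¹ * (y.1.factorial : k)⁻¹ * (y.2.factorial : k)⁻¹) •
          symm 𝕏 (parComp 𝕏 𝕫 s₁ s₂ f g φ n x.1 y.1 y.2) := by
    intro d₁ d₂ s₁ s₂ g φ hg hφ n
    rw [sstar_sstar_left hf hg hφ, sstar_sstar_right hf hg hφ,
      ← sum_antidiagonal_assoc (fun a b c =>
        ((a.factorial : k)⁻¹ * (b.factorial : k)⁻¹ * (c.factorial : k)⁻¹) •
          symm 𝕏 (seqComp 𝕏 𝕫 s₁ s₂ f g φ n a b c))]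
    simp only [Finset.sum_add_distrib, add_sub_cancel_left]
  funext n
  change sstar 𝕏 𝕫 s₂ (sstar 𝕏 𝕫 s₁ f g) φ n - sstar 𝕏 𝕫 (s₁ + s₂) f (sstar 𝕏 𝕏 s₂ g φ) n =
      sg k (s₁ * s₂) • (sstar 𝕏 𝕫 s₁ (sstar 𝕏 𝕫 s₂ f φ) g n -
        sstar 𝕏 𝕫 (s₂ + s₁) f (sstar 𝕏 𝕏 s₁ φ g) n)
  rw [H hg hφ, H hφ hg, sum_antidiagonal_comm (fun a b c =>
    ((a.factorial : k)⁻¹ * (b.factorial : k)⁻¹ * (c.factorial : k)⁻¹) •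
      symm 𝕏 (parComp 𝕏 𝕫 s₁ s₂ f g φ n a b c)), Finset.smul_sum]
  refine Finset.sum_congr rfl fun x _ => ?_
  rw [Finset.smul_sum]
  refine Finset.sum_congr rfl fun y _ => ?_
  rw [symm_parComp hf hd₁ hd₂ hg hφ, smul_comm, mul_comm (x.1.factorial : k)⁻¹]

end PreLie

/-! ### Bilinearity of the convolution product -/

section Bilinear

variable {k : Type*} [Field k] {C : CompleteCooperad k} {X Z Z' : Type*} [AddCommGroup X]
  [Module k X] [AddCommGroup Z] [Module k Z] [AddCommGroup Z'] [Module k Z']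
  {𝕏 : CompleteComplex k X} {𝕫 : CompleteComplex k Z}
  {𝕫' : CompleteComplex k Z'} {n p q r : ℕ} {u v : ℤ} {s : ℕ}

theorem IsFam.zero (u : ℤ) : IsFam 𝕏 𝕫 u (0 : Fam C X Z) :=
  ⟨fun _ => IsOp.zero u, fun _ _ => map_zero _⟩

theorem IsFam.add {f g : Fam C X Z} (hf : IsFam 𝕏 𝕫 u f) (hg : IsFam 𝕏 𝕫 u g) :
    IsFam 𝕏 𝕫 u (f + g) :=
  ⟨fun n => (hf.op n).add (hg.op n), fun n ρ => by
    rw [Pi.add_apply, map_add, hf.act, hg.act]⟩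

theorem IsFam.smul (a : k) {f : Fam C X Z} (hf : IsFam 𝕏 𝕫 u f) : IsFam 𝕏 𝕫 u (a • f) :=
  ⟨fun n => (hf.op n).smul a, fun n ρ => by rw [Pi.smul_apply, map_smul, hf.act]⟩

theorem Op.neg_one_smul (F : Op C n X Z) : (-1 : k) • F = -F :=
  LinearMap.ext fun c => MultilinearMap.ext fun x => by
    change (-1 : k) • F c x = - F c x
    rw [neg_smul, one_smul]

theorem Fam.neg_one_smul (f : Fam C X Z) : (-1 : k) • f = -f :=
  funext fun n => Op.neg_one_smul (f n)

theorem IsOp.sub {F G : Op C n X Z} (hF : IsOp 𝕏 𝕫 u F) (hG : IsOp 𝕏 𝕫 u G) :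
    IsOp 𝕏 𝕫 u (F - G) := by
  rw [sub_eq_add_neg, ← Op.neg_one_smul]; exact hF.add (hG.smul _)

theorem IsFam.neg {f : Fam C X Z} (hf : IsFam 𝕏 𝕫 u f) : IsFam 𝕏 𝕫 u (-f) := by
  rw [← Fam.neg_one_smul]; exact hf.smul _

theorem IsFam.sub {f g : Fam C X Z} (hf : IsFam 𝕏 𝕫 u f) (hg : IsFam 𝕏 𝕫 u g) :
    IsFam 𝕏 𝕫 u (f - g) := by
  rw [sub_eq_add_neg]; exact hf.add hg.neg

theorem IsFam.sum {ι : Type*} (S : Finset ι) {f : ι → Fam C X Z}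
    (hf : ∀ i ∈ S, IsFam 𝕏 𝕫 u (f i)) : IsFam 𝕏 𝕫 u (∑ i ∈ S, f i) :=
  Finset.sum_induction _ (IsFam 𝕏 𝕫 u) (fun _ _ => IsFam.add) (IsFam.zero u) hf

variable {f f' : Fam C X Z} {g g' : Fam C X X}

theorem sstar_add_left (hf : ∀ n, IsOp 𝕏 𝕫 u (f n)) (hf' : ∀ n, IsOp 𝕏 𝕫 u (f' n))
    (hg : ∀ n, IsOp 𝕏 𝕏 v (g n)) :
    sstar 𝕏 𝕫 s (f + f') g = sstar 𝕏 𝕫 s f g + sstar 𝕏 𝕫 s f' g := by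
  funext n
  simp only [sstar, Pi.add_apply, ← Finset.sum_add_distrib]
  refine Finset.sum_congr rfl fun q _ => Finset.sum_congr rfl fun ρ _ => ?_
  rw [pc_add_left _ _ (hf _) (hf' _) (hg _), map_add]

theorem sstar_add_right (hf : ∀ n, IsOp 𝕏 𝕫 u (f n)) (hg : ∀ n, IsOp 𝕏 𝕏 v (g n))
    (hg' : ∀ n, IsOp 𝕏 𝕏 v (g' n)) :
    sstar 𝕏 𝕫 s f (g + g') = sstar 𝕏 𝕫 s f g + sstar 𝕏 𝕫 s f g' := by
  funext n
  simp only [sstar, Pi.add_apply, ← Finset.sum_add_distrib]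
  refine Finset.sum_congr rfl fun q _ => Finset.sum_congr rfl fun ρ _ => ?_
  rw [pc_add_right _ _ (hf _) (hg _) (hg' _), map_add]

theorem sstar_smul_left (a : k) (hf : ∀ n, IsOp 𝕏 𝕫 u (f n)) (hg : ∀ n, IsOp 𝕏 𝕏 v (g n)) :
    sstar 𝕏 𝕫 s (a • f) g = a • sstar 𝕏 𝕫 s f g := by
  funext n
  simp only [sstar, Pi.smul_apply, Finset.smul_sum]
  refine Finset.sum_congr rfl fun q _ => Finset.sum_congr rfl fun ρ _ => ?_
  rw [pc_smul_left _ _ _ (hf _) (hg _), map_smul]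

theorem sstar_smul_right (a : k) (hf : ∀ n, IsOp 𝕏 𝕫 u (f n)) (hg : ∀ n, IsOp 𝕏 𝕏 v (g n)) :
    sstar 𝕏 𝕫 s f (a • g) = a • sstar 𝕏 𝕫 s f g := by
  funext n
  simp only [sstar, Pi.smul_apply, Finset.smul_sum]
  refine Finset.sum_congr rfl fun q _ => Finset.sum_congr rfl fun ρ _ => ?_
  rw [pc_smul_right _ _ _ (hf _) (hg _), map_smul]

theorem sstar_zero_left (hg : ∀ n, IsOp 𝕏 𝕏 v (g n)) :
    sstar 𝕏 𝕫 s (0 : Fam C X Z) g = 0 := by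
  funext n
  refine Finset.sum_eq_zero fun q _ => Finset.sum_eq_zero fun ρ _ => ?_
  exact (congrArg (perm 𝕏 ρ) (pc_zero_left (𝕏 := 𝕏) _ s (hg q))).trans (map_zero _)

theorem sstar_zero_right (hf : ∀ n, IsOp 𝕏 𝕫 u (f n)) : sstar 𝕏 𝕫 s f 0 = 0 := by
  funext n
  refine Finset.sum_eq_zero fun q _ => Finset.sum_eq_zero fun ρ _ => ?_
  exact (congrArg (perm 𝕏 ρ) (pc_zero_right (𝕏 := 𝕏) _ s (hf _))).trans (map_zero _)

theorem sstar_sub_left (hf : ∀ n, IsOp 𝕏 𝕫 u (f n)) (hf' : ∀ n, IsOp 𝕏 𝕫 u (f' n))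
    (hg : ∀ n, IsOp 𝕏 𝕏 v (g n)) :
    sstar 𝕏 𝕫 s (f - f') g = sstar 𝕏 𝕫 s f g - sstar 𝕏 𝕫 s f' g := by
  rw [eq_sub_iff_add_eq, ← sstar_add_left (f := f - f') (u := u) (v := v)
    (fun n => (hf n).sub (hf' n)) hf' hg,
    sub_add_cancel]

theorem sstar_sub_right (hf : ∀ n, IsOp 𝕏 𝕫 u (f n)) (hg : ∀ n, IsOp 𝕏 𝕏 v (g n))
    (hg' : ∀ n, IsOp 𝕏 𝕏 v (g' n)) :
    sstar 𝕏 𝕫 s f (g - g') = sstar 𝕏 𝕫 s f g - sstar 𝕏 𝕫 s f g' := by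
  rw [eq_sub_iff_add_eq, ← sstar_add_right (g := g - g') (u := u) (v := v) hf
    (fun n => (hg n).sub (hg' n)) hg',
    sub_add_cancel]

theorem sstar_sum_left {ι : Type*} (S : Finset ι) {f : ι → Fam C X Z}
    (hf : ∀ i ∈ S, IsFam 𝕏 𝕫 u (f i)) (hg : IsFam 𝕏 𝕏 v g) :
    sstar 𝕏 𝕫 s (∑ i ∈ S, f i) g = ∑ i ∈ S, sstar 𝕏 𝕫 s (f i) g := by
  classical
  induction S using Finset.induction_on with
  | empty => simpa using sstar_zero_left hg.op
  | insert i S hi ih =>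
    have h1 : ∀ j ∈ S, IsFam 𝕏 𝕫 u (f j) := fun j hj => hf j (Finset.mem_insert_of_mem hj)
    rw [Finset.sum_insert hi, Finset.sum_insert hi,
      sstar_add_left (hf i (by simp)).op (IsFam.sum S h1).op hg.op, ih h1]

theorem sstar_sum_right {ι : Type*} (S : Finset ι) (hf : IsFam 𝕏 𝕫 u f) {g : ι → Fam C X X}
    (hg : ∀ i ∈ S, IsFam 𝕏 𝕏 v (g i)) :
    sstar 𝕏 𝕫 s f (∑ i ∈ S, g i) = ∑ i ∈ S, sstar 𝕏 𝕫 s f (g i) := by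
  classical
  induction S using Finset.induction_on with
  | empty => simpa using sstar_zero_right hf.op
  | insert i S hi ih =>
    have h1 : ∀ j ∈ S, IsFam 𝕏 𝕏 v (g j) := fun j hj => hg j (Finset.mem_insert_of_mem hj)
    rw [Finset.sum_insert hi, Finset.sum_insert hi,
      sstar_add_right hf.op (hg i (by simp)).op (IsFam.sum S h1).op, ih h1]

/-- Postcomposition of the members of a family. -/
def postF (L : Z →ₗ[k] Z') : Fam C X Z →ₗ[k] Fam C X Z' where
  toFun f n := post L (f n)
  map_add' f g := by funext n; simp
  map_smul' a f := by funext n; simp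

@[simp] theorem postF_apply (L : Z →ₗ[k] Z') (f : Fam C X Z) (n : ℕ) :
    postF L f n = post L (f n) := rfl

variable {X' : Type*} [AddCommGroup X'] [Module k X'] {𝕏' : CompleteComplex k X'}

/-- Precomposition of the members of a family. -/
def preF (w : X' →ₗ[k] X) : Fam C X Z →ₗ[k] Fam C X' Z where
  toFun f n := pre w (f n)
  map_add' f g := by funext n; simp
  map_smul' a f := by funext n; simp

@[simp] theorem preF_apply (w : X' →ₗ[k] X) (f : Fam C X Z) (n : ℕ) :
    preF w f n = pre w (f n) := rfl

theorem IsFam.post {L : Z →ₗ[k] Z'} (hf : IsFam 𝕏 𝕫 u f) (hL : IsMap 𝕫 𝕫' v L) {u' : ℤ}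
    (hu : u + v = u') : IsFam 𝕏 𝕫' u' (postF L f) :=
  ⟨fun n => (hf.op n).post hL hu, fun n ρ => by rw [postF_apply, perm_post, hf.act]⟩

theorem IsFam.pre {w : X' →ₗ[k] X} (hf : IsFam 𝕏 𝕫 u f) (hw : IsMap 𝕏' 𝕏 0 w) :
    IsFam 𝕏' 𝕫 u (preF w f) :=
  ⟨fun n => (hf.op n).pre hw, fun n ρ => by rw [preF_apply, perm_pre hw, hf.act]⟩

theorem sstar_post {L : Z →ₗ[k] Z'} (hL : IsMap 𝕫 𝕫' u L) (hf : ∀ n, IsOp 𝕏 𝕫 v (f n)) {v' : ℤ}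
    (hg : ∀ n, IsOp 𝕏 𝕏 v' (g n)) :
    sstar 𝕏 𝕫' s (postF L f) g = postF L (sstar 𝕏 𝕫 s f g) := by
  funext n
  simp only [sstar, postF_apply, map_sum]
  refine Finset.sum_congr rfl fun q _ => Finset.sum_congr rfl fun ρ _ => ?_
  rw [pc_post _ _ hL (hf _) (hg _) rfl, perm_post]

/-- Restrictions of two convolution products agree if the restrictions of their factors fit. -/
theorem sstar_congr_pre {X₁ X₂ Y : Type*} [AddCommGroup X₁] [Module k X₁] [AddCommGroup X₂]
    [Module k X₂] [AddCommGroup Y] [Module k Y] {𝕏₁ : CompleteComplex k X₁}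
    {𝕏₂ : CompleteComplex k X₂} {𝕐 : CompleteComplex k Y} {w₁ : Y →ₗ[k] X₁} {w₂ : Y →ₗ[k] X₂}
    (hw₁ : IsMap 𝕐 𝕏₁ 0 w₁) (hw₂ : IsMap 𝕐 𝕏₂ 0 w₂) {u₁ u₂ v₁ v₂ : ℤ} {f₁ : Fam C X₁ Z}
    {f₂ : Fam C X₂ Z} {g₁ : Fam C X₁ X₁} {g₂ : Fam C X₂ X₂} (hf₁ : ∀ n, IsOp 𝕏₁ 𝕫 u₁ (f₁ n))
    (hf₂ : ∀ n, IsOp 𝕏₂ 𝕫 u₂ (f₂ n)) (hg₁ : ∀ n, IsOp 𝕏₁ 𝕏₁ v₁ (g₁ n))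
    (hg₂ : ∀ n, IsOp 𝕏₂ 𝕏₂ v₂ (g₂ n))
    (H : ∀ q p (a : C.obj (p + 1)) (b : C.obj q) (y : Fin q → Y) (z : Fin p → Y),
      f₁ (p + 1) a (Fin.cons (g₁ q b fun j => w₁ (y j)) fun j => w₁ (z j)) =
      f₂ (p + 1) a (Fin.cons (g₂ q b fun j => w₂ (y j)) fun j => w₂ (z j))) :
    preF w₁ (sstar 𝕏₁ 𝕫 s f₁ g₁) = preF w₂ (sstar 𝕏₂ 𝕫 s f₂ g₂) := by
  funext n
  simp only [sstar, preF_apply, map_sum]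
  refine Finset.sum_congr rfl fun q _ => Finset.sum_congr rfl fun ρ _ => ?_
  rw [← perm_pre hw₁, ← perm_pre hw₂]
  congr 1
  refine LinearMap.ext fun c => MultilinearMap.ext fun x => ?_
  rw [pre_apply, pre_apply]
  have h1 := pc_spec (𝕫 := 𝕫) (show (q : ℕ) + (n - q) = n by omega) s (hf₁ _) (hg₁ _) c
    (fun j => w₁ (x j))
  have h2 := pc_spec (𝕫 := 𝕫) (show (q : ℕ) + (n - q) = n by omega) s (hf₂ _) (hg₂ _) c
    (fun j => w₂ (x j))
  refine h1.uniq 𝕫.fil_antitone 𝕫.fil_separated ?_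
  convert h2 using 1
  exact TensorProduct.ext' fun a b => H q (n - q) _ _ _ _

/-- A convolution product vanishes if the inner outputs are killed by the outer family. -/
theorem sstar_eq_zero (hf : ∀ n, IsOp 𝕏 𝕫 u (f n)) (hg : ∀ n, IsOp 𝕏 𝕏 v (g n))
    (H : ∀ q p (a : C.obj (p + 1)) (b : C.obj q) (y : Fin q → X) (z : Fin p → X),
      f (p + 1) a (Fin.cons (g q b y) z) = 0) : sstar 𝕏 𝕫 s f g = 0 := by
  have hid : IsMap 𝕏 𝕏 0 LinearMap.id := ⟨fun n x hx => by simpa using hx, fun p x hx => hx⟩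
  have h0 : ∀ n, IsOp 𝕏 𝕫 u ((0 : Fam C X Z) n) := fun n => IsOp.zero u
  have := sstar_congr_pre (s := s) hid hid hf h0 hg hg (fun q p a b y z => H q p a b y z)
  rw [sstar_zero_left hg] at this
  exact this

end Bilinear

/-! ### Pointwise convergence -/

section Convergence

open Filter

variable {k : Type*} [Field k] {C : CompleteCooperad k} {X X' Z Z' : Type*} [AddCommGroup X]
  [Module k X] [AddCommGroup Z] [Module k Z] [AddCommGroup X'] [Module k X'] [AddCommGroup Z']
  [Module k Z'] {𝕏 : CompleteComplex k X} {𝕏' : CompleteComplex k X'} {𝕫 : CompleteComplex k Z}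
  {𝕫' : CompleteComplex k Z'} {n p q r : ℕ} {u v : ℤ} {s : ℕ}

/-- Pointwise convergence of operations. -/
def TendsOp (𝕫 : CompleteComplex k Z) (F : ℕ → Op C n X Z) (L : Op C n X Z) : Prop :=
  ∀ c x N, ∀ᶠ m in atTop, L c x - F m c x ∈ 𝕫.fil N

/-- Pointwise convergence of families of operations. -/
def Tends (𝕫 : CompleteComplex k Z) (f : ℕ → Fam C X Z) (l : Fam C X Z) : Prop :=
  ∀ n, TendsOp 𝕫 (fun m => f m n) (l n)

theorem TendsOp.unique {F : ℕ → Op C n X Z} {L L' : Op C n X Z} (h : TendsOp 𝕫 F L)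
    (h' : TendsOp 𝕫 F L') : L = L' := by
  refine LinearMap.ext fun c => MultilinearMap.ext fun x => sub_eq_zero.1 ?_
  refine 𝕫.fil_separated _ fun N => ?_
  obtain ⟨m, h1, h2⟩ := ((h c x N).and (h' c x N)).exists
  have := Submodule.sub_mem _ h1 h2
  simpa using this

theorem Tends.unique {f : ℕ → Fam C X Z} {l l' : Fam C X Z} (h : Tends 𝕫 f l)
    (h' : Tends 𝕫 f l') : l = l' := funext fun n => (h n).unique (h' n)

theorem TendsOp.const (F : Op C n X Z) : TendsOp 𝕫 (fun _ => F) F := fun c x N =>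
  .of_forall fun m => by rw [sub_self]; exact Submodule.zero_mem _

theorem Tends.const (f : Fam C X Z) : Tends 𝕫 (fun _ => f) f := fun n => TendsOp.const (f n)

theorem TendsOp.add {F G : ℕ → Op C n X Z} {L L' : Op C n X Z} (h : TendsOp 𝕫 F L)
    (h' : TendsOp 𝕫 G L') : TendsOp 𝕫 (fun m => F m + G m) (L + L') := fun c x N => by
  filter_upwards [h c x N, h' c x N] with m h1 h2
  change L c x + L' c x - (F m c x + G m c x) ∈ _
  rw [add_sub_add_comm]
  exact Submodule.add_mem _ h1 h2

theorem Tends.add {f g : ℕ → Fam C X Z} {l l' : Fam C X Z} (h : Tends 𝕫 f l)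
    (h' : Tends 𝕫 g l') : Tends 𝕫 (fun m => f m + g m) (l + l') := fun n => (h n).add (h' n)

theorem TendsOp.smul (a : k) {F : ℕ → Op C n X Z} {L : Op C n X Z} (h : TendsOp 𝕫 F L) :
    TendsOp 𝕫 (fun m => a • F m) (a • L) := fun c x N => by
  filter_upwards [h c x N] with m h1
  change a • L c x - a • F m c x ∈ _
  rw [← smul_sub]
  exact Submodule.smul_mem _ _ h1

theorem Tends.neg {f : ℕ → Fam C X Z} {l : Fam C X Z} (h : Tends 𝕫 f l) :
    Tends 𝕫 (fun m => - f m) (-l) := fun n => by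
  have := (h n).smul (-1)
  simp only [Op.neg_one_smul] at this
  exact this

theorem Tends.sub {f g : ℕ → Fam C X Z} {l l' : Fam C X Z} (h : Tends 𝕫 f l)
    (h' : Tends 𝕫 g l') : Tends 𝕫 (fun m => f m - g m) (l - l') := by
  simpa only [sub_eq_add_neg] using h.add h'.neg

theorem Tends.post {f : ℕ → Fam C X Z} {l : Fam C X Z} (h : Tends 𝕫 f l) {L : Z →ₗ[k] Z'}
    (hL : IsMap 𝕫 𝕫' u L) : Tends 𝕫' (fun m => postF L (f m)) (postF L l) := fun n c x N => by
  filter_upwards [h n c x N] with m h1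
  simp only [postF_apply, post_apply, ← map_sub]
  exact hL.fil _ _ h1

theorem Tends.pre {f : ℕ → Fam C X Z} {l : Fam C X Z} (h : Tends 𝕫 f l) (w : X' →ₗ[k] X) :
    Tends 𝕫 (fun m => preF w (f m)) (preF w l) := fun n c _ N => h n c _ N

theorem Tends.comp_succ {f : ℕ → Fam C X Z} {l : Fam C X Z} (h : Tends 𝕫 f l) :
    Tends 𝕫 (fun m => f (m + 1)) l := fun n c x N =>
  (tendsto_add_atTop_nat 1).eventually (h n c x N)

theorem TendsOp.sum {ι : Type*} (S : Finset ι) {F : ι → ℕ → Op C n X Z} {L : ι → Op C n X Z}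
    (h : ∀ i, TendsOp 𝕫 (F i) (L i)) : TendsOp 𝕫 (fun m => ∑ i ∈ S, F i m) (∑ i ∈ S, L i) := by
  classical
  induction S using Finset.induction_on with
  | empty => simpa using TendsOp.const 0
  | insert i S hi ih => simp only [Finset.sum_insert hi]; exact (h i).add ih

theorem TendsOp.perm {F : ℕ → Op C n X Z} {L : Op C n X Z} (h : TendsOp 𝕫 F L)
    (ρ : Equiv.Perm (Fin n)) : TendsOp 𝕫 (fun m => perm 𝕏 ρ (F m)) (perm 𝕏 ρ L) := fun c x N => by
  have : ∀ᶠ m in atTop, ∀ e : Fin n → ZMod 2,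
      L (C.act n ρ c) (fun i => 𝕏.parL (e (ρ i)) (x (ρ i))) -
        F m (C.act n ρ c) (fun i => 𝕏.parL (e (ρ i)) (x (ρ i))) ∈ 𝕫.fil N :=
    eventually_all.2 fun e => h _ _ N
  filter_upwards [this] with m hm
  simp only [perm_apply, permM_apply, ← Finset.sum_sub_distrib, ← smul_sub]
  exact Submodule.sum_mem _ fun e _ => Submodule.smul_mem _ _ (hm e)

theorem TendsOp.pc (h : q + p = n) (s : ℕ) {F : ℕ → Op C (p + 1) X Z} {L : Op C (p + 1) X Z}
    {G : ℕ → Op C q X X} {L' : Op C q X X} (hF : ∀ m, IsOp 𝕏 𝕫 u (F m)) (hL : IsOp 𝕏 𝕫 u L)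
    (hG : ∀ m, IsOp 𝕏 𝕏 v (G m)) (hL' : IsOp 𝕏 𝕏 v L') (hFL : TendsOp 𝕫 F L)
    (hGL : TendsOp 𝕏 G L') : TendsOp 𝕫 (fun m => pc 𝕫 h s (F m) (G m)) (pc 𝕫 h s L L') := by
  intro c x N
  choose w hw using fun j => 𝕏.fil_exhaustive (x j)
  obtain ⟨t, ht⟩ := HasEval.exists_rep (C.dec p q n h c) (N - ∑ j, w j)
  have key : ∀ᶠ m in atTop, theta h s L L' t x - theta h s (F m) (G m) t x ∈ 𝕫.fil N := by
    clear ht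
    induction t with
    | zero => exact .of_forall fun m => by simp
    | add t t' h1 h2 =>
      filter_upwards [h1, h2] with m h1 h2
      simp only [map_add, add_apply, add_sub_add_comm]
      exact Submodule.add_mem _ h1 h2
    | tmul a b =>
      obtain ⟨i, hi⟩ := (C.cx (p + 1)).fil_exhaustive (((C.cx (p + 1)).sgn ^ s) a)
      filter_upwards [hFL (((C.cx (p + 1)).sgn ^ s) a) (Fin.cons (L' b (hd h x)) (tl h x)) N,
        hGL b (hd h x) (N - i - ∑ j, tl h w j)] with m h1 h2
      have h3 := (hF m).fil _ _ hi _ _ (cons_mem 𝕏.fil h2 (tl_mem 𝕏.fil h hw))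
      rw [Fin.sum_univ_succ] at h3
      simp only [Fin.cons_zero, Fin.cons_succ] at h3
      have e := ((F m) (((C.cx (p + 1)).sgn ^ s) a)).cons_add (tl h x)
        (L' b (hd h x) - G m b (hd h x)) (G m b (hd h x))
      rw [sub_add_cancel] at e
      have e' : i + (N - i - ∑ j, tl h w j + ∑ j, tl h w j) = N := by ring
      rw [e'] at h3
      have := Submodule.add_mem _ h1 h3
      rw [theta_tmul, theta_tmul]
      rw [e] at this
      convert this using 1
      abel
  -- The estimate for the error of a representative does not depend on `m`.
  filter_upwards [key] with m hm
  have h1 := pc_estimate h s hL hL' c hw _ t ht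
  have h2 := pc_estimate h s (hF m) (hG m) c hw _ t ht
  rw [sub_add_cancel] at h1 h2
  have := Submodule.add_mem _ hm (Submodule.sub_mem _ h1 h2)
  convert this using 1
  abel

/-- The convolution product is continuous. -/
theorem Tends.sstar {f : ℕ → Fam C X Z} {l : Fam C X Z} {g : ℕ → Fam C X X} {l' : Fam C X X}
    (hf : ∀ m, IsFam 𝕏 𝕫 u (f m)) (hl : IsFam 𝕏 𝕫 u l) (hg : ∀ m, IsFam 𝕏 𝕏 v (g m))
    (hl' : IsFam 𝕏 𝕏 v l') (h : Tends 𝕫 f l) (h' : Tends 𝕏 g l') :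
    Tends 𝕫 (fun m => sstar 𝕏 𝕫 s (f m) (g m)) (sstar 𝕏 𝕫 s l l') := fun _ =>
  TendsOp.sum _ fun _ => TendsOp.sum _ fun ρ => TendsOp.perm (TendsOp.pc _ s (fun m => (hf m).op _)
    (hl.op _) (fun m => (hg m).op _) (hl'.op _) (h _) (h' _)) ρ

/-- Cauchy sequences of families converge. -/
theorem exists_tends {f : ℕ → Fam C X Z} (hf : ∀ m, IsFam 𝕏 𝕫 u (f m))
    (hc : ∀ n c x N, ∀ᶠ m in atTop, f (m + 1) n c x - f m n c x ∈ 𝕫.fil N) :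
    ∃ l, IsFam 𝕏 𝕫 u l ∧ Tends 𝕫 f l := by
  have ex : ∀ n, ∃ L : Op C n X Z, ∀ c x, ∀ N, ∀ᶠ m in atTop, L c x - f m n c x ∈ 𝕫.fil N := by
    intro n
    refine exists_op (C.cx n) 𝕏
      (fun c x z => ∀ N, ∀ᶠ m in atTop, z - f m n c x ∈ 𝕫.fil N) ?_ ?_ ?_ ?_ ?_ ?_
    · intro c c' x z z' h1 h2 N
      filter_upwards [h1 N, h2 N] with m h1 h2
      simp only [map_add, add_apply, add_sub_add_comm]
      exact Submodule.add_mem _ h1 h2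
    · intro r c x z h1 N
      filter_upwards [h1 N] with m h1
      simp only [map_smul, smul_apply, ← smul_sub]
      exact Submodule.smul_mem _ _ h1
    · intro c x j a b z z' h1 h2 N
      filter_upwards [h1 N, h2 N] with m h1 h2
      simp only [MultilinearMap.map_update_add, add_sub_add_comm]
      exact Submodule.add_mem _ h1 h2
    · intro c x j r a z h1 N
      filter_upwards [h1 N] with m h1
      simp only [MultilinearMap.map_update_smul, ← smul_sub]
      exact Submodule.smul_mem _ _ h1
    · intro c x z z' h1 h2
      refine sub_eq_zero.1 (𝕫.fil_separated _ fun N => ?_)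
      obtain ⟨m, h1, h2⟩ := ((h1 N).and (h2 N)).exists
      have := Submodule.sub_mem _ h1 h2
      simpa using this
    · intro e c hc' t x hx
      obtain ⟨z, -, hz⟩ := 𝕫.exists_lim_seq (fun m => f m n c x)
        (fun m => ((hf m).op n).deg e c hc' t x hx) (fun N => by
          obtain ⟨m₀, hm₀⟩ := eventually_atTop.1 (hc n c x N)
          refine ⟨m₀, fun m hm => ?_⟩
          induction m, hm using Nat.le_induction with
          | base => rw [sub_self]; exact Submodule.zero_mem _
          | succ m hm ih =>
            have := Submodule.add_mem _ ih (hm₀ m hm)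
            simpa using this)
      exact ⟨z, fun N => eventually_atTop.2 (hz N)⟩
  choose L hL using ex
  have hdeg : ∀ n e, ∀ c ∈ (C.cx n).deg e, ∀ (t : Fin n → ℤ) (x : Fin n → X),
      (∀ j, x j ∈ 𝕏.deg (t j)) → L n c x ∈ 𝕫.deg (e + u + ∑ j, t j) := by
    intro n e c hc' t x hx
    obtain ⟨z, hz', hz⟩ := 𝕫.exists_lim_seq (fun m => f m n c x)
        (fun m => (hf m).op n |>.deg e c hc' t x hx) (fun N => by
          obtain ⟨m₀, hm₀⟩ := eventually_atTop.1 (hL n c x N)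
          refine ⟨m₀, fun m hm => ?_⟩
          have := Submodule.sub_mem _ (hm₀ m₀ le_rfl) (hm₀ m hm)
          simpa using this)
    have : L n c x = z := by
      refine sub_eq_zero.1 (𝕫.fil_separated _ fun N => ?_)
      obtain ⟨m, h1, h2⟩ := ((hL n c x N).and (eventually_atTop.2 (hz N))).exists
      have := Submodule.sub_mem _ h1 h2
      simpa using this
    rw [this]; exact hz'
  refine ⟨L, ⟨fun n => ⟨hdeg n, fun p c hc' w x hx => ?_⟩, fun n ρ => ?_⟩, hL⟩
  · obtain ⟨m, hm⟩ := (hL n c x (p + ∑ j, w j)).exists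
    have := Submodule.add_mem _ hm (((hf m).op n).fil p c hc' w x hx)
    simpa using this
  · have h1 := TendsOp.perm (𝕏 := 𝕏) (hL n) ρ
    simp only [(hf _).act] at h1
    exact h1.unique (hL n)

end Convergence

/-! ### The order filtration defined by iterated decompositions -/

section Order

open Filter

variable {k : Type*} [Field k] {C : CompleteCooperad k} {X X' Z Z' : Type*} [AddCommGroup X]
  [Module k X] [AddCommGroup Z] [Module k Z] [AddCommGroup X'] [Module k X'] [AddCommGroup Z']
  [Module k Z'] {𝕏 : CompleteComplex k X} {𝕏' : CompleteComplex k X'} {𝕫 : CompleteComplex k Z}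
  {𝕫' : CompleteComplex k Z'} {n p q r m : ℕ} {u v : ℤ} {s : ℕ}

theorem mem_iterFil_succ {N : ℤ} {c : C.obj n} : c ∈ C.iterFil (m + 1) N n ↔
    ∀ p q (h : q + p = n) ρ, ∃ t ∈ tensorSum (fun r => C.iterFil m r (p + 1)) (C.cx q).fil N,
      (C.fil₂ (p + 1) q N).mkQ t = (C.dec p q n h (C.act n ρ c)).1 N := by
  simp only [CompleteCooperad.iterFil, Submodule.mem_iInf]
  rfl

theorem iterFil_le_succ (m : ℕ) (N : ℤ) (n : ℕ) : C.iterFil m N n ≤ C.iterFil (m + 1) N n := by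
  induction m generalizing N n with
  | zero =>
    intro c hc
    rw [mem_iterFil_succ]
    intro p q h ρ
    exact ⟨0, Submodule.zero_mem _, by
      rw [map_zero]; exact (C.dec_fil p q n h N _ (C.act_fil n ρ N c hc)).symm⟩
  | succ m ih =>
    intro c hc
    rw [mem_iterFil_succ] at hc ⊢
    intro p q h ρ
    obtain ⟨t, ht, e⟩ := hc p q h ρ
    exact ⟨t, tensorSum_le (fun i a ha b hb => tmul_mem_tensorSum (by ring) (ih _ _ ha) hb) ht, e⟩

/-- The sign involution preserves the filtration by iterated decompositions. -/
theorem sgn_mem_iterFil {N : ℤ} {c : C.obj n} (hc : c ∈ C.iterFil m N n) :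
    (C.cx n).sgn c ∈ C.iterFil m N n := by
  induction m generalizing N n with
  | zero => exact (C.cx n).sgn_fil hc
  | succ m ih =>
    rw [mem_iterFil_succ] at hc ⊢
    intro p q h ρ
    obtain ⟨t, ht, e⟩ := hc p q h ρ
    refine ⟨TensorProduct.map (C.cx (p + 1)).sgn (C.cx q).sgn t, ?_, ?_⟩
    · suffices H : tensorSum (fun r => C.iterFil m r (p + 1)) (C.cx q).fil N ≤
        (tensorSum (fun r => C.iterFil m r (p + 1)) (C.cx q).fil N).comap
          (TensorProduct.map (C.cx (p + 1)).sgn (C.cx q).sgn) from H ht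
      exact tensorSum_le fun i a ha b hb => tmul_mem_tensorSum (by ring) (ih ha)
        ((C.cx q).sgn_fil hb)
    · rw [dec_sgn h _ _ _ e]
      have := act_sgn_pow n 1 ρ c
      rw [pow_one] at this
      rw [this]

theorem sgn_pow_mem_iterFil (s : ℕ) {N : ℤ} {c : C.obj n} (hc : c ∈ C.iterFil m N n) :
    ((C.cx n).sgn ^ s) c ∈ C.iterFil m N n := by
  induction s with
  | zero => exact hc
  | succ s ih => rw [pow_succ', Module.End.mul_apply]; exact sgn_mem_iterFil ih

/-- A family has order at least `m` if its values at elements all of whose `m`-fold decompositions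
are small are small. The trees that contribute to a family of order `m` have more than `m`
vertices. -/
def Order (𝕏 : CompleteComplex k X) (𝕫 : CompleteComplex k Z) (m : ℕ) (f : Fam C X Z) : Prop :=
  ∀ n N, ∀ c ∈ C.iterFil m N n, ∀ (w : Fin n → ℤ) (x : Fin n → X), (∀ j, x j ∈ 𝕏.fil (w j)) →
    f n c x ∈ 𝕫.fil (N + ∑ j, w j)

theorem IsFam.order_zero {f : Fam C X Z} (hf : IsFam 𝕏 𝕫 u f) : Order 𝕏 𝕫 0 f :=
  fun n N c hc w x hx => (hf.op n).fil N c hc w x hx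

theorem Order.mono {m m' : ℕ} (h : m ≤ m') {f : Fam C X Z} (hf : Order 𝕏 𝕫 m' f) :
    Order 𝕏 𝕫 m f := by
  induction m', h using Nat.le_induction with
  | base => exact hf
  | succ m' _ ih => exact ih fun n N c hc => hf n N c (iterFil_le_succ m' N n hc)

theorem Order.zero (m : ℕ) : Order 𝕏 𝕫 m (0 : Fam C X Z) :=
  fun _ _ _ _ _ _ _ => Submodule.zero_mem _

theorem Order.add {f g : Fam C X Z} (hf : Order 𝕏 𝕫 m f) (hg : Order 𝕏 𝕫 m g) :
    Order 𝕏 𝕫 m (f + g) :=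
  fun n N c hc w x hx => Submodule.add_mem _ (hf n N c hc w x hx) (hg n N c hc w x hx)

theorem Order.smul (a : k) {f : Fam C X Z} (hf : Order 𝕏 𝕫 m f) : Order 𝕏 𝕫 m (a • f) :=
  fun n N c hc w x hx => Submodule.smul_mem _ _ (hf n N c hc w x hx)

theorem Order.sum {ι : Type*} (S : Finset ι) {f : ι → Fam C X Z}
    (hf : ∀ i ∈ S, Order 𝕏 𝕫 m (f i)) : Order 𝕏 𝕫 m (∑ i ∈ S, f i) :=
  Finset.sum_induction _ (Order 𝕏 𝕫 m) (fun _ _ => Order.add) (Order.zero m) hf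

theorem Order.pre {f : Fam C X Z} (hf : Order 𝕏 𝕫 m f) {w : X' →ₗ[k] X} (hw : IsMap 𝕏' 𝕏 0 w) :
    Order 𝕏' 𝕫 m (preF w f) :=
  fun n N c hc t _ hx => hf n N c hc t _ fun j => hw.fil _ _ (hx j)

theorem Order.post {f : Fam C X Z} (hf : Order 𝕏 𝕫 m f) {L : Z →ₗ[k] Z'} (hL : IsMap 𝕫 𝕫' u L) :
    Order 𝕏 𝕫' m (postF L f) :=
  fun n N c hc t x hx => hL.fil _ _ (hf n N c hc t x hx)

theorem Order.of_tends {f : ℕ → Fam C X Z} {l : Fam C X Z} (h : Tends 𝕫 f l)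
    (hf : ∀ᶠ i in atTop, Order 𝕏 𝕫 m (f i)) : Order 𝕏 𝕫 m l := by
  intro n N c hc w x hx
  obtain ⟨i, h1, h2⟩ := ((h n c x (N + ∑ j, w j)).and hf).exists
  have := Submodule.add_mem _ h1 (h2 n N c hc w x hx)
  simpa using this

/-- The convolution product raises the order. -/
theorem Order.sstar (s : ℕ) {f : Fam C X Z} {g : Fam C X X} (h : Order 𝕏 𝕫 m f)
    (hf : ∀ n, IsOp 𝕏 𝕫 u (f n)) (hg : ∀ n, IsOp 𝕏 𝕏 v (g n)) :
    Order 𝕏 𝕫 (m + 1) (sstar 𝕏 𝕫 s f g) := by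
  intro n N c hc w x hx
  simp only [FilteredHTT.sstar, LinearMap.sum_apply, sum_apply]
  refine Submodule.sum_mem _ fun q _ => Submodule.sum_mem _ fun ρ _ => ?_
  have hqn : (q : ℕ) + (n - q) = n := by omega
  obtain ⟨t, ht, e⟩ := mem_iterFil_succ.1 hc _ _ hqn ρ
  rw [perm_apply]
  refine permM_fil hx fun y hy => ?_
  -- The representative `t` of the decomposition has its first factors in the filtration for `m`.
  have h1 := pc_estimate hqn s (hf _) (hg _) _ hy N t e
  have h2 : theta hqn s (f (n - q + 1)) (g q) t y ∈ 𝕫.fil (N + ∑ j, (w ∘ ρ) j) := by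
    suffices H : tensorSum (fun r => C.iterFil m r (n - q + 1)) (C.cx q).fil N ≤
      (𝕫.fil (N + ∑ j, (w ∘ ρ) j)).comap (evalAt y ∘ₗ theta hqn s (f (n - q + 1)) (g q)) from H ht
    refine tensorSum_le fun i a ha b hb => ?_
    have h3 := (hg q).fil _ b hb _ _ (hd_mem 𝕏.fil hqn hy)
    have h4 := h _ _ _ (sgn_pow_mem_iterFil s ha) _ _ (cons_mem 𝕏.fil h3 (tl_mem 𝕏.fil hqn hy))
    change theta hqn s (f (n - q + 1)) (g q) (a ⊗ₜ b) y ∈ 𝕫.fil (N + ∑ j, (w ∘ ρ) j)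
    rw [theta_tmul]
    convert h4 using 2
    rw [Fin.sum_univ_succ, sum_split hqn]
    simp only [Fin.cons_zero, Fin.cons_succ]
    ring
  have := Submodule.add_mem _ h1 h2
  rw [sub_add_cancel] at this
  simpa only [Function.comp_apply, Equiv.sum_comp ρ w] using this

/-- Over a conilpotent cooperad, families whose order tends to infinity tend to zero. -/
theorem eventually_mem_of_order (hC : C.IsConilpotent) {f : ℕ → Fam C X Z}
    (hf : ∀ m, Order 𝕏 𝕫 m (f m)) (n : ℕ) (c : C.obj n) (x : Fin n → X) (N : ℤ) :
    ∀ᶠ m in atTop, f m n c x ∈ 𝕫.fil N := by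
  choose w hw using fun j => 𝕏.fil_exhaustive (x j)
  obtain ⟨m₀, hm₀⟩ := hC n c (N - ∑ j, w j)
  filter_upwards [eventually_ge_atTop m₀] with m hm
  have := hf m n _ c (hm₀ m hm) w x hw
  simpa using this

theorem tends_of_order (hC : C.IsConilpotent) {f : ℕ → Fam C X Z} {l : Fam C X Z}
    (hf : ∀ m, Order 𝕏 𝕫 m (l - f m)) : Tends 𝕫 f l :=
  fun n c x N => eventually_mem_of_order hC hf n c x N

theorem eq_zero_of_order (hC : C.IsConilpotent) {f : Fam C X Z} (hf : ∀ m, Order 𝕏 𝕫 m f) :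
    f = 0 := by
  funext n
  refine LinearMap.ext fun c => MultilinearMap.ext fun x => 𝕫.fil_separated _ fun N => ?_
  exact (eventually_mem_of_order hC (f := fun _ => f) hf n c x N).exists.choose_spec

end Order

/-! ### Maps and products of complete complexes -/

section Prod

variable {k : Type*} [Field k] {X Y Z : Type*} [AddCommGroup X] [Module k X] [AddCommGroup Y]
  [Module k Y] [AddCommGroup Z] [Module k Z] (𝕏 : CompleteComplex k X) (𝕐 : CompleteComplex k Y)

/-- The product of two complete complexes. -/
def CompleteComplex.prod : CompleteComplex k (X × Y) where
  deg n := (𝕏.deg n).prod (𝕐.deg n)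
  fil p := (𝕏.fil p).prod (𝕐.fil p)
  d := 𝕏.d.prodMap 𝕐.d
  isInternal := by
    have h1 := (DirectSum.isInternal_submodule_iff_iSupIndep_and_iSup_eq_top _).1 𝕏.isInternal
    have h2 := (DirectSum.isInternal_submodule_iff_iSupIndep_and_iSup_eq_top _).1 𝕐.isInternal
    refine (DirectSum.isInternal_submodule_iff_iSupIndep_and_iSup_eq_top _).2 ⟨?_, ?_⟩
    · intro i
      refine Submodule.disjoint_def.2 fun z hz hz' => ?_
      have h3 : (⨆ j, ⨆ (_ : j ≠ i), (𝕏.deg j).prod (𝕐.deg j)) ≤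
          (⨆ j, ⨆ (_ : j ≠ i), 𝕏.deg j).prod (⨆ j, ⨆ (_ : j ≠ i), 𝕐.deg j) :=
        iSup₂_le fun j hj => Submodule.prod_mono
          (le_iSup₂_of_le j hj le_rfl) (le_iSup₂_of_le j hj le_rfl)
      exact Prod.ext (Submodule.disjoint_def.1 (h1.1 i) _ hz.1 (h3 hz').1)
        (Submodule.disjoint_def.1 (h2.1 i) _ hz.2 (h3 hz').2)
    · refine Submodule.eq_top_iff'.2 fun z => ?_
      have e : z = (z.1, 0) + (0, z.2) := by simp
      rw [e]
      refine Submodule.add_mem _ ?_ ?_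
      · exact 𝕏.induction_deg (P := fun x => (x, (0 : Y)) ∈ ⨆ n, (𝕏.deg n).prod (𝕐.deg n))
          (fun n x hx => Submodule.mem_iSup_of_mem n ⟨hx, Submodule.zero_mem _⟩)
          (fun x y hx hy => by simpa using Submodule.add_mem _ hx hy) z.1
      · exact 𝕐.induction_deg (P := fun x => ((0 : X), x) ∈ ⨆ n, (𝕏.deg n).prod (𝕐.deg n))
          (fun n x hx => Submodule.mem_iSup_of_mem n ⟨Submodule.zero_mem _, hx⟩)
          (fun x y hx hy => by simpa using Submodule.add_mem _ hx hy) z.2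
  fil_antitone _ _ h := Submodule.prod_mono (𝕏.fil_antitone h) (𝕐.fil_antitone h)
  fil_homog p := by
    intro z hz
    have e : z = (z.1, 0) + (0, z.2) := by simp
    rw [e]
    refine Submodule.add_mem _ ?_ ?_
    · exact 𝕏.induction_fil (P := fun x => (x, (0 : Y)) ∈
          ⨆ n, (𝕏.fil p).prod (𝕐.fil p) ⊓ (𝕏.deg n).prod (𝕐.deg n))
        (fun n x hx hp => Submodule.mem_iSup_of_mem n
          ⟨⟨hp, Submodule.zero_mem _⟩, hx, Submodule.zero_mem _⟩)
        (fun x y hx hy => by simpa using Submodule.add_mem _ hx hy) hz.1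
    · exact 𝕐.induction_fil (P := fun x => ((0 : X), x) ∈
          ⨆ n, (𝕏.fil p).prod (𝕐.fil p) ⊓ (𝕏.deg n).prod (𝕐.deg n))
        (fun n x hx hp => Submodule.mem_iSup_of_mem n
          ⟨⟨Submodule.zero_mem _, hp⟩, Submodule.zero_mem _, hx⟩)
        (fun x y hx hy => by simpa using Submodule.add_mem _ hx hy) hz.2
  fil_exhaustive z := by
    obtain ⟨p, hp⟩ := 𝕏.fil_exhaustive z.1
    obtain ⟨q, hq⟩ := 𝕐.fil_exhaustive z.2
    exact ⟨min p q, 𝕏.fil_antitone (min_le_left _ _) hp, 𝕐.fil_antitone (min_le_right _ _) hq⟩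
  fil_separated z hz := Prod.ext (𝕏.fil_separated _ fun p => (hz p).1)
    (𝕐.fil_separated _ fun p => (hz p).2)
  fil_complete n z hz hc := by
    obtain ⟨x, hx, hx'⟩ := 𝕏.fil_complete n (fun m => (z m).1) (fun m => (hz m).1)
      (fun m => (hc m).1)
    obtain ⟨y, hy, hy'⟩ := 𝕐.fil_complete n (fun m => (z m).2) (fun m => (hz m).2)
      (fun m => (hc m).2)
    exact ⟨(x, y), ⟨hx, hy⟩, fun m => ⟨hx' m, hy' m⟩⟩
  d_deg n z hz := ⟨𝕏.d_deg n _ hz.1, 𝕐.d_deg n _ hz.2⟩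
  d_fil p z hz := ⟨𝕏.d_fil p _ hz.1, 𝕐.d_fil p _ hz.2⟩
  d_d z := Prod.ext (𝕏.d_d _) (𝕐.d_d _)

variable {𝕏 𝕐}

theorem prod_par (e : ZMod 2) (z : X × Y) : (𝕏.prod 𝕐).par e z = (𝕏.par e z.1, 𝕐.par e z.2) := by
  simp only [CompleteComplex.par_eq]
  refine (𝕏.prod 𝕐).induction_deg (P := fun z => (𝕏.prod 𝕐).parL e z =
    (𝕏.parL e z.1, 𝕐.parL e z.2)) (fun n z hz => ?_) (fun z z' h1 h2 => ?_) z
  · rw [(𝕏.prod 𝕐).parL_of_deg e hz, 𝕏.parL_of_deg e hz.1, 𝕐.parL_of_deg e hz.2]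
    split_ifs <;> rfl
  · rw [map_add, h1, h2]; simp

theorem isMap_id : IsMap 𝕏 𝕏 0 LinearMap.id :=
  ⟨fun n x hx => by rwa [add_zero], fun _ _ hx => hx⟩

theorem isMap_fst : IsMap (𝕏.prod 𝕐) 𝕏 0 (LinearMap.fst k X Y) :=
  ⟨fun n x hx => by rw [add_zero]; exact hx.1, fun _ _ hx => hx.1⟩

theorem isMap_snd : IsMap (𝕏.prod 𝕐) 𝕐 0 (LinearMap.snd k X Y) :=
  ⟨fun n x hx => by rw [add_zero]; exact hx.2, fun _ _ hx => hx.2⟩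

theorem isMap_inl : IsMap 𝕏 (𝕏.prod 𝕐) 0 (LinearMap.inl k X Y) :=
  ⟨fun n x hx => by rw [add_zero]; exact ⟨hx, Submodule.zero_mem _⟩,
    fun _ _ hx => ⟨hx, Submodule.zero_mem _⟩⟩

theorem isMap_inr : IsMap 𝕐 (𝕏.prod 𝕐) 0 (LinearMap.inr k X Y) :=
  ⟨fun n x hx => by rw [add_zero]; exact ⟨Submodule.zero_mem _, hx⟩,
    fun _ _ hx => ⟨Submodule.zero_mem _, hx⟩⟩

theorem IsMap.comp {𝕫 : CompleteComplex k Z} {r r' r'' : ℤ} {f : Y →ₗ[k] Z} {g : X →ₗ[k] Y}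
    (hf : IsMap 𝕐 𝕫 r f) (hg : IsMap 𝕏 𝕐 r' g) (h : r' + r = r'') :
    IsMap 𝕏 𝕫 r'' (f ∘ₗ g) :=
  ⟨fun _ _ hx => by rw [← h, ← add_assoc]; exact hf.deg _ _ (hg.deg _ _ hx),
    fun _ _ hx => hf.fil _ _ (hg.fil _ _ hx)⟩

theorem IsMap.add {r : ℤ} {f g : X →ₗ[k] Y} (hf : IsMap 𝕏 𝕐 r f) (hg : IsMap 𝕏 𝕐 r g) :
    IsMap 𝕏 𝕐 r (f + g) :=
  ⟨fun _ _ hx => Submodule.add_mem _ (hf.deg _ _ hx) (hg.deg _ _ hx),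
    fun _ _ hx => Submodule.add_mem _ (hf.fil _ _ hx) (hg.fil _ _ hx)⟩

end Prod

/-! ### The order of families in the second argument of the convolution product -/

section RightOrder

open Filter

universe y z

variable {k : Type*} [Field k] {C : CompleteCooperad k}

/-- Only the parity of the degrees matters for the signs. -/
theorem sgn_pow_congr {V : Type*} [AddCommGroup V] [Module k V] (𝕏 : CompleteComplex k V)
    {s s' : ℕ} (h : (s : ZMod 2) = s') : 𝕏.sgn ^ s = 𝕏.sgn ^ s' :=
  LinearMap.ext fun x => 𝕏.induction_deg (P := fun x => (𝕏.sgn ^ s) x = (𝕏.sgn ^ s') x)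
    (fun n x hx => by rw [𝕏.sgn_pow_of_deg s hx, 𝕏.sgn_pow_of_deg s' hx, h])
    (fun x y hx hy => by rw [map_add, map_add, hx, hy]) x

theorem sstar_parity {X Z : Type*} [AddCommGroup X] [Module k X] [AddCommGroup Z] [Module k Z]
    {𝕏 : CompleteComplex k X} {𝕫 : CompleteComplex k Z} {s s' : ℕ} (h : (s : ZMod 2) = s')
    (f : Fam C X Z) (g : Fam C X X) : sstar 𝕏 𝕫 s f g = sstar 𝕏 𝕫 s' f g := by
  funext n
  refine Finset.sum_congr rfl fun q _ => Finset.sum_congr rfl fun ρ _ => congrArg _ (pc_congr ?_)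
  refine TensorProduct.ext' fun a b => MultilinearMap.ext fun x => ?_
  rw [theta_tmul, theta_tmul, sgn_pow_congr _ h]

variable {X Z W X' Z' : Type*} [AddCommGroup X] [Module k X] [AddCommGroup Z] [Module k Z]
  [AddCommGroup W] [Module k W] [AddCommGroup X'] [Module k X'] [AddCommGroup Z'] [Module k Z']
  {𝕏 : CompleteComplex k X} {𝕫 : CompleteComplex k Z} {𝕨 : CompleteComplex k W}
  {𝕏' : CompleteComplex k X'} {𝕫' : CompleteComplex k Z'} {d d' : ℤ} {b c : ℕ}

/-- A family `G` of degree `d` has order at least `b` as a second factor if `f ⋆ G` has order at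
least `a + b` for all `f` of order at least `a`. Here inputs and outputs of `G` may be identified
with those of `f` by arbitrary filtered maps; this makes the notion stable under composition. -/
def RightOrder (𝕏 : CompleteComplex k X) (𝕫 : CompleteComplex k Z) (𝕨 : CompleteComplex k W)
    (d : ℤ) (b : ℕ) (G : Fam C X Z) : Prop :=
  ∀ (Y : Type y) [AddCommGroup Y] [Module k Y] (𝕐 : CompleteComplex k Y) (u : Y →ₗ[k] X)
    (j : Z →ₗ[k] Y) (r : ℤ) (s : ℕ), IsMap 𝕐 𝕏 0 u → IsMap 𝕫 𝕐 r j →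
    ((d + r : ℤ) : ZMod 2) = s → ∀ (e : ℤ) (a : ℕ) (f : Fam C Y W), IsFam 𝕐 𝕨 e f →
      Order 𝕐 𝕨 a f → Order 𝕐 𝕨 (a + b) (sstar 𝕐 𝕨 s f (postF j (preF u G)))

theorem IsFam.rightOrder_one {G : Fam C X Z} (hG : IsFam 𝕏 𝕫 d G) :
    RightOrder.{y} 𝕏 𝕫 𝕨 d 1 G := by
  intro Y _ _ 𝕐 u j r s hu hj hs e a f hf hfa
  exact hfa.sstar s hf.op ((hG.pre hu).post hj rfl).op

theorem RightOrder.mono {G : Fam C X Z} (hG : RightOrder.{y} 𝕏 𝕫 𝕨 d b G) (h : c ≤ b) :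
    RightOrder.{y} 𝕏 𝕫 𝕨 d c G := by
  intro Y _ _ 𝕐 u j r s hu hj hs e a f hf hfa
  exact (hG Y 𝕐 u j r s hu hj hs e a f hf hfa).mono (by omega)

theorem rightOrder_zero : RightOrder.{y} 𝕏 𝕫 𝕨 d b (0 : Fam C X Z) := by
  intro Y _ _ 𝕐 u j r s hu hj hs e a f hf hfa
  rw [map_zero, map_zero, sstar_zero_right hf.op]
  exact Order.zero _

theorem RightOrder.add {G H : Fam C X Z} (hG : RightOrder.{y} 𝕏 𝕫 𝕨 d b G)
    (hH : RightOrder.{y} 𝕏 𝕫 𝕨 d b H) (hG' : IsFam 𝕏 𝕫 d G) (hH' : IsFam 𝕏 𝕫 d H) :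
    RightOrder.{y} 𝕏 𝕫 𝕨 d b (G + H) := by
  intro Y _ _ 𝕐 u j r s hu hj hs e a f hf hfa
  rw [map_add, map_add, sstar_add_right hf.op ((hG'.pre hu).post hj rfl).op
    ((hH'.pre hu).post hj rfl).op]
  exact (hG Y 𝕐 u j r s hu hj hs e a f hf hfa).add (hH Y 𝕐 u j r s hu hj hs e a f hf hfa)

theorem RightOrder.smul {G : Fam C X Z} (hG : RightOrder.{y} 𝕏 𝕫 𝕨 d b G) (t : k)
    (hG' : IsFam 𝕏 𝕫 d G) : RightOrder.{y} 𝕏 𝕫 𝕨 d b (t • G) := by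
  intro Y _ _ 𝕐 u j r s hu hj hs e a f hf hfa
  rw [map_smul, map_smul, sstar_smul_right _ hf.op ((hG'.pre hu).post hj rfl).op]
  exact (hG Y 𝕐 u j r s hu hj hs e a f hf hfa).smul t

theorem RightOrder.sum {ι : Type*} (S : Finset ι) {G : ι → Fam C X Z}
    (hG : ∀ i ∈ S, RightOrder.{y} 𝕏 𝕫 𝕨 d b (G i)) (hG' : ∀ i ∈ S, IsFam 𝕏 𝕫 d (G i)) :
    RightOrder.{y} 𝕏 𝕫 𝕨 d b (∑ i ∈ S, G i) := by
  classical
  induction S using Finset.induction_on with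
  | empty => simpa using rightOrder_zero
  | insert i S hi ih =>
    have h1 : ∀ j ∈ S, IsFam 𝕏 𝕫 d (G j) := fun j hj => hG' j (Finset.mem_insert_of_mem hj)
    rw [Finset.sum_insert hi]
    exact (hG i (by simp)).add (ih (fun j hj => hG j (Finset.mem_insert_of_mem hj)) h1)
      (hG' i (by simp)) (IsFam.sum S h1)

theorem RightOrder.pre {G : Fam C X Z} (hG : RightOrder.{y} 𝕏 𝕫 𝕨 d b G) {w : X' →ₗ[k] X}
    (hw : IsMap 𝕏' 𝕏 0 w) : RightOrder.{y} 𝕏' 𝕫 𝕨 d b (preF w G) := by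
  intro Y _ _ 𝕐 u j r s hu hj hs e a f hf hfa
  exact hG Y 𝕐 (w ∘ₗ u) j r s (hw.comp hu rfl) hj hs e a f hf hfa

theorem RightOrder.post {G : Fam C X Z} (hG : RightOrder.{y} 𝕏 𝕫 𝕨 d b G) {L : Z →ₗ[k] Z'} {l : ℤ}
    (hL : IsMap 𝕫 𝕫' l L) (h : d + l = d') : RightOrder.{y} 𝕏 𝕫' 𝕨 d' b (postF L G) := by
  intro Y _ _ 𝕐 u j r s hu hj hs e a f hf hfa
  exact hG Y 𝕐 u (j ∘ₗ L) (l + r) s hu (hj.comp hL rfl) (by rw [← hs, ← h, add_assoc]) e a f hf hfa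

theorem RightOrder.of_tends {G : ℕ → Fam C X Z} {l : Fam C X Z} (hG : ∀ m, IsFam 𝕏 𝕫 d (G m))
    (hl : IsFam 𝕏 𝕫 d l) (h : Tends 𝕫 G l) (hb : ∀ᶠ m in atTop, RightOrder.{y} 𝕏 𝕫 𝕨 d b (G m)) :
    RightOrder.{y} 𝕏 𝕫 𝕨 d b l := by
  intro Y _ _ 𝕐 u j r s hu hj hs e a f hf hfa
  refine Order.of_tends (Tends.sstar (s := s) (fun _ => hf) hf
    (fun m => ((hG m).pre hu).post hj rfl) ((hl.pre hu).post hj rfl) (Tends.const f)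
    ((h.pre u).post hj)) ?_
  filter_upwards [hb] with m hm
  exact hm Y 𝕐 u j r s hu hj hs e a f hf hfa

theorem comp_cons {p : ℕ} {α β : Type*} (w : α → β) (a : α) (z : Fin p → α) :
    (fun j => w ((Fin.cons a z : Fin (p + 1) → α) j)) = Fin.cons (w a) fun j => w (z j) := by
  funext j
  refine Fin.cases ?_ (fun j => ?_) j <;> simp

theorem map_cons_zero {p : ℕ} {M : MultilinearMap k (fun _ : Fin (p + 1) => X) Z} (z : Fin p → X) :
    M (Fin.cons 0 z) = 0 := M.map_coord_zero 0 rfl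

/-- Orders add up under composition. The inputs of the third factor are separated from those of the
second one by an auxiliary product, so that only one of the terms of the pre-Lie identity
survives. -/
theorem RightOrder.sstar [CharZero k] {X : Type y} [AddCommGroup X] [Module k X]
    {𝕏 : CompleteComplex k X} {d₂ : ℤ} {s₂ : ℕ} (hs₂ : (d₂ : ZMod 2) = s₂) {G : Fam C X Z}
    {φ : Fam C X X} (hG : RightOrder.{y} 𝕏 𝕫 𝕨 d b G) (hφ : RightOrder.{y} 𝕏 𝕏 𝕨 d₂ c φ)
    (hG' : IsFam 𝕏 𝕫 d G) (hφ' : IsFam 𝕏 𝕏 d₂ φ) (h : d + d₂ = d') :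
    RightOrder.{y} 𝕏 𝕫 𝕨 d' (b + c) (sstar 𝕏 𝕫 s₂ G φ) := by
  intro Y _ _ 𝕐 u j r s hu hj hs e a f hf hfa
  obtain ⟨s₁, hs₁⟩ : ∃ s₁ : ℕ, ((d + r : ℤ) : ZMod 2) = s₁ := ⟨((d + r : ℤ) : ZMod 2).val, by simp⟩
  let 𝕐' := 𝕐.prod 𝕏
  let w : Y × X →ₗ[k] X := u ∘ₗ LinearMap.fst k Y X + LinearMap.snd k Y X
  have hw : IsMap 𝕐' 𝕏 0 w := (hu.comp isMap_fst rfl).add isMap_snd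
  have hu' : IsMap 𝕐' 𝕏 0 (u ∘ₗ LinearMap.fst k Y X) := hu.comp isMap_fst rfl
  have hj' : IsMap 𝕫 𝕐' r (LinearMap.inl k Y X ∘ₗ j) := isMap_inl.comp hj (add_zero r)
  have hf₁ : IsFam 𝕐' 𝕨 e (preF (LinearMap.fst k Y X) f) := hf.pre isMap_fst
  have hG₁ := (hG'.pre hw).post hj' rfl
  have hφ₁ := (hφ'.pre hu').post (isMap_inr (𝕏 := 𝕐)) (add_zero d₂)
  set f₁ := preF (LinearMap.fst k Y X) f
  set G₁ := postF (LinearMap.inl k Y X ∘ₗ j) (preF w G) with hG₁def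
  set φ₁ := postF (LinearMap.inr k Y X) (preF (u ∘ₗ LinearMap.fst k Y X) φ) with hφ₁def
  have h1 := hG (Y × X) 𝕐' w _ r s₁ hw hj' hs₁ e a f₁ hf₁ (hfa.pre isMap_fst)
  have h2 := hφ (Y × X) 𝕐' _ _ 0 s₂ hu' (isMap_inr (𝕏 := 𝕐)) (by rw [add_zero, hs₂]) _ (a + b) _
    (isFam_sstar s₁ hf₁ hG₁ rfl) h1
  -- `f₁` ignores the inputs from the second factor of `Y × X`, hence anything inserted there.
  have h0 : ∀ {t : ℕ} {v : ℤ} {g : Fam C (Y × X) X}, (∀ n, IsOp 𝕐' 𝕏 v (g n)) →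
      FilteredHTT.sstar 𝕐' 𝕨 t f₁ (postF (LinearMap.inr k Y X) g) = 0 := by
    intro t v g hg
    refine sstar_eq_zero hf₁.op (fun n => (hg n).post isMap_inr (add_zero v)) fun q p a b y z => ?_
    simp only [f₁, preF_apply, pre_apply]
    rw [comp_cons]
    simp only [postF_apply, post_apply, LinearMap.inr_apply, LinearMap.fst_apply]
    exact map_cons_zero _
  have hpl := sstar_preLie hs₁ hs₂ hf₁ hG₁ hφ₁
  rw [h0 (hφ'.pre hu').op, sstar_zero_left hG₁.op, hφ₁def, sstar_post isMap_inr (hφ'.pre hu').op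
    hG₁.op, h0 (isFam_sstar s₁ (hφ'.pre hu') hG₁ rfl).op, sub_zero, smul_zero, sub_eq_zero,
    ← hφ₁def] at hpl
  rw [hpl, add_assoc] at h2
  have h3 := h2.pre (isMap_inl (𝕏 := 𝕐) (𝕐 := 𝕏))
  have e1 : preF (LinearMap.inl k Y X) (FilteredHTT.sstar 𝕐' 𝕫 s₂ (preF w G) φ₁) =
      preF u (FilteredHTT.sstar 𝕏 𝕫 s₂ G φ) := by
    refine sstar_congr_pre isMap_inl hu (hG'.pre hw).op hG'.op hφ₁.op hφ'.op
      fun q p a b y z => ?_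
    simp only [preF_apply, pre_apply]
    rw [comp_cons]
    simp [w, φ₁]
  have hGφ := isFam_sstar s₂ hG' hφ' rfl
  have e2 : preF (LinearMap.inl k Y X) (FilteredHTT.sstar 𝕐' 𝕨 (s₁ + s₂) f₁
      (FilteredHTT.sstar 𝕐' 𝕐' s₂ G₁ φ₁)) = preF LinearMap.id (FilteredHTT.sstar 𝕐 𝕨 (s₁ + s₂) f
        (postF j (preF u (FilteredHTT.sstar 𝕏 𝕫 s₂ G φ)))) := by
    refine sstar_congr_pre isMap_inl isMap_id hf₁.op hf.op (isFam_sstar s₂ hG₁ hφ₁ rfl).op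
      ((hGφ.pre hu).post hj rfl).op fun q p a b y z => ?_
    rw [← e1, hG₁def, sstar_post hj' (hG'.pre hw).op hφ₁.op]
    simp only [f₁, preF_apply, pre_apply, postF_apply, post_apply]
    rw [comp_cons]
    simp
  rw [e2] at h3
  rw [sstar_parity (s := s) (s' := s₁ + s₂)]
  · exact h3
  · rw [← hs, Nat.cast_add, ← hs₁, ← hs₂, ← h]
    push_cast
    ring

/-- Over a conilpotent cooperad, a family of infinite order annihilates all families from the right.
-/
theorem sstar_eq_zero_of_rightOrder (hC : C.IsConilpotent) {Y : Type y} [AddCommGroup Y]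
    [Module k Y] {𝕐 : CompleteComplex k Y} {G : Fam C X Z}
    (hG : ∀ b, RightOrder.{y} 𝕏 𝕫 𝕨 d b G) {u : Y →ₗ[k] X} {j : Z →ₗ[k] Y} {r : ℤ} {s : ℕ}
    (hu : IsMap 𝕐 𝕏 0 u) (hj : IsMap 𝕫 𝕐 r j) (hs : ((d + r : ℤ) : ZMod 2) = s) {e : ℤ}
    {f : Fam C Y W} (hf : IsFam 𝕐 𝕨 e f) :
    FilteredHTT.sstar 𝕐 𝕨 s f (postF j (preF u G)) = 0 :=
  eq_zero_of_order (𝕏 := 𝕐) (𝕫 := 𝕨) hC fun m => by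
    have := hG m Y 𝕐 u j r s hu hj hs e 0 f hf hf.order_zero
    rwa [zero_add] at this

end RightOrder

/-! ### The differential of the convolution complex -/

section Differential

variable {k : Type*} [Field k] {C : CompleteCooperad k} {X X' Z Z' : Type*} [AddCommGroup X]
  [Module k X] [AddCommGroup Z] [Module k Z] [AddCommGroup X'] [Module k X'] [AddCommGroup Z']
  [Module k Z'] {𝕏 : CompleteComplex k X} {𝕏' : CompleteComplex k X'} {𝕫 : CompleteComplex k Z}
  {𝕫' : CompleteComplex k Z'} {n p q : ℕ} {u v : ℤ}

/-- A multilinear map as a linear map in its first argument. -/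
def consL (M : MultilinearMap k (fun _ : Fin (p + 1) => X) Z) (z : Fin p → X) : X →ₗ[k] Z where
  toFun a := M (Fin.cons a z)
  map_add' a b := M.cons_add z a b
  map_smul' r a := M.cons_smul z r a

theorem consL_apply (M : MultilinearMap k (fun _ : Fin (p + 1) => X) Z) (z : Fin p → X) (a : X) :
    consL M z a = M (Fin.cons a z) := rfl

/-- The argument maps of the `j`-th summand of `∑ ± 1 ⊗ ⋯ ⊗ d ⊗ ⋯ ⊗ 1`. -/
def dSlot (𝕏 : CompleteComplex k X) (j i : Fin n) : X →ₗ[k] X :=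
  if i < j then 𝕏.sgn else if i = j then 𝕏.d else LinearMap.id

/-- The operation `± F ∘ d`, where `d` acts on the parameter and on the arguments of `F`; on
homogeneous elements, the sign is that of moving `d` to its place from the left. -/
def dArg (𝕏 : CompleteComplex k X) : Op C n X Z →ₗ[k] Op C n X Z where
  toFun F := F ∘ₗ (C.cx n).d + ∑ j : Fin n,
    MultilinearMap.compLinearMapₗ (dSlot 𝕏 j) ∘ₗ F ∘ₗ (C.cx n).sgn
  map_add' F G := by
    refine LinearMap.ext fun c => MultilinearMap.ext fun x => ?_
    simp only [LinearMap.add_comp, LinearMap.comp_add, LinearMap.add_apply,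
      Finset.sum_add_distrib]
    abel_nf
  map_smul' r F := by
    simp only [LinearMap.smul_comp, LinearMap.comp_smul, RingHom.id_apply, smul_add,
      Finset.smul_sum]

theorem dArg_apply (F : Op C n X Z) (c : C.obj n) (x : Fin n → X) :
    dArg 𝕏 F c x = F ((C.cx n).d c) x +
      ∑ j, F ((C.cx n).sgn c) (fun i => dSlot 𝕏 j i (x i)) := by
  simp only [dArg, LinearMap.coe_mk, AddHom.coe_mk, LinearMap.add_apply, LinearMap.sum_apply,
    add_apply, sum_apply]
  rfl

theorem MultilinearMap.map_signs (M : MultilinearMap k (fun _ : Fin n => X) Z)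
    (s : Finset (Fin n)) (e : Fin n → ZMod 2) (x : Fin n → X) :
    M (fun i => if i ∈ s then sg k (e i) • x i else x i) = sg k (∑ i ∈ s, e i) • M x := by
  have h := M.map_piecewise_smul (fun i => sg k (e i)) x s
  rw [sg_sum, ← h]
  rfl

theorem dArg_of_deg (F : Op C n X Z) (c : C.obj n) {t : Fin n → ℤ} {x : Fin n → X}
    (hx : ∀ j, x j ∈ 𝕏.deg (t j)) :
    dArg 𝕏 F c x = F ((C.cx n).d c) x + ∑ j, sg k (∑ i with i < j, (t i : ZMod 2)) •
      F ((C.cx n).sgn c) (Function.update x j (𝕏.d (x j))) := by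
  rw [dArg_apply]
  congr 1
  refine Finset.sum_congr rfl fun j _ => ?_
  rw [← MultilinearMap.map_signs]
  congr 1
  ext i
  unfold dSlot
  rcases lt_trichotomy i j with h | h | h
  · simp [h, h.ne, 𝕏.sgn_of_deg (hx i)]
  · subst h; simp
  · simp [h.not_gt, h.ne']

theorem update_d_mem {t : Fin n → ℤ} {x : Fin n → X} (hx : ∀ j, x j ∈ 𝕏.deg (t j)) (j i : Fin n) :
    Function.update x j (𝕏.d (x j)) i ∈ 𝕏.deg (Function.update t j (t j + 1) i) := by
  by_cases h : i = j
  · subst h; simpa using 𝕏.d_deg _ _ (hx i)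
  · simpa [h] using hx i

theorem sum_update_add (t : Fin n → ℤ) (j : Fin n) (m : ℤ) :
    ∑ i, Function.update t j (t j + m) i = ∑ i, t i + m := by
  rw [Finset.sum_update_of_mem (Finset.mem_univ j), ← Finset.sum_erase_add _ _ (Finset.mem_univ j),
    Finset.sdiff_singleton_eq_erase]
  ring

theorem IsOp.dArg {F : Op C n X Z} (hF : IsOp 𝕏 𝕫 u F) (hv : u + 1 = v) :
    IsOp 𝕏 𝕫 v (dArg 𝕏 F) := by
  subst hv
  constructor
  · intro e c hc t x hx
    rw [dArg_of_deg _ _ hx]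
    refine Submodule.add_mem _ ?_ (Submodule.sum_mem _ fun j _ => Submodule.smul_mem _ _ ?_)
    · convert hF.deg _ _ ((C.cx n).d_deg e c hc) t x hx using 2; ring
    · convert hF.deg _ _ ((C.cx n).sgn_deg hc) _ _ (update_d_mem hx j) using 2
      rw [sum_update_add]; ring
  · intro p c hc w x hx
    rw [dArg_apply]
    refine Submodule.add_mem _ (hF.fil _ _ ((C.cx n).d_fil p c hc) w x hx)
      (Submodule.sum_mem _ fun j _ => hF.fil _ _ ((C.cx n).sgn_fil hc) w _ fun i => ?_)
    unfold dSlot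
    split_ifs
    exacts [𝕏.sgn_fil (hx i), 𝕏.d_fil _ _ (hx i), hx i]

theorem act_sgn (ρ : Equiv.Perm (Fin n)) (c : C.obj n) :
    C.act n ρ ((C.cx n).sgn c) = (C.cx n).sgn (C.act n ρ c) := by
  simpa using act_sgn_pow n 1 ρ c

theorem perm_dArg (ρ : Equiv.Perm (Fin n)) (F : Op C n X Z) :
    perm 𝕏 ρ (dArg 𝕏 F) = dArg 𝕏 (perm 𝕏 ρ F) := by
  refine Op.ext_deg 𝕏 fun c t x hx => ?_
  rw [perm_of_deg _ _ _ hx, dArg_of_deg _ _ (comp_mem 𝕏.deg hx ρ), dArg_of_deg _ _ hx, smul_add,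
    perm_of_deg _ _ _ hx, C.act_d, Finset.smul_sum,
    ← Equiv.sum_comp ρ fun j => sg k (∑ i with i < j, (t i : ZMod 2)) • _]
  congr 1
  refine Finset.sum_congr rfl fun j _ => ?_
  rw [perm_of_deg _ _ _ (update_d_mem hx (ρ j)), act_sgn, smul_smul, smul_smul, ← sg_add, ← sg_add]
  congr 2
  · have := kosExp_update ρ (fun i => (t i : ZMod 2)) j 1
    have e : (fun i => ((Function.update t (ρ j) (t (ρ j) + 1) i : ℤ) : ZMod 2)) =
        Function.update (fun i => (t i : ZMod 2)) (ρ j) (t (ρ j) + 1) := by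
      ext i; by_cases h : i = ρ j
      · subst h; simp
      · simp [h]
    rw [e, this]
    have h2 : ∀ a : ZMod 2, a + a = 0 := by decide
    simp only [Function.comp_apply]
    linear_combination (-1 : ZMod 2) * h2 (∑ i with i < ρ j, (t i : ZMod 2))
  · ext i
    by_cases h : i = j
    · subst h; simp
    · simp [h]

theorem dArg_post (L : Z →ₗ[k] Z') (F : Op C n X Z) : dArg 𝕏 (post L F) = post L (dArg 𝕏 F) := by
  refine LinearMap.ext fun c => MultilinearMap.ext fun x => ?_
  rw [post_apply, dArg_apply, dArg_apply, map_add, map_sum]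
  rfl

theorem dArg_pre {w : X' →ₗ[k] X} (hw : IsMap 𝕏' 𝕏 0 w) (hd : ∀ x, w (𝕏'.d x) = 𝕏.d (w x))
    (F : Op C n X Z) : dArg 𝕏' (pre w F) = pre w (dArg 𝕏 F) := by
  refine Op.ext_deg 𝕏' fun c t x hx => ?_
  rw [pre_apply, dArg_of_deg _ _ hx, dArg_of_deg _ _ fun j => hw.deg_zero (hx j), pre_apply]
  congr 1
  refine Finset.sum_congr rfl fun j _ => ?_
  rw [pre_apply]
  congr 2
  ext i
  by_cases h : i = j
  · subst h; simp [hd]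
  · simp [h]

theorem sum_lt_hd (h : q + p = n) (f : Fin n → ZMod 2) (j : Fin q) :
    ∑ i with i < (⟨j, by omega⟩ : Fin n), f i = ∑ i with i < j, hd h f i := by
  rw [Finset.sum_filter, sum_split h, Finset.sum_filter]
  have : ∑ i : Fin p, tl h (fun a => if a < (⟨j, by omega⟩ : Fin n) then f a else 0) i = 0 :=
    Finset.sum_eq_zero fun i _ => if_neg (by rw [Fin.mk_lt_mk]; omega)
  rw [this, add_zero]
  rfl

theorem sum_lt_tl (h : q + p = n) (f : Fin n → ZMod 2) (j : Fin p) :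
    ∑ i with i < (⟨q + j, by omega⟩ : Fin n), f i =
      ∑ i, hd h f i + ∑ i with i < j, tl h f i := by
  rw [Finset.sum_filter, sum_split h, Finset.sum_filter]
  congr 1
  · exact Finset.sum_congr rfl fun i _ => if_pos (by rw [Fin.mk_lt_mk]; omega)
  · refine Finset.sum_congr rfl fun i _ => ?_
    simp only [tl, add_lt_add_iff_left, Fin.lt_def]

theorem sum_lt_succ (a : ZMod 2) (f : Fin p → ZMod 2) (j : Fin p) :
    ∑ i with i < j.succ, (Fin.cons a f : Fin (p + 1) → ZMod 2) i = a + ∑ i with i < j, f i := by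
  rw [Finset.sum_filter, Fin.sum_univ_succ, Finset.sum_filter]
  simp

/-- The Leibniz rule for partial compositions. -/
theorem dArg_pc (h : q + p = n) {F : Op C (p + 1) X Z} {G : Op C q X X} (hF : IsOp 𝕏 𝕫 u F)
    (hG : IsOp 𝕏 𝕏 v G) (hv : (v : ZMod 2) = 0) :
    dArg 𝕏 (pc 𝕫 h 0 F G) =
      pc 𝕫 h 0 (dArg 𝕏 F) G - pc 𝕫 h 1 F (post 𝕏.d G - dArg 𝕏 G) := by
  have hd1 : IsMap 𝕏 𝕏 1 𝕏.d := ⟨𝕏.d_deg, 𝕏.d_fil⟩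
  have hbG : IsOp 𝕏 𝕏 (v + 1) (post 𝕏.d G - dArg 𝕏 G) := (hG.post hd1 rfl).sub (hG.dArg rfl)
  refine Op.ext_deg 𝕏 fun c t x hx => ?_
  rw [dArg_of_deg _ _ hx]
  have h1 := ((pc_spec h 0 hF hG ((C.cx n).d c) x).of_comp_arg (C.dec_d p q n h c)).add
    𝕫.fil_antitone (HasEval.sum 𝕫.fil_antitone Finset.univ fun j _ =>
      (((pc_spec h 0 hF hG ((C.cx n).sgn c)
        (Function.update x j (𝕏.d (x j)))).of_comp_arg (dec_sgn h c)).smul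
          (sg k (∑ i with i < j, (t i : ZMod 2)))))
  have h2 := (pc_spec h 0 (hF.dArg rfl) hG c x).sub 𝕫.fil_antitone (pc_spec h 1 hF hbG c x)
  refine h1.uniq 𝕫.fil_antitone 𝕫.fil_separated ?_
  change HasEval _ _ _ (pc 𝕫 h 0 (dArg 𝕏 F) G c x - pc 𝕫 h 1 F (post 𝕏.d G - dArg 𝕏 G) c x)
  convert h2 using 1
  refine tensor_ext_deg (C.cx (p + 1)) (C.cx q) fun m l a ha b hb => ?_
  have hy := cons_mem 𝕏.deg (hG.deg l b hb _ _ (hd_mem 𝕏.deg h hx)) (tl_mem 𝕏.deg h hx)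
  simp only [LinearMap.add_apply, LinearMap.sub_apply, LinearMap.sum_apply, LinearMap.smul_apply,
    LinearMap.comp_apply, evalAt_apply, tensorD, TensorProduct.map_tmul, LinearMap.id_apply,
    map_add, theta_tmul, pow_zero, Module.End.one_apply, pow_one]
  rw [dArg_of_deg _ _ hy, Fin.sum_univ_succ, sum_split h]
  simp only [← consL_apply]
  have e1 : ((post 𝕏.d G) b - (dArg 𝕏 G) b) (hd h x) = 𝕏.d (G b (hd h x)) -
      (G ((C.cx q).d b) (hd h x) + ∑ j, sg k (∑ i with i < j, ((hd h t i : ℤ) : ZMod 2)) •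
      G ((C.cx q).sgn b) (Function.update (hd h x) j (𝕏.d (hd h x j)))) := by
    rw [← dArg_of_deg _ _ (hd_mem 𝕏.deg h hx)]; rfl
  rw [e1, map_sub, map_add, map_sum]
  have e2 : ∀ j : Fin q, hd h (fun j => sg k (∑ i with i < j, (t i : ZMod 2)) •
      consL (F ((C.cx (p + 1)).sgn a)) (tl h (Function.update x j (𝕏.d (x j))))
        (G ((C.cx q).sgn b) (hd h (Function.update x j (𝕏.d (x j)))))) j =
      consL (F ((C.cx (p + 1)).sgn a)) (tl h x) (sg k (∑ i with i < j, ((hd h t i : ℤ) : ZMod 2)) •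
        G ((C.cx q).sgn b) (Function.update (hd h x) j (𝕏.d (hd h x j)))) := by
    intro j
    rw [map_smul]
    simp only [hd]
    rw [sum_lt_hd h (fun i => (t i : ZMod 2)) j, tl_update_lt]
    congr 3
    exact hd_update_lt h x j _
  have e3 : ∀ j : Fin p, tl h (fun j => sg k (∑ i with i < j, (t i : ZMod 2)) •
      consL (F ((C.cx (p + 1)).sgn a)) (tl h (Function.update x j (𝕏.d (x j))))
        (G ((C.cx q).sgn b) (hd h (Function.update x j (𝕏.d (x j)))))) j =
      sg k (∑ i with i < j.succ, ((Fin.cons (l + v + ∑ j, hd h t j) (tl h t) :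
        Fin (p + 1) → ℤ) i : ZMod 2)) • F ((C.cx (p + 1)).sgn a)
          (Function.update (Fin.cons (G b (hd h x)) (tl h x)) j.succ
            (𝕏.d ((Fin.cons (G b (hd h x)) (tl h x) : Fin (p + 1) → X) j.succ))) := by
    intro j
    have e : (fun i => ((Fin.cons (l + v + ∑ j, hd h t j) (tl h t) : Fin (p + 1) → ℤ) i : ZMod 2))
        = Fin.cons ((l + v + ∑ j, hd h t j : ℤ) : ZMod 2) fun i => ((tl h t i : ℤ) : ZMod 2) := by
      ext i; refine Fin.cases ?_ (fun i => ?_) i <;> simp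
    rw [e, sum_lt_succ]
    simp only [tl]
    rw [sum_lt_tl h (fun i => (t i : ZMod 2)) j]
    have e4 := hd_update_ge h x j (𝕏.d (x ⟨q + j, by omega⟩))
    have e5 := tl_update_ge h x j (𝕏.d (x ⟨q + j, by omega⟩))
    rw [e4, (C.cx q).sgn_of_deg hb, map_smul]
    change sg k _ • consL _ (tl h _) (sg k _ • G b (hd h x)) = _
    rw [map_smul, smul_smul, ← sg_add, e5, consL_apply, Fin.cons_update]
    simp only [Fin.cons_succ]
    congr 2
    push_cast
    rw [hv]
    simp only [hd, tl]
    ring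
  rw [Finset.sum_congr rfl fun j _ => e2 j, Finset.sum_congr rfl fun j _ => e3 j]
  simp only [consL_apply, Fin.update_cons_zero, Fin.cons_zero]
  have e6 : sg k (∑ i with i < (0 : Fin (p + 1)), ((Fin.cons (l + v + ∑ j, hd h t j) (tl h t) :
        Fin (p + 1) → ℤ) i : ZMod 2)) = 1 := by simp
  rw [e6, one_smul]
  abel

/-- `dArg` on families. -/
def dArgF (𝕏 : CompleteComplex k X) : Fam C X Z →ₗ[k] Fam C X Z where
  toFun f n := dArg 𝕏 (f n)
  map_add' f g := by funext n; simp
  map_smul' a f := by funext n; simp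

/-- The differential `∂f = d ∘ f - (-1)^s f ∘ d` of families of degree `s`. -/
def bd (𝕏 : CompleteComplex k X) (𝕫 : CompleteComplex k Z) (s : ZMod 2) :
    Fam C X Z →ₗ[k] Fam C X Z :=
  postF 𝕫.d - sg k s • dArgF 𝕏

theorem bd_zero (f : Fam C X Z) : bd 𝕏 𝕫 0 f = postF 𝕫.d f - dArgF 𝕏 f := by simp [bd]

theorem bd_one (f : Fam C X Z) : bd 𝕏 𝕫 1 f = postF 𝕫.d f + dArgF 𝕏 f := by simp [bd]

theorem isMap_d : IsMap 𝕏 𝕏 1 𝕏.d := ⟨𝕏.d_deg, 𝕏.d_fil⟩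

theorem IsFam.dArgF {f : Fam C X Z} (hf : IsFam 𝕏 𝕫 u f) (hv : u + 1 = v) :
    IsFam 𝕏 𝕫 v (dArgF 𝕏 f) :=
  ⟨fun n => (hf.op n).dArg hv, fun n ρ =>
    (perm_dArg ρ (f n)).trans (congrArg (dArg 𝕏) (hf.act n ρ))⟩

theorem IsFam.bd {f : Fam C X Z} (hf : IsFam 𝕏 𝕫 u f) (hv : u + 1 = v) (s : ZMod 2) :
    IsFam 𝕏 𝕫 v (bd 𝕏 𝕫 s f) :=
  (hf.post isMap_d hv).sub ((hf.dArgF hv).smul _)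

/-- On homogeneous elements, `bd` is the differential given by an explicit formula with signs. -/
theorem boundary_eq_bd (f : Fam C X Z) (s : ℤ) (n : ℕ) {e : ℤ} {c : C.obj n}
    (hc : c ∈ (C.cx n).deg e) {t : Fin n → ℤ} {x : Fin n → X} (hx : ∀ j, x j ∈ 𝕏.deg (t j)) :
    boundary C 𝕏 𝕫 s (fun n c x => f n c x) n e c t x = bd 𝕏 𝕫 s f n c x := by
  change _ = 𝕫.d (f n c x) - sg k (s : ZMod 2) • dArg 𝕏 (f n) c x
  rw [boundary, dArg_of_deg _ _ hx, smul_add, Finset.smul_sum, (C.cx n).sgn_of_deg hc]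
  simp only [negOnePow_smul (k := k), map_smul, smul_apply, smul_smul, Finset.smul_sum]
  push_cast
  simp only [sg_add]
  rw [sub_sub, add_comm]
  congr 2
  exact Finset.sum_congr rfl fun j _ => by congr 1; ring

/-- The part of the Leibniz rule in which `d` acts on the parameter and on the arguments. -/
theorem dArgF_sstar {f : Fam C X Z} {g : Fam C X X} (hf : IsFam 𝕏 𝕫 u f) (hg : IsFam 𝕏 𝕏 v g)
    (hv : (v : ZMod 2) = 0) :
    dArgF 𝕏 (sstar 𝕏 𝕫 0 f g) = sstar 𝕏 𝕫 0 (dArgF 𝕏 f) g - sstar 𝕏 𝕫 1 f (bd 𝕏 𝕏 0 g) := by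
  funext n
  change dArg 𝕏 (sstar 𝕏 𝕫 0 f g n) = _ - _
  simp only [sstar, map_sum, ← Finset.sum_sub_distrib]
  refine Finset.sum_congr rfl fun q _ => Finset.sum_congr rfl fun ρ _ => ?_
  rw [← perm_dArg, dArg_pc _ (hf.op _) (hg.op _) hv, map_sub, bd_zero]
  rfl

/-- The Leibniz rule for the convolution product of an odd and an even family. -/
theorem bd_one_sstar {f : Fam C X Z} {g : Fam C X X} (hf : IsFam 𝕏 𝕫 u f) (hg : IsFam 𝕏 𝕏 v g)
    (hv : (v : ZMod 2) = 0) :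
    bd 𝕏 𝕫 1 (sstar 𝕏 𝕫 0 f g) = sstar 𝕏 𝕫 0 (bd 𝕏 𝕫 1 f) g - sstar 𝕏 𝕫 1 f (bd 𝕏 𝕏 0 g) := by
  rw [bd_one, bd_one, dArgF_sstar hf hg hv, ← sstar_post isMap_d hf.op hg.op,
    sstar_add_left (hf.post isMap_d rfl).op (hf.dArgF rfl).op hg.op]
  abel

theorem bd_pre {w : X' →ₗ[k] X} (hw : IsMap 𝕏' 𝕏 0 w) (hd : ∀ x, w (𝕏'.d x) = 𝕏.d (w x))
    (s : ZMod 2) (f : Fam C X Z) : bd 𝕏' 𝕫 s (preF w f) = preF w (bd 𝕏 𝕫 s f) := by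
  have : dArgF 𝕏' (preF w f) = preF w (dArgF 𝕏 f) := funext fun n => dArg_pre hw hd (f n)
  simp only [bd, LinearMap.sub_apply, LinearMap.smul_apply, this, map_sub, map_smul]
  rfl

theorem dArgF_post (L : Z →ₗ[k] Z') (f : Fam C X Z) :
    dArgF 𝕏 (postF L f) = postF L (dArgF 𝕏 f) := funext fun n => dArg_post L (f n)

theorem bd_post {L : Z →ₗ[k] Z'} (hd : ∀ x, L (𝕫.d x) = 𝕫'.d (L x)) (s : ZMod 2) (f : Fam C X Z) :
    bd 𝕏 𝕫' s (postF L f) = postF L (bd 𝕏 𝕫 s f) := by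
  have : postF 𝕫'.d (postF L f) = postF L (postF 𝕫.d f) := by
    funext n
    exact LinearMap.ext fun c => MultilinearMap.ext fun x => (hd _).symm
  simp only [bd, LinearMap.sub_apply, LinearMap.smul_apply, this, map_sub, map_smul, dArgF_post]

theorem Tends.dArgF {f : ℕ → Fam C X Z} {l : Fam C X Z} (h : Tends 𝕫 f l) :
    Tends 𝕫 (fun m => dArgF 𝕏 (f m)) (dArgF 𝕏 l) := fun n c x N => by
  have : ∀ᶠ m in Filter.atTop, ∀ j : Fin n,
      l n ((C.cx n).sgn c) (fun i => dSlot 𝕏 j i (x i)) -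
        f m n ((C.cx n).sgn c) (fun i => dSlot 𝕏 j i (x i)) ∈ 𝕫.fil N :=
    Filter.eventually_all.2 fun j => h n _ _ N
  filter_upwards [this, h n ((C.cx n).d c) x N] with m h1 h2
  change FilteredHTT.dArg 𝕏 (l n) c x - FilteredHTT.dArg 𝕏 (f m n) c x ∈ 𝕫.fil N
  rw [dArg_apply, dArg_apply, add_sub_add_comm, ← Finset.sum_sub_distrib]
  exact Submodule.add_mem _ h2 (Submodule.sum_mem _ fun j _ => h1 j)

theorem Tends.bd_one {f : ℕ → Fam C X Z} {l : Fam C X Z} (h : Tends 𝕫 f l) :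
    Tends 𝕫 (fun m => bd 𝕏 𝕫 1 (f m)) (bd 𝕏 𝕫 1 l) := by
  simp only [FilteredHTT.bd_one]
  exact (h.post isMap_d).add h.dArgF

end Differential

/-! ### Exponentials of the right convolution action -/

section Exponential

open Filter

universe uV uW

variable {k : Type*} [Field k] {C : CompleteCooperad k} {V : Type uV} {W : Type uW}
  [AddCommGroup V] [Module k V] [AddCommGroup W] [Module k W] {𝕍 : CompleteComplex k V}
  {𝕎 : CompleteComplex k W} {u v : ℤ} {s : ℕ}

/-- An operation from `V` to `W`, considered as an operation on `V × W`. -/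
def lift : Fam C V W →ₗ[k] Fam C (V × W) (V × W) :=
  postF (LinearMap.inr k V W) ∘ₗ preF (LinearMap.fst k V W)

theorem lift_eq (f : Fam C V W) :
    lift f = postF (LinearMap.inr k V W) (preF (LinearMap.fst k V W) f) := rfl

theorem IsFam.lift {f : Fam C V W} (hf : IsFam 𝕍 𝕎 u f) :
    IsFam (𝕍.prod 𝕎) (𝕍.prod 𝕎) u (lift f) :=
  (hf.pre isMap_fst).post isMap_inr (add_zero u)

theorem IsFam.inr {f : Fam C (V × W) W} (hf : IsFam (𝕍.prod 𝕎) 𝕎 u f) :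
    IsFam (𝕍.prod 𝕎) (𝕍.prod 𝕎) u (postF (LinearMap.inr k V W) f) :=
  hf.post isMap_inr (add_zero u)

/-- Lifted operations have inputs from `V` only, so nothing with values in `W` can be inserted. -/
theorem lift_sstar_inr {f : Fam C V W} {g : Fam C (V × W) W} (hf : IsFam 𝕍 𝕎 u f)
    (hg : IsFam (𝕍.prod 𝕎) 𝕎 v g) (s : ℕ) :
    sstar (𝕍.prod 𝕎) (𝕍.prod 𝕎) s (lift f) (postF (LinearMap.inr k V W) g) = 0 := by
  refine sstar_eq_zero hf.lift.op hg.inr.op fun q p a b y z => ?_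
  change LinearMap.inr k V W (f (p + 1) a fun j => LinearMap.fst k V W _) = 0
  rw [comp_cons]
  simp only [postF_apply, post_apply, LinearMap.fst_apply, LinearMap.inr_apply, map_cons_zero]
  rfl

theorem lift_sstar_lift {f g : Fam C V W} (hf : IsFam 𝕍 𝕎 u f) (hg : IsFam 𝕍 𝕎 v g) (s : ℕ) :
    sstar (𝕍.prod 𝕎) (𝕍.prod 𝕎) s (lift f) (lift g) = 0 :=
  lift_sstar_inr hf (hg.pre isMap_fst) s

theorem bd_lift (s : ZMod 2) (f : Fam C V W) :
    bd (𝕍.prod 𝕎) (𝕍.prod 𝕎) s (lift f) = lift (bd 𝕍 𝕎 s f) := by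
  rw [lift_eq, bd_post (𝕫 := 𝕎) (fun x => Prod.ext (map_zero 𝕍.d).symm rfl),
    bd_pre isMap_fst (fun x => rfl), lift_eq]

/-- The terms `β ⋆ φ ⋆ ⋯ ⋆ φ / n!` of the exponential of the right action of `φ` on `β`. -/
def expTerm (𝕍 : CompleteComplex k V) (𝕎 : CompleteComplex k W) (β : Fam C (V × W) W)
    (φ : Fam C V W) : ℕ → Fam C (V × W) W
  | 0 => β
  | n + 1 => ((n + 1 : ℕ) : k)⁻¹ • sstar (𝕍.prod 𝕎) 𝕎 0 (expTerm 𝕍 𝕎 β φ n) (lift φ)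

variable {β : Fam C (V × W) W} {φ g : Fam C V W}

theorem expTerm_succ [CharZero k] (n : ℕ) :
    sstar (𝕍.prod 𝕎) 𝕎 0 (expTerm 𝕍 𝕎 β φ n) (lift φ) =
      ((n + 1 : ℕ) : k) • expTerm 𝕍 𝕎 β φ (n + 1) := by
  have : ((n + 1 : ℕ) : k) ≠ 0 := Nat.cast_ne_zero.2 n.succ_ne_zero
  rw [expTerm, smul_smul, mul_inv_cancel₀ this, one_smul]

/-- The terms of `Z ⋆ Z`, where `Z` is the exponential series. -/
def expSq (𝕍 : CompleteComplex k V) (𝕎 : CompleteComplex k W) (β : Fam C (V × W) W)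
    (φ : Fam C V W) (n : ℕ) : Fam C (V × W) W :=
  ∑ x ∈ Finset.HasAntidiagonal.antidiagonal n, sstar (𝕍.prod 𝕎) 𝕎 1 (expTerm 𝕍 𝕎 β φ x.1)
    (postF (LinearMap.inr k V W) (expTerm 𝕍 𝕎 β φ x.2))

/-- The Maurer-Cartan equation for `β`, as the initial term of `∂Z + Z ⋆ Z`. -/
theorem bd_expTerm_zero (hMC : bd (𝕍.prod 𝕎) 𝕎 1 β +
      sstar (𝕍.prod 𝕎) 𝕎 1 β (postF (LinearMap.inr k V W) β) = 0) :
    bd (𝕍.prod 𝕎) 𝕎 1 (expTerm 𝕍 𝕎 β φ 0) = -expSq 𝕍 𝕎 β φ 0 := by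
  rw [eq_neg_iff_add_eq_zero, expSq, Finset.Nat.antidiagonal_zero, Finset.sum_singleton]
  exact hMC

variable [CharZero k]

theorem IsFam.expTerm (hβ : IsFam (𝕍.prod 𝕎) 𝕎 u β) (hφ : IsFam 𝕍 𝕎 0 φ) (n : ℕ) :
    IsFam (𝕍.prod 𝕎) 𝕎 u (expTerm 𝕍 𝕎 β φ n) := by
  induction n with
  | zero => exact hβ
  | succ n ih => exact (isFam_sstar 0 ih hφ.lift (add_zero u)).smul _

theorem order_expTerm (hβ : IsFam (𝕍.prod 𝕎) 𝕎 u β) (hφ : IsFam 𝕍 𝕎 0 φ) (n : ℕ) :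
    Order (𝕍.prod 𝕎) 𝕎 n (expTerm 𝕍 𝕎 β φ n) := by
  induction n with
  | zero => exact hβ.order_zero
  | succ n ih => exact (ih.sstar 0 (hβ.expTerm hφ n).op hφ.lift.op).smul _

theorem rightOrder_expTerm (hβ : IsFam (𝕍.prod 𝕎) 𝕎 u β) (hφ : IsFam 𝕍 𝕎 0 φ) (n : ℕ) :
    RightOrder.{max uV uW} (𝕍.prod 𝕎) 𝕎 𝕎 u (n + 1) (expTerm 𝕍 𝕎 β φ n) := by
  induction n with
  | zero => exact hβ.rightOrder_one
  | succ n ih =>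
    exact (ih.sstar (s₂ := 0) (by simp) hφ.lift.rightOrder_one (hβ.expTerm hφ n) hφ.lift
      (add_zero u)).smul _ (isFam_sstar 0 (hβ.expTerm hφ n) hφ.lift (add_zero u))

/-- Right multiplication by a lifted operation commutes with the exponential. -/
theorem sstar_lift_comm (hβ : IsFam (𝕍.prod 𝕎) 𝕎 1 β) (hφ : IsFam 𝕍 𝕎 0 φ)
    (hg : IsFam 𝕍 𝕎 1 g) (n : ℕ) :
    sstar (𝕍.prod 𝕎) 𝕎 0 (sstar (𝕍.prod 𝕎) 𝕎 1 (expTerm 𝕍 𝕎 β φ n) (lift g)) (lift φ) =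
      ((n + 1 : ℕ) : k) • sstar (𝕍.prod 𝕎) 𝕎 1 (expTerm 𝕍 𝕎 β φ (n + 1)) (lift g) := by
  have hU := hβ.expTerm hφ n
  have h := sstar_preLie (s₁ := 1) (s₂ := 0) (d₁ := 1) (d₂ := 0) (by simp) (by simp) hU
    hg.lift hφ.lift
  rw [lift_sstar_lift hg hφ, lift_sstar_lift hφ hg, sstar_zero_right hU.op,
    sub_zero, sub_zero, expTerm_succ,
    sstar_smul_left _ (hβ.expTerm hφ (n + 1)).op hg.lift.op] at h
  rw [h]; simp

/-- The right action of `φ` on the terms of `Z ⋆ Z`. By the pre-Lie identity it is a derivation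
here, since nothing can be inserted in a lifted operation. -/
theorem expSq_sstar (hβ : IsFam (𝕍.prod 𝕎) 𝕎 1 β) (hφ : IsFam 𝕍 𝕎 0 φ) (n : ℕ) :
    sstar (𝕍.prod 𝕎) 𝕎 0 (expSq 𝕍 𝕎 β φ n) (lift φ) =
      ((n + 1 : ℕ) : k) • expSq 𝕍 𝕎 β φ (n + 1) := by
  have hU := hβ.expTerm hφ
  set G : ℕ → ℕ → Fam C (V × W) W := fun i j => sstar (𝕍.prod 𝕎) 𝕎 1 (expTerm 𝕍 𝕎 β φ i)
    (postF (LinearMap.inr k V W) (expTerm 𝕍 𝕎 β φ j)) with hG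
  have key : ∀ i j, sstar (𝕍.prod 𝕎) 𝕎 0 (G i j) (lift φ) =
      ((j + 1 : ℕ) : k) • G i (j + 1) + ((i + 1 : ℕ) : k) • G (i + 1) j := by
    intro i j
    have h := sstar_preLie (s₁ := 1) (s₂ := 0) (d₁ := 1) (d₂ := 0) (by simp) (by simp) (hU i)
      (hU j).inr hφ.lift
    rw [lift_sstar_inr hφ (hU j), sstar_zero_right (hU i).op, sub_zero,
      sstar_post isMap_inr (hU j).op hφ.lift.op, expTerm_succ, expTerm_succ, map_smul,
      sstar_smul_left _ (hU _).op (hU _).inr.op, sstar_smul_right _ (hU _).op (hU _).inr.op] at h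
    rw [eq_comm, ← eq_sub_iff_add_eq', eq_comm]
    simpa using h
  have h1 := Finset.Nat.sum_antidiagonal_succ (n := n) (f := fun x => (x.1 : k) • G x.1 x.2)
  have h2 := Finset.Nat.sum_antidiagonal_succ' (n := n) (f := fun x => (x.2 : k) • G x.1 x.2)
  simp only [Nat.cast_zero, zero_smul, zero_add] at h1 h2
  have h3 : ((n + 1 : ℕ) : k) • expSq 𝕍 𝕎 β φ (n + 1) =
      ∑ x ∈ Finset.HasAntidiagonal.antidiagonal (n + 1),
        ((x.1 : k) • G x.1 x.2 + (x.2 : k) • G x.1 x.2) := by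
    rw [expSq, Finset.smul_sum]
    refine Finset.sum_congr rfl fun x hx => ?_
    rw [← add_smul, ← Finset.HasAntidiagonal.mem_antidiagonal.1 hx, Nat.cast_add]
  rw [h3, Finset.sum_add_distrib, h1, h2, ← Finset.sum_add_distrib, expSq,
    sstar_sum_left _ (fun x _ => isFam_sstar 1 (hU _) (hU _).inr rfl) hφ.lift]
  refine Finset.sum_congr rfl fun x _ => ?_
  rw [key, add_comm]

theorem IsFam.expSq (hβ : IsFam (𝕍.prod 𝕎) 𝕎 1 β) (hφ : IsFam 𝕍 𝕎 0 φ) (n : ℕ) :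
    IsFam (𝕍.prod 𝕎) 𝕎 2 (expSq 𝕍 𝕎 β φ n) :=
  IsFam.sum _ fun _ _ => isFam_sstar 1 (hβ.expTerm hφ _) (hβ.expTerm hφ _).inr rfl

/-- The homogeneous parts of the equation `∂Z = - Z ⋆ Z - Z ⋆ ∂φ` for the exponential series `Z`. -/
theorem bd_expTerm_succ (hβ : IsFam (𝕍.prod 𝕎) 𝕎 1 β) (hφ : IsFam 𝕍 𝕎 0 φ)
    (hMC : bd (𝕍.prod 𝕎) 𝕎 1 β +
      sstar (𝕍.prod 𝕎) 𝕎 1 β (postF (LinearMap.inr k V W) β) = 0) (n : ℕ) :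
    bd (𝕍.prod 𝕎) 𝕎 1 (expTerm 𝕍 𝕎 β φ (n + 1)) = -expSq 𝕍 𝕎 β φ (n + 1) -
      sstar (𝕍.prod 𝕎) 𝕎 1 (expTerm 𝕍 𝕎 β φ n) (lift (bd 𝕍 𝕎 0 φ)) := by
  have hn : ∀ n : ℕ, ((n + 1 : ℕ) : k) ≠ 0 := fun n => Nat.cast_ne_zero.2 n.succ_ne_zero
  have hU := hβ.expTerm hφ
  have hQ := hβ.expSq hφ
  have hd : IsFam 𝕍 𝕎 1 (bd 𝕍 𝕎 0 φ) := hφ.bd rfl 0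
  have hl : ∀ n, bd (𝕍.prod 𝕎) 𝕎 1 (sstar (𝕍.prod 𝕎) 𝕎 0 (expTerm 𝕍 𝕎 β φ n) (lift φ)) =
      sstar (𝕍.prod 𝕎) 𝕎 0 (bd (𝕍.prod 𝕎) 𝕎 1 (expTerm 𝕍 𝕎 β φ n)) (lift φ) -
      sstar (𝕍.prod 𝕎) 𝕎 1 (expTerm 𝕍 𝕎 β φ n) (lift (bd 𝕍 𝕎 0 φ)) := by
    intro n
    rw [bd_one_sstar (hU n) hφ.lift (by simp), bd_lift]
  have hneg : ∀ n, sstar (𝕍.prod 𝕎) 𝕎 0 (-expSq 𝕍 𝕎 β φ n) (lift φ) =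
      -(((n + 1 : ℕ) : k) • expSq 𝕍 𝕎 β φ (n + 1)) := by
    intro n
    rw [← Fam.neg_one_smul, sstar_smul_left _ (hQ n).op hφ.lift.op, expSq_sstar hβ hφ,
      Fam.neg_one_smul]
  have fin : ∀ n, ((n + 1 : ℕ) : k) • bd (𝕍.prod 𝕎) 𝕎 1 (expTerm 𝕍 𝕎 β φ (n + 1)) =
      ((n + 1 : ℕ) : k) • (-expSq 𝕍 𝕎 β φ (n + 1) -
      sstar (𝕍.prod 𝕎) 𝕎 1 (expTerm 𝕍 𝕎 β φ n) (lift (bd 𝕍 𝕎 0 φ))) →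
      bd (𝕍.prod 𝕎) 𝕎 1 (expTerm 𝕍 𝕎 β φ (n + 1)) = -expSq 𝕍 𝕎 β φ (n + 1) -
      sstar (𝕍.prod 𝕎) 𝕎 1 (expTerm 𝕍 𝕎 β φ n) (lift (bd 𝕍 𝕎 0 φ)) := by
    intro n h
    have := congrArg (fun f : Fam C (V × W) W => ((n + 1 : ℕ) : k)⁻¹ • f) h
    simpa only [smul_smul, inv_mul_cancel₀ (hn n), one_smul] using this
  induction n with
  | zero =>
    refine fin 0 ?_
    rw [← map_smul, ← expTerm_succ, hl, bd_expTerm_zero hMC, hneg]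
    simp only [zero_add, Nat.cast_one, one_smul]
  | succ n ih =>
    refine fin (n + 1) ?_
    have h1 : IsFam (𝕍.prod 𝕎) 𝕎 2 (sstar (𝕍.prod 𝕎) 𝕎 1 (expTerm 𝕍 𝕎 β φ n)
      (lift (bd 𝕍 𝕎 0 φ))) := isFam_sstar 1 (hU n) hd.lift rfl
    rw [← map_smul, ← expTerm_succ, hl, ih, sstar_sub_left (hQ _).neg.op h1.op hφ.lift.op, hneg,
      sstar_lift_comm hβ hφ hd, smul_sub, sub_sub]
    congr 1
    · funext n
      exact LinearMap.ext fun c => MultilinearMap.ext fun x => (smul_neg _ _).symm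
    · push_cast
      rw [add_smul ((n : k) + 1), one_smul]

end Exponential

/-! ### The exponential series -/

section ExpSeries

open Filter

universe uV uW

variable {k : Type*} [Field k] {C : CompleteCooperad k} {V : Type uV} {W : Type uW}
  [AddCommGroup V] [Module k V] [AddCommGroup W] [Module k W] {𝕍 : CompleteComplex k V}
  {𝕎 : CompleteComplex k W} {u v : ℤ} {s : ℕ} {β : Fam C (V × W) W} {φ : Fam C V W}

/-- The partial sums of the exponential series. -/
def expPart (𝕍 : CompleteComplex k V) (𝕎 : CompleteComplex k W) (β : Fam C (V × W) W)
    (φ : Fam C V W) (m : ℕ) : Fam C (V × W) W :=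
  ∑ n ∈ Finset.range m, expTerm 𝕍 𝕎 β φ n

open Classical in
/-- The sum of the exponential series `∑ β ⋆ φ ⋆ ⋯ ⋆ φ / n!`, or zero if the series does not
converge to an equivariant filtered family. If `β` is the operation `base i α` on `V × W`, its
restriction to inputs from `V` is the total composition of `α` with `i + φ`. -/
def expSum (𝕍 : CompleteComplex k V) (𝕎 : CompleteComplex k W) (β : Fam C (V × W) W)
    (φ : Fam C V W) : Fam C (V × W) W :=
  if h : ∃ l, IsFam (𝕍.prod 𝕎) 𝕎 1 l ∧ Tends 𝕎 (expPart 𝕍 𝕎 β φ) l then h.choose else 0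

theorem expPart_succ (m : ℕ) :
    expPart 𝕍 𝕎 β φ (m + 1) = expPart 𝕍 𝕎 β φ m + expTerm 𝕍 𝕎 β φ m :=
  Finset.sum_range_succ _ _

theorem sum_range_mul_range {M : Type*} [AddCommMonoid M] (m : ℕ) (f : ℕ → ℕ → M) :
    ∑ i ∈ Finset.range m, ∑ j ∈ Finset.range m, f i j =
      ∑ n ∈ Finset.range m, ∑ x ∈ Finset.HasAntidiagonal.antidiagonal n, f x.1 x.2 +
      ∑ x ∈ Finset.range m ×ˢ Finset.range m with m ≤ x.1 + x.2, f x.1 x.2 := by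
  rw [← Finset.sum_product', ← Finset.sum_filter_not_add_sum_filter _ (fun x => m ≤ x.1 + x.2)]
  congr 1
  rw [← Finset.sum_fiberwise_of_maps_to (t := Finset.range m) (g := fun x => x.1 + x.2)]
  · refine Finset.sum_congr rfl fun n hn => Finset.sum_congr ?_ fun _ _ => rfl
    ext x
    simp only [Finset.mem_filter, Finset.mem_product, Finset.mem_range,
      Finset.HasAntidiagonal.mem_antidiagonal] at hn ⊢
    omega
  · intro x hx
    simp only [Finset.mem_filter, Finset.mem_product, Finset.mem_range] at hx ⊢
    omega

/-- A limit does not change under modifications whose order tends to infinity. -/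
theorem Tends.congr_order {X Z : Type*} [AddCommGroup X] [Module k X] [AddCommGroup Z] [Module k Z]
    {𝕏 : CompleteComplex k X} {𝕫 : CompleteComplex k Z} (hC : C.IsConilpotent)
    {f g : ℕ → Fam C X Z} {l : Fam C X Z}
    (h : Tends 𝕫 f l) (H : ∀ m, Order 𝕏 𝕫 m (f m - g m)) : Tends 𝕫 g l := fun n c x N => by
  filter_upwards [h n c x N, eventually_mem_of_order hC H n c x N] with m h1 h2
  have := Submodule.add_mem _ h1 h2
  change l n c x - f m n c x + (f m n c x - g m n c x) ∈ 𝕫.fil N at this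
  simpa using this

variable {α : Fam C W W} {i : V →ₗ[k] W} {a : Fam C V V}

/-- An operation on `V`, considered as an operation on `V × W`. -/
def liftV : Fam C V V →ₗ[k] Fam C (V × W) (V × W) :=
  postF (LinearMap.inl k V W) ∘ₗ preF (LinearMap.fst k V W)

theorem IsFam.liftV (ha : IsFam 𝕍 𝕍 u a) :
    IsFam (𝕍.prod 𝕎) (𝕍.prod 𝕎) u (liftV a) :=
  (ha.pre isMap_fst).post isMap_inl (add_zero u)

theorem liftV_sstar_lift (ha : IsFam 𝕍 𝕍 u a) (hφ : IsFam 𝕍 𝕎 v φ) (s : ℕ) :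
    sstar (𝕍.prod 𝕎) (𝕍.prod 𝕎) s (liftV a) (lift φ) = 0 := by
  refine sstar_eq_zero ha.liftV.op hφ.lift.op fun q p a' b y z => ?_
  change LinearMap.inl k V W (a (p + 1) a' fun j => LinearMap.fst k V W _) = 0
  rw [comp_cons]
  simp only [lift_eq, postF_apply, post_apply, LinearMap.fst_apply, LinearMap.inr_apply,
    map_cons_zero]
  rfl

theorem lift_sstar_liftV (ha : IsFam 𝕍 𝕍 u a) (hφ : IsFam 𝕍 𝕎 v φ) (s : ℕ) :
    sstar (𝕍.prod 𝕎) (𝕍.prod 𝕎) s (lift φ) (liftV a) = lift (sstar 𝕍 𝕎 s φ a) := by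
  rw [lift_eq, sstar_post isMap_inr (hφ.pre isMap_fst).op ha.liftV.op, lift_eq]
  congr 1
  refine sstar_congr_pre (w₁ := LinearMap.id) isMap_id isMap_fst (hφ.pre isMap_fst).op hφ.op
    ha.liftV.op ha.op fun q p a' b y z => ?_
  rw [preF_apply, pre_apply, comp_cons]
  rfl

/-- The operation `(v_1 + w_1, …) ↦ α(i v_1 + w_1, …)`. -/
def base (i : V →ₗ[k] W) (α : Fam C W W) : Fam C (V × W) W :=
  preF (LinearMap.coprod i LinearMap.id) α

theorem isMap_coprod (hi : IsMap 𝕍 𝕎 0 i) :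
    IsMap (𝕍.prod 𝕎) 𝕎 0 (LinearMap.coprod i LinearMap.id) := by
  have := (hi.comp (isMap_fst (𝕏 := 𝕍) (𝕐 := 𝕎)) (add_zero 0)).add (isMap_snd (𝕏 := 𝕍) (𝕐 := 𝕎))
  convert this using 1
  ext x <;> simp

theorem IsFam.base (hα : IsFam 𝕎 𝕎 u α) (hi : IsMap 𝕍 𝕎 0 i) :
    IsFam (𝕍.prod 𝕎) 𝕎 u (base i α) := hα.pre (isMap_coprod hi)

/-- As `base i α` maps inputs from `V` to `W` by `i`, inserting `a` in an input from `V` is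
inserting `i a` in an input from `W`. -/
theorem base_sstar_liftV (hα : IsFam 𝕎 𝕎 u α) (hi : IsMap 𝕍 𝕎 0 i) (ha : IsFam 𝕍 𝕍 v a) :
    sstar (𝕍.prod 𝕎) 𝕎 s (base i α) (liftV a) =
      sstar (𝕍.prod 𝕎) 𝕎 s (base i α) (lift (postF i a)) := by
  have hia : IsFam 𝕍 𝕎 v (postF i a) := ha.post hi (add_zero v)
  refine sstar_congr_pre (w₁ := LinearMap.id) (w₂ := LinearMap.id) isMap_id isMap_id
    (hα.base hi).op (hα.base hi).op ha.liftV.op hia.lift.op fun q p a' b y z => ?_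
  simp only [base, preF_apply, pre_apply]
  rw [comp_cons, comp_cons]
  congr 2
  simp [liftV, lift]

/-- The Maurer-Cartan equation is inherited by the operation on `V × W`. -/
theorem base_MC (hα : IsFam 𝕎 𝕎 1 α) (hi : IsMap 𝕍 𝕎 0 i) (hd : ∀ x, i (𝕍.d x) = 𝕎.d (i x))
    (hMC : bd 𝕎 𝕎 1 α + sstar 𝕎 𝕎 1 α α = 0) :
    bd (𝕍.prod 𝕎) 𝕎 1 (base i α) +
      sstar (𝕍.prod 𝕎) 𝕎 1 (base i α) (postF (LinearMap.inr k V W) (base i α)) = 0 := by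
  have h : sstar (𝕍.prod 𝕎) 𝕎 1 (base i α) (postF (LinearMap.inr k V W) (base i α)) =
      preF (LinearMap.coprod i LinearMap.id) (sstar 𝕎 𝕎 1 α α) := by
    refine sstar_congr_pre (w₁ := LinearMap.id) isMap_id (isMap_coprod hi)
      (hα.base hi).op hα.op (hα.base hi).inr.op hα.op fun q p a' b y z => ?_
    simp only [base, preF_apply, pre_apply, LinearMap.id_apply]
    rw [comp_cons]
    congr 2
    simp
  rw [h]
  have h2 : bd (𝕍.prod 𝕎) 𝕎 1 (base i α) = preF (LinearMap.coprod i LinearMap.id) (bd 𝕎 𝕎 1 α) :=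
    bd_pre (isMap_coprod hi) (fun x => by
      simp only [LinearMap.coprod_apply, LinearMap.id_apply, map_add, ← hd]; rfl) _ _
  rw [h2, ← map_add, hMC, map_zero]

/-- The initial term of the identity in `expSum_sstar_liftV`. -/
theorem expTerm_zero_sstar_liftV (hα : IsFam 𝕎 𝕎 1 α) (hi : IsMap 𝕍 𝕎 0 i) (ha : IsFam 𝕍 𝕍 1 a) :
    sstar (𝕍.prod 𝕎) 𝕎 1 (expTerm 𝕍 𝕎 (base i α) φ 0) (liftV a) =
      sstar (𝕍.prod 𝕎) 𝕎 1 (expTerm 𝕍 𝕎 (base i α) φ 0) (lift (postF i a)) :=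
  base_sstar_liftV hα hi ha

variable [CharZero k]

theorem IsFam.expPart (hβ : IsFam (𝕍.prod 𝕎) 𝕎 u β) (hφ : IsFam 𝕍 𝕎 0 φ) (n : ℕ) :
    IsFam (𝕍.prod 𝕎) 𝕎 u (expPart 𝕍 𝕎 β φ n) :=
  IsFam.sum _ fun n _ => hβ.expTerm hφ n

theorem expSum_spec (hC : C.IsConilpotent) (hβ : IsFam (𝕍.prod 𝕎) 𝕎 1 β) (hφ : IsFam 𝕍 𝕎 0 φ) :
    IsFam (𝕍.prod 𝕎) 𝕎 1 (expSum 𝕍 𝕎 β φ) ∧ Tends 𝕎 (expPart 𝕍 𝕎 β φ) (expSum 𝕍 𝕎 β φ) := by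
  have h : ∃ l, IsFam (𝕍.prod 𝕎) 𝕎 1 l ∧ Tends 𝕎 (expPart 𝕍 𝕎 β φ) l := by
    refine exists_tends (fun m => hβ.expPart hφ m) fun n c x N => ?_
    filter_upwards [eventually_mem_of_order hC (order_expTerm hβ hφ) n c x N] with m hm
    rw [expPart_succ]
    change expPart 𝕍 𝕎 β φ m n c x + expTerm 𝕍 𝕎 β φ m n c x - expPart 𝕍 𝕎 β φ m n c x ∈ 𝕎.fil N
    rwa [add_sub_cancel_left]
  rw [expSum, dif_pos h]
  exact h.choose_spec

theorem IsFam.expSum (hC : C.IsConilpotent) (hβ : IsFam (𝕍.prod 𝕎) 𝕎 1 β)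
    (hφ : IsFam 𝕍 𝕎 0 φ) : IsFam (𝕍.prod 𝕎) 𝕎 1 (expSum 𝕍 𝕎 β φ) := (expSum_spec hC hβ hφ).1

theorem tends_expPart (hC : C.IsConilpotent) (hβ : IsFam (𝕍.prod 𝕎) 𝕎 1 β)
    (hφ : IsFam 𝕍 𝕎 0 φ) : Tends 𝕎 (expPart 𝕍 𝕎 β φ) (expSum 𝕍 𝕎 β φ) := (expSum_spec hC hβ hφ).2

/-- The Cauchy product of the exponential series with itself converges to `Z ⋆ Z`: the terms that
are missing from the product of the partial sums have large order. -/
theorem tends_expSq (hC : C.IsConilpotent) (hβ : IsFam (𝕍.prod 𝕎) 𝕎 1 β) (hφ : IsFam 𝕍 𝕎 0 φ) :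
    Tends 𝕎 (fun m => ∑ n ∈ Finset.range m, expSq 𝕍 𝕎 β φ n)
      (sstar (𝕍.prod 𝕎) 𝕎 1 (expSum 𝕍 𝕎 β φ)
        (postF (LinearMap.inr k V W) (expSum 𝕍 𝕎 β φ))) := by
  have hT := tends_expPart hC hβ hφ
  have hZ := hβ.expSum hC hφ
  refine Tends.congr_order (𝕏 := 𝕍.prod 𝕎) hC (Tends.sstar (s := 1) (fun m => hβ.expPart hφ m) hZ
    (fun m => (hβ.expPart hφ m).inr) hZ.inr hT (hT.post isMap_inr)) fun m => ?_
  have e : sstar (𝕍.prod 𝕎) 𝕎 1 (expPart 𝕍 𝕎 β φ m)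
      (postF (LinearMap.inr k V W) (expPart 𝕍 𝕎 β φ m)) =
      ∑ i ∈ Finset.range m, ∑ j ∈ Finset.range m, sstar (𝕍.prod 𝕎) 𝕎 1 (expTerm 𝕍 𝕎 β φ i)
        (postF (LinearMap.inr k V W) (expTerm 𝕍 𝕎 β φ j)) := by
    conv_lhs => rw [expPart]
    rw [sstar_sum_left _ (fun i _ => hβ.expTerm hφ i) (IsFam.inr (IsFam.sum _
      fun i _ => hβ.expTerm hφ i))]
    refine Finset.sum_congr rfl fun i _ => ?_
    rw [map_sum, sstar_sum_right _ (hβ.expTerm hφ i) fun j _ => (hβ.expTerm hφ j).inr]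
  rw [e, sum_range_mul_range]
  simp only [expSq]
  rw [add_sub_cancel_left]
  refine Order.sum _ fun x hx => ?_
  simp only [Finset.mem_filter] at hx
  have := rightOrder_expTerm hβ hφ x.2 _ (𝕍.prod 𝕎) LinearMap.id (LinearMap.inr k V W) 0 1
    isMap_id isMap_inr (by simp) 1 x.1 (expTerm 𝕍 𝕎 β φ x.1) (hβ.expTerm hφ x.1)
    (order_expTerm hβ hφ x.1)
  exact this.mono (by omega)

/-- The Maurer-Cartan equation is preserved by the exponential, up to the differential of `φ`. -/
theorem bd_expSum (hC : C.IsConilpotent) (hβ : IsFam (𝕍.prod 𝕎) 𝕎 1 β) (hφ : IsFam 𝕍 𝕎 0 φ)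
    (hMC : bd (𝕍.prod 𝕎) 𝕎 1 β +
      sstar (𝕍.prod 𝕎) 𝕎 1 β (postF (LinearMap.inr k V W) β) = 0) :
    bd (𝕍.prod 𝕎) 𝕎 1 (expSum 𝕍 𝕎 β φ) =
      -sstar (𝕍.prod 𝕎) 𝕎 1 (expSum 𝕍 𝕎 β φ)
        (postF (LinearMap.inr k V W) (expSum 𝕍 𝕎 β φ)) -
      sstar (𝕍.prod 𝕎) 𝕎 1 (expSum 𝕍 𝕎 β φ) (lift (bd 𝕍 𝕎 0 φ)) := by
  have hT := tends_expPart hC hβ hφ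
  have hZ := hβ.expSum hC hφ
  have hd : IsFam (𝕍.prod 𝕎) (𝕍.prod 𝕎) 1 (lift (bd 𝕍 𝕎 0 φ)) := (hφ.bd rfl 0).lift
  have e : ∀ m, bd (𝕍.prod 𝕎) 𝕎 1 (expPart 𝕍 𝕎 β φ (m + 1)) =
      -(∑ n ∈ Finset.range (m + 1), expSq 𝕍 𝕎 β φ n) -
      sstar (𝕍.prod 𝕎) 𝕎 1 (expPart 𝕍 𝕎 β φ m) (lift (bd 𝕍 𝕎 0 φ)) := by
    intro m
    induction m with
    | zero =>
      rw [expPart_succ, map_add, bd_expTerm_zero hMC, expPart, Finset.sum_range_zero,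
        sstar_zero_left hd.op, map_zero, zero_add, sub_zero, Finset.sum_range_one]
    | succ m ih =>
      rw [expPart_succ, map_add, ih, bd_expTerm_succ hβ hφ hMC, Finset.sum_range_succ _ (m + 1),
        expPart_succ m, sstar_add_left (hβ.expPart hφ m).op (hβ.expTerm hφ m).op hd.op]
      abel
  refine (hT.bd_one (𝕏 := 𝕍.prod 𝕎)).comp_succ.unique ?_
  simp only [e]
  exact (tends_expSq hC hβ hφ).comp_succ.neg.sub (Tends.sstar (fun m => hβ.expPart hφ m) hZ
    (fun _ => hd) hd hT (Tends.const _))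

/-- The homogeneous parts of the identity in `expSum_sstar_liftV`. -/
theorem expTerm_succ_sstar_liftV (hα : IsFam 𝕎 𝕎 1 α) (hi : IsMap 𝕍 𝕎 0 i) (ha : IsFam 𝕍 𝕍 1 a)
    (hφ : IsFam 𝕍 𝕎 0 φ) (n : ℕ) :
    sstar (𝕍.prod 𝕎) 𝕎 1 (expTerm 𝕍 𝕎 (base i α) φ (n + 1)) (liftV a) =
      sstar (𝕍.prod 𝕎) 𝕎 1 (expTerm 𝕍 𝕎 (base i α) φ (n + 1)) (lift (postF i a)) +
      sstar (𝕍.prod 𝕎) 𝕎 1 (expTerm 𝕍 𝕎 (base i α) φ n) (lift (sstar 𝕍 𝕎 1 φ a)) := by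
  have hβ : IsFam (𝕍.prod 𝕎) 𝕎 1 (base i α) := hα.base hi
  have hU := hβ.expTerm hφ
  have hia : IsFam 𝕍 𝕎 1 (postF i a) := ha.post hi rfl
  have hφa : IsFam 𝕍 𝕎 1 (sstar 𝕍 𝕎 1 φ a) := isFam_sstar 1 hφ ha rfl
  have step : ∀ n, ((n + 1 : ℕ) : k) • sstar (𝕍.prod 𝕎) 𝕎 1
      (expTerm 𝕍 𝕎 (base i α) φ (n + 1)) (liftV a) =
      sstar (𝕍.prod 𝕎) 𝕎 0 (sstar (𝕍.prod 𝕎) 𝕎 1 (expTerm 𝕍 𝕎 (base i α) φ n) (liftV a)) (lift φ) +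
      sstar (𝕍.prod 𝕎) 𝕎 1 (expTerm 𝕍 𝕎 (base i α) φ n) (lift (sstar 𝕍 𝕎 1 φ a)) := by
    intro n
    have h := sstar_preLie (s₁ := 0) (s₂ := 1) (d₁ := 0) (d₂ := 1) (by simp) (by simp) (hU n)
      hφ.lift (ha.liftV (𝕎 := 𝕎))
    rw [liftV_sstar_lift ha hφ, sstar_zero_right (hU n).op, sub_zero, lift_sstar_liftV ha hφ,
      expTerm_succ, sstar_smul_left _ (hU _).op ha.liftV.op, sub_eq_iff_eq_add] at h
    simpa using h
  have fin : ∀ n {A : Fam C (V × W) W}, ((n + 1 : ℕ) : k) • sstar (𝕍.prod 𝕎) 𝕎 1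
      (expTerm 𝕍 𝕎 (base i α) φ (n + 1)) (liftV a) = ((n + 1 : ℕ) : k) • A →
      sstar (𝕍.prod 𝕎) 𝕎 1 (expTerm 𝕍 𝕎 (base i α) φ (n + 1)) (liftV a) = A := by
    intro n A h
    have := congrArg (fun f : Fam C (V × W) W => ((n + 1 : ℕ) : k)⁻¹ • f) h
    have hn : ((n + 1 : ℕ) : k) ≠ 0 := Nat.cast_ne_zero.2 n.succ_ne_zero
    simpa only [smul_smul, inv_mul_cancel₀ hn, one_smul] using this
  induction n with
  | zero =>
    refine fin 0 ?_
    rw [step, expTerm_zero_sstar_liftV hα hi ha, sstar_lift_comm hβ hφ hia]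
    simp only [zero_add, Nat.cast_one, one_smul]
  | succ n ih =>
    refine fin (n + 1) ?_
    have h1 : IsFam (𝕍.prod 𝕎) 𝕎 2 (sstar (𝕍.prod 𝕎) 𝕎 1
      (expTerm 𝕍 𝕎 (base i α) φ (n + 1)) (lift (postF i a))) := isFam_sstar 1 (hU _) hia.lift rfl
    have h2 : IsFam (𝕍.prod 𝕎) 𝕎 2 (sstar (𝕍.prod 𝕎) 𝕎 1
      (expTerm 𝕍 𝕎 (base i α) φ n) (lift (sstar 𝕍 𝕎 1 φ a))) := isFam_sstar 1 (hU _) hφa.lift rfl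
    rw [step, ih, sstar_add_left h1.op h2.op hφ.lift.op, sstar_lift_comm hβ hφ hia,
      sstar_lift_comm hβ hφ hφa, smul_add, add_assoc]
    congr 1
    push_cast
    rw [add_smul ((n : k) + 1), one_smul]

/-- Inserting `a` in one of the inputs of the exponential series amounts to inserting it in a free
input or in an input of one of the `φ`. -/
theorem expSum_sstar_liftV (hC : C.IsConilpotent) (hα : IsFam 𝕎 𝕎 1 α) (hi : IsMap 𝕍 𝕎 0 i)
    (ha : IsFam 𝕍 𝕍 1 a) (hφ : IsFam 𝕍 𝕎 0 φ) :
    sstar (𝕍.prod 𝕎) 𝕎 1 (expSum 𝕍 𝕎 (base i α) φ) (liftV a) =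
      sstar (𝕍.prod 𝕎) 𝕎 1 (expSum 𝕍 𝕎 (base i α) φ)
        (lift (postF i a + sstar 𝕍 𝕎 1 φ a)) := by
  have hβ : IsFam (𝕍.prod 𝕎) 𝕎 1 (base i α) := hα.base hi
  have hT := tends_expPart hC hβ hφ
  have hZ := hβ.expSum hC hφ
  have hia : IsFam 𝕍 𝕎 1 (postF i a) := ha.post hi rfl
  have hφa : IsFam 𝕍 𝕎 1 (sstar 𝕍 𝕎 1 φ a) := isFam_sstar 1 hφ ha rfl
  have hP := hβ.expPart hφ
  have hU := hβ.expTerm hφ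
  rw [map_add, sstar_add_right hZ.op hia.lift.op hφa.lift.op]
  have e : ∀ m, sstar (𝕍.prod 𝕎) 𝕎 1 (expPart 𝕍 𝕎 (base i α) φ (m + 1)) (liftV a) =
      sstar (𝕍.prod 𝕎) 𝕎 1 (expPart 𝕍 𝕎 (base i α) φ (m + 1)) (lift (postF i a)) +
      sstar (𝕍.prod 𝕎) 𝕎 1 (expPart 𝕍 𝕎 (base i α) φ m) (lift (sstar 𝕍 𝕎 1 φ a)) := by
    intro m
    induction m with
    | zero =>
      rw [expPart_succ, expPart, Finset.sum_range_zero, zero_add,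
        expTerm_zero_sstar_liftV hα hi ha, sstar_zero_left hφa.lift.op, add_zero]
    | succ m ih =>
      rw [expPart_succ (m + 1), sstar_add_left (hP _).op (hU _).op ha.liftV.op,
        sstar_add_left (hP _).op (hU _).op hia.lift.op, ih, expTerm_succ_sstar_liftV hα hi ha hφ,
        expPart_succ m, sstar_add_left (hP m).op (hU m).op hφa.lift.op]
      abel
  refine (Tends.sstar hP hZ (fun _ => ha.liftV (𝕎 := 𝕎)) ha.liftV hT
    (Tends.const _)).comp_succ.unique ?_
  simp only [e]
  exact (Tends.sstar hP hZ (fun _ => hia.lift) hia.lift hT (Tends.const _)).comp_succ.add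
    (Tends.sstar hP hZ (fun _ => hφa.lift) hφa.lift hT (Tends.const _))

end ExpSeries

/-! ### The fixed point equation -/

section FixedPoint

open Filter

universe uV uW

variable {k : Type*} [Field k] {C : CompleteCooperad k} {V : Type uV} {W : Type uW}
  [AddCommGroup V] [Module k V] [AddCommGroup W] [Module k W] {𝕍 : CompleteComplex k V}
  {𝕎 : CompleteComplex k W} {u v : ℤ} {s b : ℕ} {β : Fam C (V × W) W} {φ φ' : Fam C V W}

theorem RightOrder.lift {f : Fam C V W} (hf : RightOrder.{max uV uW} 𝕍 𝕎 𝕎 u b f) :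
    RightOrder.{max uV uW} (𝕍.prod 𝕎) (𝕍.prod 𝕎) 𝕎 u b (lift f) :=
  (hf.pre isMap_fst).post isMap_inr (add_zero u)

variable [CharZero k]

/-- The recursion for the change of the terms of the exponential series when `φ` is changed. -/
theorem expTerm_succ_sub (hβ : IsFam (𝕍.prod 𝕎) 𝕎 1 β) (hφ : IsFam 𝕍 𝕎 0 φ)
    (hφ' : IsFam 𝕍 𝕎 0 φ') (n : ℕ) :
    expTerm 𝕍 𝕎 β φ' (n + 1) - expTerm 𝕍 𝕎 β φ (n + 1) = ((n + 1 : ℕ) : k)⁻¹ •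
      (sstar (𝕍.prod 𝕎) 𝕎 0 (expTerm 𝕍 𝕎 β φ' n - expTerm 𝕍 𝕎 β φ n) (lift φ') +
        sstar (𝕍.prod 𝕎) 𝕎 0 (expTerm 𝕍 𝕎 β φ n) (lift (φ' - φ))) := by
  rw [sstar_sub_left (hβ.expTerm hφ' n).op (hβ.expTerm hφ n).op hφ'.lift.op, map_sub,
    sstar_sub_right (hβ.expTerm hφ n).op hφ'.lift.op hφ.lift.op, sub_add_sub_cancel, smul_sub]
  rfl

theorem order_expTerm_sub (hβ : IsFam (𝕍.prod 𝕎) 𝕎 1 β) (hφ : IsFam 𝕍 𝕎 0 φ)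
    (hφ' : IsFam 𝕍 𝕎 0 φ') (hb : RightOrder.{max uV uW} 𝕍 𝕎 𝕎 0 b (φ' - φ)) (n : ℕ) :
    Order (𝕍.prod 𝕎) 𝕎 b (expTerm 𝕍 𝕎 β φ' n - expTerm 𝕍 𝕎 β φ n) := by
  induction n with
  | zero => rw [expTerm, expTerm, sub_self]; exact Order.zero b
  | succ n ih =>
    rw [expTerm_succ_sub hβ hφ hφ']
    refine Order.smul _ (Order.add ((ih.sstar 0 ((hβ.expTerm hφ' n).sub (hβ.expTerm hφ n)).op
      hφ'.lift.op).mono (Nat.le_succ b)) ?_)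
    have := hb _ (𝕍.prod 𝕎) (LinearMap.fst k V W) (LinearMap.inr k V W) 0 0 isMap_fst isMap_inr
      (by simp) 1 0 _ (hβ.expTerm hφ n) (hβ.expTerm hφ n).order_zero
    rwa [zero_add] at this

theorem rightOrder_expTerm_sub (hβ : IsFam (𝕍.prod 𝕎) 𝕎 1 β) (hφ : IsFam 𝕍 𝕎 0 φ)
    (hφ' : IsFam 𝕍 𝕎 0 φ') (hb : RightOrder.{max uV uW} 𝕍 𝕎 𝕎 0 b (φ' - φ)) (n : ℕ) :
    RightOrder.{max uV uW} (𝕍.prod 𝕎) 𝕎 𝕎 1 (b + 1)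
      (expTerm 𝕍 𝕎 β φ' n - expTerm 𝕍 𝕎 β φ n) := by
  induction n with
  | zero => rw [expTerm, expTerm, sub_self]; exact rightOrder_zero
  | succ n ih =>
    have h1 := (hβ.expTerm hφ' n).sub (hβ.expTerm hφ n)
    have h2 := hβ.expTerm hφ n
    have h3 : IsFam 𝕍 𝕎 0 (φ' - φ) := hφ'.sub hφ
    have i1 := isFam_sstar 0 h1 hφ'.lift (add_zero (1 : ℤ))
    have i2 := isFam_sstar 0 h2 h3.lift (add_zero (1 : ℤ))
    rw [expTerm_succ_sub hβ hφ hφ']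
    refine RightOrder.smul (RightOrder.add ?_ ?_ i1 i2) _ (i1.add i2)
    · exact (ih.sstar (s₂ := 0) (by simp) hφ'.lift.rightOrder_one h1 hφ'.lift
        (add_zero (1 : ℤ))).mono (by omega)
    · exact ((rightOrder_expTerm hβ hφ n).sstar (s₂ := 0) (by simp) hb.lift h2 h3.lift
        (add_zero (1 : ℤ))).mono (by omega)

theorem tends_expPart_sub (hC : C.IsConilpotent) (hβ : IsFam (𝕍.prod 𝕎) 𝕎 1 β)
    (hφ : IsFam 𝕍 𝕎 0 φ) (hφ' : IsFam 𝕍 𝕎 0 φ') :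
    Tends 𝕎 (fun m => ∑ n ∈ Finset.range m, (expTerm 𝕍 𝕎 β φ' n - expTerm 𝕍 𝕎 β φ n))
      (expSum 𝕍 𝕎 β φ' - expSum 𝕍 𝕎 β φ) := by
  simp only [Finset.sum_sub_distrib]
  exact (tends_expPart hC hβ hφ').sub (tends_expPart hC hβ hφ)

theorem order_expSum_sub (hC : C.IsConilpotent) (hβ : IsFam (𝕍.prod 𝕎) 𝕎 1 β)
    (hφ : IsFam 𝕍 𝕎 0 φ) (hφ' : IsFam 𝕍 𝕎 0 φ')
    (hb : RightOrder.{max uV uW} 𝕍 𝕎 𝕎 0 b (φ' - φ)) :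
    Order (𝕍.prod 𝕎) 𝕎 b (expSum 𝕍 𝕎 β φ' - expSum 𝕍 𝕎 β φ) :=
  Order.of_tends (tends_expPart_sub hC hβ hφ hφ') (.of_forall fun _ =>
    Order.sum _ fun n _ => order_expTerm_sub hβ hφ hφ' hb n)

theorem rightOrder_expSum_sub (hC : C.IsConilpotent) (hβ : IsFam (𝕍.prod 𝕎) 𝕎 1 β)
    (hφ : IsFam 𝕍 𝕎 0 φ) (hφ' : IsFam 𝕍 𝕎 0 φ')
    (hb : RightOrder.{max uV uW} 𝕍 𝕎 𝕎 0 b (φ' - φ)) :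
    RightOrder.{max uV uW} (𝕍.prod 𝕎) 𝕎 𝕎 1 (b + 1) (expSum 𝕍 𝕎 β φ' - expSum 𝕍 𝕎 β φ) :=
  have h1 := fun n => (hβ.expTerm hφ' n).sub (hβ.expTerm hφ n)
  RightOrder.of_tends (fun _ => IsFam.sum _ fun n _ => h1 n)
    ((hβ.expSum hC hφ').sub (hβ.expSum hC hφ)) (tends_expPart_sub hC hβ hφ hφ') (.of_forall fun _ =>
    RightOrder.sum _ (fun n _ => rightOrder_expTerm_sub hβ hφ hφ' hb n) fun n _ => h1 n)

/-- The operator `φ ↦ h ∘ (β ⊚ φ)`, whose fixed point is the sum over trees with all edges, the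
root included, labelled by `h`. -/
def treeStep (𝕍 : CompleteComplex k V) (𝕎 : CompleteComplex k W) (h : W →ₗ[k] W)
    (β : Fam C (V × W) W) (φ : Fam C V W) : Fam C V W :=
  postF h (preF (LinearMap.inl k V W) (expSum 𝕍 𝕎 β φ))

variable {h : W →ₗ[k] W}

theorem IsFam.treeStep (hC : C.IsConilpotent) (hβ : IsFam (𝕍.prod 𝕎) 𝕎 1 β)
    (hh : IsMap 𝕎 𝕎 (-1) h) (hφ : IsFam 𝕍 𝕎 0 φ) : IsFam 𝕍 𝕎 0 (treeStep 𝕍 𝕎 h β φ) :=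
  ((hβ.expSum hC hφ).pre isMap_inl).post hh (by norm_num)

/-- Changing `φ` by a family of order `b` as a second factor changes `treeStep` by a family of order
`b`. -/
theorem order_treeStep_sub (hC : C.IsConilpotent) (hβ : IsFam (𝕍.prod 𝕎) 𝕎 1 β)
    (hh : IsMap 𝕎 𝕎 (-1) h) (hφ : IsFam 𝕍 𝕎 0 φ) (hφ' : IsFam 𝕍 𝕎 0 φ')
    (hb : RightOrder.{max uV uW} 𝕍 𝕎 𝕎 0 b (φ' - φ)) :
    Order 𝕍 𝕎 b (treeStep 𝕍 𝕎 h β φ' - treeStep 𝕍 𝕎 h β φ) := by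
  rw [treeStep, treeStep, ← map_sub, ← map_sub]
  exact ((order_expSum_sub hC hβ hφ hφ' hb).pre isMap_inl).post hh

/-- With respect to orders as second factors, `treeStep` is a contraction. -/
theorem rightOrder_treeStep_sub (hC : C.IsConilpotent) (hβ : IsFam (𝕍.prod 𝕎) 𝕎 1 β)
    (hh : IsMap 𝕎 𝕎 (-1) h) (hφ : IsFam 𝕍 𝕎 0 φ) (hφ' : IsFam 𝕍 𝕎 0 φ')
    (hb : RightOrder.{max uV uW} 𝕍 𝕎 𝕎 0 b (φ' - φ)) :
    RightOrder.{max uV uW} 𝕍 𝕎 𝕎 0 (b + 1) (treeStep 𝕍 𝕎 h β φ' - treeStep 𝕍 𝕎 h β φ) := by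
  rw [treeStep, treeStep, ← map_sub, ← map_sub]
  exact ((rightOrder_expSum_sub hC hβ hφ hφ' hb).pre isMap_inl).post hh (by norm_num)

/-- The approximations of the fixed point of `treeStep`: the sums over the trees of bounded height.
-/
def treeApprox (𝕍 : CompleteComplex k V) (𝕎 : CompleteComplex k W) (h : W →ₗ[k] W)
    (β : Fam C (V × W) W) : ℕ → Fam C V W
  | 0 => 0
  | m + 1 => treeStep 𝕍 𝕎 h β (treeApprox 𝕍 𝕎 h β m)

theorem isFam_treeApprox (hC : C.IsConilpotent) (hβ : IsFam (𝕍.prod 𝕎) 𝕎 1 β)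
    (hh : IsMap 𝕎 𝕎 (-1) h) (m : ℕ) : IsFam 𝕍 𝕎 0 (treeApprox 𝕍 𝕎 h β m) := by
  induction m with
  | zero => exact IsFam.zero 0
  | succ m ih => exact IsFam.treeStep hC hβ hh ih

theorem rightOrder_treeApprox_succ_sub (hC : C.IsConilpotent) (hβ : IsFam (𝕍.prod 𝕎) 𝕎 1 β)
    (hh : IsMap 𝕎 𝕎 (-1) h) (m : ℕ) : RightOrder.{max uV uW} 𝕍 𝕎 𝕎 0 (m + 1)
      (treeApprox 𝕍 𝕎 h β (m + 1) - treeApprox 𝕍 𝕎 h β m) := by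
  have hf := isFam_treeApprox (𝕍 := 𝕍) hC hβ hh
  induction m with
  | zero => exact ((hf 1).sub (hf 0)).rightOrder_one
  | succ m ih => exact rightOrder_treeStep_sub hC hβ hh (hf m) (hf (m + 1)) ih

/-- `treeStep` has a fixed point, the limit of its iterates. -/
theorem exists_treeStep_eq (hC : C.IsConilpotent) (hβ : IsFam (𝕍.prod 𝕎) 𝕎 1 β)
    (hh : IsMap 𝕎 𝕎 (-1) h) : ∃ φ, IsFam 𝕍 𝕎 0 φ ∧ Tends 𝕎 (treeApprox 𝕍 𝕎 h β) φ ∧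
      treeStep 𝕍 𝕎 h β φ = φ := by
  have hf := isFam_treeApprox (𝕍 := 𝕍) hC hβ hh
  have hR := rightOrder_treeApprox_succ_sub (𝕍 := 𝕍) hC hβ hh
  have hO : ∀ m, Order 𝕍 𝕎 m (treeApprox 𝕍 𝕎 h β (m + 1) - treeApprox 𝕍 𝕎 h β m) := by
    intro m
    cases m with
    | zero => exact ((hf 1).sub (hf 0)).order_zero
    | succ m => exact order_treeStep_sub hC hβ hh (hf m) (hf (m + 1)) (hR m)
  obtain ⟨φ, hφ, hT⟩ := exists_tends hf (eventually_mem_of_order hC hO)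
  refine ⟨φ, hφ, hT, ?_⟩
  have hD : ∀ m, RightOrder.{max uV uW} 𝕍 𝕎 𝕎 0 (m + 1) (φ - treeApprox 𝕍 𝕎 h β m) := by
    intro m
    refine RightOrder.of_tends (fun l => (hf l).sub (hf m)) (hφ.sub (hf m))
      (hT.sub (Tends.const _)) ?_
    filter_upwards [eventually_ge_atTop m] with l hl
    induction l, hl using Nat.le_induction with
    | base => rw [sub_self]; exact rightOrder_zero
    | succ l hl ih =>
      rw [← sub_add_sub_cancel _ (treeApprox 𝕍 𝕎 h β l)]
      exact ((hR l).mono (by omega)).add ih ((hf _).sub (hf _)) ((hf _).sub (hf _))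
  refine Tends.unique (f := fun m => treeApprox 𝕍 𝕎 h β (m + 1)) ?_ hT.comp_succ
  exact tends_of_order hC fun m =>
    (order_treeStep_sub hC hβ hh (hf m) hφ (hD m)).mono (Nat.le_succ m)

end FixedPoint

/-! ### The transferred structure -/

section Transfer

universe uV uW

variable {k : Type*} [Field k] {C : CompleteCooperad k} {V : Type uV} {W : Type uW}
  [AddCommGroup V] [Module k V] [AddCommGroup W] [Module k W] {𝕍 : CompleteComplex k V}
  {𝕎 : CompleteComplex k W} {α : Fam C W W} {i : V →ₗ[k] W} {p : W →ₗ[k] V} {h : W →ₗ[k] W}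
  {φ : Fam C V W}

/-- If the free inputs are from `V`, the inputs of the inner operation are as well. -/
theorem preF_inl_sstar_inr {f g : Fam C (V × W) W} (hf : IsFam (𝕍.prod 𝕎) 𝕎 1 f)
    (hg : IsFam (𝕍.prod 𝕎) 𝕎 1 g) :
    preF (LinearMap.inl k V W) (sstar (𝕍.prod 𝕎) 𝕎 1 f (postF (LinearMap.inr k V W) g)) =
      preF (LinearMap.inl k V W) (sstar (𝕍.prod 𝕎) 𝕎 1 f
        (lift (preF (LinearMap.inl k V W) g))) :=
  sstar_congr_pre isMap_inl isMap_inl hf.op hf.op hg.inr.op (hg.pre isMap_inl).lift.op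
    fun _ _ _ _ _ _ => rfl

/-- The convolution product with an operation on `V`, computed on `V × W`. -/
theorem sstar_preF_inl {f : Fam C (V × W) W} {a : Fam C V V} (hf : IsFam (𝕍.prod 𝕎) 𝕎 1 f)
    (ha : IsFam 𝕍 𝕍 1 a) : sstar 𝕍 𝕎 1 (preF (LinearMap.inl k V W) f) a =
      preF (LinearMap.inl k V W) (sstar (𝕍.prod 𝕎) 𝕎 1 f (liftV a)) := by
  refine sstar_congr_pre (w₁ := LinearMap.id) isMap_id isMap_inl (hf.pre isMap_inl).op hf.op
    ha.op ha.liftV.op fun q p a b y z => ?_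
  rw [preF_apply, pre_apply, comp_cons]
  rfl

variable [CharZero k]

/-- The fixed point of `treeStep` solves the equation of an infinity-morphism, and `p` applied to
its total composition is a twisting morphism. -/
theorem transfer (hC : C.IsConilpotent) (hα : IsFam 𝕎 𝕎 1 α)
    (hMC : bd 𝕎 𝕎 1 α + sstar 𝕎 𝕎 1 α α = 0) (hi : IsMap 𝕍 𝕎 0 i) (hp : IsMap 𝕎 𝕍 0 p)
    (hh : IsMap 𝕎 𝕎 (-1) h) (hid : ∀ x, i (𝕍.d x) = 𝕎.d (i x)) (hpd : ∀ x, p (𝕎.d x) = 𝕍.d (p x))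
    (hht : ∀ x, i (p x) - x = 𝕎.d (h x) + h (𝕎.d x)) (hφ : IsFam 𝕍 𝕎 0 φ)
    (hfix : treeStep 𝕍 𝕎 h (base i α) φ = φ) {a : Fam C V V}
    (ha : a = postF p (preF (LinearMap.inl k V W) (expSum 𝕍 𝕎 (base i α) φ))) :
    bd 𝕍 𝕍 1 a + sstar 𝕍 𝕍 1 a a = 0 ∧
    preF (LinearMap.inl k V W) (expSum 𝕍 𝕎 (base i α) φ) =
      postF i a + sstar 𝕍 𝕎 1 φ a - bd 𝕍 𝕎 0 φ := by
  have hβ : IsFam (𝕍.prod 𝕎) 𝕎 1 (base i α) := hα.base hi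
  set Z := expSum 𝕍 𝕎 (base i α) φ with hZdef
  have hZ : IsFam (𝕍.prod 𝕎) 𝕎 1 Z := hβ.expSum hC hφ
  have hY : IsFam 𝕍 𝕎 1 (preF (LinearMap.inl k V W) Z) := hZ.pre isMap_inl
  have ha' : IsFam 𝕍 𝕍 1 a := by rw [ha]; exact hY.post hp rfl
  have hia : IsFam 𝕍 𝕎 1 (postF i a) := ha'.post hi rfl
  have hφa : IsFam 𝕍 𝕎 1 (sstar 𝕍 𝕎 1 φ a) := isFam_sstar 1 hφ ha' rfl
  have hbφ : IsFam 𝕍 𝕎 1 (bd 𝕍 𝕎 0 φ) := hφ.bd rfl 0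
  -- `e` is the defect of the equation of an infinity-morphism.
  obtain ⟨e, he⟩ : ∃ e, e = postF i a + sstar 𝕍 𝕎 1 φ a - bd 𝕍 𝕎 0 φ -
    preF (LinearMap.inl k V W) Z := ⟨_, rfl⟩
  have he' : IsFam 𝕍 𝕎 1 e := by rw [he]; exact ((hia.add hφa).sub hbφ).sub hY
  have hlast : ∀ {f g : Fam C V W}, IsFam 𝕍 𝕎 1 f → IsFam 𝕍 𝕎 1 g →
      sstar (𝕍.prod 𝕎) 𝕎 1 Z (lift (f - g)) =
        sstar (𝕍.prod 𝕎) 𝕎 1 Z (lift f) - sstar (𝕍.prod 𝕎) 𝕎 1 Z (lift g) := by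
    intro f g hf hg
    rw [map_sub, sstar_sub_right hZ.op hf.lift.op hg.lift.op]
  have hdZ : preF (LinearMap.inl k V W) (bd (𝕍.prod 𝕎) 𝕎 1 Z) =
      -preF (LinearMap.inl k V W) (sstar (𝕍.prod 𝕎) 𝕎 1 Z
        (lift (preF (LinearMap.inl k V W) Z))) -
      preF (LinearMap.inl k V W) (sstar (𝕍.prod 𝕎) 𝕎 1 Z (lift (bd 𝕍 𝕎 0 φ))) := by
    rw [← preF_inl_sstar_inr hZ hZ, hZdef, bd_expSum hC hβ hφ (base_MC hα hi hid hMC), map_sub,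
      map_neg]
  have hZa : sstar 𝕍 𝕎 1 (preF (LinearMap.inl k V W) Z) a =
      preF (LinearMap.inl k V W) (sstar (𝕍.prod 𝕎) 𝕎 1 Z
        (lift (postF i a + sstar 𝕍 𝕎 1 φ a))) := by
    rw [sstar_preF_inl hZ ha', hZdef, expSum_sstar_liftV hC hα hi ha' hφ]
  -- the deviation of `∂Z + Z ⋆ a` from zero is governed by the defect `e` of the equation
  have hsum : preF (LinearMap.inl k V W) (bd (𝕍.prod 𝕎) 𝕎 1 Z) +
      sstar 𝕍 𝕎 1 (preF (LinearMap.inl k V W) Z) a =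
      preF (LinearMap.inl k V W) (sstar (𝕍.prod 𝕎) 𝕎 1 Z (lift e)) := by
    rw [hdZ, hZa, he, hlast ((hia.add hφa).sub hbφ) hY, hlast (hia.add hφa) hbφ, map_sub, map_sub]
    abel
  have hfix' : φ = postF h (preF (LinearMap.inl k V W) Z) := hfix.symm
  have hinl : ∀ x, LinearMap.inl k V W (𝕍.d x) = (𝕍.prod 𝕎).d (LinearMap.inl k V W x) :=
    fun x => Prod.ext rfl (map_zero 𝕎.d).symm
  have hbd : bd 𝕍 𝕎 0 φ = postF i a - preF (LinearMap.inl k V W) Z -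
      postF h (preF (LinearMap.inl k V W) (bd (𝕍.prod 𝕎) 𝕎 1 Z)) := by
    have h1 : postF 𝕎.d (postF h (preF (LinearMap.inl k V W) Z)) =
        postF i a - preF (LinearMap.inl k V W) Z -
          postF h (postF 𝕎.d (preF (LinearMap.inl k V W) Z)) := by
      funext n
      refine LinearMap.ext fun c => MultilinearMap.ext fun x => ?_
      rw [ha]
      exact eq_sub_of_add_eq (hht (Z n c fun j => LinearMap.inl k V W (x j))).symm
    rw [← bd_pre isMap_inl hinl, bd_one, map_add]
    conv_lhs => rw [hfix', bd_zero, dArgF_post, h1]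
    abel
  have heq : e = postF h (preF (LinearMap.inl k V W) (sstar (𝕍.prod 𝕎) 𝕎 1 Z (lift e))) := by
    rw [← hsum, map_add, ← sstar_post hh hY.op ha'.op, ← hfix']
    conv_lhs => rw [he, hbd]
    abel
  -- The equation `heq` raises the order of `e`, which is therefore infinite.
  have hord : ∀ b, RightOrder.{max uV uW} 𝕍 𝕎 𝕎 1 b e := by
    intro b
    induction b with
    | zero => exact he'.rightOrder_one.mono (Nat.zero_le 1)
    | succ b ih =>
      rw [heq]
      have := (hZ.rightOrder_one (𝕨 := 𝕎)).sstar (s₂ := 1) (by simp) ih.lift hZ he'.lift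
        (show (1 : ℤ) + 1 = 2 by norm_num)
      exact ((this.pre isMap_inl).post hh (by norm_num)).mono (by omega)
  have hzero : sstar (𝕍.prod 𝕎) 𝕎 1 Z (lift e) = 0 :=
    sstar_eq_zero_of_rightOrder hC hord isMap_fst isMap_inr (by simp) hZ
  constructor
  · have h1 : bd 𝕍 𝕍 1 a = postF p (preF (LinearMap.inl k V W) (bd (𝕍.prod 𝕎) 𝕎 1 Z)) := by
      rw [ha, bd_post hpd, bd_pre isMap_inl hinl]
    have h2 : sstar 𝕍 𝕍 1 a a = postF p (sstar 𝕍 𝕎 1 (preF (LinearMap.inl k V W) Z) a) := by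
      rw [← sstar_post hp hY.op ha'.op, ← ha]
    rw [h1, h2, ← map_add, hsum, hzero, map_zero, map_zero]
  · have h0 : e = 0 := by rw [heq, hzero, map_zero, map_zero]
    rw [he] at h0
    exact (sub_eq_zero.1 h0).symm

end Transfer

/-! ### Linearity over `B` -/

section Linearity

open Filter

variable {k : Type*} [Field k] {C : CompleteCooperad k} {B : Type*} [Ring B] [Algebra k B]
  {𝔹 : GradedMixedCDGA k B} {X Z : Type*} [AddCommGroup X] [Module k X] [Module B X]
  [AddCommGroup Z] [Module k Z] [Module B Z]
  {𝕏 : CompleteComplex k X} {n p q : ℕ} {s : ℤ} {K : Submodule k Z}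

variable (𝔹 𝕏) in
/-- The operation `F` of degree `s` commutes with the action of `B` up to elements of `K`, at inputs
with property `R`. -/
def LinMod (K : Submodule k Z) (s : ℤ) (R : (Fin n → X) → Prop) (F : Op C n X Z) : Prop :=
  ∀ e, ∀ c ∈ (C.cx n).deg e, ∀ (t : Fin n → ℤ) (x : Fin n → X), (∀ j, x j ∈ 𝕏.deg (t j)) → R x →
    ∀ m, ∀ b ∈ 𝔹.deg m, ∀ j, F c (Function.update x j (b • x j)) -
      sg k ((m : ZMod 2) * (e + s + ∑ i with i < j, (t i : ZMod 2))) • b • F c x ∈ K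

variable {R R' : (Fin n → X) → Prop} {F G : Op C n X Z}

theorem LinMod.mono (hF : LinMod 𝔹 𝕏 K s R F) (h : ∀ x, R' x → R x) : LinMod 𝔹 𝕏 K s R' F :=
  fun e c hc t x hx hR => hF e c hc t x hx (h x hR)

theorem LinMod.zero : LinMod 𝔹 𝕏 K s R (0 : Op C n X Z) := fun e c _ t x _ _ m b _ j => by
  simp

theorem LinMod.add (hF : LinMod 𝔹 𝕏 K s R F) (hG : LinMod 𝔹 𝕏 K s R G) :
    LinMod 𝔹 𝕏 K s R (F + G) := fun e c hc t x hx hR m b hb j => by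
  have := K.add_mem (hF e c hc t x hx hR m b hb j) (hG e c hc t x hx hR m b hb j)
  change F c _ + G c _ - _ • b • (F c x + G c x) ∈ K
  rw [smul_add, smul_add]
  convert this using 1
  abel

theorem LinMod.sum {ι : Type*} (S : Finset ι) {F : ι → Op C n X Z}
    (hF : ∀ i ∈ S, LinMod 𝔹 𝕏 K s R (F i)) : LinMod 𝔹 𝕏 K s R (∑ i ∈ S, F i) :=
  Finset.sum_induction _ (LinMod 𝔹 𝕏 K s R) (fun _ _ => LinMod.add) LinMod.zero hF

variable [IsScalarTower k B Z]

theorem LinMod.smul (a : k) (hF : LinMod 𝔹 𝕏 K s R F) : LinMod 𝔹 𝕏 K s R (a • F) :=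
  fun e c hc t x hx hR m b hb j => by
    have := K.smul_mem a (hF e c hc t x hx hR m b hb j)
    change a • F c _ - _ • b • a • F c x ∈ K
    rw [smul_sub] at this
    rwa [smul_comm b a, smul_comm _ a]

theorem LinMod.of_tends {𝕫 : CompleteDGModule 𝔹 Z} {F : ℕ → Op C n X Z} {L : Op C n X Z}
    (hK : ∀ z, (∀ N, ∃ y ∈ K, z - y ∈ 𝕫.fil N) → z ∈ K) (h : TendsOp 𝕫.toCompleteComplex F L)
    (hF : ∀ m, LinMod 𝔹 𝕏 K s R (F m)) : LinMod 𝔹 𝕏 K s R L :=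
  fun e c hc t x hx hR m b hb j => by
    refine hK _ fun N => ?_
    obtain ⟨w, hw⟩ := 𝔹.fil_exhaustive b
    obtain ⟨l, h1, h2⟩ :=
      ((h c (Function.update x j (b • x j)) N).and (h c x (N - w))).exists
    refine ⟨_, hF l e c hc t x hx hR m b hb j, ?_⟩
    have h3 := 𝕫.smul_fil _ _ b hw _ h2
    rw [add_sub_cancel, smul_sub] at h3
    have := Submodule.sub_mem _ h1 (Submodule.smul_mem _
      (sg k ((m : ZMod 2) * (e + s + ∑ i with i < j, (t i : ZMod 2)))) h3)
    rw [smul_sub] at this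
    convert this using 1
    abel

/-- Linearity is preserved by permutations of the inputs. The Koszul sign accounts for the change of
the position in which `b` is inserted. -/
theorem LinMod.perm (hsm : ∀ m l, ∀ b ∈ 𝔹.deg m, ∀ x ∈ 𝕏.deg l, b • x ∈ 𝕏.deg (m + l))
    (ρ : Equiv.Perm (Fin n)) (hR : ∀ x, R x → R (x ∘ ρ)) (hF : LinMod 𝔹 𝕏 K s R F) :
    LinMod 𝔹 𝕏 K s R (perm 𝕏 ρ F) := fun e c hc t x hx hRx m b hb j => by
  obtain ⟨j, rfl⟩ := ρ.surjective j
  have hu : ∀ i, Function.update x (ρ j) (b • x (ρ j)) i ∈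
      𝕏.deg (Function.update t (ρ j) (t (ρ j) + m) i) := by
    intro i
    by_cases h : i = ρ j
    · subst h
      rw [Function.update_self, Function.update_self, add_comm]
      exact hsm _ _ b hb _ (hx _)
    · simpa [h] using hx i
  have h := hF e _ (C.act_deg n ρ e c hc) _ _ (comp_mem 𝕏.deg hx ρ) (hR x hRx) m b hb j
  rw [perm_of_deg _ _ _ hu, perm_of_deg _ _ _ hx]
  have e1 : (fun i => ((Function.update t (ρ j) (t (ρ j) + m) i : ℤ) : ZMod 2)) =
      Function.update (fun i => (t i : ZMod 2)) (ρ j) (t (ρ j) + m) := by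
    ext i; by_cases h : i = ρ j
    · subst h; simp
    · simp [h]
  have e2 : Function.update x (ρ j) (b • x (ρ j)) ∘ ρ =
      Function.update (x ∘ ρ) j (b • (x ∘ ρ) j) := by
    ext i
    by_cases h : i = j
    · subst h; simp
    · simp [h]
  have e3 := kosExp_update ρ (fun i => (t i : ZMod 2)) j m
  rw [e1, e2, e3]
  have h' := K.smul_mem (sg k ((kosExp ρ fun i => (t i : ZMod 2)) +
    (m * (∑ i with i < ρ j, (t i : ZMod 2)) + m * ∑ i with i < j, (t (ρ i) : ZMod 2)))) h
  rw [smul_sub, smul_smul, ← sg_add] at h'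
  rw [smul_comm b, smul_smul, ← sg_add]
  convert h' using 4
  simp only [Function.comp_apply]
  have h2 : ∀ a : ZMod 2, a + a = 0 := by decide
  linear_combination (-1 : ZMod 2) * h2 (m * ∑ i with i < j, (t (ρ i) : ZMod 2))

end Linearity

section LinearityTransfer

variable {k : Type*} [Field k] {C : CompleteCooperad k} {B : Type*} [Ring B] [Algebra k B]
  {𝔹 : GradedMixedCDGA k B} {V W : Type*} [AddCommGroup V] [Module k V] [Module B V]
  [IsScalarTower k B V] [AddCommGroup W] [Module k W] [Module B W] [IsScalarTower k B W]
  {𝕍 : CompleteDGModule 𝔹 V} {𝕎 : CompleteDGModule 𝔹 W} {n p q : ℕ} {s : ℤ} {K : Submodule k W}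

theorem smul_mem_prod (m l : ℤ) (b : B) (hb : b ∈ 𝔹.deg m) (x : V × W)
    (hx : x ∈ (𝕍.toCompleteComplex.prod 𝕎.toCompleteComplex).deg l) :
    b • x ∈ (𝕍.toCompleteComplex.prod 𝕎.toCompleteComplex).deg (m + l) :=
  ⟨𝕍.smul_deg m l b hb _ hx.1, 𝕎.smul_deg m l b hb _ hx.2⟩

/-- The inputs from `V × W` with second components in `K`. -/
def SndMem (K : Submodule k W) (x : Fin n → V × W) : Prop := ∀ j, (x j).2 ∈ K

/-- The inputs from `V × W` with second components in `K`, and with first component zero if there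
is only one input. -/
def SndMem' (K : Submodule k W) (x : Fin n → V × W) : Prop :=
  SndMem K x ∧ (n = 1 → ∀ j, (x j).1 = 0)

/-- Composition with a `B`-linear operation with values in `K`. The inner operation has its values
in `K` and, if `p = 0`, they are the only input of `F`, so the inputs of `F` satisfy `SndMem'`. -/
theorem LinMod.pc (h : q + p = n) {F : Op C (p + 1) (V × W) W} {φ : Fam C V W}
    (hKc : ∀ z, (∀ N, ∃ y ∈ K, z - y ∈ 𝕎.fil N) → z ∈ K)
    (hF : IsOp (𝕍.toCompleteComplex.prod 𝕎.toCompleteComplex) 𝕎.toCompleteComplex 1 F)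
    (hφ : IsFam 𝕍.toCompleteComplex 𝕎.toCompleteComplex 0 φ) (hφK : ∀ c x, φ q c x ∈ K)
    (hFl : LinMod 𝔹 (𝕍.toCompleteComplex.prod 𝕎.toCompleteComplex) K 1 (SndMem' K) F)
    (hφl : LinMod 𝔹 𝕍.toCompleteComplex ⊥ 0 (fun _ => True) (φ q)) :
    LinMod 𝔹 (𝕍.toCompleteComplex.prod 𝕎.toCompleteComplex) K 1 (SndMem K)
      (pc 𝕎.toCompleteComplex h 0 F (lift φ q)) := by
  intro e c hc t x hx hRx m b hb j
  set x' := Function.update x j (b • x j) with hx'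
  obtain ⟨s₁, h₁⟩ := pc_spec h 0 hF (hφ.lift.op q) c x'
  obtain ⟨s₂, h₂⟩ := pc_spec h 0 hF (hφ.lift.op q) c x
  obtain ⟨w, hw⟩ := 𝔹.fil_exhaustive b
  set σ : k := sg k ((m : ZMod 2) * (e + ((1 : ℤ) : ZMod 2) + ∑ i with i < j, (t i : ZMod 2)))
    with hσ
  refine hKc _ fun N => ?_
  obtain ⟨u, huD, hu⟩ := C.dec_deg p q n h e c hc (max (N - s₁) (N - w - s₂))
  refine ⟨theta h 0 F (lift φ q) u x' - σ • b • theta h 0 F (lift φ q) u x, ?_, ?_⟩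
  · suffices H : tensorSum (C.cx (p + 1)).deg (C.cx q).deg e ≤ K.comap
        (evalAt x' ∘ₗ theta h 0 F (lift φ q) -
          σ • (Algebra.lsmul k k W b ∘ₗ evalAt x ∘ₗ theta h 0 F (lift φ q))) from H huD
    refine tensorSum_le fun d a ha b' hb' => ?_
    have hy0 := (hφ.lift.op q).deg _ b' hb' _ _ (hd_mem _ h hx)
    have hy := cons_mem _ hy0 (tl_mem _ h hx)
    have hyR : SndMem' K (Fin.cons (lift φ q b' (hd h x)) (tl h x) : Fin (p + 1) → V × W) := by
      refine ⟨Fin.cases (hφK _ _) fun i => hRx _, fun hp => Fin.cases rfl fun i => ?_⟩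
      have := i.2
      omega
    change theta h 0 F (lift φ q) (a ⊗ₜ b') x' - σ • b • theta h 0 F (lift φ q) (a ⊗ₜ b') x ∈ K
    rw [theta_tmul, theta_tmul]
    simp only [pow_zero, Module.End.one_apply]
    have key := hFl d a ha _ _ hy hyR m b hb
    have hE : (e : ZMod 2) = d + ((e - d : ℤ) : ZMod 2) := by push_cast; ring
    clear_value x'
    revert j
    rw [forall_split h]
    refine ⟨fun j hx' hσ => ?_, fun j hx' hσ => ?_⟩
    · -- The element `b` is inserted in an input of the inner operation.
      have e1 : hd h x' = Function.update (hd h x) j (b • hd h x j) := by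
        rw [hx', hd_update_lt]; rfl
      have e2 : tl h x' = tl h x := by rw [hx', tl_update_lt]
      have e3 : lift φ q b' (hd h x') =
          sg k ((m : ZMod 2) * (((e - d : ℤ) : ZMod 2) + ((0 : ℤ) : ZMod 2) +
            ∑ i with i < j, ((hd h t i : ℤ) : ZMod 2))) • b • lift φ q b' (hd h x) := by
        have := hφl (e - d) b' hb' (hd h t) (fun i => (hd h x i).1)
          (fun i => (hd_mem _ h hx i).1) trivial m b hb j
        rw [Submodule.mem_bot, sub_eq_zero] at this
        refine Prod.ext ?_ ?_
        · change (0 : V) = _ • b • (0 : V)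
          rw [smul_zero, smul_zero]
        · change φ q b' (fun i => (hd h x' i).1) = _ • b • φ q b' (fun i => (hd h x i).1)
          rw [← this]
          congr 1
          ext i
          rw [e1]
          by_cases hij : i = j
          · subst hij; simp
          · simp [hij]
      have k0 := key 0
      rw [Fin.update_cons_zero, Fin.cons_zero] at k0
      rw [e2, e3, ← consL_apply, map_smul, consL_apply]
      have := K.smul_mem (sg k ((m : ZMod 2) * (((e - d : ℤ) : ZMod 2) + ((0 : ℤ) : ZMod 2) +
            ∑ i with i < j, ((hd h t i : ℤ) : ZMod 2)))) k0
      rw [smul_sub, smul_smul, ← sg_add] at this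
      convert this using 3
      rw [hσ, sum_lt_hd h (fun i => (t i : ZMod 2)) j, hE]
      congr 1
      simp only [Fin.not_lt_zero, Finset.filter_false, Finset.sum_empty, hd]
      push_cast
      ring
    · -- The element `b` is inserted in an input of `F`.
      have e1 : hd h x' = hd h x := by rw [hx', hd_update_ge]
      have e2 : tl h x' = Function.update (tl h x) j (b • tl h x j) := by
        rw [hx', tl_update_ge]; rfl
      have k1 := key j.succ
      rw [← Fin.cons_update, Fin.cons_succ] at k1
      rw [e1, e2]
      convert k1 using 3
      rw [hσ]
      have e4 : (fun i => ((Fin.cons (e - d + 0 + ∑ j, hd h t j) (tl h t) : Fin (p + 1) → ℤ) i :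
          ZMod 2)) = Fin.cons ((e - d + 0 + ∑ j, hd h t j : ℤ) : ZMod 2)
            fun i => ((tl h t i : ℤ) : ZMod 2) := by
        ext i; refine Fin.cases ?_ (fun i => ?_) i <;> simp
      rw [e4, sum_lt_succ, sum_lt_tl h (fun i => (t i : ZMod 2)) j, hE]
      congr 1
      simp only [hd, tl]
      push_cast
      ring
  · have h3 := 𝕎.fil_antitone (show N ≤ _ by omega) (h₁ _ u hu)
    have h4 := 𝕎.smul_fil _ _ b hw _ (h₂ _ u hu)
    have h5 := 𝕎.fil_antitone (show N ≤ _ by omega) h4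
    have := Submodule.sub_mem _ h3 (Submodule.smul_mem _ σ h5)
    rw [smul_sub, smul_sub] at this
    simp only [LinearMap.comp_apply, evalAt_apply] at this
    convert this using 1
    abel

end LinearityTransfer

/-! ### Linearity of the transferred operations -/

section LinearitySeries

universe uV uW

variable {k : Type*} [Field k] [CharZero k] {C : CompleteCooperad k} {B : Type*} [Ring B]
  [Algebra k B] {𝔹 : GradedMixedCDGA k B} {V : Type uV} {W : Type uW} [AddCommGroup V] [Module k V]
  [Module B V] [IsScalarTower k B V] [AddCommGroup W] [Module k W] [Module B W]
  [IsScalarTower k B W] {𝕍 : CompleteDGModule 𝔹 V} {𝕎 : CompleteDGModule 𝔹 W} {n : ℕ}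
  {K : Submodule k W} {β : Fam C (V × W) W} {φ : Fam C V W}

/-- Linearity of the terms with at least one `φ`. If the lower vertex has only one input, this input
is the output of `φ`, and the term with `δ` lies in `K`. -/
theorem linMod_expTerm_succ (hKc : ∀ z, (∀ N, ∃ y ∈ K, z - y ∈ 𝕎.fil N) → z ∈ K)
    (hβ : IsFam (𝕍.toCompleteComplex.prod 𝕎.toCompleteComplex) 𝕎.toCompleteComplex 1 β)
    (hφ : IsFam 𝕍.toCompleteComplex 𝕎.toCompleteComplex 0 φ) (hφK : ∀ n c x, φ n c x ∈ K)
    (hφl : ∀ n, LinMod 𝔹 𝕍.toCompleteComplex ⊥ 0 (fun _ => True) (φ n)) (r : ℕ)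
    (h : ∀ n, LinMod 𝔹 (𝕍.toCompleteComplex.prod 𝕎.toCompleteComplex) K 1 (SndMem' K)
      (expTerm 𝕍.toCompleteComplex 𝕎.toCompleteComplex β φ r n)) (n : ℕ) :
    LinMod 𝔹 (𝕍.toCompleteComplex.prod 𝕎.toCompleteComplex) K 1 (SndMem K)
      (expTerm 𝕍.toCompleteComplex 𝕎.toCompleteComplex β φ (r + 1) n) := by
  refine LinMod.smul _ (LinMod.sum _ fun q _ => LinMod.sum _ fun ρ _ => ?_)
  exact LinMod.perm smul_mem_prod ρ (fun x hx j => hx (ρ j))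
    (LinMod.pc _ hKc ((hβ.expTerm hφ r).op _) hφ (hφK _) (h _) (hφl _))

theorem linMod_expTerm (hKc : ∀ z, (∀ N, ∃ y ∈ K, z - y ∈ 𝕎.fil N) → z ∈ K)
    (hβ : IsFam (𝕍.toCompleteComplex.prod 𝕎.toCompleteComplex) 𝕎.toCompleteComplex 1 β)
    (hφ : IsFam 𝕍.toCompleteComplex 𝕎.toCompleteComplex 0 φ) (hφK : ∀ n c x, φ n c x ∈ K)
    (hφl : ∀ n, LinMod 𝔹 𝕍.toCompleteComplex ⊥ 0 (fun _ => True) (φ n))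
    (hβl : ∀ n, LinMod 𝔹 (𝕍.toCompleteComplex.prod 𝕎.toCompleteComplex) K 1 (SndMem' K) (β n))
    (r : ℕ) : ∀ n, LinMod 𝔹 (𝕍.toCompleteComplex.prod 𝕎.toCompleteComplex) K 1 (SndMem' K)
      (expTerm 𝕍.toCompleteComplex 𝕎.toCompleteComplex β φ r n) := by
  induction r with
  | zero => exact hβl
  | succ r ih =>
    exact fun n => (linMod_expTerm_succ hKc hβ hφ hφK hφl r ih n).mono fun x hx => hx.1

/-- Apart from its leading term, the exponential series is `B`-linear up to elements of `K`. -/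
theorem linMod_expSum_sub (hC : C.IsConilpotent)
    (hKc : ∀ z, (∀ N, ∃ y ∈ K, z - y ∈ 𝕎.fil N) → z ∈ K)
    (hβ : IsFam (𝕍.toCompleteComplex.prod 𝕎.toCompleteComplex) 𝕎.toCompleteComplex 1 β)
    (hφ : IsFam 𝕍.toCompleteComplex 𝕎.toCompleteComplex 0 φ) (hφK : ∀ n c x, φ n c x ∈ K)
    (hφl : ∀ n, LinMod 𝔹 𝕍.toCompleteComplex ⊥ 0 (fun _ => True) (φ n))
    (hβl : ∀ n, LinMod 𝔹 (𝕍.toCompleteComplex.prod 𝕎.toCompleteComplex) K 1 (SndMem' K) (β n))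
    (n : ℕ) : LinMod 𝔹 (𝕍.toCompleteComplex.prod 𝕎.toCompleteComplex) K 1 (SndMem K)
      ((expSum 𝕍.toCompleteComplex 𝕎.toCompleteComplex β φ - β) n) := by
  have hT := ((tends_expPart hC hβ hφ).comp_succ.sub (Tends.const β)) n
  refine LinMod.of_tends hKc hT fun m => ?_
  have e : expPart 𝕍.toCompleteComplex 𝕎.toCompleteComplex β φ (m + 1) - β =
      ∑ r ∈ Finset.range m, expTerm 𝕍.toCompleteComplex 𝕎.toCompleteComplex β φ (r + 1) := by
    rw [expPart, Finset.sum_range_succ', expTerm, add_sub_cancel_right]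
  simp only [e, Finset.sum_apply]
  exact LinMod.sum _ fun r _ => linMod_expTerm_succ hKc hβ hφ hφK hφl r
    (linMod_expTerm hKc hβ hφ hφK hφl hβl r) n

end LinearitySeries

section Retract

universe uV uW

variable {k : Type*} [Field k] {C : CompleteCooperad k} {B : Type*} [Ring B]
  [Algebra k B] {𝔹 : GradedMixedCDGA k B} {V : Type uV} {W : Type uW} [AddCommGroup V] [Module k V]
  [Module B V] [IsScalarTower k B V] [AddCommGroup W] [Module k W] [Module B W]
  [IsScalarTower k B W] {𝕍 : CompleteDGModule 𝔹 V} {𝕎 : CompleteDGModule 𝔹 W} {n : ℕ}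
  {lam : C.obj 1 →ₗ[k] k}

theorem PBAlgebra.isFam (w : PBAlgebra C lam 𝕎) :
    IsFam 𝕎.toCompleteComplex 𝕎.toCompleteComplex 1 w.op :=
  ⟨fun n => ⟨w.op_deg n, w.op_fil n⟩, fun n ρ => Op.ext_deg 𝕎.toCompleteComplex fun c t x hx => by
    rw [perm_of_deg _ _ _ hx, w.op_act n c ρ t x hx, koszulSign_smul (k := k), smul_smul,
      sg_mul_self, one_smul]⟩

theorem IsFam.op_act {X Z : Type*} [AddCommGroup X] [Module k X] [AddCommGroup Z] [Module k Z]
    {𝕏 : CompleteComplex k X} {𝕫 : CompleteComplex k Z} {s : ℤ} {f : Fam C X Z}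
    (hf : IsFam 𝕏 𝕫 s f) (n : ℕ) (c : C.obj n) (ρ : Equiv.Perm (Fin n)) (t : Fin n → ℤ)
    (x : Fin n → X) (hx : ∀ j, x j ∈ 𝕏.deg (t j)) :
    f n (C.act n ρ c) (x ∘ ρ) = koszulSign ρ (fun j => (t j : ZMod 2)) • f n c x := by
  have h := perm_of_deg (𝕏 := 𝕏) ρ (f n) c hx
  rw [hf.act] at h
  rw [h, koszulSign_smul (k := k), smul_smul, sg_mul_self, one_smul]

/-- The Maurer-Cartan equation as an equation of families. -/
theorem PBAlgebra.bd_add_sstar (w : PBAlgebra C lam 𝕎) :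
    bd 𝕎.toCompleteComplex 𝕎.toCompleteComplex 1 w.op +
      sstar 𝕎.toCompleteComplex 𝕎.toCompleteComplex 1 w.op w.op = 0 := by
  funext n
  refine Op.ext_deg 𝕎.toCompleteComplex fun c t x hx => ?_
  refine (C.cx n).induction_deg (P := fun c => (bd 𝕎.toCompleteComplex 𝕎.toCompleteComplex 1 w.op +
      sstar 𝕎.toCompleteComplex 𝕎.toCompleteComplex 1 w.op w.op) n c x = 0) (fun e c hc => ?_)
    (fun c c' h h' => by rw [map_add, add_apply, h, h', add_zero]) c
  have h := w.maurerCartan n e c hc t x hx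
  rw [boundary_eq_bd w.op 1 n hc hx, star_eq_sstar w.isFam.op w.isFam.op] at h
  simpa using h

namespace DeformationRetract

variable (D : DeformationRetract 𝕍 𝕎)

/-- The inclusion as a `k`-linear map. -/
def iₗ : V →ₗ[k] W := D.i.restrictScalars k

/-- The projection as a `k`-linear map. -/
def pₗ : W →ₗ[k] V := D.p.restrictScalars k

@[simp] theorem iₗ_apply (x : V) : D.iₗ x = D.i x := rfl

@[simp] theorem pₗ_apply (x : W) : D.pₗ x = D.p x := rfl

theorem isMap_i : IsMap 𝕍.toCompleteComplex 𝕎.toCompleteComplex 0 D.iₗ :=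
  ⟨fun n x hx => by rw [add_zero]; exact D.i_deg n x hx, D.i_fil⟩

theorem isMap_p : IsMap 𝕎.toCompleteComplex 𝕍.toCompleteComplex 0 D.pₗ :=
  ⟨fun n x hx => by rw [add_zero]; exact D.p_deg n x hx, D.p_fil⟩

theorem isMap_h : IsMap 𝕎.toCompleteComplex 𝕎.toCompleteComplex (-1) D.h :=
  ⟨D.h_deg, D.h_fil⟩

/-- The kernel of `(h, p)`. By the side conditions it contains the image of `h`. The deviations of
the operations of `W` from `B`-linearity take place in `K` only, as long as they are not inserted
in further operations without an `h` in between. -/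
def K : Submodule k W := LinearMap.ker D.h ⊓ LinearMap.ker D.pₗ

theorem mem_K {z : W} : z ∈ D.K ↔ D.h z = 0 ∧ D.p z = 0 := Iff.rfl

/-- The submodule `K` is closed. -/
theorem mem_K_of_forall (z : W) (h : ∀ N, ∃ y ∈ D.K, z - y ∈ 𝕎.fil N) : z ∈ D.K := by
  rw [mem_K]
  constructor
  · refine 𝕎.fil_separated _ fun N => ?_
    obtain ⟨y, hy, hz⟩ := h N
    have := D.h_fil N _ hz
    rwa [map_sub, (D.mem_K.1 hy).1, sub_zero] at this
  · refine 𝕍.fil_separated _ fun N => ?_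
    obtain ⟨y, hy, hz⟩ := h N
    have := D.p_fil N _ hz
    rwa [map_sub, (D.mem_K.1 hy).2, sub_zero] at this

theorem smul_mem_K {m : ℤ} {b : B} (hb : b ∈ 𝔹.deg m) {z : W} (hz : z ∈ D.K) : b • z ∈ D.K := by
  rw [mem_K] at hz ⊢
  rw [D.h_smul m b hb, hz.1, map_smul, hz.2, smul_zero, smul_zero, smul_zero]
  exact ⟨rfl, rfl⟩

theorem base_smul (w : PBAlgebra C lam 𝕎) (hn : n ≠ 1) {e : ℤ} {c : C.obj n}
    (hc : c ∈ (C.cx n).deg e) {t : Fin n → ℤ} {x : Fin n → V × W}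
    (hx : ∀ j, x j ∈ (𝕍.toCompleteComplex.prod 𝕎.toCompleteComplex).deg (t j)) {m : ℤ} {b : B}
    (hb : b ∈ 𝔹.deg m) (j : Fin n) :
    base D.iₗ w.op n c (Function.update x j (b • x j)) =
      sg k ((m : ZMod 2) * (e + ((1 : ℤ) : ZMod 2) + ∑ i with i < j, (t i : ZMod 2))) • b •
        base D.iₗ w.op n c x := by
  have hx' := fun j => (isMap_coprod D.isMap_i).deg_zero (hx j)
  have := w.op_smul n hn e c hc t _ hx' m b hb j
  rw [negOnePow_smul (k := k)] at this
  push_cast at this ⊢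
  rw [base, preF_apply, pre_apply, pre_apply, ← this]
  congr 1
  ext i
  by_cases h : i = j
  · subst h; simp
  · simp [h]

theorem base_smul_one (w : PBAlgebra C lam 𝕎) {e : ℤ} {c : C.obj 1}
    (hc : c ∈ (C.cx 1).deg e) (x : Fin 1 → V × W) {m : ℤ} {b : B} (hb : b ∈ 𝔹.deg m) (j : Fin 1)
    (t : Fin 1 → ℤ) :
    base D.iₗ w.op 1 c (Function.update x j (b • x j)) =
      sg k ((m : ZMod 2) * (e + ((1 : ℤ) : ZMod 2) + ∑ i with i < j, (t i : ZMod 2))) • b •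
        base D.iₗ w.op 1 c x + lam c • 𝔹.δ b • (D.i (x j).1 + (x j).2) := by
  obtain rfl : j = 0 := Subsingleton.elim _ _
  have := w.op_smul_one e c hc (D.i (x 0).1 + (x 0).2) m b hb
  rw [negOnePow_smul (k := k)] at this
  push_cast at this ⊢
  have h0 : ∑ i with i < (0 : Fin 1), (t i : ZMod 2) = 0 := by simp
  rw [h0, add_zero, base, preF_apply, pre_apply, pre_apply]
  convert this using 2
  · ext i
    obtain rfl : i = 0 := Subsingleton.elim _ _
    simp
  · congr 3
    ext i
    obtain rfl : i = 0 := Subsingleton.elim _ _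
    simp

/-- For a lower vertex with one input, the term with `δ` is a multiple of `i v + w`, which lies in
`K` under the condition on the inputs. -/
theorem linMod_base (w : PBAlgebra C lam 𝕎) (n : ℕ) :
    LinMod 𝔹 (𝕍.toCompleteComplex.prod 𝕎.toCompleteComplex) D.K 1 (SndMem' D.K)
      (base D.iₗ w.op n) := by
  intro e c hc t x hx hRx m b hb j
  by_cases hn : n = 1
  · subst hn
    rw [D.base_smul_one w hc x hb j t, add_sub_cancel_left, hRx.2 rfl j, map_zero, zero_add]
    exact Submodule.smul_mem _ _ (D.smul_mem_K (𝔹.δ_deg m b hb) (hRx.1 j))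
  · rw [D.base_smul w hn hc hx hb j, sub_self]
    exact Submodule.zero_mem _

theorem treeStep_mem_K (hph : ∀ x, D.p (D.h x) = 0) (hhh : ∀ x, D.h (D.h x) = 0)
    (β : Fam C (V × W) W) (φ : Fam C V W) (n : ℕ) (c : C.obj n) (x : Fin n → V) :
    treeStep 𝕍.toCompleteComplex 𝕎.toCompleteComplex D.h β φ n c x ∈ D.K :=
  D.mem_K.2 ⟨hhh _, hph _⟩

theorem treeApprox_mem_K (hph : ∀ x, D.p (D.h x) = 0) (hhh : ∀ x, D.h (D.h x) = 0)
    (β : Fam C (V × W) W) (m n : ℕ) (c : C.obj n) (x : Fin n → V) :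
    treeApprox 𝕍.toCompleteComplex 𝕎.toCompleteComplex D.h β m n c x ∈ D.K := by
  cases m with
  | zero => exact Submodule.zero_mem _
  | succ m => exact D.treeStep_mem_K hph hhh β _ n c x

variable [CharZero k]

/-- The deviation from `B`-linearity of the total composition with `i + φ`. -/
theorem expSum_smul (hC : C.IsConilpotent) (w : PBAlgebra C lam 𝕎) {φ : Fam C V W}
    (hφ : IsFam 𝕍.toCompleteComplex 𝕎.toCompleteComplex 0 φ) (hφK : ∀ n c x, φ n c x ∈ D.K)
    (hφl : ∀ n, LinMod 𝔹 𝕍.toCompleteComplex ⊥ 0 (fun _ => True) (φ n)) {e : ℤ} {c : C.obj n}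
    (hc : c ∈ (C.cx n).deg e) {t : Fin n → ℤ} {x : Fin n → V} (hx : ∀ j, x j ∈ 𝕍.deg (t j))
    {m : ℤ} {b : B} (hb : b ∈ 𝔹.deg m) (j : Fin n) :
    preF (LinearMap.inl k V W) (expSum 𝕍.toCompleteComplex 𝕎.toCompleteComplex
        (base D.iₗ w.op) φ) n c (Function.update x j (b • x j)) -
      (sg k ((m : ZMod 2) * (e + ((1 : ℤ) : ZMod 2) + ∑ i with i < j, (t i : ZMod 2))) • b •
        preF (LinearMap.inl k V W) (expSum 𝕍.toCompleteComplex 𝕎.toCompleteComplex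
          (base D.iₗ w.op) φ) n c x +
      (if h : n = 1 then lam (h ▸ c) • 𝔹.δ b • D.i (x j) else 0)) ∈ D.K := by
  set Z := expSum 𝕍.toCompleteComplex 𝕎.toCompleteComplex (base D.iₗ w.op) φ with hZ
  set y : Fin n → V × W := fun j => (x j, 0) with hy
  have hy' : ∀ j, y j ∈ (𝕍.toCompleteComplex.prod 𝕎.toCompleteComplex).deg (t j) :=
    fun j => ⟨hx j, Submodule.zero_mem _⟩
  have hT := linMod_expSum_sub hC D.mem_K_of_forall (w.isFam.base D.isMap_i) hφ hφK hφl
    (D.linMod_base w) n e c hc t y hy' (fun _ => Submodule.zero_mem _) m b hb j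
  have e1 : (fun i => LinearMap.inl k V W (Function.update x j (b • x j) i)) =
      Function.update y j (b • y j) := by
    ext i
    · by_cases h : i = j
      · subst h; simp [hy]
      · simp [h, hy]
    · by_cases h : i = j
      · subst h; simp [hy]
      · simp [h, hy]
  have e2 : base D.iₗ w.op n c (Function.update y j (b • y j)) =
      sg k ((m : ZMod 2) * (e + ((1 : ℤ) : ZMod 2) + ∑ i with i < j, (t i : ZMod 2))) • b •
        base D.iₗ w.op n c y +
      (if h : n = 1 then lam (h ▸ c) • 𝔹.δ b • D.i (x j) else 0) := by
    by_cases hn : n = 1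
    · subst hn
      rw [D.base_smul_one w hc y hb j t, dif_pos rfl, add_zero]
    · rw [D.base_smul w hn hc hy' hb j, dif_neg hn, add_zero]
  rw [preF_apply, pre_apply, pre_apply, e1]
  change Z n c (Function.update y j (b • y j)) - (_ • b • Z n c y + _) ∈ D.K
  change Z n c (Function.update y j (b • y j)) -
    base D.iₗ w.op n c (Function.update y j (b • y j)) -
      _ • b • (Z n c y - base D.iₗ w.op n c y) ∈ D.K at hT
  rw [e2, smul_sub, smul_sub] at hT
  convert hT using 1
  abel

/-- `treeStep` preserves `B`-linearity. The term with `δ` is killed by `h` because of `h i = 0`. -/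
theorem linMod_treeStep (hC : C.IsConilpotent) (hhi : ∀ x, D.h (D.i x) = 0)
    (w : PBAlgebra C lam 𝕎) {φ : Fam C V W}
    (hφ : IsFam 𝕍.toCompleteComplex 𝕎.toCompleteComplex 0 φ) (hφK : ∀ n c x, φ n c x ∈ D.K)
    (hφl : ∀ n, LinMod 𝔹 𝕍.toCompleteComplex ⊥ 0 (fun _ => True) (φ n)) (n : ℕ) :
    LinMod 𝔹 𝕍.toCompleteComplex ⊥ 0 (fun _ => True) (treeStep 𝕍.toCompleteComplex
      𝕎.toCompleteComplex D.h (base D.iₗ w.op) φ n) := by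
  intro e c hc t x hx _ m b hb j
  have h := (D.mem_K.1 (D.expSum_smul hC w hφ hφK hφl hc hx hb j)).1
  rw [map_sub, map_add, sub_eq_zero, map_smul, D.h_smul m b hb, negOnePow_smul (k := k)] at h
  have h0 : D.h (if h : n = 1 then lam (h ▸ c) • 𝔹.δ b • D.i (x j) else 0) = 0 := by
    split_ifs with hn
    · rw [map_smul, D.h_smul _ _ (𝔹.δ_deg m b hb), hhi, smul_zero, smul_zero, smul_zero]
    · exact map_zero _
  rw [h0, add_zero, smul_smul, ← sg_add] at h
  rw [Submodule.mem_bot, sub_eq_zero]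
  refine h.trans ?_
  change sg k _ • b • D.h _ = sg k _ • b • D.h _
  congr 2
  push_cast
  have h2 : ∀ a : ZMod 2, a + a = 0 := by decide
  linear_combination h2 (m : ZMod 2)

theorem linMod_treeApprox (hC : C.IsConilpotent) (hph : ∀ x, D.p (D.h x) = 0)
    (hhi : ∀ x, D.h (D.i x) = 0) (hhh : ∀ x, D.h (D.h x) = 0) (w : PBAlgebra C lam 𝕎) (m : ℕ) :
    ∀ n, LinMod 𝔹 𝕍.toCompleteComplex ⊥ 0 (fun _ => True) (treeApprox 𝕍.toCompleteComplex
      𝕎.toCompleteComplex D.h (base D.iₗ w.op) m n) := by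
  induction m with
  | zero => exact fun n => LinMod.zero
  | succ m ih =>
    exact D.linMod_treeStep hC hhi w
      (isFam_treeApprox hC (w.isFam.base D.isMap_i) D.isMap_h m)
      (D.treeApprox_mem_K hph hhh _ m) ih

/-- The limit of the sums over trees is `B`-linear. -/
theorem linMod_of_tends_treeApprox (hC : C.IsConilpotent) (hph : ∀ x, D.p (D.h x) = 0)
    (hhi : ∀ x, D.h (D.i x) = 0) (hhh : ∀ x, D.h (D.h x) = 0) (w : PBAlgebra C lam 𝕎)
    {φ : Fam C V W} (hφ : Tends 𝕎.toCompleteComplex (treeApprox 𝕍.toCompleteComplex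
      𝕎.toCompleteComplex D.h (base D.iₗ w.op)) φ) (n : ℕ) :
    LinMod 𝔹 𝕍.toCompleteComplex ⊥ 0 (fun _ => True) (φ n) := by
  refine LinMod.of_tends (𝕫 := 𝕎) (fun z hz => ?_) (hφ n) fun m =>
    D.linMod_treeApprox hC hph hhi hhh w m n
  refine (Submodule.mem_bot k).2 (𝕎.fil_separated _ fun N => ?_)
  obtain ⟨y, hy, h⟩ := hz N
  rwa [(Submodule.mem_bot k).1 hy, sub_zero] at h

end DeformationRetract

end Retract

/-! ### Total compositions and the transfer theorem -/

section TotalComposition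

open Filter

universe uV uW

variable {k : Type*} [Field k] [CharZero k] {C : CompleteCooperad k} {V : Type uV} {W : Type uW}
  [AddCommGroup V] [Module k V] [AddCommGroup W] [Module k W] {𝕍 : CompleteComplex k V}
  {𝕎 : CompleteComplex k W} {α : Fam C W W} {i : V →ₗ[k] W} {φ : Fam C V W}

/-- The iterated products in the definition of the total composition are the terms of the
exponential series, without the factorials. -/
theorem compTerm_eq (hα : IsFam 𝕎 𝕎 1 α) (hi : IsMap 𝕍 𝕎 0 i) (hφ : IsFam 𝕍 𝕎 0 φ) (r : ℕ) :
    compTerm 𝕍 𝕎 (fun n c x => α n c x) i (fun n c x => φ n c x) r =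
      fun n c x => ((r.factorial : k) • expTerm 𝕍 𝕎 (base i α) φ r) n c x := by
  induction r with
  | zero =>
    funext n c x
    rw [Nat.factorial_zero, Nat.cast_one, one_smul]
    rfl
  | succ r ih =>
    have hU : IsFam (𝕍.prod 𝕎) 𝕎 1 (expTerm 𝕍 𝕎 (base i α) φ r) := (hα.base hi).expTerm hφ r
    have hp : (fun (e : ZMod 2) (x : V × W) => (𝕍.par e x.1, 𝕎.par e x.2)) = (𝕍.prod 𝕎).par :=
      funext fun e => funext fun x => (prod_par e x).symm
    funext n c x
    rw [compTerm, ih, hp]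
    have h := star_eq_sstar (𝕏 := 𝕍.prod 𝕎) (hU.smul (r.factorial : k)).op hφ.lift.op 0 n c x
    refine h.trans ?_
    rw [sstar_smul_left _ hU.op hφ.lift.op, expTerm_succ, smul_smul, Nat.factorial_succ,
      Nat.cast_mul, mul_comm]

theorem sum_compTerm_eq (hα : IsFam 𝕎 𝕎 1 α) (hi : IsMap 𝕍 𝕎 0 i) (hφ : IsFam 𝕍 𝕎 0 φ) (R n : ℕ)
    (c : C.obj n) (x : Fin n → V) :
    ∑ r ∈ Finset.range R, (r.factorial : k)⁻¹ • compTerm 𝕍 𝕎 (fun n c x => α n c x) i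
      (fun n c x => φ n c x) r n c (fun j => (x j, 0)) =
      preF (LinearMap.inl k V W) (expPart 𝕍 𝕎 (base i α) φ R) n c x := by
  rw [expPart, map_sum]
  simp only [Finset.sum_apply, LinearMap.sum_apply, sum_apply]
  refine Finset.sum_congr rfl fun r _ => ?_
  rw [compTerm_eq hα hi hφ]
  change (r.factorial : k)⁻¹ • (r.factorial : k) • expTerm 𝕍 𝕎 (base i α) φ r n c _ = _
  rw [smul_smul, inv_mul_cancel₀ (Nat.cast_ne_zero.2 r.factorial_ne_zero), one_smul]
  rfl

/-- The total composition with `i + φ` is the restriction of the exponential series to `V`. -/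
theorem isComp_iff (hC : C.IsConilpotent) (hα : IsFam 𝕎 𝕎 1 α) (hi : IsMap 𝕍 𝕎 0 i)
    (hφ : IsFam 𝕍 𝕎 0 φ) (n : ℕ) (c : C.obj n) (x : Fin n → V) (z : W) :
    IsComp 𝕍 𝕎 (fun n c x => α n c x) i (fun n c x => φ n c x) n c x z ↔
      z = preF (LinearMap.inl k V W) (expSum 𝕍 𝕎 (base i α) φ) n c x := by
  have hT := ((tends_expPart hC (hα.base hi) hφ).pre (LinearMap.inl k V W)) n c x
  constructor
  · intro h
    refine sub_eq_zero.1 (𝕎.fil_separated _ fun N => ?_)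
    obtain ⟨R₀, hR⟩ := h N
    obtain ⟨m, h1, h2⟩ := ((hT N).and (eventually_ge_atTop R₀)).exists
    have h3 := hR m h2
    rw [sum_compTerm_eq hα hi hφ] at h3
    have := Submodule.sub_mem _ h3 h1
    rwa [sub_sub_sub_cancel_right] at this
  · rintro rfl N
    obtain ⟨R₀, hR⟩ := eventually_atTop.1 (hT N)
    refine ⟨R₀, fun R h => ?_⟩
    rw [sum_compTerm_eq hα hi hφ]
    exact hR R h

end TotalComposition

end FilteredHTT

end

open FilteredHTT in
theorem theorem3p5 {k : Type*} [Field k] [CharZero k]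
    (C : CompleteCooperad k) (hC : C.IsConilpotent) (lam : C.obj 1 →ₗ[k] k)
    {B : Type*} [Ring B] [Algebra k B] (𝔹 : GradedMixedCDGA k B)
    {V : Type*} [AddCommGroup V] [Module k V] [Module B V] [IsScalarTower k B V]
    {W : Type*} [AddCommGroup W] [Module k W] [Module B W] [IsScalarTower k B W]
    (𝕍 : CompleteDGModule 𝔹 V) (𝕎 : CompleteDGModule 𝔹 W)
    (w : PBAlgebra C lam 𝕎) (D : DeformationRetract 𝕍 𝕎)
    (hph : ∀ x, D.p (D.h x) = 0) (hhi : ∀ x, D.h (D.i x) = 0) (hhh : ∀ x, D.h (D.h x) = 0) :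
    ∃ (v : PBAlgebra C lam 𝕍) (Φ : InftyMorphism v w), Φ.lin = D.i ∧
      ∀ n (c : C.obj n) (x : Fin n → V) (z : W),
        IsComp 𝕍.toCompleteComplex 𝕎.toCompleteComplex (fun n c x => w.op n c x) D.i
          (fun n c x => Φ.op n c x) n c x z →
        v.op n c x = D.p z ∧ Φ.op n c x = D.h z := by
  have hα := w.isFam
  obtain ⟨φ, hφ, hT, hfix⟩ := exists_treeStep_eq hC (hα.base D.isMap_i) D.isMap_h
  have hφK : ∀ n c x, φ n c x ∈ D.K := fun n c x => by
    rw [← hfix]; exact D.treeStep_mem_K hph hhh _ _ n c x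
  have hφl := D.linMod_of_tends_treeApprox hC hph hhi hhh w hT
  set Y := preF (LinearMap.inl k V W)
    (expSum 𝕍.toCompleteComplex 𝕎.toCompleteComplex (base D.iₗ w.op) φ) with hY
  have hYf : IsFam 𝕍.toCompleteComplex 𝕎.toCompleteComplex 1 Y :=
    ((hα.base D.isMap_i).expSum hC hφ).pre isMap_inl
  obtain ⟨a, ha⟩ : ∃ a, a = postF D.pₗ Y := ⟨_, rfl⟩
  have haf : IsFam 𝕍.toCompleteComplex 𝕍.toCompleteComplex 1 a := by
    rw [ha]; exact hYf.post D.isMap_p (add_zero 1)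
  obtain ⟨hMC, hmor⟩ := transfer hC hα w.bd_add_sstar D.isMap_i D.isMap_p D.isMap_h D.i_d D.p_d
    D.homotopy hφ hfix ha
  have hasmul : ∀ n e (c : C.obj n), c ∈ (C.cx n).deg e → ∀ (t : Fin n → ℤ) (x : Fin n → V),
      (∀ j, x j ∈ 𝕍.deg (t j)) → ∀ m, ∀ b ∈ 𝔹.deg m, ∀ j,
      a n c (Function.update x j (b • x j)) =
        (m * (e + 1 + ∑ i with i < j, t i)).negOnePow • b • a n c x +
          (if h : n = 1 then lam (h ▸ c) • 𝔹.δ b • x j else 0) := by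
    intro n e c hc t x hx m b hb j
    have h := (D.mem_K.1 (D.expSum_smul hC w hφ hφK hφl hc hx hb j)).2
    rw [map_sub, map_add, sub_eq_zero, ← D.pₗ_apply (_ • b • _), map_smul, D.pₗ_apply,
      map_smul] at h
    rw [negOnePow_smul (k := k), ha]
    refine h.trans ?_
    congr 1
    · push_cast
      rfl
    · split_ifs with hn
      · rw [← D.pₗ_apply, map_smul, D.pₗ_apply, map_smul, D.p_i]
      · exact map_zero _
  let v : PBAlgebra C lam 𝕍 :=
    { op := a
      op_deg := fun n => (haf.op n).deg
      op_fil := fun n => (haf.op n).fil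
      op_act := haf.op_act
      maurerCartan := fun n e c hc t x hx => by
        rw [boundary_eq_bd a 1 n hc hx, star_eq_sstar haf.op haf.op]
        have := congrArg (fun f : Fam C V V => f n c x) hMC
        simpa using this
      op_smul := fun n hn e c hc t x hx m b hb j => by
        rw [hasmul n e c hc t x hx m b hb j, dif_neg hn, add_zero]
      op_smul_one := fun e c hc x m b hb => by
        -- The condition is additive in `x`, so `x` may be taken homogeneous.
        have hu : ∀ y : V, (fun _ : Fin 1 => y) = Function.update (0 : Fin 1 → V) 0 y := fun y => by
          ext i
          obtain rfl : i = 0 := Subsingleton.elim _ _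
          simp
        refine 𝕍.induction_deg (P := fun x => a 1 c (fun _ => b • x) =
          (m * (e + 1)).negOnePow • b • a 1 c (fun _ => x) + lam c • 𝔹.δ b • x)
          (fun t x hx => ?_) (fun x y h1 h2 => ?_) x
        · have h := hasmul 1 e c hc (fun _ => t) (fun _ => x) (fun _ => hx) m b hb 0
          have h0 : ∑ i with i < (0 : Fin 1), t = 0 := by simp
          rw [dif_pos rfl, h0, add_zero] at h
          rw [← h]
          congr 1
          ext i
          obtain rfl : i = 0 := Subsingleton.elim _ _
          simp
        · rw [hu] at h1 h2 ⊢
          rw [hu x] at h1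
          rw [hu y] at h2
          rw [hu (x + y), smul_add, MultilinearMap.map_update_add, MultilinearMap.map_update_add,
            h1, h2]
          simp only [smul_add]
          abel }

  let Φ : InftyMorphism v w :=
    { lin := D.i
      lin_deg := D.i_deg
      lin_fil := D.i_fil
      lin_d := D.i_d
      op := φ
      op_deg := fun n e c hc t x hx => by simpa using (hφ.op n).deg e c hc t x hx
      op_fil := fun n => (hφ.op n).fil
      op_act := hφ.op_act
      op_smul := fun n e c hc t x hx m b hb j => by
        have := hφl n e c hc t x hx trivial m b hb j
        rw [Submodule.mem_bot, sub_eq_zero] at this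
        rw [this, negOnePow_smul (k := k)]
        push_cast
        rw [add_zero]
      equation := fun n e c hc t x hx => by
        refine (isComp_iff hC hα D.isMap_i hφ n c x _).2 ?_
        rw [boundary_eq_bd φ 0 n hc hx, star_eq_sstar hφ.op haf.op]
        have := congrArg (fun f : Fam C V W => f n c x) hmor
        simpa using this.symm }
  refine ⟨v, Φ, rfl, fun n c x z hz => ?_⟩
  rw [(isComp_iff hC hα D.isMap_i hφ n c x z).1 hz]
  refine ⟨?_, ?_⟩
  · change a n c x = _
    rw [ha]; rfl
  · change φ n c x = _
    conv_lhs => rw [← hfix]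
    rfl
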